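/- **Theorem.** For $1\le p\le\infty$ write $L^p=L^p(\mathbb R^3)$, and let $L^3_\sigma$ be the space of vector fields $v\in L^3(\mathbb R^3;\mathbb R^3)$ with $\operatorname{div}v=0$ in the sense of distributions. Consider the Boussinesq system $$\partial_tu+u\cdot\nabla u+\nabla P=\Delta u+\theta e_3,\qquad \operatorname{div}u=0,\qquad \partial_t\theta+u\cdot\nabla\theta=\Delta\theta\qquad\text{in }(0,\infty)\times\mathbb R^3,$$ where $e_3=(0,0,1)^T$. A *strong solution* with initial data $(u_0,\theta_0)$ is a pair $(u,\theta)$ such that * $u\in C([0,\infty);L^3_\sigma)$, $\theta\in C([0,\infty);L^1)$, $u(0)=u_0$ and $\theta(0)=\theta_0$ almost everywhere; * on $(0,\infty)\times\mathbb R^3$ the functions $u,\theta$ are $C^1$ in $(t,x)$, are $C^2$ in $x$ for each $t>0$, and have second derivatives in $x$ that are continuous in $(t,x)$; * for some function $P$ with $P(t,\cdot)\in C^1(\mathbb R^3)$ for each $t>0$, the system holds at every point of $(0,\infty)\times\mathbb R^3$. There are absolute constants $\epsilon_1>0$ and $C>0$ such that for every $0<\epsilon_0\le\epsilon_1$ the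 following holds. If $u_0\in L^3_\sigma$ and $\theta_0\in L^1$ satisfy $$\|u_0\|_{L^3}+\|\theta_0\|_{L^1}\le\epsilon_0,$$ then the Boussinesq system has a strong solution $(u,\theta)$ with initial data $(u_0,\theta_0)$ such that, for all $t>0$, $k\in\{0,1\}$ and $3\le q\le\infty$, $$\|\nabla^ku(t)\|_{L^q}\le C\epsilon_0\,t^{-\frac k2-\frac32\left(\frac13-\frac1q\right)},\qquad \|\nabla^k\theta(t)\|_{L^q}\le C\epsilon_0\,t^{-\frac k2-1-\frac32\left(\frac13-\frac1q\right)},$$ where $1/q=0$ if $q=\infty$. -/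

import Mathlib

open MeasureTheory Filter Topology
open scoped ENNReal ContDiff

/-- Euclidean three-space, with the Euclidean norm and Lebesgue measure. -/
abbrev R3 : Type := EuclideanSpace ℝ (Fin 3)

/-- The vertical unit vector `e₃ = (0, 0, 1)`. -/
noncomputable def e3 : R3 := EuclideanSpace.single (2 : Fin 3) (1 : ℝ)

/-- The pointwise divergence `∑ i, ∂ᵢ vᵢ` of a differentiable vector field on `ℝ³`. -/
noncomputable def divergence (v : R3 → R3) (x : R3) : ℝ :=
  ∑ i : Fin 3, (fderiv ℝ v x (EuclideanSpace.single i (1 : ℝ))) i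

/-- Membership in `L³_σ(ℝ³)`: the field is in `L³` and its distributional divergence vanishes,
i.e. `∫ v · ∇φ = 0` for every test function `φ`. -/
def MemL3Sigma (v : R3 → R3) : Prop :=
  MemLp v 3 volume ∧
    ∀ φ : R3 → ℝ, ContDiff ℝ ∞ φ → HasCompactSupport φ →
      ∫ x, inner ℝ (v x) (gradient φ x) = 0

/-- `f` belongs to `C([0, ∞); L^p(ℝ³))`. -/
def IsContinuousIntoLp {F : Type*} [NormedAddCommGroup F] (p : ℝ≥0∞) (f : ℝ → R3 → F) : Prop :=
  (∀ t : ℝ, 0 ≤ t → MemLp (f t) p volume) ∧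
    ∀ s : ℝ, 0 ≤ s →
      Tendsto (fun t : ℝ => eLpNorm (f t - f s) p volume) (𝓝[Set.Ici 0] s) (𝓝 0)

/-- Classical regularity at positive times: `f` is `C¹` jointly in `(t, x)` on `(0, ∞) × ℝ³`,
and `C²` in `x` for each `t > 0`, with second spatial derivatives jointly continuous. -/
def IsClassicalForPosTime {F : Type*} [NormedAddCommGroup F] [NormedSpace ℝ F]
    (f : ℝ → R3 → F) : Prop :=
  ContDiffOn ℝ 1 (fun z : ℝ × R3 => f z.1 z.2) (Set.Ioi 0 ×ˢ Set.univ) ∧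
    (∀ t : ℝ, 0 < t → ContDiff ℝ 2 (f t)) ∧
    ContinuousOn (fun z : ℝ × R3 => iteratedFDeriv ℝ 2 (f z.1) z.2) (Set.Ioi 0 ×ˢ Set.univ)

/-- `(u, θ)` is a global strong solution of the viscous Boussinesq system
`∂ₜu + u·∇u + ∇P = Δu + θ e₃`, `div u = 0`, `∂ₜθ + u·∇θ = Δθ` on `ℝ³`
with initial data `(u₀, θ₀)`: it is continuous in time with values in `L³_σ × L¹`, starts at
`(u₀, θ₀)`, has all the derivatives in the equations at positive times, and satisfies the
equations at every point of `(0, ∞) × ℝ³` for some pressure `P`. -/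
structure IsStrongSolution (u₀ : R3 → R3) (θ₀ : R3 → ℝ)
    (u : ℝ → R3 → R3) (θ : ℝ → R3 → ℝ) : Prop where
  continuous_u : IsContinuousIntoLp 3 u
  solenoidal_u : ∀ t : ℝ, 0 ≤ t → MemL3Sigma (u t)
  continuous_θ : IsContinuousIntoLp 1 θ
  initial_u : u 0 =ᵐ[volume] u₀
  initial_θ : θ 0 =ᵐ[volume] θ₀
  regular_u : IsClassicalForPosTime u
  regular_θ : IsClassicalForPosTime θ
  momentum : ∃ P : ℝ → R3 → ℝ,
    (∀ t : ℝ, 0 < t → ContDiff ℝ 1 (P t)) ∧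
    ∀ t : ℝ, 0 < t → ∀ x : R3,
      deriv (fun s : ℝ => u s x) t + fderiv ℝ (u t) x (u t x) + gradient (P t) x
        = Laplacian.laplacian (u t) x + θ t x • e3
  incompressible : ∀ t : ℝ, 0 < t → ∀ x : R3, divergence (u t) x = 0
  temperature : ∀ t : ℝ, 0 < t → ∀ x : R3,
    deriv (fun s : ℝ => θ s x) t + fderiv ℝ (θ t) x (u t x) = Laplacian.laplacian (θ t) x

/-! ### Minkowski's integral inequality for natural exponents. -/

section Minkowski

/-! The norms of `u₀` in `L³` and of `θ₀` in `L¹` are invariant under the scaling of the system, so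
the solution comes from a contraction in scaling-invariant norms. The decisive reformulation removes
the temperature from the buoyancy: inserting θ(s) = e^{sΔ}θ₀ - ∫₀ˢ e^{(s-r)Δ} div(uθ)(r) dr into ∫₀ᵗ
e^{(t-s)Δ}ℙ(θ(s)e₃) ds and composing the heat flows gives u(t) = e^{tΔ}u₀ + t e^{tΔ}ℙ(θ₀e₃) - ∫₀ᵗ
e^{(t-s)Δ}ℙ div(u⊗u)(s) ds - ∫₀ᵗ (t-s) e^{(t-s)Δ}ℙ(div(uθ)(s) e₃) ds. With the equation for θ this
is a fixed-point problem whose data part `Dat` is linear in the data and whose remainder `Quad` is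
purely quadratic. Every Duhamel kernel carries a derivative and so stays integrable after the Leray
projection.

The norm `Z p a n M` controls t^a ‖f(t)‖_p and t^(a+3/(2p)) ‖f(t)‖_∞ for `f` and for its derivatives
up to order `n` along t∂ₜ and √t∂ᵢ. A product with a velocity costs t^(-1/2) (`Z.mul`), and
integration against the kernel of e^{(t-s)Δ}ℙ∂ gains t^(1/2) back (`exists_Z_Dop`). In the variable
σ = s/t a Duhamel integral is a superposition of convolutions at scale (1-σ)t; the derivative √t∂ᵢ
is put on the kernel for σ ≤ 1/2 and on the field for σ ≥ 1/2 (`exists_Z_Isl`). Hence three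
derivatives are part of the fixed-point norm itself and no separate bootstrap is needed. For small
data the Picard series converges geometrically (`exists_QuadBound`, `picardLim_eq`). The `L^q`
bounds follow by interpolation between `L³` and `L^∞`, the temperature being moved from `L¹` to `L³`
by `Z.one_to_three`.

To recover the equations, the Leray kernel is split into δᵢⱼ times the heat profile and the gradient
part ∂ᵢ∂ⱼ(-Δ)⁻¹ (`ForceData.Force_split`). On the first part the heat operator is computed exactly
(`Hop_Dop_neg_half`, `Hop_Dop_half`). The second part is curl-free and stays so under the heat
operator (`GoodData.presGrad_curl`), so it is the gradient of a pressure by the Poincaré lemma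
(`exists_potential`); the pressure needs no estimate.

Since the norms are critical, boundedness alone does not give continuity at t = 0. The extra
information is that √t ‖u(t)‖_∞ → 0. It holds for the data by truncation (`van_Lop_gs`,
`small0_time_mul_Lop`), passes to each iterate because the quadratic term only sees earlier times
(`small0_Quad`), and survives the limit; the quadratic term then vanishes as t → 0. -/

/-- Jensen's inequality for natural powers and the lower Lebesgue integral. -/
theorem lintegral_pow_le {α : Type*} [MeasurableSpace α] (μ : Measure α) {f : α → ℝ≥0∞}
    (hf : AEMeasurable f μ) {p : ℕ} (hp : 1 ≤ p) :
    (∫⁻ x, f x ∂μ) ^ p ≤ (∫⁻ x, f x ^ p ∂μ) * μ Set.univ ^ (p - 1) := by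
  have hp0 : (p : ℝ) ≠ 0 := by positivity
  have h := eLpNorm_le_eLpNorm_mul_rpow_measure_univ (μ := μ) (p := 1) (q := (p : ℝ≥0∞))
    (by exact_mod_cast hp) hf.aestronglyMeasurable
  rw [eLpNorm_one_eq_lintegral_enorm, eLpNorm_eq_lintegral_rpow_enorm_toReal
    (by exact_mod_cast (by omega : p ≠ 0)) (by simp)] at h
  simp only [enorm_eq_self, ENNReal.toReal_natCast, ENNReal.toReal_one, ENNReal.rpow_natCast] at h
  calc (∫⁻ x, f x ∂μ) ^ p
      ≤ ((∫⁻ x, f x ^ p ∂μ) ^ (1 / (p : ℝ)) * μ Set.univ ^ ((1 : ℝ) / 1 - 1 / p)) ^ p := by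
        gcongr
    _ = _ := by
        rw [mul_pow, ← ENNReal.rpow_natCast, ← ENNReal.rpow_mul, ← ENNReal.rpow_natCast _ p,
          ← ENNReal.rpow_mul]
        congr 1
        · rw [one_div, inv_mul_cancel₀ hp0, ENNReal.rpow_one]
        · rw [← ENNReal.rpow_natCast]
          congr 1
          rw [Nat.cast_sub hp]
          field_simp
          simp

theorem eLpNorm_natCast_pow {α E : Type*} [MeasurableSpace α] [NormedAddCommGroup E]
    {μ : Measure α} (f : α → E) {p : ℕ} (hp : 1 ≤ p) :
    eLpNorm f p μ ^ p = ∫⁻ x, ‖f x‖ₑ ^ p ∂μ := by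
  have hp0 : (p : ℝ) ≠ 0 := by positivity
  rw [eLpNorm_eq_lintegral_rpow_enorm_toReal (by exact_mod_cast (by omega : p ≠ 0)) (by simp)]
  simp only [ENNReal.toReal_natCast, ENNReal.rpow_natCast]
  rw [← ENNReal.rpow_natCast, ← ENNReal.rpow_mul, one_div, inv_mul_cancel₀ hp0, ENNReal.rpow_one]

theorem eLpNorm_natCast_le_iff {α E : Type*} [MeasurableSpace α] [NormedAddCommGroup E]
    {μ : Measure α} (f : α → E) {p : ℕ} (hp : 1 ≤ p) (M : ℝ≥0∞) :
    eLpNorm f p μ ≤ M ↔ ∫⁻ x, ‖f x‖ₑ ^ p ∂μ ≤ M ^ p := by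
  rw [← eLpNorm_natCast_pow f hp]
  exact (ENNReal.pow_le_pow_left_iff (by omega)).symm

/-- Minkowski's integral inequality, with a majorant of the inner norms. -/
theorem eLpNorm_integral_le {Ω α : Type*} [MeasurableSpace Ω] [MeasurableSpace α]
    (μ : Measure Ω) [SigmaFinite μ] (ν : Measure α) [SFinite ν] {p : ℕ} (hp : 1 ≤ p)
    {I : Ω → α → ℝ} (hI : Measurable (Function.uncurry I)) {M : Ω → ℝ≥0∞} (hM : AEMeasurable M μ)
    (hfin : ∀ w, M w ≠ ⊤) (h : ∀ w, eLpNorm (I w) p ν ≤ M w) :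
    eLpNorm (fun x => ∫ w, I w x ∂μ) p ν ≤ ∫⁻ w, M w ∂μ := by
  -- The majorant `M` may vanish, and the argument divides by it. A strictly positive `m` of total
  -- mass below `ε` is therefore added, and `ε` is removed at the end.
  refine ENNReal.le_of_forall_pos_le_add fun ε hε _ => ?_
  obtain ⟨m, hm0, hmm, hmε⟩ := exists_pos_lintegral_lt_of_sigmaFinite μ
    (ε := (ε : ℝ≥0∞)) (by exact_mod_cast hε.ne')
  set B : Ω → ℝ≥0∞ := fun w => M w + m w with hB
  have hBm : AEMeasurable B μ := hM.add (by fun_prop)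
  have hB0 : ∀ w, B w ≠ 0 := fun w => by
    simp only [hB]; intro h0; have := (add_eq_zero.1 h0).2; have h1 := hm0 w
    simp only [ENNReal.coe_eq_zero] at this; exact h1.ne' this
  have hBt : ∀ w, B w ≠ ⊤ := fun w => by simp [hB, hfin w]
  have hS : ∫⁻ w, B w ∂μ ≤ ∫⁻ w, M w ∂μ + ε := by
    rw [lintegral_add_left' hM]; gcongr
  refine le_trans ?_ hS
  rw [eLpNorm_natCast_le_iff _ hp]
  have hIm : ∀ x, Measurable fun w => ‖I w x‖ₑ := fun x => by
    have : Measurable fun w => I w x := hI.comp (by fun_prop : Measurable fun w => (w, x))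
    exact this.enorm
  have hIm' : Measurable fun q : α × Ω => ‖I q.2 q.1‖ₑ :=
    (hI.comp (by fun_prop : Measurable fun q : α × Ω => (q.2, q.1))).enorm
  -- Jensen's inequality for the measure `B μ`, applied to the quotient of `‖I w x‖` by `B w`. After
  -- exchanging the integrals each slice contributes at most `B w`.
  have step : ∀ x, ‖∫ w, I w x ∂μ‖ₑ ^ p ≤
      (∫⁻ w, B w * (‖I w x‖ₑ / B w) ^ p ∂μ) * (∫⁻ w, B w ∂μ) ^ (p - 1) := by
    intro x
    have hq : AEMeasurable (fun w => ‖I w x‖ₑ / B w) μ := (hIm x).aemeasurable.div hBm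
    have e1 : ∫⁻ w, ‖I w x‖ₑ ∂μ = ∫⁻ w, ‖I w x‖ₑ / B w ∂(μ.withDensity B) := by
      rw [lintegral_withDensity_eq_lintegral_mul₀ hBm hq]
      refine lintegral_congr fun w => ?_
      simp only [Pi.mul_apply]
      rw [ENNReal.mul_div_cancel (hB0 w) (hBt w)]
    calc ‖∫ w, I w x ∂μ‖ₑ ^ p ≤ (∫⁻ w, ‖I w x‖ₑ ∂μ) ^ p := by
          gcongr; exact enorm_integral_le_lintegral_enorm _
      _ ≤ _ := by
          rw [e1]
          refine (lintegral_pow_le _ (hq.mono_ac (withDensity_absolutelyContinuous _ _))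
            hp).trans (le_of_eq ?_)
          rw [lintegral_withDensity_eq_lintegral_mul₀ hBm (hq.pow_const p),
            withDensity_apply _ MeasurableSet.univ, Measure.restrict_univ]
          rfl
  calc ∫⁻ x, ‖∫ w, I w x ∂μ‖ₑ ^ p ∂ν
      ≤ ∫⁻ x, (∫⁻ w, B w * (‖I w x‖ₑ / B w) ^ p ∂μ) * (∫⁻ w, B w ∂μ) ^ (p - 1) ∂ν :=
        lintegral_mono step
    _ = (∫⁻ x, ∫⁻ w, B w * (‖I w x‖ₑ / B w) ^ p ∂μ ∂ν) * (∫⁻ w, B w ∂μ) ^ (p - 1) := by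
        rw [lintegral_mul_const'']
        refine AEMeasurable.lintegral_prod_right' (f := fun q : α × Ω =>
          B q.2 * (‖I q.2 q.1‖ₑ / B q.2) ^ p) ?_
        have := hBm.comp_snd (μ := ν)
        exact this.mul ((hIm'.aemeasurable.div this).pow_const p)
    _ ≤ (∫⁻ w, B w ∂μ) * (∫⁻ w, B w ∂μ) ^ (p - 1) := by
        gcongr
        rw [lintegral_lintegral_swap (by
          have := hBm.comp_snd (μ := ν)
          exact this.mul ((hIm'.aemeasurable.div this).pow_const p))]
        refine lintegral_mono fun w => ?_
        have hx : Measurable fun x => ‖I w x‖ₑ :=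
          (hI.comp (by fun_prop : Measurable fun x => (w, x))).enorm
        have h1 : ∫⁻ x, ‖I w x‖ₑ ^ p ∂ν ≤ B w ^ p :=
          (eLpNorm_natCast_le_iff _ hp _).1 ((h w).trans (by simp [hB]))
        calc ∫⁻ x, B w * (‖I w x‖ₑ / B w) ^ p ∂ν
            = ∫⁻ x, (B w * (B w)⁻¹ ^ p) * ‖I w x‖ₑ ^ p ∂ν := by
              refine lintegral_congr fun x => ?_
              rw [div_eq_mul_inv, mul_pow]; ring
          _ = (B w * (B w)⁻¹ ^ p) * ∫⁻ x, ‖I w x‖ₑ ^ p ∂ν :=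
              lintegral_const_mul _ (hx.pow_const p)
          _ ≤ (B w * (B w)⁻¹ ^ p) * B w ^ p := by gcongr
          _ = B w := by
              rw [mul_assoc, ← mul_pow, ENNReal.inv_mul_cancel (hB0 w) (hBt w)]; simp
    _ = (∫⁻ w, B w ∂μ) ^ p := by
        rw [← pow_succ', Nat.sub_add_cancel hp]

end Minkowski

/-! ### Scaling-invariant weighted norms on space-time. -/

section WeightedFields

/-- Space-time `ℝ × ℝ³`. -/
abbrev STime : Type := ℝ × R3

/-- The standard basis of `ℝ³`. -/
noncomputable def bv (i : Fin 3) : R3 := EuclideanSpace.single i (1 : ℝ)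

/-- The directions `t ∂ₜ` (for `none`) and `√t ∂ᵢ` (for `some i`), which respect the parabolic
scaling. -/
noncomputable def dir (j : Option (Fin 3)) (t : ℝ) : STime :=
  match j with
  | none => (t, 0)
  | some i => (0, √t • bv i)

/-- The scaling-invariant derivatives `t ∂ₜ f` and `√t ∂ᵢ f` at positive times. -/
noncomputable def X (j : Option (Fin 3)) (f : STime → ℝ) (z : STime) : ℝ :=
  if 0 < z.1 then fderiv ℝ f z (dir j z.1) else 0

/-- `f(t)` is of size `M t^(-a)` in `L^p` and of size `M t^(-a-3/(2p))` in the sup norm. -/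
structure ZBase (p : ℕ) (a M : ℝ) (f : STime → ℝ) : Prop where
  meas : Measurable f
  lp : ∀ t : ℝ, 0 < t → eLpNorm (fun x => f (t, x)) p volume ≤ ENNReal.ofReal (M * t ^ (-a))
  sup : ∀ z : STime, 0 < z.1 → |f z| ≤ M * z.1 ^ (-a - 3 / (2 * p))

/-- The bounds of `ZBase` for `f` and all its scaling-invariant derivatives up to order `n`. -/
def Z (p : ℕ) (a : ℝ) : ℕ → ℝ → (STime → ℝ) → Prop
  | 0, M, f => ZBase p a M f
  | n + 1, M, f => ZBase p a M f ∧ (∀ z : STime, 0 < z.1 → DifferentiableAt ℝ f z) ∧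
      ∀ j, Z p a n M (X j f)

variable {p : ℕ} {a b M N : ℝ} {n : ℕ} {f g : STime → ℝ}

theorem Z.base (h : Z p a n M f) : ZBase p a M f := by
  cases n with
  | zero => exact h
  | succ n => exact h.1

theorem Z.of_succ : ∀ {n : ℕ} {f : STime → ℝ}, Z p a (n + 1) M f → Z p a n M f
  | 0, _, h => h.1
  | _ + 1, _, h => ⟨h.1, h.2.1, fun j => Z.of_succ (h.2.2 j)⟩

theorem ZBase.nonneg (h : ZBase p a M f) : 0 ≤ M := by
  have := (abs_nonneg _).trans (h.sup (1, 0) one_pos)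
  simpa using this

theorem isOpen_posTime : IsOpen {z : STime | 0 < z.1} := isOpen_lt continuous_const continuous_fst

theorem posTime_mem_nhds {z : STime} (hz : 0 < z.1) : {z : STime | 0 < z.1} ∈ 𝓝 z :=
  isOpen_posTime.mem_nhds hz

theorem X_of_pos (j : Option (Fin 3)) (f : STime → ℝ) {z : STime} (hz : 0 < z.1) :
    X j f z = fderiv ℝ f z (dir j z.1) := if_pos hz

theorem X_of_nonpos (j : Option (Fin 3)) (f : STime → ℝ) {z : STime} (hz : ¬ 0 < z.1) :
    X j f z = 0 := if_neg hz

theorem X_congr (j : Option (Fin 3)) (h : ∀ z : STime, 0 < z.1 → f z = g z) : X j f = X j g := by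
  ext z
  by_cases hz : 0 < z.1
  · rw [X_of_pos j f hz, X_of_pos j g hz]
    rw [Filter.EventuallyEq.fderiv_eq]
    filter_upwards [posTime_mem_nhds hz] with w hw using h w hw
  · rw [X_of_nonpos j f hz, X_of_nonpos j g hz]

theorem differentiableAt_congr_pos (h : ∀ z : STime, 0 < z.1 → f z = g z) {z : STime} (hz : 0 < z.1)
    (hg : DifferentiableAt ℝ g z) : DifferentiableAt ℝ f z :=
  hg.congr_of_eventuallyEq (by filter_upwards [posTime_mem_nhds hz] with w hw using h w hw)

theorem ZBase.congr (h : ∀ z : STime, 0 < z.1 → f z = g z) (hf : Measurable f)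
    (hg : ZBase p a M g) : ZBase p a M f where
  meas := hf
  lp t ht := by
    have : (fun x => f (t, x)) = fun x => g (t, x) := funext fun x => h (t, x) ht
    rw [this]; exact hg.lp t ht
  sup z hz := by rw [h z hz]; exact hg.sup z hz

theorem Z.congr (h : ∀ z : STime, 0 < z.1 → f z = g z) (hf : Measurable f)
    (hg : Z p a n M g) : Z p a n M f := by
  cases n with
  | zero => exact ZBase.congr h hf hg
  | succ n =>
    exact ⟨ZBase.congr h hf hg.1, fun z hz => differentiableAt_congr_pos h hz (hg.2.1 z hz),
      fun j => by rw [X_congr j h]; exact hg.2.2 j⟩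

theorem ZBase.mono (hMN : M ≤ N) (h : ZBase p a M f) : ZBase p a N f where
  meas := h.meas
  lp t ht := (h.lp t ht).trans (by gcongr)
  sup z hz := (h.sup z hz).trans (by
    have := Real.rpow_nonneg hz.le (-a - 3 / (2 * p)); gcongr)

theorem Z.mono (hMN : M ≤ N) : ∀ {n : ℕ} {f : STime → ℝ}, Z p a n M f → Z p a n N f
  | 0, _, h => ZBase.mono hMN h
  | _ + 1, _, h => ⟨ZBase.mono hMN h.1, h.2.1, fun j => (h.2.2 j).mono hMN⟩

theorem ZBase.add (hp : 1 ≤ p) (hf : ZBase p a M f) (hg : ZBase p a N g) :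
    ZBase p a (M + N) (fun z => f z + g z) where
  meas := hf.meas.add hg.meas
  lp t ht := by
    have h1 := hf.nonneg
    have h2 := hg.nonneg
    rw [add_mul, ENNReal.ofReal_add (by positivity) (by positivity)]
    have hm : ∀ {h : STime → ℝ}, Measurable h → AEStronglyMeasurable (fun x => h (t, x)) volume :=
      fun hh => (hh.comp (by fun_prop : Measurable fun x : R3 => ((t, x) : STime))).aestronglyMeasurable
    exact (eLpNorm_add_le (hm hf.meas) (hm hg.meas) (by exact_mod_cast hp)).trans
      (add_le_add (hf.lp t ht) (hg.lp t ht))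
  sup z hz := (abs_add_le _ _).trans (by
    rw [add_mul]; exact add_le_add (hf.sup z hz) (hg.sup z hz))

theorem X_add (j : Option (Fin 3)) (hf : ∀ z : STime, 0 < z.1 → DifferentiableAt ℝ f z)
    (hg : ∀ z : STime, 0 < z.1 → DifferentiableAt ℝ g z) :
    X j (fun z => f z + g z) = fun z => X j f z + X j g z := by
  ext z
  by_cases hz : 0 < z.1
  · rw [X_of_pos _ _ hz, X_of_pos _ _ hz, X_of_pos _ _ hz, fderiv_fun_add (hf z hz) (hg z hz)]
    rfl
  · simp [X_of_nonpos _ _ hz]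

theorem Z.add (hp : 1 ≤ p) : ∀ {n : ℕ} {f g : STime → ℝ}, Z p a n M f → Z p a n N g →
    Z p a n (M + N) (fun z => f z + g z)
  | 0, _, _, hf, hg => ZBase.add hp hf hg
  | _ + 1, _, _, hf, hg => ⟨hf.1.add hp hg.1, fun z hz => (hf.2.1 z hz).add (hg.2.1 z hz),
      fun j => by rw [X_add j hf.2.1 hg.2.1]; exact (hf.2.2 j).add hp (hg.2.2 j)⟩

theorem ZBase.const_mul (c : ℝ) (hf : ZBase p a M f) : ZBase p a (|c| * M) (fun z => c * f z) where
  meas := hf.meas.const_mul c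
  lp t ht := by
    have h1 := hf.nonneg
    have : (fun x => c * f (t, x)) = c • fun x => f (t, x) := rfl
    rw [this, eLpNorm_const_smul, mul_assoc, ENNReal.ofReal_mul (abs_nonneg c),
      Real.enorm_eq_ofReal_abs]
    gcongr
    exact hf.lp t ht
  sup z hz := by
    rw [abs_mul, mul_assoc]
    gcongr
    exact hf.sup z hz

theorem X_const_mul (j : Option (Fin 3)) (c : ℝ) (f : STime → ℝ) :
    X j (fun z => c * f z) = fun z => c * X j f z := by
  ext z
  by_cases hz : 0 < z.1
  · rw [X_of_pos _ _ hz, X_of_pos _ _ hz]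
    have : (fun z => c * f z) = c • f := rfl
    rw [this, fderiv_const_smul_field]
    rfl
  · simp [X_of_nonpos _ _ hz]

theorem Z.const_mul (c : ℝ) : ∀ {n : ℕ} {f : STime → ℝ}, Z p a n M f →
    Z p a n (|c| * M) (fun z => c * f z)
  | 0, _, hf => ZBase.const_mul c hf
  | _ + 1, _, hf => ⟨hf.1.const_mul c, fun z hz => (hf.2.1 z hz).const_mul c,
      fun j => by rw [X_const_mul]; exact (hf.2.2 j).const_mul c⟩

theorem Z.neg (h : Z p a n M f) : Z p a n M (fun z => -f z) := by
  have := h.const_mul (-1)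
  simpa using this

theorem Z.sub (hp : 1 ≤ p) (hf : Z p a n M f) (hg : Z p a n N g) :
    Z p a n (M + N) (fun z => f z - g z) := by
  simpa [sub_eq_add_neg] using hf.add hp hg.neg

theorem ZBase.zero : ZBase p a 0 (fun _ => 0) where
  meas := measurable_const
  lp t _ := by simp
  sup z _ := by simp

theorem X_zero (j : Option (Fin 3)) : X j (fun _ => 0) = fun _ => 0 := by
  ext z; simp [X]

theorem Z.zero : ∀ n : ℕ, Z p a n 0 (fun _ => 0)
  | 0 => ZBase.zero
  | n + 1 => ⟨ZBase.zero, fun _ _ => differentiableAt_const _, fun j => by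
      rw [X_zero]; exact Z.zero n⟩

theorem Z.sum (hp : 1 ≤ p) {ι : Type*} (s : Finset ι) {F : ι → STime → ℝ} {M : ι → ℝ}
    (h : ∀ i ∈ s, Z p a n (M i) (F i)) : Z p a n (∑ i ∈ s, M i) (fun z => ∑ i ∈ s, F i z) := by
  classical
  induction s using Finset.induction_on with
  | empty => simpa using Z.zero n
  | insert i s hi ih =>
    simp only [Finset.sum_insert hi]
    exact (h i (Finset.mem_insert_self _ _)).add hp
      (ih fun k hk => h k (Finset.mem_insert_of_mem hk))

theorem fderiv_dir_mul {z : STime} (hf : DifferentiableAt ℝ f z) (hg : DifferentiableAt ℝ g z)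
    (v : STime) : fderiv ℝ (fun z => f z * g z) z v = fderiv ℝ f z v * g z + f z * fderiv ℝ g z v := by
  rw [fderiv_fun_mul hf hg]
  simp only [_root_.add_apply, _root_.smul_apply, smul_eq_mul]
  ring

theorem X_mul (j : Option (Fin 3)) (hf : ∀ z : STime, 0 < z.1 → DifferentiableAt ℝ f z)
    (hg : ∀ z : STime, 0 < z.1 → DifferentiableAt ℝ g z) :
    X j (fun z => f z * g z) = fun z => X j f z * g z + f z * X j g z := by
  ext z
  by_cases hz : 0 < z.1
  · rw [X_of_pos _ _ hz, X_of_pos _ _ hz, X_of_pos _ _ hz, fderiv_dir_mul (hf z hz) (hg z hz)]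
  · simp [X_of_nonpos _ _ hz]

theorem eLpNorm_mul_le_of_bound {α : Type*} [MeasurableSpace α] {μ : Measure α} {q : ℝ≥0∞}
    {u v : α → ℝ} {A B : ℝ} (hB : 0 ≤ B)
    (hu : eLpNorm u q μ ≤ ENNReal.ofReal A) (hv : ∀ x, |v x| ≤ B) :
    eLpNorm (fun x => u x * v x) q μ ≤ ENNReal.ofReal (A * B) := by
  have h1 : eLpNorm (fun x => u x * v x) q μ ≤ eLpNorm (B • u) q μ := by
    refine eLpNorm_mono fun x => ?_
    simp only [Pi.smul_apply, norm_mul, smul_eq_mul, Real.norm_eq_abs, abs_of_nonneg hB]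
    rw [mul_comm]
    exact mul_le_mul_of_nonneg_right (hv x) (abs_nonneg _)
  refine h1.trans ?_
  rw [eLpNorm_const_smul, mul_comm A, ENNReal.ofReal_mul hB, Real.enorm_eq_ofReal hB]
  gcongr

/-- The first factor keeps its own norm and the second is always measured in the sup norm, whose
weight for exponent 3 is t^(-b-1/2); this is the origin of the extra 1/2. -/
theorem ZBase.mul (hf : ZBase p a M f) (hg : ZBase 3 b N g) :
    ZBase p (a + b + 1 / 2) (M * N) (fun z => f z * g z) where
  meas := hf.meas.mul hg.meas
  lp t ht := by
    have hN := hg.nonneg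
    have e : M * N * t ^ (-(a + b + 1 / 2)) =
        (M * t ^ (-a)) * (N * t ^ (-b - 3 / (2 * (3 : ℕ)) : ℝ)) := by
      have : (-(a + b + 1 / 2)) = (-a) + (-b - 3 / (2 * (3 : ℕ)) : ℝ) := by norm_num; ring
      rw [this, Real.rpow_add ht]; ring
    rw [e]
    exact eLpNorm_mul_le_of_bound (by positivity) (hf.lp t ht) fun x => hg.sup (t, x) ht
  sup z hz := by
    have hM := hf.nonneg
    have hN := hg.nonneg
    have e : M * N * z.1 ^ (-(a + b + 1 / 2) - 3 / (2 * (p : ℝ))) =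
        (M * z.1 ^ (-a - 3 / (2 * (p : ℝ)))) * (N * z.1 ^ (-b - 3 / (2 * (3 : ℕ)) : ℝ)) := by
      have : (-(a + b + 1 / 2) - 3 / (2 * (p : ℝ))) =
        (-a - 3 / (2 * (p : ℝ))) + (-b - 3 / (2 * (3 : ℕ)) : ℝ) := by norm_num; ring
      rw [this, Real.rpow_add hz]; ring
    rw [e, abs_mul]
    exact mul_le_mul (hf.sup z hz) (hg.sup z hz) (abs_nonneg _)
      (mul_nonneg hM (Real.rpow_nonneg hz.le _))

/-- By the Leibniz rule each scaled derivative of the product gives two products of the same kind,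
hence the factor `2 ^ n`. -/
theorem Z.mul (hp : 1 ≤ p) : ∀ {n : ℕ} {f g : STime → ℝ}, Z p a n M f → Z 3 b n N g →
    Z p (a + b + 1 / 2) n (2 ^ n * (M * N)) (fun z => f z * g z)
  | 0, _, _, hf, hg => by
    have := ZBase.mul hf hg
    simpa [Z] using this
  | n + 1, f, g, hf, hg => by
    have hMN : 0 ≤ M * N := mul_nonneg hf.1.nonneg hg.1.nonneg
    refine ⟨(hf.1.mul hg.1).mono ?_, fun z hz => (hf.2.1 z hz).mul (hg.2.1 z hz), fun j => ?_⟩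
    · exact le_mul_of_one_le_left hMN (one_le_pow₀ one_le_two)
    · rw [X_mul j hf.2.1 hg.2.1]
      refine ((Z.mul hp (hf.2.2 j) hg.of_succ).add hp (Z.mul hp hf.of_succ (hg.2.2 j))).mono ?_
      rw [pow_succ]; linarith

theorem measurable_snd_rpow (c : ℝ) : Measurable fun z : STime => z.1 ^ c := by fun_prop

theorem ZBase.rpow_mul (c : ℝ) (hf : ZBase p a M f) :
    ZBase p (a - c) M (fun z => z.1 ^ c * f z) where
  meas := (measurable_snd_rpow c).mul hf.meas
  lp t ht := by
    have : (fun x => ((t, x) : STime).1 ^ c * f (t, x)) = (t ^ c) • fun x => f (t, x) := rfl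
    rw [this, eLpNorm_const_smul]
    have e : M * t ^ (-(a - c)) = t ^ c * (M * t ^ (-a)) := by
      have : -(a - c) = c + -a := by ring
      rw [this, Real.rpow_add ht]; ring
    rw [e, ENNReal.ofReal_mul (by positivity), Real.enorm_eq_ofReal (by positivity)]
    gcongr
    exact hf.lp t ht
  sup z hz := by
    have e : M * z.1 ^ (-(a - c) - 3 / (2 * (p : ℝ))) =
        z.1 ^ c * (M * z.1 ^ (-a - 3 / (2 * (p : ℝ)))) := by
      have : -(a - c) - 3 / (2 * (p : ℝ)) = c + (-a - 3 / (2 * (p : ℝ))) := by ring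
      rw [this, Real.rpow_add hz]; ring
    rw [e, abs_mul, abs_of_nonneg (Real.rpow_nonneg hz.le c)]
    exact mul_le_mul_of_nonneg_left (hf.sup z hz) (Real.rpow_nonneg hz.le c)

theorem hasFDerivAt_time_rpow (c : ℝ) {z : STime} (hz : 0 < z.1) :
    HasFDerivAt (fun z : STime => z.1 ^ c) ((c * z.1 ^ (c - 1)) • ContinuousLinearMap.fst ℝ ℝ R3) z :=
  (Real.hasDerivAt_rpow_const (Or.inl hz.ne')).comp_hasFDerivAt z hasFDerivAt_fst

/-- The operator t∂ₜ multiplies t^c by the constant `c`, so time powers only shift the weight. The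
indicator keeps the identity valid at nonpositive times, where `X` vanishes by convention. -/
theorem X_none_rpow_mul (c : ℝ) (hf : ∀ z : STime, 0 < z.1 → DifferentiableAt ℝ f z) :
    X none (fun z => z.1 ^ c * f z) =
      fun z => c * (z.1 ^ c * f z) * (if 0 < z.1 then 1 else 0) + z.1 ^ c * X none f z := by
  ext z
  by_cases hz : 0 < z.1
  · rw [X_of_pos _ _ hz, X_of_pos _ _ hz,
      fderiv_dir_mul (hasFDerivAt_time_rpow c hz).differentiableAt (hf z hz),
      (hasFDerivAt_time_rpow c hz).fderiv]
    simp only [dir, _root_.smul_apply, ContinuousLinearMap.coe_fst', smul_eq_mul,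
      if_pos hz, mul_one]
    have : z.1 ^ c = z.1 ^ (c - 1) * z.1 := by
      rw [Real.rpow_sub_one hz.ne']; field_simp
    rw [this]; ring
  · simp [X_of_nonpos _ _ hz, if_neg hz]

theorem X_some_rpow_mul (c : ℝ) (i : Fin 3) (hf : ∀ z : STime, 0 < z.1 → DifferentiableAt ℝ f z) :
    X (some i) (fun z => z.1 ^ c * f z) = fun z => z.1 ^ c * X (some i) f z := by
  ext z
  by_cases hz : 0 < z.1
  · rw [X_of_pos _ _ hz, X_of_pos _ _ hz,
      fderiv_dir_mul (hasFDerivAt_time_rpow c hz).differentiableAt (hf z hz),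
      (hasFDerivAt_time_rpow c hz).fderiv]
    simp [dir]
  · simp [X_of_nonpos _ _ hz]

theorem Z.rpow_mul (hp : 1 ≤ p) (c : ℝ) : ∀ {n : ℕ} {f : STime → ℝ}, Z p a n M f →
    Z p (a - c) n ((1 + |c|) ^ n * M) (fun z => z.1 ^ c * f z)
  | 0, _, hf => by simpa [Z] using ZBase.rpow_mul c hf
  | n + 1, f, hf => by
    have hM : 0 ≤ M := hf.1.nonneg
    have hc : 1 ≤ 1 + |c| := by linarith [abs_nonneg c]
    refine ⟨(hf.1.rpow_mul c).mono (le_mul_of_one_le_left hM (one_le_pow₀ hc)),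
      fun z hz => (hasFDerivAt_time_rpow c hz).differentiableAt.mul (hf.2.1 z hz), fun j => ?_⟩
    cases j with
    | none =>
      have h1 := ((Z.rpow_mul hp c hf.of_succ).const_mul c).add hp (Z.rpow_mul hp c (hf.2.2 none))
      refine Z.congr ?_ ?_ (h1.mono (by rw [pow_succ]; linarith))
      · intro z hz
        rw [X_none_rpow_mul c hf.2.1]; simp [if_pos hz]
      · rw [X_none_rpow_mul c hf.2.1]
        exact (((hf.1.rpow_mul c).meas.const_mul c).mul (Measurable.ite
          isOpen_posTime.measurableSet measurable_const measurable_const)).add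
          ((measurable_snd_rpow c).mul (hf.2.2 none).base.meas)
    | some i =>
      rw [X_some_rpow_mul c i hf.2.1]
      refine (Z.rpow_mul hp c (hf.2.2 (some i))).mono ?_
      gcongr
      · omega

/-- Interpolation through |u|³ ≤ ‖u‖_∞² |u|. The hypotheses are phrased with cubes so that no
fractional powers enter. -/
theorem eLpNorm_three_le {α : Type*} [MeasurableSpace α] {μ : Measure α} {u : α → ℝ} {A B : ℝ}
    (hA : 0 ≤ A) (hu : eLpNorm u (1 : ℕ) μ ≤ ENNReal.ofReal (A ^ 3))
    (hv : ∀ x, |u x| ≤ B ^ 3) :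
    eLpNorm u (3 : ℕ) μ ≤ ENNReal.ofReal (A * B ^ 2) := by
  rw [eLpNorm_natCast_le_iff _ (by norm_num)] at hu ⊢
  calc ∫⁻ x, ‖u x‖ₑ ^ 3 ∂μ ≤ ∫⁻ x, ENNReal.ofReal (B ^ 6) * ‖u x‖ₑ ^ 1 ∂μ := by
        refine lintegral_mono fun x => ?_
        rw [Real.enorm_eq_ofReal_abs, ← ENNReal.ofReal_pow (abs_nonneg _),
          ← ENNReal.ofReal_pow (abs_nonneg _), ← ENNReal.ofReal_mul (by positivity)]
        refine ENNReal.ofReal_le_ofReal ?_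
        have h1 := hv x
        have h2 : |u x| ^ 2 ≤ (B ^ 3) ^ 2 := pow_le_pow_left₀ (abs_nonneg _) h1 2
        calc |u x| ^ 3 = |u x| ^ 2 * |u x| := by ring
          _ ≤ (B ^ 3) ^ 2 * |u x| := mul_le_mul_of_nonneg_right h2 (abs_nonneg _)
          _ = _ := by ring
    _ = ENNReal.ofReal (B ^ 6) * ∫⁻ x, ‖u x‖ₑ ^ 1 ∂μ :=
        lintegral_const_mul' _ _ ENNReal.ofReal_ne_top
    _ ≤ ENNReal.ofReal (B ^ 6) * ENNReal.ofReal (A ^ 3) ^ 1 := by gcongr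
    _ = _ := by
        rw [pow_one, ← ENNReal.ofReal_mul (by positivity), ← ENNReal.ofReal_pow (by positivity)]
        ring_nf

/-- The parabolic weights make both sup bounds coincide, since a + 3/2 = (a + 1) + 1/2; the `L³`
bound is the interpolation of the `L¹` bound with it. -/
theorem ZBase.one_to_three (hf : ZBase 1 a M f) : ZBase 3 (a + 1) M f where
  meas := hf.meas
  lp t ht := by
    have hM := hf.nonneg
    have key : M * t ^ (-(a + 1)) =
        (M * t ^ (-a)) ^ (1 / 3 : ℝ) * ((M * t ^ (-a - 3 / 2)) ^ (1 / 3 : ℝ)) ^ 2 := by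
      rw [← Real.rpow_natCast _ 2, ← Real.rpow_mul (by positivity), Real.mul_rpow hM (by positivity),
        Real.mul_rpow hM (by positivity), ← Real.rpow_mul ht.le, ← Real.rpow_mul ht.le]
      have : M = M ^ (1 / 3 : ℝ) * M ^ (1 / 3 * ((2 : ℕ) : ℝ)) := by
        rw [← Real.rpow_add_of_nonneg hM (by norm_num) (by norm_num)]
        norm_num
      nth_rewrite 1 [this]
      have h2 : t ^ (-(a + 1)) = t ^ (-a * (1 / 3)) * t ^ ((-a - 3 / 2) * (1 / 3 * ((2 : ℕ) : ℝ))) := by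
        rw [← Real.rpow_add ht]; congr 1; push_cast; ring
      rw [h2]; ring
    have cube : ∀ y : ℝ, 0 ≤ y → (y ^ (1 / 3 : ℝ)) ^ 3 = y := fun y hy => by
      rw [← Real.rpow_natCast, ← Real.rpow_mul hy]; norm_num
    rw [key]
    refine eLpNorm_three_le (by positivity) ?_ fun x => ?_
    · rw [cube _ (by positivity)]; exact hf.lp t ht
    · rw [cube _ (by positivity)]
      have := hf.sup (t, x) ht
      simpa using this
  sup z hz := by
    have := hf.sup z hz
    convert this using 3
    norm_num; ring

theorem Z.one_to_three : ∀ {n : ℕ} {f : STime → ℝ}, Z 1 a n M f → Z 3 (a + 1) n M f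
  | 0, _, h => ZBase.one_to_three h
  | _ + 1, _, h => ⟨ZBase.one_to_three h.1, h.2.1, fun j => (h.2.2 j).one_to_three⟩

end WeightedFields

/-! ### Superpositions of weighted fields and their derivatives. -/

section Superposition

theorem rpow_le_add_of_mem_Icc {l u s : ℝ} (hl : 0 < l) (h1 : l ≤ s) (h2 : s ≤ u) (r : ℝ) :
    s ^ r ≤ l ^ r + u ^ r := by
  have hs : 0 < s := hl.trans_le h1
  have hu : 0 < u := hs.trans_le h2
  rcases le_total 0 r with hr | hr
  · have := Real.rpow_le_rpow hs.le h2 hr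
    have := Real.rpow_nonneg hl.le r
    linarith
  · have := Real.rpow_le_rpow_of_nonpos hl h1 hr
    have := Real.rpow_nonneg hu.le r
    linarith

theorem sum_coord_smul_bv (x : R3) : ∑ i, x i • bv i = x := by
  ext k
  fin_cases k <;> simp [bv, Fin.sum_univ_three]

/-- A linear functional on space-time in terms of its components. -/
theorem stime_clm_eq (L : STime →L[ℝ] ℝ) :
    L = L (1, 0) • ContinuousLinearMap.fst ℝ ℝ R3 +
      ∑ i, L (0, bv i) • (EuclideanSpace.proj i ∘L ContinuousLinearMap.snd ℝ ℝ R3) := by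
  refine ContinuousLinearMap.ext fun v => ?_
  have hv : v = v.1 • ((1, 0) : STime) + ∑ i, v.2 i • ((0, bv i) : STime) := by
    refine Prod.ext ?_ ?_
    · simp [Prod.fst_sum]
    · simp only [Prod.snd_add, Prod.smul_snd, smul_zero, zero_add, Prod.snd_sum]
      exact (sum_coord_smul_bv v.2).symm
  conv_lhs => rw [hv]
  simp only [map_add, map_smul, map_sum, smul_eq_mul, _root_.add_apply, _root_.smul_apply,
    ContinuousLinearMap.coe_fst', _root_.sum_apply, ContinuousLinearMap.comp_apply,
    ContinuousLinearMap.coe_snd', PiLp.proj_apply]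
  congr 1
  · ring
  · exact Finset.sum_congr rfl fun i _ => mul_comm _ _

theorem norm_proj_comp_snd_le (i : Fin 3) :
    ‖(EuclideanSpace.proj i ∘L ContinuousLinearMap.snd ℝ ℝ R3 : STime →L[ℝ] ℝ)‖ ≤ 1 := by
  refine ContinuousLinearMap.opNorm_le_bound _ zero_le_one fun v => ?_
  rw [one_mul]
  exact (PiLp.norm_apply_le v.2 i).trans (norm_snd_le v)

theorem stime_clm_norm_le (L : STime →L[ℝ] ℝ) : ‖L‖ ≤ |L (1, 0)| + ∑ i, |L (0, bv i)| := by
  conv_lhs => rw [stime_clm_eq L]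
  refine (norm_add_le _ _).trans (add_le_add ?_ ((norm_sum_le _ _).trans
    (Finset.sum_le_sum fun i _ => ?_)))
  · rw [norm_smul, Real.norm_eq_abs]
    exact mul_le_of_le_one_right (abs_nonneg _) (ContinuousLinearMap.norm_fst_le ℝ ℝ R3)
  · rw [norm_smul, Real.norm_eq_abs]
    exact mul_le_of_le_one_right (abs_nonneg _) (norm_proj_comp_snd_le i)

theorem fderiv_time_eq (f : STime → ℝ) {z : STime} (hz : 0 < z.1) :
    fderiv ℝ f z (1, 0) = z.1⁻¹ * X none f z := by
  rw [X_of_pos _ _ hz]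
  have : dir none z.1 = z.1 • ((1, 0) : STime) := by simp [dir]
  rw [this, map_smul, smul_eq_mul]
  field_simp

theorem fderiv_space_eq (f : STime → ℝ) (i : Fin 3) {z : STime} (hz : 0 < z.1) :
    fderiv ℝ f z (0, bv i) = (√z.1)⁻¹ * X (some i) f z := by
  rw [X_of_pos _ _ hz]
  have : dir (some i) z.1 = √z.1 • ((0, bv i) : STime) := by simp [dir]
  have h2 : √z.1 ≠ 0 := (Real.sqrt_pos.2 hz).ne'
  rw [this, map_smul, smul_eq_mul]
  field_simp

variable {Ω : Type*} [MeasurableSpace Ω] {p : ℕ} {a : ℝ}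

/-- Scaling-invariant derivatives of a measurable family of differentiable fields are measurable in
all variables. -/
theorem measurable_X_uncurry {I : Ω → STime → ℝ} (hI : Measurable (Function.uncurry I))
    (hd : ∀ w, ∀ z : STime, 0 < z.1 → DifferentiableAt ℝ (I w) z) (j : Option (Fin 3)) :
    Measurable (Function.uncurry fun w => X j (I w)) := by
  have hdir : Measurable fun t : ℝ => dir j t := by
    cases j with
    | none => exact (by fun_prop : Measurable fun t : ℝ => ((t, 0) : STime))
    | some i => exact (by fun_prop : Measurable fun t : ℝ => ((0, √t • bv i) : STime))
  have hS : MeasurableSet {q : Ω × STime | 0 < q.2.1} :=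
    measurableSet_lt measurable_const (by fun_prop)
  -- Joint measurability is obtained by writing the derivative as the pointwise limit of the
  -- difference quotients with step 1/(n+1), each of which is jointly measurable.
  set G : ℕ → Ω × STime → ℝ := fun n q => if 0 < q.2.1 then
    ((n : ℝ) + 1) * (I q.1 (q.2 + ((n : ℝ) + 1)⁻¹ • dir j q.2.1) - I q.1 q.2) else 0 with hG
  refine measurable_of_tendsto_metrizable (f := G) (fun n => ?_) ?_
  · refine Measurable.ite hS ?_ measurable_const
    have h1 : Measurable fun q : Ω × STime =>
        (q.1, q.2 + ((n : ℝ) + 1)⁻¹ • dir j q.2.1) := by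
      have := hdir.comp (by fun_prop : Measurable fun q : Ω × STime => q.2.1)
      exact measurable_fst.prodMk (measurable_snd.add (this.const_smul (((n : ℝ) + 1)⁻¹)))
    exact ((hI.comp h1).sub hI).const_mul _
  · rw [tendsto_pi_nhds]
    rintro ⟨w, z⟩
    by_cases hz : 0 < z.1
    · simp only [hG, Function.uncurry, if_pos hz, X_of_pos _ _ hz]
      have hc : Tendsto (fun n : ℕ => ‖(n : ℝ) + 1‖) atTop atTop :=
        tendsto_norm_atTop_atTop.comp (tendsto_atTop_add_const_right _ _ tendsto_natCast_atTop_atTop)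
      simpa [smul_eq_mul] using (hd w z hz).hasFDerivAt.lim (dir j z.1) hc
    · simp only [hG, Function.uncurry, if_neg hz, X_of_nonpos _ _ hz]
      exact tendsto_const_nhds

theorem ZBase.integrable_family {μ : Measure Ω} {I : Ω → STime → ℝ}
    (hI : Measurable (Function.uncurry I)) {M : Ω → ℝ} (hM : Integrable M μ)
    (h : ∀ w, ZBase p a (M w) (I w)) {z : STime} (hz : 0 < z.1) : Integrable (fun w => I w z) μ := by
  refine (hM.mul_const (z.1 ^ (-a - 3 / (2 * (p : ℝ))))).mono' ?_ ?_
  · exact (hI.comp (by fun_prop : Measurable fun w : Ω => (w, z))).aestronglyMeasurable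
  · exact Eventually.of_forall fun w => (h w).sup z hz

theorem measurable_integral_family {μ : Measure Ω} [SFinite μ] {I : Ω → STime → ℝ}
    (hI : Measurable (Function.uncurry I)) : Measurable fun z => ∫ w, I w z ∂μ := by
  have h1 : StronglyMeasurable (Function.uncurry fun (z : STime) (w : Ω) => I w z) :=
    (hI.comp (by fun_prop : Measurable fun q : STime × Ω => (q.2, q.1))).stronglyMeasurable
  exact h1.integral_prod_right.measurable

theorem ZBase.superpose (hp : 1 ≤ p) {μ : Measure Ω} [SigmaFinite μ] {I : Ω → STime → ℝ}
    (hI : Measurable (Function.uncurry I)) {M : Ω → ℝ} (hM : Integrable M μ)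
    (h : ∀ w, ZBase p a (M w) (I w)) : ZBase p a (∫ w, M w ∂μ) (fun z => ∫ w, I w z ∂μ) where
  meas := measurable_integral_family hI
  lp t ht := by
    have h0 : ∀ w, 0 ≤ M w := fun w => (h w).nonneg
    have hc : 0 ≤ t ^ (-a) := Real.rpow_nonneg ht.le _
    have key := eLpNorm_integral_le μ (volume : Measure R3) hp (I := fun w x => I w (t, x))
      (hI.comp (by fun_prop : Measurable fun q : Ω × R3 => (q.1, ((t, q.2) : STime))))
      (M := fun w => ENNReal.ofReal (M w * t ^ (-a)))
      (hM.1.aemeasurable.mul_const _).ennreal_ofReal (fun w => ENNReal.ofReal_ne_top)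
      (fun w => (h w).lp t ht)
    refine key.trans (le_of_eq ?_)
    rw [← integral_mul_const, ofReal_integral_eq_lintegral_ofReal (hM.mul_const _)
      (Eventually.of_forall fun w => mul_nonneg (h0 w) hc)]
  sup z hz := by
    calc |∫ w, I w z ∂μ| ≤ ∫ w, |I w z| ∂μ := abs_integral_le_integral_abs
      _ ≤ ∫ w, M w * z.1 ^ (-a - 3 / (2 * (p : ℝ))) ∂μ :=
          integral_mono (ZBase.integrable_family hI hM h hz).abs (hM.mul_const _)
            fun w => (h w).sup z hz
      _ = _ := integral_mul_const _ _

/-- On the slab between half and twice the given time, the scaled derivatives bound the full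
derivative by `M w` times a constant independent of the space point, so differentiation under the
integral is dominated. -/
theorem hasFDerivAt_superpose {μ : Measure Ω} {I : Ω → STime → ℝ}
    (hI : Measurable (Function.uncurry I)) {M : Ω → ℝ} (hM : Integrable M μ)
    (h : ∀ w, Z p a 1 (M w) (I w)) {z : STime} (hz : 0 < z.1) :
    HasFDerivAt (fun z => ∫ w, I w z ∂μ) (∫ w, fderiv ℝ (I w) z ∂μ) z ∧
      Integrable (fun w => fderiv ℝ (I w) z) μ := by
  set b : ℝ := -a - 3 / (2 * (p : ℝ)) with hb
  set l : ℝ := z.1 / 2 with hl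
  set u : ℝ := 2 * z.1 with hu
  have hl0 : 0 < l := by positivity
  set A : ℝ := (l⁻¹ + 3 * (√l)⁻¹) * (l ^ b + u ^ b) with hA
  have hbound : ∀ w, ∀ y ∈ {y : STime | l < y.1 ∧ y.1 < u}, ‖fderiv ℝ (I w) y‖ ≤ M w * A := by
    rintro w y ⟨hy1, hy2⟩
    have hy : 0 < y.1 := hl0.trans hy1
    have hM0 : 0 ≤ M w := (h w).1.nonneg
    have hX : ∀ j, |X j (I w) y| ≤ M w * (l ^ b + u ^ b) := fun j =>
      (((h w).2.2 j : ZBase p a (M w) _).sup y hy).trans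
        (mul_le_mul_of_nonneg_left (rpow_le_add_of_mem_Icc hl0 hy1.le hy2.le b) hM0)
    have hR : 0 ≤ M w * (l ^ b + u ^ b) := (abs_nonneg _).trans (hX none)
    refine (stime_clm_norm_le _).trans ?_
    rw [fderiv_time_eq _ hy, abs_mul, abs_of_pos (inv_pos.2 hy)]
    have h1 : y.1⁻¹ * |X none (I w) y| ≤ l⁻¹ * (M w * (l ^ b + u ^ b)) :=
      mul_le_mul (inv_anti₀ hl0 hy1.le) (hX none) (abs_nonneg _) (inv_pos.2 hl0).le
    have h2 : ∑ i, |fderiv ℝ (I w) y (0, bv i)| ≤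
        ∑ _i : Fin 3, (√l)⁻¹ * (M w * (l ^ b + u ^ b)) := by
      refine Finset.sum_le_sum fun i _ => ?_
      rw [fderiv_space_eq _ _ hy, abs_mul, abs_of_pos (inv_pos.2 (Real.sqrt_pos.2 hy))]
      exact mul_le_mul (inv_anti₀ (Real.sqrt_pos.2 hl0) (Real.sqrt_le_sqrt hy1.le)) (hX _)
        (abs_nonneg _) (inv_pos.2 (Real.sqrt_pos.2 hl0)).le
    refine (add_le_add h1 h2).trans (le_of_eq ?_)
    rw [Finset.sum_const, Finset.card_univ, Fintype.card_fin, hA]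
    simp only [nsmul_eq_mul]
    push_cast
    ring
  have hs : {y : STime | l < y.1 ∧ y.1 < u} ∈ 𝓝 z := by
    refine IsOpen.mem_nhds ?_ ⟨by simp only [hl]; linarith, by simp only [hu]; linarith⟩
    exact (isOpen_lt continuous_const continuous_fst).inter
      (isOpen_lt continuous_fst continuous_const)
  have hmeas : AEStronglyMeasurable (fun w => fderiv ℝ (I w) z) μ := by
    have hXm : ∀ j, Measurable fun w => X j (I w) z := fun j =>
      (measurable_X_uncurry hI (fun w => (h w).2.1) j).comp
        (by fun_prop : Measurable fun w : Ω => (w, z))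
    have e : (fun w => fderiv ℝ (I w) z) = fun w =>
        (z.1⁻¹ * X none (I w) z) • ContinuousLinearMap.fst ℝ ℝ R3 +
        ∑ i, ((√z.1)⁻¹ * X (some i) (I w) z) •
          (EuclideanSpace.proj i ∘L ContinuousLinearMap.snd ℝ ℝ R3 : STime →L[ℝ] ℝ) := by
      funext w
      conv_lhs => rw [stime_clm_eq (fderiv ℝ (I w) z)]
      rw [fderiv_time_eq _ hz]
      simp_rw [fderiv_space_eq _ _ hz]
    rw [e]
    refine AEStronglyMeasurable.add ?_ ?_
    · exact (((hXm none).const_mul _).aestronglyMeasurable).smul_const _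
    · refine Finset.aestronglyMeasurable_fun_sum _ fun i _ => ?_
      exact (((hXm (some i)).const_mul _).aestronglyMeasurable).smul_const _
  refine ⟨hasFDerivAt_integral_of_dominated_of_fderiv_le hs (Eventually.of_forall fun y => ?_)
    (ZBase.integrable_family hI hM (fun w => (h w).1) hz) hmeas
    (Eventually.of_forall hbound) (hM.mul_const A) (Eventually.of_forall fun w y hy =>
      ((h w).2.1 y (hl0.trans hy.1)).hasFDerivAt), ?_⟩
  · exact (hI.comp (by fun_prop : Measurable fun w : Ω => (w, y))).aestronglyMeasurable
  · exact (hM.mul_const A).mono' hmeas (Eventually.of_forall fun w => hbound w z (mem_of_mem_nhds hs))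

theorem X_superpose {μ : Measure Ω} {I : Ω → STime → ℝ}
    (hI : Measurable (Function.uncurry I)) {M : Ω → ℝ} (hM : Integrable M μ)
    (h : ∀ w, Z p a 1 (M w) (I w)) (j : Option (Fin 3)) :
    X j (fun z => ∫ w, I w z ∂μ) = fun z => ∫ w, X j (I w) z ∂μ := by
  ext z
  by_cases hz : 0 < z.1
  · simp_rw [X_of_pos _ _ hz]
    obtain ⟨h1, h2⟩ := hasFDerivAt_superpose hI hM h hz
    rw [h1.fderiv, ContinuousLinearMap.integral_apply h2]
  · simp [X_of_nonpos _ _ hz]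

theorem Z.of_le : ∀ {n m : ℕ} {M : ℝ} {f : STime → ℝ}, m ≤ n → Z p a n M f → Z p a m M f
  | n, m, M, f, hmn, h => by
    induction n, hmn using Nat.le_induction with
    | base => exact h
    | succ n _ ih => exact ih h.of_succ

/-- Scaled derivatives commute with the superposition, so the base case (Minkowski for `L^p`, the
triangle inequality for the sup norm) propagates to all orders. It serves both the Duhamel integrals
and, with counting measure, the Picard series. -/
theorem Z.superpose (hp : 1 ≤ p) {μ : Measure Ω} [SigmaFinite μ] : ∀ {n : ℕ} {I : Ω → STime → ℝ},
    Measurable (Function.uncurry I) → ∀ {M : Ω → ℝ}, Integrable M μ →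
    (∀ w, Z p a n (M w) (I w)) → Z p a n (∫ w, M w ∂μ) (fun z => ∫ w, I w z ∂μ)
  | 0, _, hI, _, hM, h => ZBase.superpose hp hI hM h
  | n + 1, I, hI, M, hM, h => by
    have h1 : ∀ w, Z p a 1 (M w) (I w) := fun w => Z.of_le (by omega) (h w)
    refine ⟨ZBase.superpose hp hI hM fun w => (h w).1,
      fun z hz => (hasFDerivAt_superpose hI hM h1 hz).1.differentiableAt, fun j => ?_⟩
    rw [X_superpose hI hM h1]
    exact Z.superpose hp (measurable_X_uncurry hI (fun w => (h w).2.1) j) hM fun w => (h w).2.2 j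

end Superposition

/-! ### Decaying profiles and self-similar kernels. -/

section Profiles

/-- The partial derivative `∂ᵢ k`. -/
noncomputable def pd (i : Fin 3) (k : R3 → ℝ) (z : R3) : ℝ := fderiv ℝ k z (bv i)

/-- The radial derivative `z · ∇k`. -/
noncomputable def eul (k : R3 → ℝ) (z : R3) : ℝ := fderiv ℝ k z z

/-- The profile of `τ ∂_τ (τ^(-3/2) k(w/√τ))`. -/
noncomputable def par (k : R3 → ℝ) (z : R3) : ℝ := -(3 / 2) * k z - 1 / 2 * eul k z

/-- Continuity and decay of order `d`. -/
def Decays (d : ℝ) (k : R3 → ℝ) : Prop :=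
  Continuous k ∧ ∃ C, ∀ z, |k z| ≤ C * (1 + ‖z‖) ^ (-d)

/-- Kernel profiles that decay with order `d` together with their derivatives up to order `n`. -/
def Prof (d : ℝ) : ℕ → (R3 → ℝ) → Prop
  | 0, k => Decays d k
  | n + 1, k => Decays d k ∧ Differentiable ℝ k ∧ (∀ i, Prof d n (pd i k)) ∧ Prof d n (eul k)

variable {d : ℝ} {n : ℕ} {k q : R3 → ℝ}

theorem Prof.base (h : Prof d n k) : Decays d k := by
  cases n with
  | zero => exact h
  | succ n => exact h.1

theorem Prof.of_succ : ∀ {n : ℕ} {k : R3 → ℝ}, Prof d (n + 1) k → Prof d n k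
  | 0, _, h => h.1
  | _ + 1, _, h => ⟨h.1, h.2.1, fun i => (h.2.2.1 i).of_succ, h.2.2.2.of_succ⟩

theorem Prof.of_le {m : ℕ} (hmn : m ≤ n) (h : Prof d n k) : Prof d m k := by
  induction n, hmn using Nat.le_induction with
  | base => exact h
  | succ n _ ih => exact ih h.of_succ

theorem Decays.add (hk : Decays d k) (hq : Decays d q) : Decays d (fun z => k z + q z) := by
  obtain ⟨C, hC⟩ := hk.2
  obtain ⟨D, hD⟩ := hq.2
  exact ⟨hk.1.add hq.1, C + D, fun z => (abs_add_le _ _).trans (by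
    rw [add_mul]; exact add_le_add (hC z) (hD z))⟩

theorem Decays.const_mul (c : ℝ) (hk : Decays d k) : Decays d (fun z => c * k z) := by
  obtain ⟨C, hC⟩ := hk.2
  exact ⟨hk.1.const_mul c, |c| * C, fun z => by
    rw [abs_mul, mul_assoc]; exact mul_le_mul_of_nonneg_left (hC z) (abs_nonneg _)⟩

theorem fderiv_add_fun (hk : Differentiable ℝ k) (hq : Differentiable ℝ q) (z v : R3) :
    fderiv ℝ (fun z => k z + q z) z v = fderiv ℝ k z v + fderiv ℝ q z v := by
  rw [fderiv_fun_add (hk z) (hq z)]; rfl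

theorem fderiv_const_mul_fun (c : ℝ) (k : R3 → ℝ) (z v : R3) :
    fderiv ℝ (fun z => c * k z) z v = c * fderiv ℝ k z v := by
  have : (fun z => c * k z) = c • k := rfl
  rw [this, fderiv_const_smul_field]; rfl

theorem Prof.add : ∀ {n : ℕ} {k q : R3 → ℝ}, Prof d n k → Prof d n q →
    Prof d n (fun z => k z + q z)
  | 0, _, _, hk, hq => Decays.add hk hq
  | n + 1, k, q, hk, hq => by
    refine ⟨hk.1.add hq.1, hk.2.1.add hq.2.1, fun i => ?_, ?_⟩
    · rw [show pd i (fun z => k z + q z) = fun z => pd i k z + pd i q z from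
        funext fun z => fderiv_add_fun hk.2.1 hq.2.1 z _]
      exact (hk.2.2.1 i).add (hq.2.2.1 i)
    · rw [show eul (fun z => k z + q z) = fun z => eul k z + eul q z from
        funext fun z => fderiv_add_fun hk.2.1 hq.2.1 z _]
      exact hk.2.2.2.add hq.2.2.2

theorem Prof.const_mul (c : ℝ) : ∀ {n : ℕ} {k : R3 → ℝ}, Prof d n k → Prof d n (fun z => c * k z)
  | 0, _, hk => Decays.const_mul c hk
  | n + 1, k, hk => by
    refine ⟨hk.1.const_mul c, hk.2.1.const_mul c, fun i => ?_, ?_⟩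
    · rw [show pd i (fun z => c * k z) = fun z => c * pd i k z from
        funext fun z => fderiv_const_mul_fun c k z _]
      exact (hk.2.2.1 i).const_mul c
    · rw [show eul (fun z => c * k z) = fun z => c * eul k z from
        funext fun z => fderiv_const_mul_fun c k z _]
      exact hk.2.2.2.const_mul c

/-- Decay of the radial derivative is built into `Prof` for this purpose: differentiating a
self-similar kernel in its scale uses up one derivative but no decay. -/
theorem Prof.par (hk : Prof d (n + 1) k) : Prof d n (par k) := by
  have : _root_.par k = fun z => (-(3 / 2)) * k z + (-(1 / 2)) * eul k z := by
    funext z; simp only [_root_.par]; ring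
  rw [this]
  exact (hk.of_succ.const_mul _).add (hk.2.2.2.const_mul _)

theorem Decays.integrable (hd : 3 < d) (hk : Decays d k) : Integrable k := by
  obtain ⟨C, hC⟩ := hk.2
  exact ((integrable_one_add_norm (by simpa using hd)).const_mul C).mono'
    hk.1.aestronglyMeasurable (Eventually.of_forall hC)

theorem Decays.bounded (hd : 0 ≤ d) (hk : Decays d k) : ∃ C, 0 ≤ C ∧ ∀ z, |k z| ≤ C := by
  obtain ⟨C, hC⟩ := hk.2
  have hC0 : 0 ≤ C := by
    have := (abs_nonneg _).trans (hC 0)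
    simpa using this
  refine ⟨C, hC0, fun z => (hC z).trans (mul_le_of_le_one_right hC0 ?_)⟩
  exact Real.rpow_le_one_of_one_le_of_nonpos (by linarith [norm_nonneg z]) (by linarith)

/-- The self-similar kernel `τ^(-3/2) k(w/√τ)`. -/
noncomputable def hker (k : R3 → ℝ) (τ : ℝ) (w : R3) : ℝ :=
  τ ^ (-(3 / 2) : ℝ) * k ((√τ)⁻¹ • w)

theorem r3_clm_apply (L : R3 →L[ℝ] ℝ) (x : R3) : L x = ∑ i, x i * L (bv i) := by
  conv_lhs => rw [← sum_coord_smul_bv x]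
  simp [map_sum]

/-- The family of self-similar kernels is stable under differentiation: up to the factors 1/τ and
1/√τ the derivatives are again such kernels, with profiles `par k` and `pd i k`. -/
theorem hasFDerivAt_hker (hk : Differentiable ℝ k) {τ : ℝ} (hτ : 0 < τ) (w : R3) :
    HasFDerivAt (fun y : STime => hker k y.1 y.2)
      ((τ⁻¹ * hker (par k) τ w) • ContinuousLinearMap.fst ℝ ℝ R3 +
        ∑ i, ((√τ)⁻¹ * hker (pd i k) τ w) •
          (EuclideanSpace.proj i ∘L ContinuousLinearMap.snd ℝ ℝ R3 : STime →L[ℝ] ℝ)) (τ, w) := by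
  have hs : √τ ≠ 0 := (Real.sqrt_pos.2 hτ).ne'
  have h1 : HasFDerivAt (fun y : STime => y.1 ^ (-(3 / 2) : ℝ))
      ((-(3 / 2) * τ ^ (-(3 / 2) - 1 : ℝ)) • ContinuousLinearMap.fst ℝ ℝ R3) (τ, w) :=
    hasFDerivAt_time_rpow (-(3 / 2)) (z := (τ, w)) hτ
  have h2 : HasFDerivAt (fun y : STime => (√y.1)⁻¹)
      ((-(1 / (2 * √τ)) / (√τ) ^ 2) • ContinuousLinearMap.fst ℝ ℝ R3) (τ, w) := by
    have h : HasDerivAt (fun s : ℝ => (√s)⁻¹) (-(1 / (2 * √τ)) / (√τ) ^ 2) τ :=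
      (Real.hasDerivAt_sqrt hτ.ne').inv hs
    exact HasDerivAt.comp_hasFDerivAt (f := fun y : STime => y.1) (τ, w) h hasFDerivAt_fst
  have h3 := h2.smul (hasFDerivAt_snd : HasFDerivAt (fun y : STime => y.2) _ (τ, w))
  have h4 := (hk ((√τ)⁻¹ • w)).hasFDerivAt.comp (τ, w) h3
  have h5 := h1.mul h4
  refine h5.congr_fderiv ?_
  refine ContinuousLinearMap.ext fun v => ?_
  simp only [Function.comp_apply, _root_.add_apply, _root_.smul_apply, smul_eq_mul,
    ContinuousLinearMap.comp_apply, ContinuousLinearMap.coe_fst', ContinuousLinearMap.coe_snd',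
    ContinuousLinearMap.smulRight_apply, _root_.sum_apply, PiLp.proj_apply, map_add, map_smul,
    hker, par, eul, pd]
  have e1 : fderiv ℝ k ((√τ)⁻¹ • w) v.2 = ∑ i, v.2 i * fderiv ℝ k ((√τ)⁻¹ • w) (bv i) :=
    r3_clm_apply _ _
  have e2 : τ ^ (-(3 / 2) - 1 : ℝ) = τ ^ (-(3 / 2) : ℝ) * τ⁻¹ := by
    rw [Real.rpow_sub_one hτ.ne']; rfl
  have e3 : (√τ) ^ 2 = τ := Real.sq_sqrt hτ.le
  rw [e1, e2, e3]
  have e4 : ∑ i, (√τ)⁻¹ * (τ ^ (-(3 / 2) : ℝ) * fderiv ℝ k ((√τ)⁻¹ • w) (bv i)) * v.2 i =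
      τ ^ (-(3 / 2) : ℝ) * ((√τ)⁻¹ * ∑ i, v.2 i * fderiv ℝ k ((√τ)⁻¹ • w) (bv i)) := by
    rw [Finset.mul_sum, Finset.mul_sum]
    exact Finset.sum_congr rfl fun i _ => by ring
  have e5 : ((fun y : STime => (√y.1)⁻¹) • (Prod.snd : STime → R3)) (τ, w) = (√τ)⁻¹ • w := rfl
  rw [e4, e5]
  field_simp
  ring

/-- For bounded `x` and for τ comparable to τ₀, 1 + ‖y‖ is at most a constant times 1 + ‖(x-y)/√τ‖.
All these kernels are thus dominated by one weight in `y`, as dominated differentiation requires. -/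
theorem hker_bound (hd : 0 ≤ d) (hk : Decays d k) {τ₀ : ℝ} (hτ₀ : 0 < τ₀) {R : ℝ} (hR : 0 ≤ R) :
    ∃ c, 0 ≤ c ∧ ∀ τ, τ₀ / 2 ≤ τ → τ ≤ 2 * τ₀ → ∀ x : R3, ‖x‖ ≤ R → ∀ y,
      |hker k τ (x - y)| ≤ c * (1 + ‖y‖) ^ (-d) := by
  obtain ⟨C, hC⟩ := hk.2
  have hC0 : 0 ≤ C := by
    have := (abs_nonneg _).trans (hC 0)
    simpa using this
  set A : ℝ := 1 + R + √(2 * τ₀) with hA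
  have hA0 : 0 < A := by positivity
  refine ⟨(τ₀ / 2) ^ (-(3 / 2) : ℝ) * (C * A ^ d), by positivity, fun τ h1 h2 x hx y => ?_⟩
  have hτ : 0 < τ := by linarith
  have hs : 0 < √τ := Real.sqrt_pos.2 hτ
  set r : ℝ := ‖(√τ)⁻¹ • (x - y)‖ with hr
  have hr0 : 0 ≤ r := norm_nonneg _
  have hxy : ‖x - y‖ = √τ * r := by
    rw [hr, norm_smul, norm_inv, Real.norm_of_nonneg hs.le]; field_simp
  have hy : 1 + ‖y‖ ≤ A * (1 + r) := by
    have h3 : ‖y‖ ≤ ‖x‖ + ‖x - y‖ := by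
      calc ‖y‖ = ‖x - (x - y)‖ := by simp
        _ ≤ _ := norm_sub_le _ _
    have h4 : √τ ≤ √(2 * τ₀) := Real.sqrt_le_sqrt h2
    have h5 : √τ * r ≤ √(2 * τ₀) * r := mul_le_mul_of_nonneg_right h4 hr0
    have h6 : 0 ≤ √(2 * τ₀) := Real.sqrt_nonneg _
    have h7 : 0 ≤ R * r := mul_nonneg hR hr0
    rw [hxy] at h3
    simp only [hA]
    nlinarith
  have hpow : (1 + r) ^ (-d) ≤ A ^ d * (1 + ‖y‖) ^ (-d) := by
    have hy0 : 0 < 1 + ‖y‖ := by positivity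
    have h3 := Real.rpow_le_rpow_of_nonpos hy0 hy (by linarith : -d ≤ 0)
    rw [Real.mul_rpow hA0.le (by positivity)] at h3
    have h4 : A ^ d * A ^ (-d) = 1 := by rw [← Real.rpow_add hA0]; simp
    calc (1 + r) ^ (-d) = A ^ d * (A ^ (-d) * (1 + r) ^ (-d)) := by rw [← mul_assoc, h4, one_mul]
      _ ≤ _ := by gcongr
  rw [hker, abs_mul, abs_of_nonneg (Real.rpow_nonneg hτ.le _), mul_assoc]
  refine mul_le_mul (Real.rpow_le_rpow_of_nonpos (by positivity) h1 (by norm_num)) ?_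
    (abs_nonneg _) (by positivity)
  calc |k ((√τ)⁻¹ • (x - y))| ≤ C * (1 + r) ^ (-d) := hC _
    _ ≤ C * (A ^ d * (1 + ‖y‖) ^ (-d)) := by gcongr
    _ = _ := by ring

theorem continuous_hker (hk : Continuous k) (τ : ℝ) : Continuous (hker k τ) := by
  unfold hker; fun_prop

theorem measurable_hker (hk : Continuous k) : Measurable fun y : STime => hker k y.1 y.2 := by
  unfold hker
  exact (measurable_snd_rpow _).mul (hk.measurable.comp (by fun_prop))

end Profiles

/-! ### Convolution of a kernel with a time slice, and its derivative. -/

section ConvolutionOperators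

variable {d : ℝ} {n : ℕ} {k q : R3 → ℝ} {f g fs : STime → ℝ}

/-- The convolution of the self-similar kernel at scale `τ` with the slice `f(s)`. -/
noncomputable def Psi (k : R3 → ℝ) (f : STime → ℝ) (τ s : ℝ) (x : R3) : ℝ :=
  ∫ y, hker k τ (x - y) * f (s, y)

/-- Local domination of a field and of its time derivative near the time `s₀`, suitable for
differentiating `Psi`. -/
def LocDom (d : ℝ) (f fs : STime → ℝ) (s₀ : ℝ) : Prop :=
  Measurable f ∧ Measurable fs ∧ ∃ ε > 0, ∃ b : R3 → ℝ,
    Integrable (fun y => b y * (1 + ‖y‖) ^ (-d)) ∧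
    ∀ s, |s - s₀| < ε → ∀ y, |f (s, y)| ≤ b y ∧ |fs (s, y)| ≤ b y ∧
      HasDerivAt (fun s => f (s, y)) (fs (s, y)) s

theorem integrable_hker_mul (hd : 0 ≤ d) (hk : Decays d k) (hf : Measurable f) {b : R3 → ℝ}
    (hb : Integrable (fun y => b y * (1 + ‖y‖) ^ (-d))) {s : ℝ} (hfb : ∀ y, |f (s, y)| ≤ b y)
    {τ : ℝ} (hτ : 0 < τ) (x : R3) : Integrable fun y => hker k τ (x - y) * f (s, y) := by
  obtain ⟨c, hc0, hc⟩ := hker_bound hd hk hτ (norm_nonneg x)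
  refine (hb.const_mul c).mono' ?_ (Eventually.of_forall fun y => ?_)
  · refine (Continuous.aestronglyMeasurable ?_).mul
      (hf.comp (by fun_prop : Measurable fun y : R3 => ((s, y) : STime))).aestronglyMeasurable
    exact (continuous_hker hk.1 τ).comp (by fun_prop)
  · rw [norm_mul, Real.norm_eq_abs, Real.norm_eq_abs]
    calc |hker k τ (x - y)| * |f (s, y)| ≤ (c * (1 + ‖y‖) ^ (-d)) * b y :=
          mul_le_mul (hc τ (by linarith) (by linarith) x le_rfl y) (hfb y) (abs_nonneg _)
            (by positivity)
      _ = _ := by ring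

/-- The projections of `ℝ × (ℝ × ℝ³)`. -/
noncomputable def projScale : ℝ × STime →L[ℝ] ℝ := ContinuousLinearMap.fst ℝ ℝ STime

noncomputable def projTime : ℝ × STime →L[ℝ] ℝ :=
  ContinuousLinearMap.fst ℝ ℝ R3 ∘L ContinuousLinearMap.snd ℝ ℝ STime

noncomputable def projSpace (i : Fin 3) : ℝ × STime →L[ℝ] ℝ :=
  (EuclideanSpace.proj i ∘L ContinuousLinearMap.snd ℝ ℝ R3 : STime →L[ℝ] ℝ) ∘L
    ContinuousLinearMap.snd ℝ ℝ STime

theorem norm_projScale_le : ‖projScale‖ ≤ 1 := ContinuousLinearMap.norm_fst_le ℝ ℝ STime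

theorem norm_projTime_le : ‖projTime‖ ≤ 1 :=
  ContinuousLinearMap.opNorm_le_bound _ zero_le_one fun v => by
    rw [one_mul]; exact (norm_fst_le v.2).trans (norm_snd_le v)

theorem norm_projSpace_le (i : Fin 3) : ‖projSpace i‖ ≤ 1 :=
  ContinuousLinearMap.opNorm_le_bound _ zero_le_one fun v => by
    rw [one_mul]; exact (PiLp.norm_apply_le v.2.2 i).trans ((norm_snd_le v.2).trans (norm_snd_le v))

theorem norm_smul_clm_le {E : Type*} [NormedAddCommGroup E] [NormedSpace ℝ E] {L : E →L[ℝ] ℝ}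
    (hL : ‖L‖ ≤ 1) {c B : ℝ} (hc : |c| ≤ B) : ‖c • L‖ ≤ B := by
  rw [norm_smul, Real.norm_eq_abs]
  exact (mul_le_of_le_one_right (abs_nonneg _) hL).trans hc

/-- Scale and time are independent variables here, so that the evolution of data (time frozen) and
the Duhamel slices (both proportional to t) are instances of the chain rule. Scale and space
derivatives fall on the kernel, the time derivative on the field. -/
theorem hasFDerivAt_Psi (hd : 0 ≤ d) (hk : Prof d 1 k) {s₀ τ₀ : ℝ} (hτ₀ : 0 < τ₀)
    (hf : LocDom d f fs s₀) (x₀ : R3) :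
    HasFDerivAt (fun q : ℝ × STime => Psi k f q.1 q.2.1 q.2.2)
      ((τ₀⁻¹ * Psi (par k) f τ₀ s₀ x₀) • projScale + Psi k fs τ₀ s₀ x₀ • projTime +
        ∑ i, ((√τ₀)⁻¹ * Psi (pd i k) f τ₀ s₀ x₀) • projSpace i) (τ₀, s₀, x₀) := by
  obtain ⟨hfm, hfsm, ε, hε, b, hb, hloc⟩ := hf
  have hpar : Decays d (par k) := hk.par
  have hpd : ∀ i, Decays d (pd i k) := fun i => hk.2.2.1 i
  set R : ℝ := ‖x₀‖ + 1 with hR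
  have hR0 : 0 ≤ R := by positivity
  obtain ⟨c0, hc00, hc0⟩ := hker_bound hd hk.1 hτ₀ hR0
  obtain ⟨c1, hc10, hc1⟩ := hker_bound hd hpar hτ₀ hR0
  choose c2 hc20 hc2 using fun i => hker_bound hd (hpd i) hτ₀ hR0
  set F : ℝ × STime → R3 → ℝ := fun q y => hker k q.1 (q.2.2 - y) * f (q.2.1, y) with hF
  set F' : ℝ × STime → R3 → (ℝ × STime →L[ℝ] ℝ) := fun q y =>
    (q.1⁻¹ * (hker (par k) q.1 (q.2.2 - y) * f (q.2.1, y))) • projScale +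
      (hker k q.1 (q.2.2 - y) * fs (q.2.1, y)) • projTime +
      ∑ i, ((√q.1)⁻¹ * (hker (pd i k) q.1 (q.2.2 - y) * f (q.2.1, y))) • projSpace i with hF'
  set S : Set (ℝ × STime) := {q | τ₀ / 2 < q.1 ∧ q.1 < 2 * τ₀ ∧ |q.2.1 - s₀| < ε ∧ ‖q.2.2‖ < R}
    with hS
  have hSn : S ∈ 𝓝 (τ₀, s₀, x₀) := by
    have o1 : IsOpen {q : ℝ × STime | τ₀ / 2 < q.1} := isOpen_lt (by fun_prop) (by fun_prop)
    have o2 : IsOpen {q : ℝ × STime | q.1 < 2 * τ₀} := isOpen_lt (by fun_prop) (by fun_prop)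
    have o3 : IsOpen {q : ℝ × STime | |q.2.1 - s₀| < ε} := isOpen_lt (by fun_prop) (by fun_prop)
    have o4 : IsOpen {q : ℝ × STime | ‖q.2.2‖ < R} := isOpen_lt (by fun_prop) (by fun_prop)
    exact (o1.inter (o2.inter (o3.inter o4))).mem_nhds ⟨by simp only [Set.mem_ofPred_eq]; linarith,
      by simp only [Set.mem_ofPred_eq]; linarith, by simpa using hε, by simp [hR]⟩
  have hslice : ∀ {h : STime → ℝ} (s : ℝ), Measurable h →
      AEStronglyMeasurable (fun y => h (s, y)) (volume : Measure R3) := fun s hh =>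
    (hh.comp (by fun_prop : Measurable fun y : R3 => ((s, y) : STime))).aestronglyMeasurable
  have hkm : ∀ {q : R3 → ℝ} (τ : ℝ) (x : R3), Continuous q →
      AEStronglyMeasurable (fun y => hker q τ (x - y)) (volume : Measure R3) := fun τ x hq =>
    ((continuous_hker hq τ).comp (by fun_prop)).aestronglyMeasurable
  have i0 := integrable_hker_mul hd hk.1 hfm hb (fun y => (hloc s₀ (by simpa using hε) y).1) hτ₀ x₀
  have is := integrable_hker_mul hd hk.1 hfsm hb (fun y => (hloc s₀ (by simpa using hε) y).2.1) hτ₀ x₀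
  have i1 := integrable_hker_mul hd hpar hfm hb (fun y => (hloc s₀ (by simpa using hε) y).1) hτ₀ x₀
  have i2 := fun i => integrable_hker_mul hd (hpd i) hfm hb
    (fun y => (hloc s₀ (by simpa using hε) y).1) hτ₀ x₀
  have key := hasFDerivAt_integral_of_dominated_of_fderiv_le (μ := (volume : Measure R3))
    (F := F) (F' := F') (x₀ := (τ₀, s₀, x₀))
    (bound := fun y => ((τ₀ / 2)⁻¹ * c1 + c0 + ∑ i, (√(τ₀ / 2))⁻¹ * c2 i) *
      (b y * (1 + ‖y‖) ^ (-d))) hSn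
    (Eventually.of_forall fun q => (hkm _ _ hk.1.1).mul (hslice _ hfm)) i0 ?_ ?_
    (hb.const_mul _) ?_
  · refine key.congr_fderiv ?_
    simp only [hF']
    rw [integral_add, integral_add, integral_finsetSum]
    · simp only [integral_smul_const, integral_const_mul]
      rfl
    · exact fun i _ => ((i2 i).const_mul _).smul_const _
    · exact (i1.const_mul _).smul_const _
    · exact is.smul_const _
    · exact ((i1.const_mul _).smul_const _).add (is.smul_const _)
    · exact integrable_finsetSum _ fun i _ => ((i2 i).const_mul _).smul_const _
  · refine ((((hkm _ _ hpar.1).mul (hslice _ hfm)).const_mul _).smul_const _ |>.add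
      (((hkm _ _ hk.1.1).mul (hslice _ hfsm)).smul_const _)).add ?_
    exact Finset.aestronglyMeasurable_fun_sum _ fun i _ =>
      (((hkm _ _ (hpd i).1).mul (hslice _ hfm)).const_mul _).smul_const _
  · refine Eventually.of_forall fun y q hq => ?_
    obtain ⟨h1, h2, h3, h4⟩ := hq
    have hq1 : 0 < q.1 := by linarith
    obtain ⟨g1, g2, -⟩ := hloc _ h3 y
    have hw : 0 ≤ (1 + ‖y‖) ^ (-d) := by positivity
    have hby : 0 ≤ b y := (abs_nonneg _).trans g1
    have gen : ∀ {u v c w W : ℝ}, |u| ≤ c * (1 + ‖y‖) ^ (-d) → |v| ≤ b y → 0 ≤ w → w ≤ W → 0 ≤ c →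
        |w * (u * v)| ≤ W * c * (b y * (1 + ‖y‖) ^ (-d)) := by
      intro u v c w W hu hv hw0 hwW hc
      rw [abs_mul, abs_mul, abs_of_nonneg hw0]
      calc w * (|u| * |v|) ≤ W * ((c * (1 + ‖y‖) ^ (-d)) * b y) := by
            gcongr
            exact hw0.trans hwW
        _ = _ := by ring
    have e1 := gen (hc1 q.1 h1.le h2.le q.2.2 h4.le y) g1 (inv_pos.2 hq1).le
      (inv_anti₀ (by positivity) h1.le) hc10
    have e0 := gen (hc0 q.1 h1.le h2.le q.2.2 h4.le y) g2 zero_le_one le_rfl hc00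
    have e2 := fun i => gen (hc2 i q.1 h1.le h2.le q.2.2 h4.le y) g1
      (inv_pos.2 (Real.sqrt_pos.2 hq1)).le
      (inv_anti₀ (Real.sqrt_pos.2 (by positivity)) (Real.sqrt_le_sqrt h1.le)) (hc20 i)
    rw [one_mul, one_mul] at e0
    simp only [hF']
    refine (norm_add_le _ _).trans ((add_le_add ((norm_add_le _ _).trans (add_le_add
      (norm_smul_clm_le norm_projScale_le e1) (norm_smul_clm_le norm_projTime_le e0)))
      ((norm_sum_le _ _).trans (Finset.sum_le_sum fun i _ =>
        norm_smul_clm_le (norm_projSpace_le i) (e2 i)))).trans (le_of_eq ?_))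
    rw [add_mul, add_mul, Finset.sum_mul]
  · refine Eventually.of_forall fun y q hq => ?_
    obtain ⟨h1, h2, h3, h4⟩ := hq
    have hq1 : 0 < q.1 := by linarith
    have hA : HasFDerivAt (fun q : ℝ × STime => ((q.1, q.2.2 - y) : STime))
        ((ContinuousLinearMap.fst ℝ ℝ STime).prod (ContinuousLinearMap.snd ℝ ℝ R3 ∘L
          ContinuousLinearMap.snd ℝ ℝ STime)) q :=
      hasFDerivAt_fst.prodMk ((hasFDerivAt_snd.comp q hasFDerivAt_snd).sub_const y)
    have hB := (hasFDerivAt_hker hk.2.1 hq1 (q.2.2 - y)).comp q hA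
    have hC : HasFDerivAt (fun q : ℝ × STime => q.2.1) projTime q := projTime.hasFDerivAt
    have hD := (hloc _ h3 y).2.2.comp_hasFDerivAt q hC
    refine (hB.mul hD).congr_fderiv ?_
    refine ContinuousLinearMap.ext fun v => ?_
    simp only [hF', Function.comp_apply, _root_.add_apply, _root_.smul_apply, smul_eq_mul,
      ContinuousLinearMap.comp_apply, _root_.sum_apply, ContinuousLinearMap.prod_apply,
      projScale, projTime, projSpace, ContinuousLinearMap.coe_fst', ContinuousLinearMap.coe_snd',
      PiLp.proj_apply]
    rw [mul_add, Finset.mul_sum]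
    have : ∀ i, f (q.2.1, y) * ((√q.1)⁻¹ * hker (pd i k) q.1 (q.2.2 - y) * v.2.2 i) =
        (√q.1)⁻¹ * (hker (pd i k) q.1 (q.2.2 - y) * f (q.2.1, y)) * v.2.2 i := fun i => by ring
    simp_rw [this]
    ring

end ConvolutionOperators

/-! ### Young and smoothing estimates. -/

section KernelEstimates

variable {d : ℝ} {n p : ℕ} {k q : R3 → ℝ} {f g : STime → ℝ} {a M : ℝ}

theorem lintegral_comp_smul_r3 {F : R3 → ℝ≥0∞} (hF : Measurable F) {r : ℝ} (hr : 0 < r) :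
    ∫⁻ w, F (r • w) = ENNReal.ofReal ((r ^ 3)⁻¹) * ∫⁻ w, F w := by
  have h := Measure.map_addHaar_smul (volume : Measure R3) hr.ne'
  rw [← lintegral_map hF (measurable_const_smul r), h, lintegral_smul_measure]
  simp only [finrank_euclideanSpace, Fintype.card_fin]
  rw [abs_of_pos (by positivity)]
  rfl

theorem sqrt_pow_three {τ : ℝ} (hτ : 0 < τ) : (√τ) ^ 3 = τ ^ (3 / 2 : ℝ) := by
  rw [Real.sqrt_eq_rpow, ← Real.rpow_natCast, ← Real.rpow_mul hτ.le]; norm_num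

theorem lintegral_hker_pow (hk : Continuous k) {τ : ℝ} (hτ : 0 < τ) (m : ℕ) :
    ∫⁻ w, ‖hker k τ w‖ₑ ^ m =
      ENNReal.ofReal (τ ^ (3 / 2 * (1 - m) : ℝ)) * ∫⁻ w, ‖k w‖ₑ ^ m := by
  have hs : 0 < √τ := Real.sqrt_pos.2 hτ
  have hmeas : Measurable fun w => ‖k w‖ₑ ^ m := (hk.measurable.enorm).pow_const m
  have e1 : ∀ w, ‖hker k τ w‖ₑ ^ m =
      ENNReal.ofReal (τ ^ (-(3 / 2) * m : ℝ)) * ‖k ((√τ)⁻¹ • w)‖ₑ ^ m := fun w => by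
    rw [hker, enorm_mul, mul_pow, Real.enorm_eq_ofReal (Real.rpow_nonneg hτ.le _),
      ← ENNReal.ofReal_pow (Real.rpow_nonneg hτ.le _), ← Real.rpow_natCast, ← Real.rpow_mul hτ.le]
  simp_rw [e1]
  rw [lintegral_const_mul' _ _ ENNReal.ofReal_ne_top,
    lintegral_comp_smul_r3 (F := fun w => ‖k w‖ₑ ^ m) hmeas (inv_pos.2 hs), ← mul_assoc,
    ← ENNReal.ofReal_mul (Real.rpow_nonneg hτ.le _)]
  congr 2
  rw [inv_pow, inv_inv, sqrt_pow_three hτ, ← Real.rpow_add hτ]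
  congr 1; ring

theorem lintegral_sub_left_r3 (F : R3 → ℝ≥0∞) (x : R3) : ∫⁻ y, F (x - y) = ∫⁻ y, F y :=
  lintegral_sub_left_eq_self F x

/-- The substitution y = x - √τ z moves the scale from the kernel into the argument of the field.
This form serves Young's inequality, differentiation of the field, and the limit τ → 0. -/
theorem Psi_eq_integral_profile (k : R3 → ℝ) (f : STime → ℝ) {τ : ℝ} (hτ : 0 < τ) (s : ℝ)
    (x : R3) : Psi k f τ s x = ∫ z, k z * f (s, x - √τ • z) := by
  have hs : 0 < √τ := Real.sqrt_pos.2 hτ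
  have h1 : Psi k f τ s x = ∫ w, hker k τ w * f (s, x - w) := by
    rw [Psi, ← integral_sub_left_eq_self (fun w => hker k τ w * f (s, x - w)) volume x]
    simp
  have h2 := Measure.integral_comp_smul (volume : Measure R3)
    (fun w => hker k τ w * f (s, x - w)) (√τ)
  simp only [finrank_euclideanSpace, Fintype.card_fin, smul_eq_mul] at h2
  rw [abs_of_pos (by positivity), sqrt_pow_three hτ] at h2
  have h3 : ∀ z : R3, hker k τ (√τ • z) = τ ^ (-(3 / 2) : ℝ) * k z := fun z => by
    rw [hker, smul_smul, inv_mul_cancel₀ hs.ne', one_smul]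
  simp_rw [h3, mul_assoc, integral_const_mul] at h2
  rw [Real.rpow_neg hτ.le] at h2
  rw [h1]
  exact (mul_left_cancel₀ (by positivity) h2).symm

theorem measurable_Psi (hk : Continuous k) (hf : Measurable f) :
    Measurable fun q : ℝ × STime => Psi k f q.1 q.2.1 q.2.2 := by
  have h1 : StronglyMeasurable (Function.uncurry fun (q : ℝ × STime) (y : R3) =>
      hker k q.1 (q.2.2 - y) * f (q.2.1, y)) := by
    refine Measurable.stronglyMeasurable (Measurable.mul ?_ ?_)
    · exact (measurable_hker hk).comp
        (by fun_prop : Measurable fun u : (ℝ × STime) × R3 => ((u.1.1, u.1.2.2 - u.2) : STime))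
    · exact hf.comp
        (by fun_prop : Measurable fun u : (ℝ × STime) × R3 => ((u.1.2.1, u.2) : STime))
  exact h1.integral_prod_right.measurable

theorem measurable_slice (hf : Measurable f) (s : ℝ) : Measurable fun y : R3 => f (s, y) :=
  hf.comp (by fun_prop)

/-- Young's inequality for an integrable profile. -/
theorem eLpNorm_Psi_le (hp : 1 ≤ p) (hkc : Continuous k) (hk : Integrable k) (hf : Measurable f)
    {τ s A : ℝ} (hτ : 0 < τ) (hA : 0 ≤ A)
    (h : eLpNorm (fun y => f (s, y)) p volume ≤ ENNReal.ofReal A) :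
    eLpNorm (fun x => Psi k f τ s x) p volume ≤ ENNReal.ofReal ((∫ z, |k z|) * A) := by
  have e : (fun x => Psi k f τ s x) = fun x => ∫ z, k z * f (s, x - √τ • z) :=
    funext fun x => Psi_eq_integral_profile k f hτ s x
  rw [e]
  have hI : Measurable (Function.uncurry fun (z x : R3) => k z * f (s, x - √τ • z)) := by
    refine Measurable.mul (hkc.measurable.comp measurable_fst) ?_
    exact hf.comp (by fun_prop : Measurable fun u : R3 × R3 => ((s, u.2 - √τ • u.1) : STime))
  refine (eLpNorm_integral_le volume volume hp hI (M := fun z => ENNReal.ofReal (|k z| * A))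
    ((hk.abs.1.aemeasurable.mul_const _).ennreal_ofReal) (fun _ => ENNReal.ofReal_ne_top)
    fun z => ?_).trans (le_of_eq ?_)
  · have e1 : (fun x => k z * f (s, x - √τ • z)) = k z • fun x => f (s, x - √τ • z) := rfl
    rw [e1, eLpNorm_const_smul, ENNReal.ofReal_mul (abs_nonneg _), Real.enorm_eq_ofReal_abs]
    gcongr
    refine le_trans (le_of_eq ?_) h
    exact eLpNorm_comp_measurePreserving (g := fun y => f (s, y))
      (measurable_slice hf s).aestronglyMeasurable (measurePreserving_sub_right volume (√τ • z))
  · rw [← integral_mul_const, ofReal_integral_eq_lintegral_ofReal (hk.abs.mul_const _)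
      (Eventually.of_forall fun z => mul_nonneg (abs_nonneg _) hA)]

theorem abs_Psi_le_of_bound (hk : Integrable k) {τ s B : ℝ} (hτ : 0 < τ)
    (h : ∀ y, |f (s, y)| ≤ B) (x : R3) : |Psi k f τ s x| ≤ (∫ z, |k z|) * B := by
  rw [Psi_eq_integral_profile k f hτ, ← integral_mul_const, ← Real.norm_eq_abs]
  refine norm_integral_le_of_norm_le (hk.abs.mul_const B) (Eventually.of_forall fun z => ?_)
  rw [norm_mul]
  exact mul_le_mul_of_nonneg_left (h _) (abs_nonneg _)

/-- Smoothing from `L^p` to the sup norm. -/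
theorem exists_abs_Psi_le_of_lp (hd : 0 ≤ d) (hp : 1 ≤ p) (hk : Decays d k)
    (hkp : Integrable k ∨ p = 1) :
    ∃ C, 0 ≤ C ∧ ∀ (f : STime → ℝ) (τ s A : ℝ), Measurable f → 0 < τ → 0 ≤ A →
      eLpNorm (fun y => f (s, y)) p volume ≤ ENNReal.ofReal A → ∀ x,
      |Psi k f τ s x| ≤ C * τ ^ (-(3 / (2 * p)) : ℝ) * A := by
  obtain ⟨C0, hC00, hC0⟩ := hk.bounded hd
  have hp0 : (p : ℝ) ≠ 0 := by positivity
  set K : ℝ := ∫ z, |k z| with hK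
  have hK0 : 0 ≤ K := integral_nonneg fun _ => abs_nonneg _
  refine ⟨(C0 * K ^ (p - 1)) ^ (1 / p : ℝ), by positivity, fun f τ s A hf hτ hA h x => ?_⟩
  have hsub : Measurable fun y : R3 => ‖hker k τ (x - y)‖ₑ :=
    ((continuous_hker hk.1 τ).measurable.comp (by fun_prop)).enorm
  have hfm : Measurable fun y : R3 => ‖f (s, y)‖ₑ := (measurable_slice hf s).enorm
  -- Jensen's inequality is used for the measure with density the absolute value of the kernel. Its
  -- mass enters with exponent `p - 1`, so for `p = 1` the profile need not be integrable.
  set ν : Measure R3 := volume.withDensity fun y => ‖hker k τ (x - y)‖ₑ with hν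
  have hν1 : ν Set.univ ^ (p - 1) ≤ ENNReal.ofReal (K ^ (p - 1)) := by
    rcases hkp with hki | rfl
    · have : ν Set.univ = ENNReal.ofReal K := by
        rw [hν, withDensity_apply _ MeasurableSet.univ, Measure.restrict_univ,
          lintegral_sub_left_r3 (fun w => ‖hker k τ w‖ₑ) x]
        have h1 := lintegral_hker_pow hk.1 hτ 1
        simp only [pow_one, Nat.cast_one, sub_self, mul_zero, Real.rpow_zero, ENNReal.ofReal_one,
          one_mul] at h1
        rw [h1, hK, ofReal_integral_eq_lintegral_ofReal hki.abs
          (Eventually.of_forall fun _ => abs_nonneg _)]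
        simp_rw [Real.enorm_eq_ofReal_abs]
      rw [this, ENNReal.ofReal_pow hK0]
    · simp
  have hlp : ∫⁻ y, ‖f (s, y)‖ₑ ^ p ≤ ENNReal.ofReal A ^ p := (eLpNorm_natCast_le_iff _ hp _).1 h
  have main : ‖Psi k f τ s x‖ₑ ^ p ≤
      ENNReal.ofReal (C0 * τ ^ (-(3 / 2) : ℝ)) * ENNReal.ofReal A ^ p * ENNReal.ofReal (K ^ (p - 1)) := by
    calc ‖Psi k f τ s x‖ₑ ^ p ≤ (∫⁻ y, ‖hker k τ (x - y)‖ₑ * ‖f (s, y)‖ₑ) ^ p := by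
          gcongr
          refine (enorm_integral_le_lintegral_enorm _).trans (le_of_eq ?_)
          simp_rw [enorm_mul]
      _ = (∫⁻ y, ‖f (s, y)‖ₑ ∂ν) ^ p := by
          rw [hν, lintegral_withDensity_eq_lintegral_mul _ hsub hfm]
          rfl
      _ ≤ (∫⁻ y, ‖f (s, y)‖ₑ ^ p ∂ν) * ν Set.univ ^ (p - 1) :=
          lintegral_pow_le ν hfm.aemeasurable hp
      _ ≤ _ := by
          gcongr
          rw [hν, lintegral_withDensity_eq_lintegral_mul _ hsub (hfm.pow_const p)]
          calc ∫⁻ y, ((fun y => ‖hker k τ (x - y)‖ₑ) * fun y => ‖f (s, y)‖ₑ ^ p) y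
              ≤ ∫⁻ y, ENNReal.ofReal (C0 * τ ^ (-(3 / 2) : ℝ)) * ‖f (s, y)‖ₑ ^ p := by
                refine lintegral_mono fun y => ?_
                simp only [Pi.mul_apply]
                gcongr
                rw [Real.enorm_eq_ofReal_abs]
                refine ENNReal.ofReal_le_ofReal ?_
                rw [hker, abs_mul, abs_of_nonneg (Real.rpow_nonneg hτ.le _), mul_comm]
                gcongr
                exact hC0 _
            _ = ENNReal.ofReal (C0 * τ ^ (-(3 / 2) : ℝ)) * ∫⁻ y, ‖f (s, y)‖ₑ ^ p :=
                lintegral_const_mul' _ _ ENNReal.ofReal_ne_top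
            _ ≤ _ := by gcongr
  have main' : |Psi k f τ s x| ^ p ≤ (C0 * τ ^ (-(3 / 2) : ℝ)) * A ^ p * K ^ (p - 1) := by
    rw [Real.enorm_eq_ofReal_abs, ← ENNReal.ofReal_pow (abs_nonneg _), ← ENNReal.ofReal_pow hA,
      ← ENNReal.ofReal_mul (by positivity), ← ENNReal.ofReal_mul (by positivity)] at main
    exact (ENNReal.ofReal_le_ofReal_iff (by positivity)).1 main
  refine (pow_le_pow_iff_left₀ (abs_nonneg _) (by positivity) (by omega : p ≠ 0)).1
    (main'.trans (le_of_eq ?_))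
  rw [mul_pow, mul_pow, ← Real.rpow_natCast (_ ^ (1 / p : ℝ)), ← Real.rpow_mul (by positivity),
    ← Real.rpow_natCast (τ ^ _), ← Real.rpow_mul hτ.le]
  have e1 : (1 / p : ℝ) * p = 1 := by field_simp
  have e2 : -(3 / (2 * p)) * (p : ℝ) = -(3 / 2) := by field_simp
  rw [e1, e2, Real.rpow_one]
  ring

/-- Smoothing from `L¹` to `L³`. -/
theorem eLpNorm_three_Psi_le (hkc : Continuous k) {K A τ s : ℝ} (hK : 0 ≤ K)
    (hk3 : eLpNorm k (3 : ℕ) volume ≤ ENNReal.ofReal K) (hf : Measurable f) (hτ : 0 < τ)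
    (h : eLpNorm (fun y => f (s, y)) (1 : ℕ) volume ≤ ENNReal.ofReal A) :
    eLpNorm (fun x => Psi k f τ s x) (3 : ℕ) volume ≤ ENNReal.ofReal (K * τ⁻¹ * A) := by
  have hI : Measurable (Function.uncurry fun (y x : R3) => hker k τ (x - y) * f (s, y)) := by
    refine Measurable.mul ?_ ?_
    · exact (continuous_hker hkc τ).measurable.comp
        (by fun_prop : Measurable fun u : R3 × R3 => u.2 - u.1)
    · exact (measurable_slice hf s).comp measurable_fst
  -- By scaling the integral of the cubed kernel is τ⁻³ times that of the profile, whence τ⁻¹ for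
  -- the norm. The convolution is then a superposition of translates of the kernel, to which
  -- Minkowski applies.
  have hker3 : eLpNorm (hker k τ) (3 : ℕ) volume ≤ ENNReal.ofReal (K * τ⁻¹) := by
    rw [eLpNorm_natCast_le_iff _ (by norm_num)] at hk3 ⊢
    rw [lintegral_hker_pow hkc hτ]
    refine (mul_le_mul_right hk3 _).trans (le_of_eq ?_)
    rw [ENNReal.ofReal_mul hK, mul_pow, mul_comm]
    congr 1
    rw [← ENNReal.ofReal_pow (by positivity)]
    congr 1
    rw [← Real.rpow_neg_one, ← Real.rpow_natCast, ← Real.rpow_mul hτ.le]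
    norm_num
  refine (eLpNorm_integral_le volume volume (by norm_num) hI
    (M := fun y => ENNReal.ofReal (K * τ⁻¹) * ‖f (s, y)‖ₑ)
    ((measurable_slice hf s).enorm.const_mul _).aemeasurable
    (fun y => ENNReal.mul_ne_top ENNReal.ofReal_ne_top enorm_ne_top) fun y => ?_).trans ?_
  · have e1 : (fun x => hker k τ (x - y) * f (s, y)) = f (s, y) • fun x => hker k τ (x - y) :=
      funext fun x => mul_comm _ _
    rw [e1, eLpNorm_const_smul, mul_comm]
    gcongr
    refine le_trans (le_of_eq ?_) hker3
    exact eLpNorm_comp_measurePreserving (g := hker k τ)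
      (continuous_hker hkc τ).aestronglyMeasurable (measurePreserving_sub_right volume y)
  · rw [lintegral_const_mul' _ _ ENNReal.ofReal_ne_top,
      ENNReal.ofReal_mul (p := K * τ⁻¹) (by positivity)]
    gcongr
    rw [eLpNorm_natCast_le_iff _ le_rfl] at h
    simpa using h

end KernelEstimates

/-! ### Admissible fields and data for differentiation. -/

section Domination

variable {d : ℝ} {n p : ℕ} {k q : R3 → ℝ} {f g : STime → ℝ} {a M : ℝ}

theorem Z.meas_X (h : Z p a (n + 1) M f) (j : Option (Fin 3)) : Measurable (X j f) :=
  (h.2.2 j).base.meas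

theorem hasDerivAt_time (hf : ∀ z : STime, 0 < z.1 → DifferentiableAt ℝ f z) {s : ℝ} (hs : 0 < s)
    (y : R3) : HasDerivAt (fun s => f (s, y)) (s⁻¹ * X none f (s, y)) s := by
  have h1 := (hf (s, y) hs).hasFDerivAt.comp_hasDerivAt s
    ((hasDerivAt_id s).prodMk (hasDerivAt_const s y))
  rw [fderiv_time_eq f hs] at h1
  exact h1

theorem hasFDerivAt_space (hf : ∀ z : STime, 0 < z.1 → DifferentiableAt ℝ f z) {s : ℝ} (hs : 0 < s)
    (x : R3) : HasFDerivAt (fun x => f (s, x))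
      (fderiv ℝ f (s, x) ∘L ContinuousLinearMap.inr ℝ ℝ R3) x :=
  (hf (s, x) hs).hasFDerivAt.comp x (hasFDerivAt_prodMk_right s x)

theorem integrable_decay (hd : 3 < d) : Integrable fun y : R3 => (1 + ‖y‖) ^ (-d) :=
  integrable_one_add_norm (by simpa using hd)

/-- On a slab away from t = 0 the field and its time derivative are bounded, and a constant is
admissible because the weight is integrable for d > 3. -/
theorem LocDom.of_Z (hd : 3 < d) (h : Z p a 1 M f) {s₀ : ℝ} (hs₀ : 0 < s₀) :
    LocDom d f (fun z => z.1⁻¹ * X none f z) s₀ := by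
  set b : ℝ := -a - 3 / (2 * (p : ℝ)) with hb
  have hM : 0 ≤ M := h.1.nonneg
  set B : ℝ := M * ((s₀ / 2) ^ b + (2 * s₀) ^ b) with hB
  have hB0 : 0 ≤ B := by positivity
  refine ⟨h.1.meas, (by fun_prop : Measurable fun z : STime => z.1⁻¹).mul (h.meas_X none), s₀ / 2,
    by positivity, fun _ => B + (s₀ / 2)⁻¹ * B, (integrable_decay hd).const_mul _, fun s hs y => ?_⟩
  obtain ⟨h1, h2⟩ := abs_lt.1 hs
  have hs0 : 0 < s := by linarith
  have hpow := rpow_le_add_of_mem_Icc (by positivity : 0 < s₀ / 2) (by linarith : s₀ / 2 ≤ s)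
    (by linarith : s ≤ 2 * s₀) b
  have g1 : |f (s, y)| ≤ B := (h.1.sup (s, y) hs0).trans (mul_le_mul_of_nonneg_left hpow hM)
  have g2 : |X none f (s, y)| ≤ B :=
    ((h.2.2 none).base.sup (s, y) hs0).trans (mul_le_mul_of_nonneg_left hpow hM)
  refine ⟨g1.trans (by have : 0 ≤ (s₀ / 2)⁻¹ * B := by positivity
                       linarith), ?_, hasDerivAt_time h.2.1 hs0 y⟩
  rw [abs_mul, abs_of_pos (inv_pos.2 hs0)]
  have : s⁻¹ * |X none f (s, y)| ≤ (s₀ / 2)⁻¹ * B :=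
    mul_le_mul (inv_anti₀ (by positivity) (by linarith)) g2 (abs_nonneg _) (by positivity)
  linarith

theorem LocDom.of_data {f₀ : R3 → ℝ} (hf₀ : Measurable f₀)
    (hi : Integrable fun y => |f₀ y| * (1 + ‖y‖) ^ (-d)) (s₀ : ℝ) :
    LocDom d (fun z => f₀ z.2) (fun _ => 0) s₀ :=
  ⟨hf₀.comp measurable_snd, measurable_const, 1, one_pos, fun y => |f₀ y|, hi, fun s _ y =>
    ⟨le_rfl, by simp, hasDerivAt_const s (f₀ y)⟩⟩

/-- Where |f₀| ≥ 1 it is bounded by |f₀|^p and the weight by 1; elsewhere the product is at most the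
weight. -/
theorem integrable_data_decay (hd : 3 < d) (hp : 1 ≤ p) {f₀ : R3 → ℝ} (hf₀ : MemLp f₀ p volume) :
    Integrable fun y => |f₀ y| * (1 + ‖y‖) ^ (-d) := by
  have h1 : Integrable fun y => ‖f₀ y‖ ^ p := hf₀.integrable_norm_pow (by omega)
  have hw : ∀ y : R3, 0 ≤ (1 + ‖y‖) ^ (-d) := fun y => by positivity
  have hw1 : ∀ y : R3, (1 + ‖y‖) ^ (-d) ≤ 1 := fun y =>
    Real.rpow_le_one_of_one_le_of_nonpos (by linarith [norm_nonneg y]) (by linarith)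
  refine (h1.add (integrable_decay hd)).mono' ?_ (Eventually.of_forall fun y => ?_)
  · exact hf₀.1.norm.mul (integrable_decay hd).1
  · rw [Real.norm_of_nonneg (mul_nonneg (abs_nonneg _) (hw y))]
    simp only [Pi.add_apply, Real.norm_eq_abs]
    rcases le_total 1 |f₀ y| with h | h
    · have h2 : |f₀ y| ≤ |f₀ y| ^ p := le_self_pow₀ h (by omega)
      have h3 := mul_le_mul h2 (hw1 y) (hw y) (by positivity)
      linarith [hw y]
    · have h3 := mul_le_mul_of_nonneg_right h (hw y)
      have : 0 ≤ |f₀ y| ^ p := by positivity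
      linarith

theorem integrable_data_decay_one (hd : 0 ≤ d) {f₀ : R3 → ℝ} (hf₀ : Integrable f₀) :
    Integrable fun y => |f₀ y| * (1 + ‖y‖) ^ (-d) := by
  refine hf₀.abs.mono' (hf₀.1.norm.mul ?_) (Eventually.of_forall fun y => ?_)
  · exact (by fun_prop : Measurable fun y : R3 => (1 + ‖y‖) ^ (-d)).aestronglyMeasurable
  · have hw : 0 ≤ (1 + ‖y‖) ^ (-d) := by positivity
    rw [Real.norm_of_nonneg (mul_nonneg (abs_nonneg _) hw)]
    exact mul_le_of_le_one_right (abs_nonneg _)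
      (Real.rpow_le_one_of_one_le_of_nonpos (by linarith [norm_nonneg y]) (by linarith))

/-- Spatial derivatives can be moved from the profile to the field. -/
theorem Psi_pd_eq (hd : 3 < d) (hk : Prof d 1 k) (h : Z p a 1 M f) {τ s : ℝ} (hτ : 0 < τ)
    (hs : 0 < s) (i : Fin 3) (x : R3) :
    (√τ)⁻¹ * Psi (pd i k) f τ s x = (√s)⁻¹ * Psi k (X (some i) f) τ s x := by
  -- The derivative in the direction `bv i` is computed twice, with the kernel depending on x (`h1`)
  -- and, after the substitution, with the field depending on x (`h2`). Uniqueness of the derivative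
  -- gives the identity.
  have h1 := (hasFDerivAt_Psi (by linarith) hk hτ (LocDom.of_Z hd h hs) x).comp_hasDerivAt_of_eq
    (0 : ℝ) (f := fun r : ℝ => ((τ, s, x + r • bv i) : ℝ × STime))
    (f' := (0, 0, bv i)) ?_ (by simp)
  swap
  · refine (hasDerivAt_const _ _).prodMk ((hasDerivAt_const _ _).prodMk ?_)
    simpa using ((hasDerivAt_id (0 : ℝ)).smul_const (bv i)).const_add x
  have hki : Integrable k := hk.1.integrable hd
  set b : ℝ := -a - 3 / (2 * (p : ℝ)) with hb
  have hfd : ∀ (r : ℝ) (z : R3), HasDerivAt (fun r : ℝ => k z * f (s, x + r • bv i - √τ • z))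
      (k z * ((√s)⁻¹ * X (some i) f (s, x + r • bv i - √τ • z))) r := fun r z => by
    have h3 : HasDerivAt (fun r : ℝ => ((s, x + r • bv i - √τ • z) : STime)) (0, bv i) r := by
      refine (hasDerivAt_const _ _).prodMk ?_
      simpa using (((hasDerivAt_id r).smul_const (bv i)).const_add x).sub_const (√τ • z)
    have h4 := (h.2.1 (s, x + r • bv i - √τ • z) hs).hasFDerivAt.comp_hasDerivAt r h3
    rw [fderiv_space_eq f i hs] at h4
    exact h4.const_mul (k z)
  have hcomp : ∀ {g : STime → ℝ} (r : ℝ), Measurable g →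
      AEStronglyMeasurable (fun z => g (s, x + r • bv i - √τ • z)) (volume : Measure R3) :=
    fun r hg => (hg.comp (by fun_prop :
      Measurable fun z : R3 => ((s, x + r • bv i - √τ • z) : STime))).aestronglyMeasurable
  have h2 := (hasDerivAt_integral_of_dominated_loc_of_deriv_le (μ := (volume : Measure R3))
    (x₀ := (0 : ℝ)) (s := Set.univ) (F := fun (r : ℝ) z => k z * f (s, x + r • bv i - √τ • z))
    (F' := fun r z => k z * ((√s)⁻¹ * X (some i) f (s, x + r • bv i - √τ • z)))
    (bound := fun z => |k z| * ((√s)⁻¹ * (M * s ^ b))) univ_mem ?_ ?_ ?_ ?_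
    (hki.abs.mul_const _) (Eventually.of_forall fun z r _ => hfd r z)).2
  · have e1 : (fun r : ℝ => ∫ z, k z * f (s, x + r • bv i - √τ • z)) =
        ((fun q : ℝ × STime => Psi k f q.1 q.2.1 q.2.2) ∘ fun r : ℝ => (τ, s, x + r • bv i)) :=
      funext fun r => (Psi_eq_integral_profile k f hτ s _).symm
    rw [e1] at h2
    have h5 := h1.unique h2
    simp only [_root_.add_apply, _root_.smul_apply, _root_.sum_apply, projScale, projTime,
      projSpace, ContinuousLinearMap.comp_apply, ContinuousLinearMap.coe_fst',
      ContinuousLinearMap.coe_snd', PiLp.proj_apply, smul_eq_mul, mul_zero, zero_add] at h5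
    rw [Finset.sum_eq_single i] at h5
    · rw [Psi_eq_integral_profile k (X (some i) f) hτ, ← integral_const_mul]
      simp only [bv, PiLp.single_apply, if_true, mul_one] at h5
      rw [h5]
      refine integral_congr_ae (Eventually.of_forall fun z => ?_)
      simp only [zero_smul, add_zero]
      ring
    · intro l _ hl
      simp [bv, hl]
    · simp
  · exact Eventually.of_forall fun r => hk.1.1.aestronglyMeasurable.mul (hcomp r h.1.meas)
  · refine (hki.abs.mul_const (M * s ^ b)).mono'
      (hk.1.1.aestronglyMeasurable.mul (hcomp 0 h.1.meas)) (Eventually.of_forall fun z => ?_)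
    rw [norm_mul]
    exact mul_le_mul_of_nonneg_left (h.1.sup _ hs) (abs_nonneg _)
  · exact hk.1.1.aestronglyMeasurable.mul ((hcomp 0 (h.meas_X _)).const_mul _)
  · refine Eventually.of_forall fun z r _ => ?_
    rw [norm_mul, norm_mul, Real.norm_of_nonneg (inv_nonneg.2 (Real.sqrt_nonneg s))]
    refine mul_le_mul_of_nonneg_left ?_ (abs_nonneg _)
    exact mul_le_mul_of_nonneg_left ((h.2.2 (some i)).base.sup _ hs)
      (inv_nonneg.2 (Real.sqrt_nonneg s))

end Domination

/-! ### Evolution of the initial data. -/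

section DataOperator

variable {d : ℝ} {n p : ℕ} {k q : R3 → ℝ} {f g : STime → ℝ} {a M : ℝ} {f₀ g₀ : R3 → ℝ}

/-- The evolution `t^(-3/2) k(·/√t) * f₀` of the data `f₀`. -/
noncomputable def Lop (k : R3 → ℝ) (f₀ : R3 → ℝ) (z : STime) : ℝ :=
  -- The slice time 1 is immaterial, because the data are treated as a field constant in time.
  Psi k (fun y => f₀ y.2) z.1 1 z.2

theorem measurable_Lop (hk : Continuous k) (hf₀ : Measurable f₀) : Measurable (Lop k f₀) :=
  (measurable_Psi hk (hf₀.comp measurable_snd)).comp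
    (by fun_prop : Measurable fun z : STime => ((z.1, 1, z.2) : ℝ × STime))

theorem hasFDerivAt_Lop (hd : 0 ≤ d) (hk : Prof d 1 k) (hf₀ : Measurable f₀)
    (hi : Integrable fun y => |f₀ y| * (1 + ‖y‖) ^ (-d)) {z : STime} (hz : 0 < z.1) :
    HasFDerivAt (Lop k f₀) ((z.1⁻¹ * Lop (par k) f₀ z) • ContinuousLinearMap.fst ℝ ℝ R3 +
      ∑ i, ((√z.1)⁻¹ * Lop (pd i k) f₀ z) •
        (EuclideanSpace.proj i ∘L ContinuousLinearMap.snd ℝ ℝ R3 : STime →L[ℝ] ℝ)) z := by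
  have h1 := hasFDerivAt_Psi hd hk hz (LocDom.of_data hf₀ hi 1) z.2
  have h2 : HasFDerivAt (fun z : STime => ((z.1, 1, z.2) : ℝ × STime))
      ((ContinuousLinearMap.fst ℝ ℝ R3).prod
        ((0 : STime →L[ℝ] ℝ).prod (ContinuousLinearMap.snd ℝ ℝ R3))) z :=
    hasFDerivAt_fst.prodMk ((hasFDerivAt_const _ _).prodMk hasFDerivAt_snd)
  refine (HasFDerivAt.comp (g := fun q : ℝ × STime => Psi k (fun y => f₀ y.2) q.1 q.2.1 q.2.2)
    z h1 h2).congr_fderiv (ContinuousLinearMap.ext fun v => ?_)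
  simp [projScale, projTime, projSpace, Lop]

theorem X_none_Lop (hd : 0 ≤ d) (hk : Prof d 1 k) (hf₀ : Measurable f₀)
    (hi : Integrable fun y => |f₀ y| * (1 + ‖y‖) ^ (-d)) {z : STime} (hz : 0 < z.1) :
    X none (Lop k f₀) z = Lop (par k) f₀ z := by
  rw [X_of_pos _ _ hz, (hasFDerivAt_Lop hd hk hf₀ hi hz).fderiv]
  simp [dir]
  field_simp

theorem sum_coord_bv (c : Fin 3 → ℝ) (r : ℝ) (i : Fin 3) :
    ∑ l, c l * (r • bv i) l = c i * r := by
  rw [Finset.sum_eq_single i]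
  · simp [bv]
  · intro l _ hl; simp [bv, hl]
  · simp

theorem X_some_Lop (hd : 0 ≤ d) (hk : Prof d 1 k) (hf₀ : Measurable f₀)
    (hi : Integrable fun y => |f₀ y| * (1 + ‖y‖) ^ (-d)) (i : Fin 3) {z : STime} (hz : 0 < z.1) :
    X (some i) (Lop k f₀) z = Lop (pd i k) f₀ z := by
  have hs : √z.1 ≠ 0 := (Real.sqrt_pos.2 hz).ne'
  rw [X_of_pos _ _ hz, (hasFDerivAt_Lop hd hk hf₀ hi hz).fderiv]
  have h := sum_coord_bv (fun l => (√z.1)⁻¹ * Lop (pd l k) f₀ z) (√z.1) i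
  simp only [dir, _root_.add_apply, _root_.smul_apply, _root_.sum_apply,
    ContinuousLinearMap.comp_apply, ContinuousLinearMap.coe_fst', ContinuousLinearMap.coe_snd',
    PiLp.proj_apply, smul_eq_mul, mul_zero, zero_add] at h ⊢
  rw [h]
  field_simp

/-- Scaled derivatives of the evolved data are evolutions of the same data with differentiated
profiles, so a base bound valid for all profiles yields every order. The class `D` is left abstract
to cover both `L^p` and the passage from `L¹` to `L³`. -/
theorem Z_Lop_of_base (hd : 0 ≤ d) (D : (R3 → ℝ) → ℝ → Prop)
    (hD : ∀ f₀ A, D f₀ A → Measurable f₀ ∧ Integrable fun y => |f₀ y| * (1 + ‖y‖) ^ (-d))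
    (H : ∀ k, Decays d k → ∃ C, 0 ≤ C ∧ ∀ f₀ A, D f₀ A → ZBase p a (C * A) (Lop k f₀))
    (hA : ∀ f₀ A, D f₀ A → 0 ≤ A) :
    ∀ (n : ℕ) (k : R3 → ℝ), Prof d n k →
      ∃ C, 0 ≤ C ∧ ∀ f₀ A, D f₀ A → Z p a n (C * A) (Lop k f₀)
  | 0, k, hk => H k hk
  | n + 1, k, hk => by
    obtain ⟨C0, hC0, h0⟩ := H k hk.base
    obtain ⟨C1, hC1, h1⟩ := Z_Lop_of_base hd D hD H hA n (par k) hk.par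
    choose C2 hC2 h2 using fun i => Z_Lop_of_base hd D hD H hA n (pd i k) (hk.2.2.1 i)
    have hsum : 0 ≤ ∑ i, C2 i := Finset.sum_nonneg fun i _ => hC2 i
    have hk1 : Prof d 1 k := hk.of_le (by omega)
    refine ⟨C0 + C1 + ∑ i, C2 i, by positivity, fun f₀ A hf => ?_⟩
    obtain ⟨hm, hi⟩ := hD f₀ A hf
    have hA0 := hA f₀ A hf
    have hdiff : ∀ z : STime, 0 < z.1 → DifferentiableAt ℝ (Lop k f₀) z := fun z hz =>
      (hasFDerivAt_Lop hd hk1 hm hi hz).differentiableAt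
    -- The measurability result for families is applied to a family indexed by one point.
    have hXm : ∀ j, Measurable (X j (Lop k f₀)) := fun j =>
      (measurable_X_uncurry (Ω := Unit) (I := fun _ => Lop k f₀)
        ((measurable_Lop hk.base.1 hm).comp measurable_snd) (fun _ => hdiff) j).comp
        (by fun_prop : Measurable fun z : STime => ((), z))
    refine ⟨(h0 f₀ A hf).mono (by gcongr; linarith), hdiff, fun j => ?_⟩
    cases j with
    | none =>
      exact Z.congr (fun z hz => X_none_Lop hd hk1 hm hi hz) (hXm _)
        ((h1 f₀ A hf).mono (by gcongr; linarith))
    | some i =>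
      have := Finset.single_le_sum (fun i _ => hC2 i) (Finset.mem_univ i)
      exact Z.congr (fun z hz => X_some_Lop hd hk1 hm hi i hz) (hXm _)
        ((h2 i f₀ A hf).mono (by gcongr; linarith))

/-- The data operator on `L^p` for a rapidly decaying profile. -/
theorem exists_Z_Lop (hd : 3 < d) (hp : 1 ≤ p) (n : ℕ) (k : R3 → ℝ) (hk : Prof d n k) :
    ∃ C, 0 ≤ C ∧ ∀ f₀ A, (Measurable f₀ ∧ 0 ≤ A ∧ eLpNorm f₀ p volume ≤ ENNReal.ofReal A) →
      Z p 0 n (C * A) (Lop k f₀) := by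
  refine Z_Lop_of_base (by linarith) _ (fun f₀ A h => ⟨h.1, integrable_data_decay hd hp
    ⟨h.1.aestronglyMeasurable, h.2.2.trans_lt ENNReal.ofReal_lt_top⟩⟩) (fun k hk => ?_)
    (fun f₀ A h => h.2.1) n k hk
  obtain ⟨C, hC, h⟩ := exists_abs_Psi_le_of_lp (by linarith) hp hk (Or.inl (hk.integrable hd))
  have hI : 0 ≤ ∫ z, |k z| := integral_nonneg fun _ => abs_nonneg _
  refine ⟨C + ∫ z, |k z|, by positivity, fun f₀ A hf => ⟨measurable_Lop hk.1 hf.1, fun t ht => ?_,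
    fun z hz => ?_⟩⟩
  · refine (eLpNorm_Psi_le hp hk.1 (hk.integrable hd) (hf.1.comp measurable_snd) ht hf.2.1
      hf.2.2).trans (ENNReal.ofReal_le_ofReal ?_)
    rw [neg_zero, Real.rpow_zero, mul_one]
    have := hf.2.1
    gcongr
    linarith
  · refine (h _ z.1 1 A (hf.1.comp measurable_snd) hz hf.2.1 hf.2.2 z.2).trans ?_
    rw [neg_zero, zero_sub, mul_assoc, mul_assoc, mul_comm A]
    have := hf.2.1
    have := Real.rpow_nonneg hz.le (-(3 / (2 * p)) : ℝ)
    gcongr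
    linarith

theorem Decays.eLpNorm_three (hd : 1 < d) (hk : Decays d k) :
    ∃ K, 0 ≤ K ∧ eLpNorm k (3 : ℕ) volume ≤ ENNReal.ofReal K := by
  obtain ⟨C, hC⟩ := hk.2
  have hi : MemLp k (3 : ℕ) volume := by
    rw [← integrable_norm_rpow_iff hk.1.aestronglyMeasurable (by norm_num) (by norm_num)]
    simp only [ENNReal.toReal_natCast, Real.rpow_natCast]
    refine ((integrable_decay (d := 3 * d) (by linarith)).const_mul (C ^ 3)).mono'
      (hk.1.aestronglyMeasurable.norm.pow 3) (Eventually.of_forall fun z => ?_)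
    rw [Real.norm_of_nonneg (by positivity), Real.norm_eq_abs]
    refine (pow_le_pow_left₀ (abs_nonneg _) (hC z) 3).trans (le_of_eq ?_)
    rw [mul_pow, ← Real.rpow_natCast ((1 + ‖z‖) ^ (-d)), ← Real.rpow_mul (by positivity)]
    congr 2
    push_cast; ring
  exact ⟨(eLpNorm k (3 : ℕ) volume).toReal, ENNReal.toReal_nonneg,
    (ENNReal.ofReal_toReal hi.2.ne).ge⟩

/-- The data operator from `L¹` to `L³` for a slowly decaying profile. -/
theorem exists_Z_Lop_one_three (hd : 1 < d) (n : ℕ) (k : R3 → ℝ) (hk : Prof d n k) :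
    ∃ C, 0 ≤ C ∧ ∀ f₀ A, (Measurable f₀ ∧ 0 ≤ A ∧
      eLpNorm f₀ (1 : ℕ) volume ≤ ENNReal.ofReal A) → Z 3 1 n (C * A) (Lop k f₀) := by
  refine Z_Lop_of_base (by linarith) _ (fun f₀ A h => ⟨h.1, integrable_data_decay_one (by linarith)
    (memLp_one_iff_integrable.1 ⟨h.1.aestronglyMeasurable, ?_⟩)⟩) (fun k hk => ?_)
    (fun f₀ A h => h.2.1) n k hk
  · simpa using h.2.2.trans_lt ENNReal.ofReal_lt_top
  obtain ⟨C, hC, h⟩ := exists_abs_Psi_le_of_lp (p := 1) (by linarith) le_rfl hk (Or.inr rfl)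
  obtain ⟨K, hK, hk3⟩ := hk.eLpNorm_three hd
  refine ⟨C + K, by positivity, fun f₀ A hf => ⟨measurable_Lop hk.1 hf.1, fun t ht => ?_,
    fun z hz => ?_⟩⟩
  · refine (eLpNorm_three_Psi_le hk.1 hK hk3 (hf.1.comp measurable_snd) ht hf.2.2).trans
      (ENNReal.ofReal_le_ofReal ?_)
    rw [Real.rpow_neg_one, mul_assoc, mul_assoc, mul_comm A]
    have := hf.2.1
    gcongr
    linarith
  · refine (h _ z.1 1 A (hf.1.comp measurable_snd) hz hf.2.1 hf.2.2 z.2).trans ?_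
    have e : (-1 - 3 / (2 * ((3 : ℕ) : ℝ)) : ℝ) = -(3 / (2 * ((1 : ℕ) : ℝ))) := by norm_num
    rw [e, mul_assoc, mul_assoc, mul_comm A]
    have := hf.2.1
    have := Real.rpow_nonneg hz.le (-(3 / (2 * ((1 : ℕ) : ℝ))) : ℝ)
    gcongr
    linarith

end DataOperator

/-! ### Slices of Duhamel integrals in the variable σ = s/t. -/

section Slices

variable {d : ℝ} {n p : ℕ} {k q : R3 → ℝ} {f g : STime → ℝ} {a M : ℝ}

/-- The contribution at time `t` of the slice of the field at time `σ t` to a Duhamel integral. -/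
noncomputable def Isl (k : R3 → ℝ) (f : STime → ℝ) (σ : ℝ) (z : STime) : ℝ :=
  Psi k f ((1 - σ) * z.1) (σ * z.1) z.2

theorem measurable_Isl_uncurry (hk : Continuous k) (hf : Measurable f) :
    Measurable (Function.uncurry (Isl k f)) :=
  (measurable_Psi hk hf).comp (by fun_prop :
    Measurable fun u : ℝ × STime => (((1 - u.1) * u.2.1, u.1 * u.2.1, u.2.2) : ℝ × STime))

theorem measurable_Isl (hk : Continuous k) (hf : Measurable f) (σ : ℝ) : Measurable (Isl k f σ) :=
  (measurable_Isl_uncurry hk hf).comp (by fun_prop : Measurable fun z : STime => (σ, z))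

theorem Psi_time_deriv (k : R3 → ℝ) (f : STime → ℝ) (τ s : ℝ) (x : R3) :
    Psi k (fun z => z.1⁻¹ * X none f z) τ s x = s⁻¹ * Psi k (X none f) τ s x := by
  rw [Psi, Psi, ← integral_const_mul]
  exact integral_congr_ae (Eventually.of_forall fun y => by ring)

theorem hasFDerivAt_Isl (hd : 3 < d) (hk : Prof d 1 k) (h : Z p a 1 M f) {σ : ℝ} (h0 : 0 < σ)
    (h1 : σ < 1) {z : STime} (hz : 0 < z.1) :
    HasFDerivAt (Isl k f σ)
      ((z.1⁻¹ * (Isl (par k) f σ z + Isl k (X none f) σ z)) • ContinuousLinearMap.fst ℝ ℝ R3 +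
      ∑ i, ((√((1 - σ) * z.1))⁻¹ * Isl (pd i k) f σ z) •
        (EuclideanSpace.proj i ∘L ContinuousLinearMap.snd ℝ ℝ R3 : STime →L[ℝ] ℝ)) z := by
  have hσ : 0 < 1 - σ := by linarith
  have g1 := hasFDerivAt_Psi (by linarith) hk (mul_pos hσ hz)
    (LocDom.of_Z hd h (mul_pos h0 hz)) z.2
  set A : STime →L[ℝ] ℝ × STime := ((1 - σ) • ContinuousLinearMap.fst ℝ ℝ R3).prod
    ((σ • ContinuousLinearMap.fst ℝ ℝ R3).prod (ContinuousLinearMap.snd ℝ ℝ R3)) with hA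
  refine (HasFDerivAt.comp (g := fun q : ℝ × STime => Psi k f q.1 q.2.1 q.2.2)
    z g1 A.hasFDerivAt).congr_fderiv (ContinuousLinearMap.ext fun v => ?_)
  rw [Psi_time_deriv]
  simp only [hA, projScale, projTime, projSpace, Isl, _root_.add_apply, _root_.smul_apply,
    _root_.sum_apply, ContinuousLinearMap.comp_apply, ContinuousLinearMap.coe_fst',
    ContinuousLinearMap.coe_snd', PiLp.proj_apply, smul_eq_mul, ContinuousLinearMap.prod_apply]
  congr 1
  field_simp

/-- Scale (1-σ)t and time σt are both proportional to t, so t∂ₜ splits into a kernel term and a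
field term with no singular factor in σ. -/
theorem X_none_Isl (hd : 3 < d) (hk : Prof d 1 k) (h : Z p a 1 M f) {σ : ℝ} (h0 : 0 < σ)
    (h1 : σ < 1) {z : STime} (hz : 0 < z.1) :
    X none (Isl k f σ) z = Isl (par k) f σ z + Isl k (X none f) σ z := by
  rw [X_of_pos _ _ hz, (hasFDerivAt_Isl hd hk h h0 h1 hz).fderiv]
  simp [dir]
  field_simp

theorem X_some_Isl (hd : 3 < d) (hk : Prof d 1 k) (h : Z p a 1 M f) {σ : ℝ} (h0 : 0 < σ)
    (h1 : σ < 1) (i : Fin 3) {z : STime} (hz : 0 < z.1) :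
    X (some i) (Isl k f σ) z = (√(1 - σ))⁻¹ * Isl (pd i k) f σ z := by
  have hσ : 0 < 1 - σ := by linarith
  have hs : √z.1 ≠ 0 := (Real.sqrt_pos.2 hz).ne'
  have hs2 : √(1 - σ) ≠ 0 := (Real.sqrt_pos.2 hσ).ne'
  rw [X_of_pos _ _ hz, (hasFDerivAt_Isl hd hk h h0 h1 hz).fderiv]
  have h := sum_coord_bv (fun l => (√((1 - σ) * z.1))⁻¹ * Isl (pd l k) f σ z) (√z.1) i
  simp only [dir, _root_.add_apply, _root_.smul_apply, _root_.sum_apply,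
    ContinuousLinearMap.comp_apply, ContinuousLinearMap.coe_fst', ContinuousLinearMap.coe_snd',
    PiLp.proj_apply, smul_eq_mul, mul_zero, zero_add] at h ⊢
  rw [h, Real.sqrt_mul hσ.le]
  field_simp

/-- Alternative to `X_some_Isl`: placing the derivative on the field costs σ^(-1/2) instead of
(1-σ)^(-1/2). Each form is harmless on one half of the unit interval. -/
theorem X_some_Isl' (hd : 3 < d) (hk : Prof d 1 k) (h : Z p a 1 M f) {σ : ℝ} (h0 : 0 < σ)
    (h1 : σ < 1) (i : Fin 3) {z : STime} (hz : 0 < z.1) :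
    X (some i) (Isl k f σ) z = (√σ)⁻¹ * Isl k (X (some i) f) σ z := by
  have hσ : 0 < 1 - σ := by linarith
  have hs : √z.1 ≠ 0 := (Real.sqrt_pos.2 hz).ne'
  have hs1 : √σ ≠ 0 := (Real.sqrt_pos.2 h0).ne'
  have hs2 : √(1 - σ) ≠ 0 := (Real.sqrt_pos.2 hσ).ne'
  have key := Psi_pd_eq hd hk h (mul_pos hσ hz) (mul_pos h0 hz) i z.2
  rw [Real.sqrt_mul hσ.le, Real.sqrt_mul h0.le] at key
  rw [X_some_Isl hd hk h h0 h1 i hz]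
  simp only [Isl]
  field_simp at key ⊢
  linarith

/-- Young's inequality gives the `L^p` bound. For the sup norm, smoothing from `L^p` is used when σ
≤ 1/2 and the sup bound of the field when σ ≥ 1/2, so that the only singularity in σ is σ^(-a). -/
theorem exists_ZBase_Isl (hd : 3 < d) (hp : 1 ≤ p) (hk : Decays d k) :
    ∃ C, 0 ≤ C ∧ ∀ (M : ℝ) (f : STime → ℝ) (σ : ℝ), 0 < σ → σ < 1 → ZBase p a M f →
      ZBase p a (C * (σ ^ (-a) * M)) (Isl k f σ) := by
  obtain ⟨C, hC, h⟩ := exists_abs_Psi_le_of_lp (by linarith) hp hk (Or.inl (hk.integrable hd))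
  set K : ℝ := ∫ z, |k z| with hK
  have hK0 : 0 ≤ K := integral_nonneg fun _ => abs_nonneg _
  set B : ℝ := (1 / 2 : ℝ) ^ (-(3 / (2 * p)) : ℝ) with hB
  have hB1 : 1 ≤ B := Real.one_le_rpow_of_pos_of_le_one_of_nonpos (by norm_num) (by norm_num)
    (by simp only [Left.neg_nonpos_iff]; positivity)
  refine ⟨(C + K) * B, by positivity, fun M f σ h0 h1 hf => ?_⟩
  have hM := hf.nonneg
  have hσ : 0 < 1 - σ := by linarith
  have hσa : 0 ≤ σ ^ (-a) := Real.rpow_nonneg h0.le _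
  refine ⟨measurable_Isl hk.1 hf.meas σ, fun t ht => ?_, fun z hz => ?_⟩
  · have hta : 0 ≤ t ^ (-a) := Real.rpow_nonneg ht.le _
    refine (eLpNorm_Psi_le (A := M * (σ * t) ^ (-a)) hp hk.1 (hk.integrable hd) hf.meas (mul_pos hσ ht)
      (by positivity) (hf.lp _ (mul_pos h0 ht))).trans (ENNReal.ofReal_le_ofReal ?_)
    rw [Real.mul_rpow h0.le ht.le]
    calc K * (M * (σ ^ (-a) * t ^ (-a))) = K * 1 * (σ ^ (-a) * M * t ^ (-a)) := by ring
      _ ≤ (C + K) * B * (σ ^ (-a) * M * t ^ (-a)) := by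
        gcongr; linarith
      _ = _ := by ring
  · set e : ℝ := -(3 / (2 * p)) with he
    have e1 : -a - 3 / (2 * (p : ℝ)) = -a + e := by rw [he]; ring
    have hta : 0 ≤ z.1 ^ (-a) := Real.rpow_nonneg hz.le _
    have hte : 0 ≤ z.1 ^ e := Real.rpow_nonneg hz.le _
    have he0 : e ≤ 0 := by rw [he, Left.neg_nonpos_iff]; positivity
    rw [e1, Real.rpow_add hz]
    rcases le_total σ (1 / 2) with hh | hh
    · have g1 := h f ((1 - σ) * z.1) (σ * z.1) (M * (σ * z.1) ^ (-a)) hf.meas (mul_pos hσ hz)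
        (by positivity) (hf.lp _ (mul_pos h0 hz)) z.2
      refine g1.trans ?_
      rw [Real.mul_rpow h0.le hz.le, Real.mul_rpow hσ.le hz.le]
      have g2 : (1 - σ) ^ e ≤ B :=
        Real.rpow_le_rpow_of_nonpos (by norm_num) (by linarith) he0
      calc C * ((1 - σ) ^ e * z.1 ^ e) * (M * (σ ^ (-a) * z.1 ^ (-a)))
          = C * (1 - σ) ^ e * (σ ^ (-a) * M * (z.1 ^ (-a) * z.1 ^ e)) := by ring
        _ ≤ (C + K) * B * (σ ^ (-a) * M * (z.1 ^ (-a) * z.1 ^ e)) := by gcongr; linarith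
        _ = _ := by ring
    · have g1 := abs_Psi_le_of_bound (k := k) (f := f) (hk.integrable hd) (mul_pos hσ hz)
        (s := σ * z.1) (B := M * (σ * z.1) ^ (-a - 3 / (2 * (p : ℝ))))
        (fun y => hf.sup (σ * z.1, y) (mul_pos h0 hz)) z.2
      refine g1.trans ?_
      rw [e1, Real.mul_rpow h0.le hz.le, Real.rpow_add h0, Real.rpow_add hz]
      have g2 : σ ^ e ≤ B := Real.rpow_le_rpow_of_nonpos (by norm_num) hh he0
      calc K * (M * (σ ^ (-a) * σ ^ e * (z.1 ^ (-a) * z.1 ^ e)))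
          = K * σ ^ e * (σ ^ (-a) * M * (z.1 ^ (-a) * z.1 ^ e)) := by ring
        _ ≤ (C + K) * B * (σ ^ (-a) * M * (z.1 ^ (-a) * z.1 ^ e)) := by gcongr; linarith
        _ = _ := by ring

/-- Induction on the order: each space derivative goes on the kernel for σ ≤ 1/2 and on the field
for σ ≥ 1/2, at a cost of at most 2 in either case. The loss in σ is therefore the same σ^(-a) at
every order. -/
theorem exists_Z_Isl (hd : 3 < d) (hp : 1 ≤ p) : ∀ (n : ℕ) (k : R3 → ℝ), Prof d n k →
    ∃ C, 0 ≤ C ∧ ∀ (M : ℝ) (f : STime → ℝ) (σ : ℝ), 0 < σ → σ < 1 → Z p a n M f →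
      Z p a n (C * (σ ^ (-a) * M)) (Isl k f σ)
  | 0, k, hk => exists_ZBase_Isl hd hp hk
  | n + 1, k, hk => by
    obtain ⟨C0, hC0, h0⟩ := exists_ZBase_Isl (p := p) hd hp hk.base
    obtain ⟨C1, hC1, h1⟩ := exists_Z_Isl hd hp n (par k) hk.par
    obtain ⟨C2, hC2, h2⟩ := exists_Z_Isl hd hp n k hk.of_succ
    choose C3 hC3 h3 using fun i => exists_Z_Isl hd hp n (pd i k) (hk.2.2.1 i)
    have hsum : 0 ≤ ∑ i, C3 i := Finset.sum_nonneg fun i _ => hC3 i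
    have hk1 : Prof d 1 k := hk.of_le (by omega)
    refine ⟨C0 + C1 + 2 * C2 + 2 * ∑ i, C3 i, by positivity, fun M f σ hσ0 hσ1 hf => ?_⟩
    have hf1 : Z p a 1 M f := Z.of_le (by omega) hf
    have hM : 0 ≤ M := hf.base.nonneg
    have hR : 0 ≤ σ ^ (-a) * M := mul_nonneg (Real.rpow_nonneg hσ0.le _) hM
    have hσ : 0 < 1 - σ := by linarith
    have hdiff : ∀ z : STime, 0 < z.1 → DifferentiableAt ℝ (Isl k f σ) z := fun z hz =>
      (hasFDerivAt_Isl hd hk1 hf1 hσ0 hσ1 hz).differentiableAt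
    have hXm : ∀ j, Measurable (X j (Isl k f σ)) := fun j =>
      (measurable_X_uncurry (Ω := Unit) (I := fun _ => Isl k f σ)
        ((measurable_Isl hk.base.1 hf.1.meas σ).comp measurable_snd) (fun _ => hdiff) j).comp
        (by fun_prop : Measurable fun z : STime => ((), z))
    have half : ∀ {r : ℝ}, 1 / 2 ≤ r → |(√r)⁻¹| ≤ 2 := fun {r} hr => by
      have h4 : (1 / 2 : ℝ) ≤ √r := Real.le_sqrt_of_sq_le (by linarith)
      rw [abs_of_nonneg (by positivity)]
      calc (√r)⁻¹ ≤ (1 / 2 : ℝ)⁻¹ := inv_anti₀ (by norm_num) h4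
        _ = 2 := by norm_num
    refine ⟨(h0 M f σ hσ0 hσ1 hf.1).mono ?_, hdiff, fun j => ?_⟩
    · gcongr; linarith
    cases j with
    | none =>
      refine Z.congr (fun z hz => X_none_Isl hd hk1 hf1 hσ0 hσ1 hz) (hXm _)
        (((h1 M f σ hσ0 hσ1 hf.of_succ).add hp (h2 M _ σ hσ0 hσ1 (hf.2.2 none))).mono ?_)
      rw [← add_mul]
      exact mul_le_mul_of_nonneg_right (by linarith) hR
    | some i =>
      have hle := Finset.single_le_sum (fun i _ => hC3 i) (Finset.mem_univ i)
      rcases le_total σ (1 / 2) with hh | hh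
      · refine Z.congr (fun z hz => X_some_Isl hd hk1 hf1 hσ0 hσ1 i hz) (hXm _)
          (((h3 i M f σ hσ0 hσ1 hf.of_succ).const_mul _).mono ?_)
        have := half (by linarith : 1 / 2 ≤ 1 - σ)
        have h4 := hC3 i
        calc |(√(1 - σ))⁻¹| * (C3 i * (σ ^ (-a) * M)) ≤ 2 * (C3 i * (σ ^ (-a) * M)) := by gcongr
          _ = 2 * C3 i * (σ ^ (-a) * M) := by ring
          _ ≤ _ := by gcongr; linarith
      · refine Z.congr (fun z hz => X_some_Isl' hd hk1 hf1 hσ0 hσ1 i hz) (hXm _)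
          (((h2 M _ σ hσ0 hσ1 (hf.2.2 (some i))).const_mul _).mono ?_)
        have := half hh
        calc |(√σ)⁻¹| * (C2 * (σ ^ (-a) * M)) ≤ 2 * (C2 * (σ ^ (-a) * M)) := by gcongr
          _ = 2 * C2 * (σ ^ (-a) * M) := by ring
          _ ≤ _ := by gcongr; linarith

end Slices

/-! ### Duhamel integrals as weighted superpositions of slices. -/

section Duhamel

variable {d : ℝ} {n p : ℕ} {k q : R3 → ℝ} {f g : STime → ℝ} {a M N c : ℝ}

/-- The weight `(1 - σ)^c` on `(0, 1)`. -/
noncomputable def wt (c σ : ℝ) : ℝ := if 0 < σ ∧ σ < 1 then (1 - σ) ^ c else 0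

theorem wt_nonneg (c σ : ℝ) : 0 ≤ wt c σ := by
  unfold wt
  split_ifs with h
  · exact Real.rpow_nonneg (by linarith [h.2]) _
  · exact le_rfl

theorem measurable_wt (c : ℝ) : Measurable (wt c) := by
  refine Measurable.ite ?_ (by fun_prop) measurable_const
  exact (measurableSet_lt measurable_const measurable_id).inter
    (measurableSet_lt measurable_id measurable_const)

/-- A Beta integral: on each half of (0,1) one of the two powers is bounded and the other is
integrable. -/
theorem integrable_wt_mul_rpow (hc : -1 < c) (ha : a < 1) :
    Integrable fun σ => wt c σ * σ ^ (-a) := by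
  have h1 : IntegrableOn (fun σ : ℝ => σ ^ (-a)) (Set.Ioo 0 1) := by
    rw [← intervalIntegrable_iff_integrableOn_Ioo_of_le zero_le_one]
    exact intervalIntegral.intervalIntegrable_rpow' (by linarith)
  have h2 : IntegrableOn (fun σ : ℝ => (1 - σ) ^ c) (Set.Ioo 0 1) := by
    rw [← intervalIntegrable_iff_integrableOn_Ioo_of_le zero_le_one]
    have := (intervalIntegral.intervalIntegrable_rpow' (a := 0) (b := 1) hc).comp_sub_left 1
    simpa using this.symm
  set A : ℝ := (1 / 2 : ℝ) ^ (-a) + 1 ^ (-a) with hA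
  set B : ℝ := (1 / 2 : ℝ) ^ c + 1 ^ c with hB
  have h3 : IntegrableOn (fun σ : ℝ => wt c σ * σ ^ (-a)) (Set.Ioo 0 1) := by
    refine ((h1.const_mul B).add (h2.const_mul A)).mono'
      ((measurable_wt c).mul (by fun_prop)).aestronglyMeasurable ?_
    refine (ae_restrict_iff' measurableSet_Ioo).2 (Eventually.of_forall fun σ hσ => ?_)
    have e : wt c σ = (1 - σ) ^ c := if_pos hσ
    have p1 : 0 ≤ (1 - σ) ^ c := Real.rpow_nonneg (by linarith [hσ.2]) _
    have p2 : 0 ≤ σ ^ (-a) := Real.rpow_nonneg hσ.1.le _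
    rw [e, Real.norm_of_nonneg (mul_nonneg p1 p2)]
    simp only [Pi.add_apply]
    rcases le_total σ (1 / 2) with h | h
    · have := rpow_le_add_of_mem_Icc (by norm_num : (0 : ℝ) < 1 / 2)
        (by linarith : 1 / 2 ≤ 1 - σ) (by linarith [hσ.1] : 1 - σ ≤ 1) c
      have h4 := mul_le_mul_of_nonneg_right this p2
      have : 0 ≤ A * (1 - σ) ^ c := by positivity
      linarith
    · have := rpow_le_add_of_mem_Icc (by norm_num : (0 : ℝ) < 1 / 2) h hσ.2.le (-a)
      have h4 := mul_le_mul_of_nonneg_left this p1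
      have : 0 ≤ B * σ ^ (-a) := by positivity
      linarith
  refine (integrableOn_iff_integrable_of_support_subset ?_).1 h3
  intro σ hσ
  by_contra hn
  exact hσ (by simp [wt, show ¬(0 < σ ∧ σ < 1) from hn])

/-- The family of weighted slices whose superposition is a Duhamel integral. -/
noncomputable def Wsl (c : ℝ) (k : R3 → ℝ) (f : STime → ℝ) (σ : ℝ) (z : STime) : ℝ :=
  wt c σ * Isl k f σ z

theorem measurable_Wsl_uncurry (c : ℝ) (hk : Continuous k) (hf : Measurable f) :
    Measurable (Function.uncurry (Wsl c k f)) :=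
  ((measurable_wt c).comp measurable_fst).mul (measurable_Isl_uncurry hk hf)

/-- The Duhamel integral `∫₀ᵗ (t-s)^c · (t-s)^(-3/2) k(·/√(t-s)) * f(s) ds` in the variable
`σ = s/t`. -/
noncomputable def Dop (c : ℝ) (k : R3 → ℝ) (f : STime → ℝ) (z : STime) : ℝ :=
  z.1 ^ (c + 1) * ∫ σ, Wsl c k f σ z

theorem exists_Z_Wsl (hd : 3 < d) (hp : 1 ≤ p) (c : ℝ) (n : ℕ) (k : R3 → ℝ) (hk : Prof d n k) :
    ∃ C, 0 ≤ C ∧ ∀ (M : ℝ) (f : STime → ℝ), Z p a n M f →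
      ∀ σ, Z p a n (wt c σ * σ ^ (-a) * (C * M)) (Wsl c k f σ) := by
  obtain ⟨C, hC, h⟩ := exists_Z_Isl (p := p) (a := a) hd hp n k hk
  refine ⟨C, hC, fun M f hf σ => ?_⟩
  by_cases hσ : 0 < σ ∧ σ < 1
  · have h1 := (h M f σ hσ.1 hσ.2 hf).const_mul (wt c σ)
    rw [abs_of_nonneg (wt_nonneg c σ)] at h1
    have e : wt c σ * σ ^ (-a) * (C * M) = wt c σ * (C * (σ ^ (-a) * M)) := by ring
    rw [e]
    exact h1
  · have h0 : wt c σ = 0 := if_neg hσ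
    have e : Wsl c k f σ = fun _ => 0 := by funext z; simp [Wsl, h0]
    rw [e, h0]
    simpa using Z.zero n

theorem exists_Z_integral_Wsl (hd : 3 < d) (hp : 1 ≤ p) (hc : -1 < c) (ha : a < 1) (n : ℕ)
    (k : R3 → ℝ) (hk : Prof d n k) :
    ∃ C, 0 ≤ C ∧ ∀ (M : ℝ) (f : STime → ℝ), Z p a n M f →
      Z p a n (C * M) (fun z => ∫ σ, Wsl c k f σ z) := by
  obtain ⟨C, hC, h⟩ := exists_Z_Wsl (p := p) (a := a) hd hp c n k hk
  have hI := integrable_wt_mul_rpow (a := a) hc ha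
  have hI0 : 0 ≤ ∫ σ, wt c σ * σ ^ (-a) := by
    refine integral_nonneg fun σ => ?_
    by_cases hσ : 0 < σ ∧ σ < 1
    · exact mul_nonneg (wt_nonneg _ _) (Real.rpow_nonneg hσ.1.le _)
    · simp [wt, hσ]
  refine ⟨(∫ σ, wt c σ * σ ^ (-a)) * C, by positivity, fun M f hf => ?_⟩
  have := Z.superpose hp (measurable_Wsl_uncurry c hk.base.1 hf.base.meas)
    (hI.mul_const (C * M)) (h M f hf)
  rw [integral_mul_const] at this
  rwa [mul_assoc]

/-- Duhamel integrals gain `c + 1` powers of time. -/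
theorem exists_Z_Dop (hd : 3 < d) (hp : 1 ≤ p) (hc : -1 < c) (ha : a < 1) (n : ℕ)
    (k : R3 → ℝ) (hk : Prof d n k) :
    ∃ C, 0 ≤ C ∧ ∀ (M : ℝ) (f : STime → ℝ), Z p a n M f →
      Z p (a - (c + 1)) n (C * M) (Dop c k f) := by
  obtain ⟨C, hC, h⟩ := exists_Z_integral_Wsl (p := p) hd hp hc ha n k hk
  refine ⟨(1 + |c + 1|) ^ n * C, by positivity, fun M f hf => ?_⟩
  rw [mul_assoc]
  exact (h M f hf).rpow_mul hp (c + 1)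

theorem integrable_Wsl (hd : 3 < d) (hp : 1 ≤ p) (hc : -1 < c) (ha : a < 1)
    (hk : Decays d k) (hf : ZBase p a M f) {z : STime} (hz : 0 < z.1) :
    Integrable fun σ => Wsl c k f σ z := by
  obtain ⟨C, hC, h⟩ := exists_Z_Wsl (p := p) (a := a) hd hp c 0 k hk
  exact ZBase.integrable_family (measurable_Wsl_uncurry c hk.1 hf.meas)
    ((integrable_wt_mul_rpow (a := a) hc ha).mul_const (C * M)) (h M f hf) hz

theorem integrable_hker_mul_of_ZBase (hd : 3 < d) (hk : Decays d k) (hf : ZBase p a M f) {τ s : ℝ}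
    (hτ : 0 < τ) (hs : 0 < s) (x : R3) : Integrable fun y => hker k τ (x - y) * f (s, y) :=
  integrable_hker_mul (b := fun _ => M * s ^ (-a - 3 / (2 * (p : ℝ)))) (by linarith) hk hf.meas
    ((integrable_decay hd).const_mul _)
    (fun y => hf.sup (s, y) hs) hτ x

theorem Isl_sub (hd : 3 < d) (hk : Decays d k) (hf : ZBase p a M f) (hg : ZBase p a N g)
    {σ : ℝ} (h0 : 0 < σ) (h1 : σ < 1) {z : STime} (hz : 0 < z.1) :
    Isl k (fun z => f z - g z) σ z = Isl k f σ z - Isl k g σ z := by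
  have hτ : 0 < (1 - σ) * z.1 := mul_pos (by linarith) hz
  simp only [Isl, Psi]
  rw [← integral_sub (integrable_hker_mul_of_ZBase hd hk hf hτ (mul_pos h0 hz) z.2)
    (integrable_hker_mul_of_ZBase hd hk hg hτ (mul_pos h0 hz) z.2)]
  exact integral_congr_ae (Eventually.of_forall fun y => mul_sub _ _ _)

theorem Dop_sub (hd : 3 < d) (hp : 1 ≤ p) (hc : -1 < c) (ha : a < 1) (hk : Decays d k)
    (hf : ZBase p a M f) (hg : ZBase p a N g) {z : STime} (hz : 0 < z.1) :
    Dop c k (fun z => f z - g z) z = Dop c k f z - Dop c k g z := by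
  rw [Dop, Dop, Dop, ← mul_sub, ← integral_sub (integrable_Wsl hd hp hc ha hk hf hz)
    (integrable_Wsl hd hp hc ha hk hg hz)]
  congr 1
  refine integral_congr_ae (Eventually.of_forall fun σ => ?_)
  simp only [Wsl]
  by_cases hσ : 0 < σ ∧ σ < 1
  · rw [Isl_sub hd hk hf hg hσ.1 hσ.2 hz, mul_sub]
  · simp [wt, hσ]

/-- A Duhamel integral up to time `t` only depends on the field before time `t`. -/
theorem Dop_congr_before {z : STime} (hz : 0 < z.1) (h : ∀ w : STime, 0 < w.1 → w.1 < z.1 → f w = g w) :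
    Dop c k f z = Dop c k g z := by
  rw [Dop, Dop]
  congr 1
  refine integral_congr_ae (Eventually.of_forall fun σ => ?_)
  simp only [Wsl]
  by_cases hσ : 0 < σ ∧ σ < 1
  · congr 1
    refine integral_congr_ae (Eventually.of_forall fun y => ?_)
    simp only
    rw [h (σ * z.1, y) (mul_pos hσ.1 hz) (by simp only; nlinarith [hσ.2])]
  · simp [wt, hσ]

end Duhamel

/-! ### The heat kernel, its derivatives, and self-similar heat solutions. -/

section GaussianProfiles

/-- The heat kernel at time one. -/
noncomputable def gs (z : R3) : ℝ := (4 * Real.pi) ^ (-(3 / 2) : ℝ) * Real.exp (-‖z‖ ^ 2 / 4)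

/-- The span of the products of monomials with the heat kernel. -/
inductive GaussPoly : (R3 → ℝ) → Prop
  | base : GaussPoly gs
  | coord {k : R3 → ℝ} (i : Fin 3) : GaussPoly k → GaussPoly fun z => z i * k z
  | add {k q : R3 → ℝ} : GaussPoly k → GaussPoly q → GaussPoly fun z => k z + q z
  | smul {k : R3 → ℝ} (c : ℝ) : GaussPoly k → GaussPoly fun z => c * k z

variable {d : ℝ} {n : ℕ} {k q : R3 → ℝ}

theorem contDiff_gs : ContDiff ℝ ∞ gs := by
  unfold gs
  exact contDiff_const.mul ((((contDiff_norm_sq ℝ).neg).div_const 4).exp)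

theorem GaussPoly.contDiff (h : GaussPoly k) : ContDiff ℝ ∞ k := by
  induction h with
  | base => exact contDiff_gs
  | coord i _ ih => exact (EuclideanSpace.proj (𝕜 := ℝ) (i : Fin 3)).contDiff.mul ih
  | add _ _ h1 h2 => exact h1.add h2
  | smul c _ ih => exact contDiff_const.mul ih

theorem GaussPoly.differentiable (h : GaussPoly k) : Differentiable ℝ k :=
  h.contDiff.differentiable (by simp)

theorem exp_neg_sq_le (m : ℕ) (r : ℝ) (hr : 0 ≤ r) :
    Real.exp (-r ^ 2 / 4) ≤ (8 ^ m * m.factorial * Real.exp (1 / 4)) * (1 + r) ^ (-(m : ℝ)) := by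
  have h1 : (1 + r) ^ m ≤ 8 ^ m * (m.factorial * Real.exp ((1 + r ^ 2) / 4)) := by
    have h2 := Real.pow_div_factorial_le_exp ((1 + r ^ 2) / 4) (by positivity) m
    rw [div_le_iff₀ (by positivity)] at h2
    have h3 : 1 + r ≤ 8 * ((1 + r ^ 2) / 4) := by nlinarith [sq_nonneg (r - 1)]
    calc (1 + r) ^ m ≤ (8 * ((1 + r ^ 2) / 4)) ^ m := pow_le_pow_left₀ (by positivity) h3 m
      _ = 8 ^ m * ((1 + r ^ 2) / 4) ^ m := mul_pow _ _ _
      _ ≤ _ := by gcongr; linarith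
  have h4 : Real.exp ((1 + r ^ 2) / 4) = Real.exp (1 / 4) * Real.exp (r ^ 2 / 4) := by
    rw [← Real.exp_add]; congr 1; ring
  have h5 : Real.exp (-r ^ 2 / 4) * Real.exp (r ^ 2 / 4) = 1 := by
    rw [← Real.exp_add]; simp [neg_div]
  rw [Real.rpow_neg (by positivity), Real.rpow_natCast, ← div_eq_mul_inv, le_div_iff₀ (by positivity)]
  calc Real.exp (-r ^ 2 / 4) * (1 + r) ^ m
      ≤ Real.exp (-r ^ 2 / 4) * (8 ^ m * (m.factorial * Real.exp ((1 + r ^ 2) / 4))) := by gcongr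
    _ = 8 ^ m * m.factorial * Real.exp (1 / 4) *
        (Real.exp (-r ^ 2 / 4) * Real.exp (r ^ 2 / 4)) := by rw [h4]; ring
    _ = _ := by rw [h5, mul_one]

theorem one_add_norm_rpow_mono {r s : ℝ} (h : r ≤ s) (z : R3) : (1 + ‖z‖) ^ r ≤ (1 + ‖z‖) ^ s :=
  Real.rpow_le_rpow_of_exponent_le (by linarith [norm_nonneg z]) h

theorem GaussPoly.decays (h : GaussPoly k) : ∀ d : ℝ, Decays d k := by
  -- The order `d` is quantified inside the induction because multiplication by a coordinate
  -- consumes one order of decay.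
  have key : ∀ d : ℝ, ∃ C, ∀ z, |k z| ≤ C * (1 + ‖z‖) ^ (-d) := by
    induction h with
    | base =>
      intro d
      obtain ⟨m, hm⟩ := exists_nat_ge d
      refine ⟨(4 * Real.pi) ^ (-(3 / 2) : ℝ) * (8 ^ m * m.factorial * Real.exp (1 / 4)), fun z => ?_⟩
      rw [gs, abs_of_nonneg (by positivity), mul_assoc]
      gcongr
      refine (exp_neg_sq_le m ‖z‖ (norm_nonneg z)).trans ?_
      gcongr
      · linarith [norm_nonneg z]
    | @coord k i _ ih =>
      intro d
      obtain ⟨C, hC⟩ := ih (d + 1)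
      refine ⟨C, fun z => ?_⟩
      have hz : 0 < 1 + ‖z‖ := by positivity
      have e : (1 + ‖z‖) ^ (-d) = (1 + ‖z‖) * (1 + ‖z‖) ^ (-(d + 1)) := by
        rw [neg_add, ← sub_eq_add_neg, Real.rpow_sub_one hz.ne']; field_simp
      have h1 : |z i| ≤ 1 + ‖z‖ := by
        have := PiLp.norm_apply_le z i
        rw [Real.norm_eq_abs] at this; linarith
      rw [abs_mul, e]
      calc |z i| * |k z| ≤ (1 + ‖z‖) * (C * (1 + ‖z‖) ^ (-(d + 1))) :=
            mul_le_mul h1 (hC z) (abs_nonneg _) hz.le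
        _ = _ := by ring
    | add _ _ h1 h2 =>
      intro d
      obtain ⟨C, hC⟩ := h1 d
      obtain ⟨D, hD⟩ := h2 d
      exact ⟨C + D, fun z => (abs_add_le _ _).trans (by
        rw [add_mul]; exact add_le_add (hC z) (hD z))⟩
    | smul c _ ih =>
      intro d
      obtain ⟨C, hC⟩ := ih d
      exact ⟨|c| * C, fun z => by
        rw [abs_mul, mul_assoc]; exact mul_le_mul_of_nonneg_left (hC z) (abs_nonneg _)⟩
  exact fun d => ⟨h.contDiff.continuous, key d⟩

theorem hasFDerivAt_gs (z : R3) : HasFDerivAt gs ((-(1 / 2) * gs z) • innerSL ℝ z) z := by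
  have h1 := (((hasStrictFDerivAt_norm_sq z).hasFDerivAt.neg.mul_const (1 / 4 : ℝ)).exp).const_mul
    ((4 * Real.pi) ^ (-(3 / 2) : ℝ))
  have e : gs = fun z => (4 * Real.pi) ^ (-(3 / 2) : ℝ) * Real.exp (-‖z‖ ^ 2 * (1 / 4)) := by
    funext z; rw [gs]; congr 2; ring
  rw [e]
  refine h1.congr_fderiv (ContinuousLinearMap.ext fun v => ?_)
  simp
  ring

theorem pd_gs (i : Fin 3) (z : R3) : pd i gs z = -(1 / 2) * (z i * gs z) := by
  rw [pd, (hasFDerivAt_gs z).fderiv]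
  simp [bv, EuclideanSpace.inner_single_right]
  ring

theorem pd_mul (hk : Differentiable ℝ k) (hq : Differentiable ℝ q) (i : Fin 3) (z : R3) :
    pd i (fun z => k z * q z) z = pd i k z * q z + k z * pd i q z := by
  rw [pd, fderiv_fun_mul (hk z) (hq z)]
  simp [pd]; ring

theorem differentiable_coord (i : Fin 3) : Differentiable ℝ fun z : R3 => z i :=
  (EuclideanSpace.proj (𝕜 := ℝ) i).differentiable

theorem pd_coord (i j : Fin 3) (z : R3) : pd i (fun z : R3 => z j) z = if j = i then 1 else 0 := by
  have h : HasFDerivAt (fun z : R3 => z j) (EuclideanSpace.proj (𝕜 := ℝ) j) z :=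
    (EuclideanSpace.proj (𝕜 := ℝ) j).hasFDerivAt
  rw [pd, h.fderiv]
  simp [bv]

theorem GaussPoly.pd (h : GaussPoly k) (i : Fin 3) : GaussPoly (pd i k) := by
  induction h with
  | base =>
    have : _root_.pd i gs = fun z => -(1 / 2) * (z i * gs z) := funext (pd_gs i)
    rw [this]
    exact .smul _ (.coord i .base)
  | @coord k j hk ih =>
    have : _root_.pd i (fun z => z j * k z) =
        fun z => (if j = i then 1 else 0) * k z + z j * _root_.pd i k z := by
      funext z
      rw [pd_mul (differentiable_coord j) hk.differentiable, pd_coord]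
    rw [this]
    exact .add (.smul _ hk) (.coord j ih)
  | @add k q hk hq h1 h2 =>
    have : _root_.pd i (fun z => k z + q z) = fun z => _root_.pd i k z + _root_.pd i q z :=
      funext fun z => fderiv_add_fun hk.differentiable hq.differentiable z _
    rw [this]
    exact .add h1 h2
  | @smul k c hk ih =>
    have : _root_.pd i (fun z => c * k z) = fun z => c * _root_.pd i k z :=
      funext fun z => fderiv_const_mul_fun c k z _
    rw [this]
    exact .smul c ih

theorem eul_eq_sum (k : R3 → ℝ) (z : R3) : eul k z = ∑ i, z i * pd i k z := r3_clm_apply _ z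

theorem GaussPoly.eul (h : GaussPoly k) : GaussPoly (eul k) := by
  have : _root_.eul k = fun z => z 0 * _root_.pd 0 k z + z 1 * _root_.pd 1 k z +
      z 2 * _root_.pd 2 k z := by
    funext z; rw [eul_eq_sum, Fin.sum_univ_three]
  rw [this]
  exact .add (.add (.coord 0 (h.pd 0)) (.coord 1 (h.pd 1))) (.coord 2 (h.pd 2))

theorem GaussPoly.prof (d : ℝ) : ∀ (n : ℕ) {k : R3 → ℝ}, GaussPoly k → Prof d n k
  | 0, _, h => h.decays d
  | n + 1, _, h => ⟨h.decays d, h.differentiable, fun i => (h.pd i).prof d n, h.eul.prof d n⟩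

theorem pd_comm (hk : ContDiff ℝ ∞ k) (i j : Fin 3) : pd i (pd j k) = pd j (pd i k) := by
  have hd : Differentiable ℝ (fderiv ℝ k) :=
    (hk.fderiv_right (m := ∞) (by simp)).differentiable (by simp)
  have e : ∀ (u v z : R3), fderiv ℝ (fun z => fderiv ℝ k z v) z u = fderiv ℝ (fderiv ℝ k) z u v :=
    fun u v z => by
      rw [fderiv_clm_apply (hd z) (differentiableAt_const v)]
      simp
  funext z
  have hsymm : IsSymmSndFDerivAt ℝ k z := hk.contDiffAt.isSymmSndFDerivAt (by
    simp only [minSmoothness_of_isRCLikeNormedField]; exact WithTop.coe_le_coe.2 le_top)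
  change fderiv ℝ (fun z => fderiv ℝ k z (bv j)) z (bv i) =
    fderiv ℝ (fun z => fderiv ℝ k z (bv i)) z (bv j)
  rw [e, e]
  exact hsymm _ _

/-- The Laplacian of a profile. -/
noncomputable def lap (k : R3 → ℝ) (z : R3) : ℝ := ∑ i, pd i (pd i k) z

theorem GaussPoly.lap (h : GaussPoly k) : GaussPoly (lap k) := by
  have : _root_.lap k = fun z => _root_.pd 0 (_root_.pd 0 k) z + _root_.pd 1 (_root_.pd 1 k) z +
      _root_.pd 2 (_root_.pd 2 k) z := by
    funext z; rw [_root_.lap, Fin.sum_univ_three]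
  rw [this]
  exact .add (.add ((h.pd 0).pd 0) ((h.pd 1).pd 1)) ((h.pd 2).pd 2)

/-- The self-similar heat equation: `τ^(-(m+3)/2) k(x/√τ)` solves the heat equation. -/
def HeatProf (m : ℝ) (k : R3 → ℝ) : Prop := ∀ z, par k z = lap k z + m / 2 * k z

theorem heatProf_gs : HeatProf 0 gs := fun z => by
  have h1 : ∀ i : Fin 3, pd i (pd i gs) z = -(1 / 2) * gs z + 1 / 4 * (z i * z i * gs z) := fun i => by
    have : pd i gs = fun z => -(1 / 2) * (z i * gs z) := funext (pd_gs i)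
    rw [this]
    have h2 : pd i (fun z => -(1 / 2) * (z i * gs z)) z = -(1 / 2) * pd i (fun z => z i * gs z) z :=
      fderiv_const_mul_fun _ _ z _
    rw [h2, pd_mul (differentiable_coord i) GaussPoly.base.differentiable, pd_coord, pd_gs]
    simp; ring
  rw [par, eul_eq_sum, lap]
  simp_rw [h1, pd_gs, Fin.sum_univ_three]
  ring

theorem pd_eul (h : GaussPoly k) (j : Fin 3) (z : R3) :
    pd j (eul k) z = pd j k z + eul (pd j k) z := by
  have e : eul k = fun z => z 0 * pd 0 k z + z 1 * pd 1 k z + z 2 * pd 2 k z := by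
    funext z; rw [eul_eq_sum, Fin.sum_univ_three]
  have hc : ∀ i, Differentiable ℝ fun z : R3 => z i * pd i k z := fun i =>
    (differentiable_coord i).mul (h.pd i).differentiable
  have h1 : pd j (eul k) z = pd j (fun z => z 0 * pd 0 k z) z + pd j (fun z => z 1 * pd 1 k z) z +
      pd j (fun z => z 2 * pd 2 k z) z := by
    rw [e]
    have a1 : pd j (fun z : R3 => z 0 * pd 0 k z + z 1 * pd 1 k z + z 2 * pd 2 k z) z =
        pd j (fun z : R3 => z 0 * pd 0 k z + z 1 * pd 1 k z) z + pd j (fun z => z 2 * pd 2 k z) z :=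
      fderiv_add_fun ((hc 0).add (hc 1)) (hc 2) z _
    have a2 : pd j (fun z : R3 => z 0 * pd 0 k z + z 1 * pd 1 k z) z =
        pd j (fun z : R3 => z 0 * pd 0 k z) z + pd j (fun z => z 1 * pd 1 k z) z :=
      fderiv_add_fun (hc 0) (hc 1) z _
    rw [a1, a2]
  rw [h1, eul_eq_sum, Fin.sum_univ_three]
  simp_rw [fun i => pd_mul (differentiable_coord i) (h.pd i).differentiable j z, pd_coord]
  rw [pd_comm h.contDiff j 0, pd_comm h.contDiff j 1, pd_comm h.contDiff j 2]
  fin_cases j <;> simp <;> ring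

/-- The derivative commutes with the Laplacian, whereas its commutator with z·∇ is the derivative
itself; the resulting -1/2 in `par` raises the order `m` by one. -/
theorem HeatProf.pd {m : ℝ} (hk : GaussPoly k) (h : HeatProf m k) (j : Fin 3) :
    HeatProf (m + 1) (pd j k) := fun z => by
  have e1 : par k = fun z => -(3 / 2) * k z + -(1 / 2) * eul k z := by
    funext z; rw [par]; ring
  have e2 : par k = fun z => lap k z + m / 2 * k z := funext h
  have c1 : _root_.pd j (par k) z = -(3 / 2) * _root_.pd j k z + -(1 / 2) * _root_.pd j (eul k) z := by
    rw [e1]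
    have a1 := fderiv_add_fun (hk.differentiable.const_mul (-(3 / 2)))
      (hk.eul.differentiable.const_mul (-(1 / 2))) z (bv j)
    rw [fderiv_const_mul_fun, fderiv_const_mul_fun] at a1
    exact a1
  have c2 : _root_.pd j (par k) z = _root_.pd j (lap k) z + m / 2 * _root_.pd j k z := by
    rw [e2]
    have a1 := fderiv_add_fun hk.lap.differentiable (hk.differentiable.const_mul (m / 2)) z (bv j)
    rw [fderiv_const_mul_fun] at a1
    exact a1
  have c3 : _root_.pd j (lap k) z = lap (_root_.pd j k) z := by
    have e3 : lap k = fun z => _root_.pd 0 (_root_.pd 0 k) z + _root_.pd 1 (_root_.pd 1 k) z +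
      _root_.pd 2 (_root_.pd 2 k) z := by
      funext z; rw [lap, Fin.sum_univ_three]
    rw [e3]
    have hd := fun i => ((hk.pd i).pd i).differentiable
    have a1 := fderiv_add_fun ((hd 0).add (hd 1)) (hd 2) z (bv j)
    have a2 := fderiv_add_fun (hd 0) (hd 1) z (bv j)
    have a3 : ∀ i, _root_.pd j (_root_.pd i (_root_.pd i k)) =
        _root_.pd i (_root_.pd i (_root_.pd j k)) := fun i => by
      rw [pd_comm (hk.pd i).contDiff j i, pd_comm hk.contDiff j i]
    rw [lap, Fin.sum_univ_three, ← a3 0, ← a3 1, ← a3 2]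
    exact a1.trans (congrArg₂ (· + ·) a2 rfl)
  rw [pd_eul hk] at c1
  rw [par, ← c3]
  linarith

theorem integral_gs : ∫ z, gs z = 1 := by
  have h := GaussianFourier.integral_rexp_neg_mul_sq_norm (V := R3) (b := 1 / 4) (by norm_num)
  have e : ∀ z : R3, gs z = (4 * Real.pi) ^ (-(3 / 2) : ℝ) * Real.exp (-(1 / 4) * ‖z‖ ^ 2) :=
    fun z => by rw [gs]; congr 2; ring
  simp_rw [e]
  rw [integral_const_mul, h]
  simp only [finrank_euclideanSpace, Fintype.card_fin]
  have e2 : Real.pi / (1 / 4) = 4 * Real.pi := by ring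
  rw [e2, ← Real.rpow_add (by positivity)]
  norm_num

end GaussianProfiles

/-! ### Averages over dilations, representing the inverse Laplacian. -/

section Tails

variable {d b : ℝ} {n : ℕ} {k q : R3 → ℝ}

/-- The superposition `∫₁^∞ μ^(-b) k(z/√μ) dμ` of dilated profiles. -/
noncomputable def Rop (b : ℝ) (k : R3 → ℝ) (z : R3) : ℝ :=
  ∫ μ in Set.Ioi (1 : ℝ), μ ^ (-b) * k ((√μ)⁻¹ • z)

theorem Rop_integrand_measurable (b : ℝ) (hk : Continuous k) (z : R3) :
    AEStronglyMeasurable (fun μ : ℝ => μ ^ (-b) * k ((√μ)⁻¹ • z))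
      (volume.restrict (Set.Ioi (1 : ℝ))) := by
  refine Measurable.aestronglyMeasurable (Measurable.mul (by fun_prop) ?_)
  exact hk.measurable.comp (by fun_prop)

theorem Rop_integrand_le {C : ℝ} (hC : ∀ z, |k z| ≤ C) (z : R3) :
    ∀ᵐ μ ∂(volume.restrict (Set.Ioi (1 : ℝ))), ‖μ ^ (-b) * k ((√μ)⁻¹ • z)‖ ≤ C * μ ^ (-b) := by
  refine (ae_restrict_iff' measurableSet_Ioi).2 (Eventually.of_forall fun μ hμ => ?_)
  have hμ0 : (0 : ℝ) < μ := zero_lt_one.trans hμ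
  rw [norm_mul, Real.norm_of_nonneg (Real.rpow_nonneg hμ0.le _), mul_comm]
  exact mul_le_mul_of_nonneg_right (hC _) (Real.rpow_nonneg hμ0.le _)

theorem integrable_tail (hb : 1 < b) : IntegrableOn (fun μ : ℝ => μ ^ (-b)) (Set.Ioi 1) :=
  integrableOn_Ioi_rpow_of_lt (by linarith) one_pos

theorem Rop_integrable (hb : 1 < b) (hk : Continuous k) {C : ℝ} (hC : ∀ z, |k z| ≤ C) (z : R3) :
    IntegrableOn (fun μ : ℝ => μ ^ (-b) * k ((√μ)⁻¹ • z)) (Set.Ioi 1) :=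
  ((integrable_tail hb).const_mul C).mono' (Rop_integrand_measurable b hk z) (Rop_integrand_le hC z)

/-- Dilation by √μ ≥ 1 worsens a bound of order d by the factor μ^(d/2), and μ^(d/2-b) is integrable
at infinity because b > 1 + d/2. -/
theorem Decays.rop (hd : 0 ≤ d) (hb : 1 + d / 2 < b) (hk : Decays d k) : Decays d (Rop b k) := by
  obtain ⟨C, hC⟩ := hk.2
  obtain ⟨B, hB0, hB⟩ := hk.bounded hd
  refine ⟨?_, C * ∫ μ in Set.Ioi (1 : ℝ), μ ^ (-(b - d / 2)), fun z => ?_⟩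
  · refine continuous_of_dominated (fun z => Rop_integrand_measurable b hk.1 z)
      (fun z => Rop_integrand_le hB z) ((integrable_tail (by linarith)).const_mul B)
      (Eventually.of_forall fun μ => ?_)
    exact continuous_const.mul (hk.1.comp (continuous_const_smul _))
  · have e : ∀ μ : ℝ, C * (1 + ‖z‖) ^ (-d) * μ ^ (-(b - d / 2)) =
        C * (1 + ‖z‖) ^ (-d) * μ ^ (-(b - d / 2)) := fun _ => rfl
    rw [mul_right_comm, ← integral_const_mul, ← Real.norm_eq_abs]
    refine norm_integral_le_of_norm_le ((integrable_tail (by linarith)).const_mul _)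
      ((ae_restrict_iff' measurableSet_Ioi).2 (Eventually.of_forall fun μ hμ => ?_))
    have hμ1 : (1 : ℝ) ≤ μ := le_of_lt hμ
    have hμ0 : (0 : ℝ) < μ := zero_lt_one.trans_le hμ1
    have hs : 0 < √μ := Real.sqrt_pos.2 hμ0
    have hs1 : 1 ≤ √μ := Real.one_le_sqrt.2 hμ1
    have hpb : 0 ≤ μ ^ (-b) := Real.rpow_nonneg hμ0.le _
    rw [norm_mul, Real.norm_of_nonneg hpb, Real.norm_eq_abs]
    have h1 := hC ((√μ)⁻¹ • z)
    have hC0 : 0 ≤ C := by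
      have := (abs_nonneg _).trans (hC 0)
      simpa using this
    have h2 : (√μ)⁻¹ * (1 + ‖z‖) ≤ 1 + ‖(√μ)⁻¹ • z‖ := by
      rw [norm_smul, norm_inv, Real.norm_of_nonneg hs.le, mul_add, mul_one]
      have := inv_le_one_of_one_le₀ hs1
      linarith
    have h3 := Real.rpow_le_rpow_of_nonpos (by positivity) h2 (by linarith : -d ≤ 0)
    rw [Real.mul_rpow (by positivity) (by positivity)] at h3
    have h4 : ((√μ)⁻¹) ^ (-d) = μ ^ (d / 2) := by
      rw [Real.inv_rpow hs.le, Real.rpow_neg hs.le, inv_inv, Real.sqrt_eq_rpow, ← Real.rpow_mul hμ0.le]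
      congr 1; ring
    rw [h4] at h3
    have h5 : μ ^ (-(b - d / 2)) = μ ^ (-b) * μ ^ (d / 2) := by
      rw [← Real.rpow_add hμ0]; congr 1; ring
    rw [h5]
    calc μ ^ (-b) * |k ((√μ)⁻¹ • z)| ≤ μ ^ (-b) * (C * (μ ^ (d / 2) * (1 + ‖z‖) ^ (-d))) := by
          gcongr; exact h1.trans (by gcongr)
      _ = _ := by ring

theorem norm_r3_clm_le (L : R3 →L[ℝ] ℝ) : ‖L‖ ≤ ∑ i, |L (bv i)| := by
  refine L.opNorm_le_bound (Finset.sum_nonneg fun i _ => abs_nonneg _) fun x => ?_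
  rw [r3_clm_apply L x, Finset.sum_mul]
  refine (norm_sum_le _ _).trans (Finset.sum_le_sum fun i _ => ?_)
  rw [norm_mul, mul_comm, Real.norm_eq_abs (L _)]
  exact mul_le_mul_of_nonneg_left (PiLp.norm_apply_le x i) (abs_nonneg _)

theorem hasFDerivAt_Rop (hd : 0 ≤ d) (hb : 1 < b) (hk : Prof d 1 k) (z : R3) :
    HasFDerivAt (Rop b k) (∫ μ in Set.Ioi (1 : ℝ), (μ ^ (-b) * (√μ)⁻¹) • fderiv ℝ k ((√μ)⁻¹ • z)) z ∧
      IntegrableOn (fun μ : ℝ => (μ ^ (-b) * (√μ)⁻¹) • fderiv ℝ k ((√μ)⁻¹ • z)) (Set.Ioi 1) := by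
  obtain ⟨B, hB0, hB⟩ := hk.base.bounded hd
  choose E hE0 hE using fun i => (hk.2.2.1 i : Decays d (pd i k)).bounded hd
  have hfd : ∀ w, ‖fderiv ℝ k w‖ ≤ ∑ i, E i := fun w =>
    (norm_r3_clm_le _).trans (Finset.sum_le_sum fun i _ => hE i w)
  have hbd : ∀ w : R3, ∀ μ ∈ Set.Ioi (1 : ℝ),
      ‖(μ ^ (-b) * (√μ)⁻¹) • fderiv ℝ k ((√μ)⁻¹ • w)‖ ≤ (∑ i, E i) * μ ^ (-b) := by
    intro w μ hμ
    have hμ1 : (1 : ℝ) ≤ μ := le_of_lt hμ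
    have hpb : 0 ≤ μ ^ (-b) := Real.rpow_nonneg (by linarith) _
    have hs1 : (√μ)⁻¹ ≤ 1 := inv_le_one_of_one_le₀ (Real.one_le_sqrt.2 hμ1)
    rw [norm_smul, Real.norm_of_nonneg (by positivity), mul_comm]
    exact mul_le_mul (hfd _) (mul_le_of_le_one_right hpb hs1) (by positivity)
      (Finset.sum_nonneg fun i _ => hE0 i)
  have hm : AEStronglyMeasurable (fun μ : ℝ => (μ ^ (-b) * (√μ)⁻¹) • fderiv ℝ k ((√μ)⁻¹ • z))
      (volume.restrict (Set.Ioi (1 : ℝ))) := by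
    refine AEStronglyMeasurable.smul
      (by fun_prop : Measurable fun μ : ℝ => μ ^ (-b) * (√μ)⁻¹).aestronglyMeasurable ?_
    exact ((measurable_fderiv ℝ k).comp
      (by fun_prop : Measurable fun μ : ℝ => (√μ)⁻¹ • z)).aestronglyMeasurable
  refine ⟨hasFDerivAt_integral_of_dominated_of_fderiv_le (s := Set.univ)
    (F := fun (z : R3) (μ : ℝ) => μ ^ (-b) * k ((√μ)⁻¹ • z))
    (F' := fun z μ => (μ ^ (-b) * (√μ)⁻¹) • fderiv ℝ k ((√μ)⁻¹ • z))
    (bound := fun μ => (∑ i, E i) * μ ^ (-b)) univ_mem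
    (Eventually.of_forall fun w => Rop_integrand_measurable b hk.base.1 w)
    (Rop_integrable hb hk.base.1 hB z) hm ?_ ((integrable_tail hb).const_mul _)
    (Eventually.of_forall fun μ w _ => ?_), ?_⟩
  · exact (ae_restrict_iff' measurableSet_Ioi).2 (Eventually.of_forall fun μ hμ w _ => hbd w μ hμ)
  · have h1 := (hk.2.1 ((√μ)⁻¹ • w)).hasFDerivAt.comp w
      ((hasFDerivAt_id w).const_smul (√μ)⁻¹)
    refine (h1.const_mul (μ ^ (-b))).congr_fderiv (ContinuousLinearMap.ext fun v => ?_)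
    simp; ring
  · exact ((integrable_tail hb).const_mul _).mono' hm
      ((ae_restrict_iff' measurableSet_Ioi).2 (Eventually.of_forall fun μ hμ => hbd z μ hμ))

/-- Each space derivative brings out a factor μ^(-1/2) from the dilation. -/
theorem pd_Rop (hd : 0 ≤ d) (hb : 1 < b) (hk : Prof d 1 k) (i : Fin 3) :
    pd i (Rop b k) = Rop (b + 1 / 2) (pd i k) := by
  funext z
  obtain ⟨h1, h2⟩ := hasFDerivAt_Rop hd hb hk z
  rw [pd, h1.fderiv, ContinuousLinearMap.integral_apply h2]
  refine setIntegral_congr_fun measurableSet_Ioi fun μ hμ => ?_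
  have hμ0 : (0 : ℝ) < μ := zero_lt_one.trans hμ
  have : μ ^ (-(b + 1 / 2)) = μ ^ (-b) * (√μ)⁻¹ := by
    rw [neg_add, Real.rpow_add hμ0, Real.rpow_neg hμ0.le (1 / 2), ← Real.sqrt_eq_rpow]
  simp only [this]
  rfl

theorem eul_Rop (hd : 0 ≤ d) (hb : 1 < b) (hk : Prof d 1 k) : eul (Rop b k) = Rop b (eul k) := by
  funext z
  obtain ⟨h1, h2⟩ := hasFDerivAt_Rop hd hb hk z
  rw [eul, h1.fderiv, ContinuousLinearMap.integral_apply h2]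
  refine setIntegral_congr_fun measurableSet_Ioi fun μ hμ => ?_
  simp [eul]
  ring

theorem Prof.rop (hd : 0 ≤ d) : ∀ {n : ℕ} {b : ℝ} {k : R3 → ℝ}, 1 + d / 2 < b → Prof d n k →
    Prof d n (Rop b k)
  | 0, _, _, hb, hk => Decays.rop hd hb hk
  | n + 1, b, k, hb, hk => by
    have hb1 : 1 < b := by linarith
    have hk1 : Prof d 1 k := hk.of_le (by omega)
    refine ⟨hk.base.rop hd hb, fun z => (hasFDerivAt_Rop hd hb1 hk1 z).1.differentiableAt,
      fun i => ?_, ?_⟩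
    · rw [pd_Rop hd hb1 hk1]
      exact Prof.rop hd (by linarith) (hk.2.2.1 i)
    · rw [eul_Rop hd hb1 hk1]
      exact Prof.rop hd hb hk.2.2.2

/-- `(-Δ)⁻¹` of a heat profile, applied to its Laplacian, gives back the profile. -/
theorem Rop_lap {m : ℝ} (hm : 0 ≤ m) (hq : GaussPoly q) (h : HeatProf m q) (z : R3) :
    Rop ((m + 5) / 2) (lap q) z = -q z := by
  obtain ⟨B, hB0, hB⟩ := (hq.lap.decays 0).bounded le_rfl
  obtain ⟨B', hB'0, hB'⟩ := (hq.decays 0).bounded le_rfl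
  -- By the heat profile identity the integrand is the exact μ-derivative of the self-similar
  -- solution μ^(-(m+3)/2) q(z/√μ). It vanishes at infinity, so only its value at μ = 1 remains.
  have hderiv : ∀ μ ∈ Set.Ioi (1 : ℝ), HasDerivAt (fun μ : ℝ => hker q μ z * μ ^ (-(m / 2)))
      (μ ^ (-((m + 5) / 2)) * lap q ((√μ)⁻¹ • z)) μ := fun μ hμ => by
    have hμ0 : (0 : ℝ) < μ := zero_lt_one.trans hμ
    have h1 := (hasFDerivAt_hker hq.differentiable hμ0 z).comp_hasDerivAt μ
      ((hasDerivAt_id μ).prodMk (hasDerivAt_const μ z))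
    have h2 := h1.mul (Real.hasDerivAt_rpow_const (p := -(m / 2)) (Or.inl hμ0.ne'))
    refine h2.congr_deriv ?_
    simp only [Function.comp_apply, id, _root_.add_apply, _root_.smul_apply, _root_.sum_apply,
      ContinuousLinearMap.comp_apply, ContinuousLinearMap.coe_fst', ContinuousLinearMap.coe_snd',
      PiLp.proj_apply, PiLp.zero_apply, smul_eq_mul, mul_one, mul_zero, Finset.sum_const_zero,
      add_zero, hker]
    rw [h]
    rw [Real.rpow_sub_one hμ0.ne']
    have e : μ ^ (-((m + 5) / 2)) = μ⁻¹ * (μ ^ (-(3 / 2) : ℝ) * μ ^ (-(m / 2))) := by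
      rw [← Real.rpow_add hμ0, ← Real.rpow_neg_one, ← Real.rpow_add hμ0]; congr 1; ring
    rw [e]
    field_simp
    ring
  have hlim : Tendsto (fun μ : ℝ => hker q μ z * μ ^ (-(m / 2))) atTop (𝓝 0) := by
    refine squeeze_zero_norm' (a := fun μ : ℝ => B' * μ ^ (-(3 / 2) : ℝ)) ?_ ?_
    · filter_upwards [eventually_ge_atTop (1 : ℝ)] with μ hμ
      have hμ0 : (0 : ℝ) < μ := by linarith
      have p1 := Real.rpow_nonneg hμ0.le (-(3 / 2))
      have p2 : μ ^ (-(m / 2)) ≤ 1 := Real.rpow_le_one_of_one_le_of_nonpos hμ (by linarith)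
      have p3 := Real.rpow_nonneg hμ0.le (-(m / 2))
      rw [hker, norm_mul, norm_mul, Real.norm_of_nonneg p1, Real.norm_of_nonneg p3, mul_assoc, mul_comm]
      refine mul_le_mul_of_nonneg_right ?_ p1
      exact (mul_le_of_le_one_right (norm_nonneg _) p2).trans (hB' _)
    · simpa using (tendsto_rpow_neg_atTop (by norm_num : (0 : ℝ) < 3 / 2)).const_mul B'
  have hcont : ContinuousWithinAt (fun μ : ℝ => hker q μ z * μ ^ (-(m / 2))) (Set.Ici 1) 1 := by
    have h1 := (hasFDerivAt_hker hq.differentiable one_pos z).continuousAt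
    have h2 : ContinuousAt (fun μ : ℝ => hker q μ z) 1 :=
      ContinuousAt.comp (f := fun μ : ℝ => ((μ, z) : STime)) h1 (by fun_prop)
    exact (h2.mul (Real.continuousAt_rpow_const _ _ (Or.inl one_ne_zero))).continuousWithinAt
  have key := integral_Ioi_of_hasDerivAt_of_tendsto hcont hderiv
    (Rop_integrable (by linarith) hq.lap.contDiff.continuous hB z) hlim
  rw [Rop, key]
  simp [hker]

end Tails

/-! ### Leray projection of heat profiles. -/

section LerayProfiles

variable {d b m : ℝ} {n : ℕ} {k q : R3 → ℝ}

/-- The gradient part `∂ᵢ∂ⱼ(-Δ)⁻¹` of the Leray projection of a heat profile. -/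
noncomputable def Rie (m : ℝ) (q : R3 → ℝ) (i j : Fin 3) : R3 → ℝ :=
  -- In (-Δ)⁻¹ = ∫₀^∞ e^{sΔ} ds put μ = 1 + s: the flow turns the profile into μ^(-(m+3)/2) q(z/√μ),
  -- and the two derivatives contribute a further μ⁻¹.
  Rop ((m + 5) / 2) (pd i (pd j q))

/-- The Leray projection of a heat profile. -/
noncomputable def Ler (m : ℝ) (q : R3 → ℝ) (i j : Fin 3) (z : R3) : ℝ :=
  (if i = j then 1 else 0) * q z + Rie m q i j z

/-- The threshold is that of `Prof.rop` for the exponent (m+5)/2. For m = 1 it admits d = 7/2, which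
gives integrability; for m = 0 it only admits d < 3, so the projected heat kernel is used from `L¹`
to `L³` alone. -/
theorem prof_Rie (hd : 0 ≤ d) (hdm : d < m + 3) (hq : GaussPoly q) (n : ℕ) (i j : Fin 3) :
    Prof d n (Rie m q i j) :=
  Prof.rop hd (by linarith) (((hq.pd j).pd i).prof d n)

theorem prof_Ler (hd : 0 ≤ d) (hdm : d < m + 3) (hq : GaussPoly q) (n : ℕ) (i j : Fin 3) :
    Prof d n (Ler m q i j) :=
  ((hq.prof d n).const_mul _).add (prof_Rie hd hdm hq n i j)

/-- Both sides average the same third derivative of `q`. The gradient part is thus curl-free in its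
first index, which is what produces the pressure. -/
theorem pd_Rie_comm (hm : 0 ≤ m) (hq : GaussPoly q) (i j l : Fin 3) :
    pd l (Rie m q i j) = pd i (Rie m q l j) := by
  have hb : 1 < (m + 5) / 2 := by linarith
  rw [Rie, Rie, pd_Rop le_rfl hb (((hq.pd j).pd i).prof 0 1),
    pd_Rop le_rfl hb (((hq.pd j).pd l).prof 0 1), pd_comm (hq.pd j).contDiff l i]

/-- The divergence produces the Laplacian of the derivative of `q`, a heat profile of order m + 1,
and `Rop_lap` inverts it. The result cancels the divergence of the δᵢⱼ part. -/
theorem sum_pd_Rie (hm : 0 ≤ m) (hq : GaussPoly q) (h : HeatProf m q) (j : Fin 3) (z : R3) :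
    ∑ i, pd i (Rie m q i j) z = -pd j q z := by
  have hb : 1 < (m + 5) / 2 := by linarith
  have e : ∀ i, pd i (Rie m q i j) = Rop ((m + 1 + 5) / 2) (pd i (pd i (pd j q))) := fun i => by
    rw [Rie, pd_Rop le_rfl hb (((hq.pd j).pd i).prof 0 1)]
    congr 1; ring
  simp_rw [e]
  rw [← Rop_lap (by linarith : 0 ≤ m + 1) (hq.pd j) (h.pd hq j) z]
  simp only [Rop]
  rw [← integral_finsetSum]
  · refine setIntegral_congr_fun measurableSet_Ioi fun μ _ => ?_
    simp only [lap, Finset.mul_sum]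
  · intro i _
    obtain ⟨B, -, hB⟩ := ((((hq.pd j).pd i).pd i).decays 0).bounded le_rfl
    exact Rop_integrable (by linarith) (((hq.pd j).pd i).pd i).contDiff.continuous hB z

theorem sum_pd_Ler (hm : 0 ≤ m) (hq : GaussPoly q) (h : HeatProf m q) (j : Fin 3) (z : R3) :
    ∑ i, pd i (Ler m q i j) z = 0 := by
  have e : ∀ i, pd i (Ler m q i j) z = (if i = j then 1 else 0) * pd i q z + pd i (Rie m q i j) z :=
    fun i => by
      have h1 := fderiv_add_fun (hq.differentiable.const_mul (if i = j then (1 : ℝ) else 0))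
        (prof_Rie le_rfl (by linarith) hq 1 i j : Prof 0 1 (Rie m q i j)).2.1 z (bv i)
      rw [fderiv_const_mul_fun] at h1
      exact h1
  simp_rw [e]
  rw [Finset.sum_add_distrib, sum_pd_Rie hm hq h]
  simp

theorem gaussPoly_pd_gs (k : Fin 3) : GaussPoly (pd k gs) := GaussPoly.base.pd k

theorem heatProf_pd_gs (k : Fin 3) : HeatProf 1 (pd k gs) := by
  simpa using heatProf_gs.pd GaussPoly.base k

end LerayProfiles

/-! ### Linearity in the profile; curl and divergence of the operators. -/

section LinearInProfile

variable {d : ℝ} {n p : ℕ} {k q : R3 → ℝ} {f g : STime → ℝ} {a M N c : ℝ}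

theorem Isl_add_left (hd : 3 < d) (hk : Decays d k) (hq : Decays d q) (hf : ZBase p a M f)
    {σ : ℝ} (h0 : 0 < σ) (h1 : σ < 1) {z : STime} (hz : 0 < z.1) :
    Isl (fun z => k z + q z) f σ z = Isl k f σ z + Isl q f σ z := by
  have t1 : 0 < (1 - σ) * z.1 := mul_pos (by linarith) hz
  have t2 : 0 < σ * z.1 := mul_pos h0 hz
  rw [Isl, Isl, Isl, Psi, Psi, Psi, ← integral_add
    (integrable_hker_mul_of_ZBase hd hk hf t1 t2 _) (integrable_hker_mul_of_ZBase hd hq hf t1 t2 _)]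
  refine integral_congr_ae (Eventually.of_forall fun y => ?_)
  simp only [hker]; ring

theorem Psi_const_mul_left (c : ℝ) (k : R3 → ℝ) (f : STime → ℝ) (τ s : ℝ) (x : R3) :
    Psi (fun z => c * k z) f τ s x = c * Psi k f τ s x := by
  rw [Psi, Psi, ← integral_const_mul]
  refine integral_congr_ae (Eventually.of_forall fun y => ?_)
  simp only [hker]; ring

theorem Isl_const_mul_left (c : ℝ) (k : R3 → ℝ) (f : STime → ℝ) (σ : ℝ) (z : STime) :
    Isl (fun z => c * k z) f σ z = c * Isl k f σ z :=
  Psi_const_mul_left c k f _ _ _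

theorem wt_eq_zero {σ : ℝ} (h : ¬ (0 < σ ∧ σ < 1)) : wt c σ = 0 := by
  rw [wt, if_neg h]

theorem Dop_add_left (hd : 3 < d) (hp : 1 ≤ p) (hc : -1 < c) (ha : a < 1) (hk : Decays d k)
    (hq : Decays d q) (hf : ZBase p a M f) {z : STime} (hz : 0 < z.1) :
    Dop c (fun z => k z + q z) f z = Dop c k f z + Dop c q f z := by
  rw [Dop, Dop, Dop, ← mul_add, ← integral_add (integrable_Wsl hd hp hc ha hk hf hz)
    (integrable_Wsl hd hp hc ha hq hf hz)]
  congr 1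
  refine integral_congr_ae (Eventually.of_forall fun σ => ?_)
  simp only [Wsl]
  by_cases h : 0 < σ ∧ σ < 1
  · rw [Isl_add_left hd hk hq hf h.1 h.2 hz, mul_add]
  · simp [wt_eq_zero h]

theorem Dop_const_mul_left (r : ℝ) (k : R3 → ℝ) (f : STime → ℝ) (z : STime) :
    Dop c (fun z => r * k z) f z = r * Dop c k f z := by
  rw [Dop, Dop, mul_left_comm, ← integral_const_mul r]
  congr 1
  refine integral_congr_ae (Eventually.of_forall fun σ => ?_)
  simp only [Wsl, Isl_const_mul_left]; ring

theorem Lop_add_left (hd : 0 ≤ d) (hk : Decays d k) (hq : Decays d q) {f₀ : R3 → ℝ}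
    (hf₀ : Measurable f₀) (hi : Integrable fun y => |f₀ y| * (1 + ‖y‖) ^ (-d)) {z : STime}
    (hz : 0 < z.1) : Lop (fun z => k z + q z) f₀ z = Lop k f₀ z + Lop q f₀ z := by
  have hm : Measurable (f₀ ∘ Prod.snd : STime → ℝ) := hf₀.comp measurable_snd
  have i1 := integrable_hker_mul hd hk hm hi (s := 1) (fun y => le_rfl) hz z.2
  have i2 := integrable_hker_mul hd hq hm hi (s := 1) (fun y => le_rfl) hz z.2
  refine Eq.trans ?_ (integral_add i1 i2)
  refine integral_congr_ae (Eventually.of_forall fun y => ?_)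
  simp only [hker]; ring

theorem Lop_const_mul_left (c : ℝ) (k f₀ : R3 → ℝ) (z : STime) :
    Lop (fun z => c * k z) f₀ z = c * Lop k f₀ z :=
  Psi_const_mul_left c k _ _ _ _

/-- The space derivatives of the Duhamel operator fall on the profile. -/
theorem X_some_Dop (hd : 3 < d) (hp : 1 ≤ p) (hc : -1 < c) (ha : a < 1) (hk : Prof d 1 k)
    (hf : Z p a 1 M f) (i : Fin 3) {z : STime} (hz : 0 < z.1) :
    X (some i) (Dop c k f) z = z.1 ^ (c + 1) *
      ∫ σ, wt c σ * ((√(1 - σ))⁻¹ * Isl (pd i k) f σ z) ∧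
    Integrable fun σ => wt c σ * ((√(1 - σ))⁻¹ * Isl (pd i k) f σ z) := by
  obtain ⟨C, hC0, hC⟩ := exists_Z_Wsl hd hp (a := a) c 1 k hk
  have hW := hC M f hf
  have hI := measurable_Wsl_uncurry c hk.base.1 hf.base.meas
  have hM : Integrable fun σ => wt c σ * σ ^ (-a) * (C * M) := (integrable_wt_mul_rpow hc ha).mul_const _
  have hS := Z.superpose hp hI hM hW
  have e : ∀ σ, X (some i) (Wsl c k f σ) z = wt c σ * ((√(1 - σ))⁻¹ * Isl (pd i k) f σ z) := fun σ => by
    have : Wsl c k f σ = fun z => wt c σ * Isl k f σ z := rfl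
    rw [this, X_const_mul]
    by_cases h : 0 < σ ∧ σ < 1
    · simp only [X_some_Isl hd hk hf h.1 h.2 i hz]
    · simp [wt_eq_zero h]
  constructor
  · have : Dop c k f = fun z => z.1 ^ (c + 1) * ∫ σ, Wsl c k f σ z := rfl
    rw [this, X_some_rpow_mul _ _ hS.2.1]
    rw [X_superpose hI hM hW]
    simp_rw [e]
  -- For c = -1/2 the weight alone gives (1-σ)⁻¹, which is not integrable. Integrability comes from
  -- the bounds for the slices, which near σ = 1 have the derivative on the field.
  · have := ZBase.integrable_family (measurable_X_uncurry hI (fun w => (hW w).2.1) (some i)) hM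
      (fun w => (hW w).2.2 (some i)) hz
    simpa only [Function.uncurry, e] using this

/-- Since the derivative acts through the profile, an identity between derivatives of profiles holds
slice by slice and passes to the Duhamel operators; curl-freeness is transferred in this way. -/
theorem X_some_Dop_comm {q : R3 → ℝ} (hd : 3 < d) (hp : 1 ≤ p) (hc : -1 < c) (ha : a < 1)
    (hk : Prof d 1 k) (hq : Prof d 1 q) (hf : Z p a 1 M f) {i l : Fin 3} (h : pd l k = pd i q)
    {z : STime} (hz : 0 < z.1) : X (some l) (Dop c k f) z = X (some i) (Dop c q f) z := by
  rw [(X_some_Dop hd hp hc ha hk hf l hz).1, (X_some_Dop hd hp hc ha hq hf i hz).1, h]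

theorem Isl_sum_left (hd : 3 < d) {κ : Fin 3 → R3 → ℝ} (hκ : ∀ i, Decays d (κ i))
    (hf : ZBase p a M f) {σ : ℝ} (h0 : 0 < σ) (h1 : σ < 1) {z : STime} (hz : 0 < z.1)
    (h : ∀ w, ∑ i, κ i w = 0) : ∑ i, Isl (κ i) f σ z = 0 := by
  have t1 : 0 < (1 - σ) * z.1 := mul_pos (by linarith) hz
  have t2 : 0 < σ * z.1 := mul_pos h0 hz
  simp only [Isl, Psi]
  rw [← integral_finsetSum _ fun i _ => integrable_hker_mul_of_ZBase hd (hκ i) hf t1 t2 z.2]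
  simp_rw [← Finset.sum_mul, hker, ← Finset.mul_sum, h]
  simp

theorem sum_X_some_Dop (hd : 3 < d) (hp : 1 ≤ p) (hc : -1 < c) (ha : a < 1)
    {κ : Fin 3 → R3 → ℝ} (hκ : ∀ i, Prof d 1 (κ i)) (h : ∀ w, ∑ i, pd i (κ i) w = 0)
    (hf : Z p a 1 M f) {z : STime} (hz : 0 < z.1) :
    ∑ i, X (some i) (Dop c (κ i) f) z = 0 := by
  rw [Finset.sum_congr rfl fun i _ => (X_some_Dop hd hp hc ha (hκ i) hf i hz).1,
    ← Finset.mul_sum, ← integral_finsetSum _ fun i _ => (X_some_Dop hd hp hc ha (hκ i) hf i hz).2]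
  refine mul_eq_zero_of_right _ (integral_eq_zero_of_ae (Eventually.of_forall fun σ => ?_))
  by_cases hσ : 0 < σ ∧ σ < 1
  · simp_rw [← Finset.mul_sum]
    rw [Isl_sum_left hd (fun i => ((hκ i).2.2.1 i : Decays d _)) hf.base hσ.1 hσ.2 hz h]
    simp
  · simp [wt_eq_zero hσ]

theorem X_some_Lop_comm {q f₀ : R3 → ℝ} (hd : 0 ≤ d) (hk : Prof d 1 k) (hq : Prof d 1 q)
    (hf₀ : Measurable f₀) (hi : Integrable fun y => |f₀ y| * (1 + ‖y‖) ^ (-d)) {i l : Fin 3}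
    (h : pd l k = pd i q) {z : STime} (hz : 0 < z.1) :
    X (some l) (Lop k f₀) z = X (some i) (Lop q f₀) z := by
  rw [X_some_Lop hd hk hf₀ hi l hz, X_some_Lop hd hq hf₀ hi i hz, h]

theorem sum_X_some_Lop (hd : 0 ≤ d) {κ : Fin 3 → R3 → ℝ} (hκ : ∀ i, Prof d 1 (κ i))
    (h : ∀ w, ∑ i, pd i (κ i) w = 0) {f₀ : R3 → ℝ} (hf₀ : Measurable f₀)
    (hi : Integrable fun y => |f₀ y| * (1 + ‖y‖) ^ (-d)) {z : STime} (hz : 0 < z.1) :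
    ∑ i, X (some i) (Lop (κ i) f₀) z = 0 := by
  have hm : Measurable (f₀ ∘ Prod.snd : STime → ℝ) := hf₀.comp measurable_snd
  rw [Finset.sum_congr rfl fun i _ => X_some_Lop hd (hκ i) hf₀ hi i hz]
  simp only [Lop, Psi]
  refine (integral_finsetSum Finset.univ fun i _ => integrable_hker_mul hd
    ((hκ i).2.2.1 i : Decays d _) hm hi (s := 1) (fun y => le_rfl) hz z.2).symm.trans ?_
  simp_rw [← Finset.sum_mul, hker, ← Finset.mul_sum, h]
  simp

end LinearInProfile

/-! ### The scaled heat operator on data and on slices. -/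

section HeatOperator

variable {d : ℝ} {n p : ℕ} {k q : R3 → ℝ} {f g : STime → ℝ} {a M N c : ℝ}

/-- The heat operator `t (∂ₜ - Δ)`. -/
noncomputable def Hop (f : STime → ℝ) (z : STime) : ℝ :=
  X none f z - ∑ i, X (some i) (X (some i) f) z

theorem Hop_congr (h : ∀ z : STime, 0 < z.1 → f z = g z) : Hop f = Hop g := by
  funext z
  simp only [Hop, X_congr _ h]

theorem Z.diff (h : Z p a (n + 1) M f) : ∀ z : STime, 0 < z.1 → DifferentiableAt ℝ f z := h.2.1

theorem Z.X (h : Z p a (n + 1) M f) (j : Option (Fin 3)) : Z p a n M (X j f) := h.2.2 j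

theorem Hop_add (hf : Z p a 2 M f) (hg : Z p a 2 N g) :
    Hop (fun z => f z + g z) = fun z => Hop f z + Hop g z := by
  funext z
  simp only [Hop, X_add _ hf.diff hg.diff]
  simp_rw [fun i : Fin 3 => X_add (some i) (hf.X (some i)).diff (hg.X (some i)).diff]
  rw [Finset.sum_add_distrib]
  ring

theorem Hop_const_mul (c : ℝ) (f : STime → ℝ) : Hop (fun z => c * f z) = fun z => c * Hop f z := by
  funext z
  simp only [Hop, X_const_mul, ← Finset.mul_sum]
  ring

theorem Hop_rpow_mul (c : ℝ) (hf : Z p a 2 M f) {z : STime} (hz : 0 < z.1) :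
    Hop (fun z => z.1 ^ c * f z) z = z.1 ^ c * (c * f z + Hop f z) := by
  simp only [Hop, X_none_rpow_mul _ hf.diff, X_some_rpow_mul _ _ hf.diff]
  simp_rw [fun i : Fin 3 => X_some_rpow_mul c i (hf.X (some i)).diff]
  rw [if_pos hz, ← Finset.mul_sum]
  ring

theorem Hop_Lop_gs (hd : 0 ≤ d) {f₀ : R3 → ℝ} (hf₀ : Measurable f₀)
    (hi : Integrable fun y => |f₀ y| * (1 + ‖y‖) ^ (-d)) {z : STime} (hz : 0 < z.1) :
    Hop (Lop gs f₀) z = 0 := by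
  have hm : Measurable (f₀ ∘ Prod.snd : STime → ℝ) := hf₀.comp measurable_snd
  have hg := GaussPoly.base
  have e : ∀ i, X (some i) (X (some i) (Lop gs f₀)) z = Lop (pd i (pd i gs)) f₀ z := fun i => by
    rw [X_congr (some i) fun z hz => X_some_Lop hd (hg.prof d 1) hf₀ hi i hz,
      X_some_Lop hd ((hg.pd i).prof d 1) hf₀ hi i hz]
  rw [Hop, X_none_Lop hd (hg.prof d 1) hf₀ hi hz, Finset.sum_congr rfl fun i _ => e i, sub_eq_zero]
  simp only [Lop, Psi]
  refine Eq.trans ?_ (integral_finsetSum Finset.univ fun i _ => integrable_hker_mul hd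
    (((hg.pd i).pd i).decays d) hm hi (s := 1) (fun y => le_rfl) hz z.2)
  refine integral_congr_ae (Eventually.of_forall fun y => ?_)
  simp only [hker, heatProf_gs _, lap, ← Finset.sum_mul, ← Finset.mul_sum]
  simp

theorem Isl_finset_sum (hd : 3 < d) {κ : Fin 3 → R3 → ℝ} (hκ : ∀ i, Decays d (κ i))
    (hf : ZBase p a M f) {σ : ℝ} (h0 : 0 < σ) (h1 : σ < 1) {z : STime} (hz : 0 < z.1) :
    Isl (fun w => ∑ i, κ i w) f σ z = ∑ i, Isl (κ i) f σ z := by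
  have t1 : 0 < (1 - σ) * z.1 := mul_pos (by linarith) hz
  have t2 : 0 < σ * z.1 := mul_pos h0 hz
  simp only [Isl, Psi]
  rw [← integral_finsetSum _ fun i _ => integrable_hker_mul_of_ZBase hd (hκ i) hf t1 t2 z.2]
  refine integral_congr_ae (Eventually.of_forall fun y => ?_)
  simp only [hker, ← Finset.sum_mul, ← Finset.mul_sum]

theorem Hop_Isl (hd : 3 < d) (hk : GaussPoly k) (hf : Z p a 1 M f) {σ : ℝ} (h0 : 0 < σ)
    (h1 : σ < 1) {z : STime} (hz : 0 < z.1) :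
    Hop (Isl k f σ) z = Isl (par k) f σ z + Isl k (X none f) σ z -
      (1 - σ)⁻¹ * Isl (lap k) f σ z := by
  have e : ∀ i, X (some i) (X (some i) (Isl k f σ)) z = (1 - σ)⁻¹ * Isl (pd i (pd i k)) f σ z :=
    fun i => by
      rw [X_congr (some i) fun z hz => X_some_Isl hd (hk.prof d 1) hf h0 h1 i hz, X_const_mul]
      simp only [X_some_Isl hd ((hk.pd i).prof d 1) hf h0 h1 i hz]
      rw [← mul_assoc, ← mul_inv, Real.mul_self_sqrt (by linarith)]
  have e2 : Isl (lap k) f σ z = ∑ i, Isl (pd i (pd i k)) f σ z :=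
    Isl_finset_sum hd (fun i => ((hk.pd i).pd i).decays d) hf.base h0 h1 hz
  rw [Hop, X_none_Isl hd (hk.prof d 1) hf h0 h1 hz, Finset.sum_congr rfl fun i _ => e i,
    ← Finset.mul_sum, ← e2]

theorem hasDerivAt_Isl_param (hd : 3 < d) (hk : Prof d 1 k) (hf : Z p a 1 M f) {σ : ℝ} (h0 : 0 < σ)
    (h1 : σ < 1) {z : STime} (hz : 0 < z.1) :
    HasDerivAt (fun σ => Isl k f σ z)
      (-(1 - σ)⁻¹ * Isl (par k) f σ z + σ⁻¹ * Isl k (X none f) σ z) σ := by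
  have t1 : 0 < (1 - σ) * z.1 := mul_pos (by linarith) hz
  have t2 : 0 < σ * z.1 := mul_pos h0 hz
  have hF := hasFDerivAt_Psi (by linarith) hk t1 (LocDom.of_Z hd hf t2) z.2
  have hc : HasDerivAt (fun σ : ℝ => ((1 - σ) * z.1, σ * z.1, z.2))
      ((-z.1, z.1, (0 : R3)) : ℝ × STime) σ := by
    refine HasDerivAt.prodMk ?_ (HasDerivAt.prodMk ?_ (hasDerivAt_const _ _))
    · simpa using ((hasDerivAt_id σ).const_sub 1).mul_const z.1
    · simpa using (hasDerivAt_id σ).mul_const z.1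
  have h := hF.comp_hasDerivAt σ hc
  refine h.congr_deriv ?_
  have hs : 1 - σ ≠ 0 := by linarith
  have hz0 := hz.ne'
  have hσ0 := h0.ne'
  simp [projScale, projTime, projSpace, Isl, Psi_time_deriv]
  field_simp

theorem HeatProf.Isl_par {m : ℝ} (hd : 3 < d) (hk : GaussPoly k) (h : HeatProf m k)
    (hf : ZBase p a M f) {σ : ℝ} (h0 : 0 < σ) (h1 : σ < 1) {z : STime} (hz : 0 < z.1) :
    Isl (par k) f σ z = Isl (lap k) f σ z + m / 2 * Isl k f σ z := by
  have e : par k = fun z => lap k z + m / 2 * k z := funext h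
  rw [e, Isl_add_left hd (hk.lap.decays d) ((hk.decays d).const_mul _) hf h0 h1 hz,
    Isl_const_mul_left]

theorem wt_of_mem {σ : ℝ} (h0 : 0 < σ) (h1 : σ < 1) : wt c σ = (1 - σ) ^ c := by
  rw [wt, if_pos ⟨h0, h1⟩]

theorem hasDerivAt_wt {σ : ℝ} (h0 : 0 < σ) (h1 : σ < 1) :
    HasDerivAt (wt c) (-c * (1 - σ)⁻¹ * wt c σ) σ := by
  have hs : 0 < 1 - σ := by linarith
  have h := ((hasDerivAt_id σ).const_sub 1).rpow_const (p := c) (Or.inl hs.ne')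
  have e : wt c =ᶠ[𝓝 σ] fun σ => (1 - id σ) ^ c := by
    filter_upwards [Ioo_mem_nhds h0 h1] with s hs
    exact wt_of_mem hs.1 hs.2
  refine (h.congr_of_eventuallyEq e).congr_deriv ?_
  rw [wt_of_mem h0 h1]
  simp only [id, Real.rpow_sub_one hs.ne']
  ring

/-- The heat operator acts on the slices of the Duhamel integral as a derivative in the
slicing parameter. -/
theorem hasDerivAt_slice (hd : 3 < d) (hk : GaussPoly k) (h : HeatProf 1 k) (hf : Z p a 1 M f)
    {σ : ℝ} (h0 : 0 < σ) (h1 : σ < 1) {z : STime} (hz : 0 < z.1) :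
    HasDerivAt (fun σ => σ * Wsl (-(1 / 2)) k f σ z)
      (Hop (Wsl (-(1 / 2)) k f σ) z + 1 / 2 * Wsl (-(1 / 2)) k f σ z) σ := by
  have hD := (hasDerivAt_id σ).mul ((hasDerivAt_wt (c := -(1 / 2)) h0 h1).mul
    (hasDerivAt_Isl_param hd (hk.prof d 1) hf h0 h1 hz))
  refine hD.congr_deriv ?_
  have e : Wsl (-(1 / 2)) k f σ = fun z => wt (-(1 / 2)) σ * Isl k f σ z := rfl
  have hs : 1 - σ ≠ 0 := by linarith
  rw [e, Hop_const_mul]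
  -- The weight exponent -1/2 and the order 1 of the profile are matched: the term σ/(2(1-σ)) times
  -- the slice from differentiating the weight cancels the one from the zeroth-order term of the
  -- heat profile.
  simp only [Hop_Isl hd hk hf h0 h1 hz, h.Isl_par hd hk hf.base h0 h1 hz, id, Pi.mul_apply]
  field_simp
  ring

theorem integral_unit_of_hasDerivAt {G G' : ℝ → ℝ} {A B : ℝ}
    (hG : ∀ σ, 0 < σ → σ < 1 → HasDerivAt G (G' σ) σ) (h0 : ∀ σ, ¬ (0 < σ ∧ σ < 1) → G' σ = 0)
    (hi : Integrable G') (hA : Tendsto G (𝓝[>] 0) (𝓝 A)) (hB : Tendsto G (𝓝[<] 1) (𝓝 B)) :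
    ∫ σ, G' σ = B - A := by
  rw [← intervalIntegral.integral_eq_sub_of_hasDerivAt_of_tendsto one_pos
    (fun σ hσ => hG σ hσ.1 hσ.2) hi.intervalIntegrable hA hB,
    intervalIntegral.integral_of_le zero_le_one]
  refine (setIntegral_eq_integral_of_forall_compl_eq_zero fun σ hσ => h0 σ fun hh => hσ ?_).symm
  exact ⟨hh.1, hh.2.le⟩

end HeatOperator

/-! ### Duhamel integrals solve the inhomogeneous heat equation. -/

section DuhamelHeat

variable {d : ℝ} {n p : ℕ} {k q : R3 → ℝ} {f g : STime → ℝ} {a M N c : ℝ}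

theorem Hop_superpose {Ω : Type*} [MeasurableSpace Ω] {μ : Measure Ω} {I : Ω → STime → ℝ}
    (hI : Measurable (Function.uncurry I)) {M : Ω → ℝ} (hM : Integrable M μ)
    (h : ∀ w, Z p a 2 (M w) (I w)) {z : STime} (hz : 0 < z.1) :
    Hop (fun z => ∫ w, I w z ∂μ) z = ∫ w, Hop (I w) z ∂μ ∧ Integrable (fun w => Hop (I w) z) μ := by
  have m1 : ∀ j, Measurable (Function.uncurry fun w => X j (I w)) := fun j =>
    measurable_X_uncurry hI (fun w => (h w).diff) j
  have m2 : ∀ i, Measurable (Function.uncurry fun w => X (some i) (X (some i) (I w))) := fun i =>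
    measurable_X_uncurry (m1 (some i)) (fun w => ((h w).X (some i)).diff) (some i)
  have i0 : Integrable (fun w => X none (I w) z) μ :=
    ZBase.integrable_family (m1 none) hM (fun w => ((h w).X none).base) hz
  have i1 : ∀ i, Integrable (fun w => X (some i) (X (some i) (I w)) z) μ := fun i =>
    ZBase.integrable_family (m2 i) hM (fun w => (((h w).X (some i)).X (some i)).base) hz
  have i2 := integrable_finsetSum Finset.univ fun i _ => i1 i
  refine ⟨?_, i0.sub i2⟩
  have h1 : ∀ w, Z p a 1 (M w) (I w) := fun w => (h w).of_succ
  simp only [Hop, X_superpose hI hM h1]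
  simp_rw [fun i : Fin 3 => X_superpose (m1 (some i)) hM (fun w => (h w).X (some i)) (some i)]
  rw [integral_sub i0 i2, integral_finsetSum _ fun i _ => i1 i]

theorem Hop_integral_Wsl (hd : 3 < d) (hp : 1 ≤ p) (hc : -1 < c) (ha : a < 1) (hk : Prof d 2 k)
    (hf : Z p a 2 M f) {z : STime} (hz : 0 < z.1) :
    Hop (fun z => ∫ σ, Wsl c k f σ z) z = ∫ σ, Hop (Wsl c k f σ) z ∧
      Integrable fun σ => Hop (Wsl c k f σ) z := by
  obtain ⟨C, hC0, hC⟩ := exists_Z_Wsl hd hp (a := a) c 2 k hk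
  exact Hop_superpose (measurable_Wsl_uncurry c hk.base.1 hf.base.meas)
    ((integrable_wt_mul_rpow hc ha).mul_const _) (hC M f hf) hz

/-- The factor σ beats the singularity σ^(-a) because a < 1. -/
theorem tendsto_slice_zero (hd : 3 < d) (hp : 1 ≤ p) (ha : a < 1) (hk : Decays d k)
    (hf : ZBase p a M f) {z : STime} (hz : 0 < z.1) :
    Tendsto (fun σ => σ * Wsl (-(1 / 2)) k f σ z) (𝓝[>] 0) (𝓝 0) := by
  obtain ⟨C, hC0, hC⟩ := exists_ZBase_Isl hd hp (a := a) hk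
  set B := C * M * z.1 ^ (-a - 3 / (2 * p)) with hB
  refine squeeze_zero_norm' (a := fun σ : ℝ => σ ^ (1 - a) * (1 - σ) ^ (-(1 / 2) : ℝ) * B) ?_ ?_
  · filter_upwards [Ioo_mem_nhdsGT one_pos] with σ hσ
    have hs : 0 < 1 - σ := by linarith [hσ.2]
    have h1 := (hC M f σ hσ.1 hσ.2 hf).sup z hz
    rw [Wsl, wt_of_mem hσ.1 hσ.2, norm_mul, norm_mul, Real.norm_of_nonneg hσ.1.le,
      Real.norm_of_nonneg (Real.rpow_nonneg hs.le _), Real.norm_eq_abs,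
      sub_eq_add_neg 1 a, Real.rpow_add hσ.1, Real.rpow_one]
    have h0 := Real.rpow_nonneg hs.le (-(1 / 2))
    calc σ * ((1 - σ) ^ (-(1 / 2) : ℝ) * |Isl k f σ z|)
        ≤ σ * ((1 - σ) ^ (-(1 / 2) : ℝ) * (C * (σ ^ (-a) * M) * z.1 ^ (-a - 3 / (2 * p)))) := by
          have := hσ.1.le
          gcongr
      _ = _ := by rw [hB]; ring
  · have h1 : ContinuousAt (fun σ : ℝ => σ ^ (1 - a) * (1 - σ) ^ (-(1 / 2) : ℝ) * B) 0 := by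
      refine ContinuousAt.mul (ContinuousAt.mul ?_ ?_) continuousAt_const
      · exact Real.continuousAt_rpow_const _ _ (Or.inr (by linarith))
      · exact ContinuousAt.rpow_const (by fun_prop) (Or.inl (by norm_num))
    have h2 := h1.tendsto.mono_left (nhdsWithin_le_nhds (s := Set.Ioi 0))
    simpa [Real.zero_rpow (by linarith : (1 - a) ≠ 0)] using h2

/-- The heat kernel slices converge to the identity. -/
theorem tendsto_Isl_gs (hf : Z p a 1 M f) {z : STime} (hz : 0 < z.1) :
    Tendsto (fun σ => Isl gs f σ z) (𝓝[<] 1) (𝓝 (f z)) := by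
  set b : ℝ := -a - 3 / (2 * p) with hb
  set A := M * ((z.1 / 2) ^ b + z.1 ^ b) with hA
  have hg : Integrable gs := (GaussPoly.base.decays 4).integrable (by norm_num)
  have hfc : ContinuousAt f z := (hf.diff z hz).continuousAt
  have e : ∀ᶠ σ in 𝓝[<] (1 : ℝ), Isl gs f σ z =
      ∫ w, gs w * f (σ * z.1, z.2 - √((1 - σ) * z.1) • w) := by
    filter_upwards [Ioo_mem_nhdsLT (by norm_num : (1 / 2 : ℝ) < 1)] with σ hσ
    exact Psi_eq_integral_profile _ _ (mul_pos (by linarith [hσ.2]) hz) _ _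
  refine Tendsto.congr' (EventuallyEq.symm e) ?_
  have h1 : f z = ∫ w, gs w * f z := by rw [integral_mul_const, integral_gs, one_mul]
  rw [h1]
  refine tendsto_integral_filter_of_dominated_convergence (fun w => |gs w| * A) ?_ ?_
    (hg.abs.mul_const A) ?_
  · refine Eventually.of_forall fun σ => ?_
    refine (contDiff_gs.continuous.measurable.mul (hf.base.meas.comp ?_)).aestronglyMeasurable
    fun_prop
  · filter_upwards [Ioo_mem_nhdsLT (by norm_num : (1 / 2 : ℝ) < 1)] with σ hσ
    refine Eventually.of_forall fun w => ?_
    have hσ0 : 0 < σ := by linarith [hσ.1]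
    rw [norm_mul, Real.norm_eq_abs, Real.norm_eq_abs]
    refine mul_le_mul_of_nonneg_left ?_ (abs_nonneg _)
    refine (hf.base.sup _ (mul_pos hσ0 hz)).trans
      (mul_le_mul_of_nonneg_left ?_ hf.base.nonneg)
    exact rpow_le_add_of_mem_Icc (half_pos hz) (by simp only; nlinarith [hσ.1])
      (by simp only; nlinarith [hσ.2]) b
  · refine Eventually.of_forall fun w => ?_
    refine Tendsto.mul tendsto_const_nhds (hfc.tendsto.comp ?_)
    have : Tendsto (fun σ : ℝ => ((σ * z.1, z.2 - √((1 - σ) * z.1) • w) : STime)) (𝓝 1)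
        (𝓝 (1 * z.1, z.2 - √((1 - 1) * z.1) • w)) :=
      Continuous.tendsto (by fun_prop) 1
    simpa using this.mono_left nhdsWithin_le_nhds

/-- The singular weight (1-σ)^(-1/2) is exactly what moving the derivative from the kernel to the
field absorbs. What is left is a heat-kernel average of the derivative of `f`, and this is the
boundary term that becomes the source. -/
theorem tendsto_slice_one (hf : Z p a 2 M f) (j : Fin 3) {z : STime} (hz : 0 < z.1) :
    Tendsto (fun σ => Wsl (-(1 / 2)) (pd j gs) f σ z) (𝓝[<] 1) (𝓝 (X (some j) f z)) := by
  have h4 : (3 : ℝ) < 4 := by norm_num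
  have hg := GaussPoly.base.prof 4 1
  have h1 := tendsto_Isl_gs (hf.X (some j)) hz
  have h2 : Tendsto (fun σ : ℝ => (√σ)⁻¹) (𝓝[<] 1) (𝓝 1) := by
    have : ContinuousAt (fun σ : ℝ => (√σ)⁻¹) 1 :=
      ContinuousAt.inv₀ (by fun_prop) (by simp)
    simpa using this.tendsto.mono_left (nhdsWithin_le_nhds (s := Set.Iio 1))
  have h3 := h2.mul h1
  rw [one_mul] at h3
  refine h3.congr' ?_
  filter_upwards [Ioo_mem_nhdsLT (by norm_num : (1 / 2 : ℝ) < 1)] with σ hσ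
  have hσ0 : 0 < σ := by linarith [hσ.1]
  have hs : 0 < 1 - σ := by linarith [hσ.2]
  rw [← X_some_Isl' h4 hg hf.of_succ hσ0 hσ.2 j hz, X_some_Isl h4 hg hf.of_succ hσ0 hσ.2 j hz, Wsl,
    wt_of_mem hσ0 hσ.2, Real.sqrt_eq_rpow, ← Real.rpow_neg hs.le]

theorem Wsl_eq_zero {σ : ℝ} (h : ¬ (0 < σ ∧ σ < 1)) : Wsl c k f σ = fun _ => 0 := by
  funext z
  simp [Wsl, wt_eq_zero h]

theorem Hop_zero : Hop (fun _ => 0) = fun _ => 0 := by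
  funext z
  simp [Hop, X_zero]

theorem Hop_Dop (hd : 3 < d) (hp : 1 ≤ p) (hc : -1 < c) (ha : a < 1) (hk : Prof d 2 k)
    (hf : Z p a 2 M f) {z : STime} (hz : 0 < z.1) :
    Hop (Dop c k f) z = z.1 ^ (c + 1) *
      ((c + 1) * (∫ σ, Wsl c k f σ z) + ∫ σ, Hop (Wsl c k f σ) z) := by
  obtain ⟨C, -, hC⟩ := exists_Z_integral_Wsl hd hp hc ha 2 k hk
  have : Dop c k f = fun z => z.1 ^ (c + 1) * ∫ σ, Wsl c k f σ z := rfl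
  rw [this, Hop_rpow_mul _ (hC M f hf) hz, (Hop_integral_Wsl hd hp hc ha hk hf hz).1]

/-- `(∂ₜ - Δ) ∫₀ᵗ ∂ⱼ e^{(t-s)Δ} f(s) ds = ∂ⱼ f`. -/
theorem Hop_Dop_neg_half (hp : 1 ≤ p) (ha : a < 1) (hf : Z p a 2 M f) (j : Fin 3) {z : STime}
    (hz : 0 < z.1) : Hop (Dop (-(1 / 2)) (pd j gs) f) z = √z.1 * X (some j) f z := by
  have h4 : (3 : ℝ) < 4 := by norm_num
  have hc : (-1 : ℝ) < -(1 / 2) := by norm_num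
  have hk := gaussPoly_pd_gs j
  have iW := integrable_Wsl h4 hp hc ha (hk.decays 4) hf.base hz
  have iH := (Hop_integral_Wsl h4 hp hc ha (hk.prof 4 2) hf hz).2
  rw [Hop_Dop h4 hp hc ha (hk.prof 4 2) hf hz]
  -- The factor 1/2 in the integrated derivative agrees with c + 1, the constant produced by the
  -- prefactor t^(c+1); the whole expression is therefore the boundary value at σ = 1.
  have key := integral_unit_of_hasDerivAt
    (fun σ h0 h1 => hasDerivAt_slice h4 hk (heatProf_pd_gs j) hf.of_succ h0 h1 hz)
    (fun σ h => by rw [Wsl_eq_zero h, Hop_zero]; simp) (iH.add (iW.const_mul _))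
    (tendsto_slice_zero h4 hp ha (hk.decays 4) hf.base hz)
    ((tendsto_id.mono_left nhdsWithin_le_nhds).mul (tendsto_slice_one hf j hz))
  rw [integral_add iH (iW.const_mul _), integral_const_mul] at key
  rw [Real.sqrt_eq_rpow, show (-(1 / 2) + 1 : ℝ) = 1 / 2 by norm_num, add_comm, key]
  simp

theorem wt_half {σ : ℝ} : wt (1 / 2) σ = (1 - σ) * wt (-(1 / 2)) σ := by
  by_cases h : 0 < σ ∧ σ < 1
  · have hs : 0 < 1 - σ := by linarith [h.2]
    rw [wt_of_mem h.1 h.2, wt_of_mem h.1 h.2, show (1 / 2 : ℝ) = 1 + -(1 / 2) by norm_num,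
      Real.rpow_add hs, Real.rpow_one]
    norm_num
  · simp [wt_eq_zero h]

theorem Wsl_half (σ : ℝ) :
    Wsl (1 / 2) k f σ = fun z => (1 - σ) * Wsl (-(1 / 2)) k f σ z := by
  funext z
  rw [Wsl, Wsl, wt_half, mul_assoc]

/-- `(∂ₜ - Δ) ∫₀ᵗ (t-s) ∂ⱼ e^{(t-s)Δ} f(s) ds = ∫₀ᵗ ∂ⱼ e^{(t-s)Δ} f(s) ds`. -/
theorem Hop_Dop_half (hp : 1 ≤ p) (ha : a < 1) (hf : Z p a 2 M f) (j : Fin 3) {z : STime}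
    (hz : 0 < z.1) :
    Hop (Dop (1 / 2) (pd j gs) f) z = z.1 * Dop (-(1 / 2)) (pd j gs) f z := by
  have h4 : (3 : ℝ) < 4 := by norm_num
  have hc : (-1 : ℝ) < -(1 / 2) := by norm_num
  have hc' : (-1 : ℝ) < 1 / 2 := by norm_num
  have hk := gaussPoly_pd_gs j
  have iW := integrable_Wsl h4 hp hc ha (hk.decays 4) hf.base hz
  have iW' := integrable_Wsl h4 hp hc' ha (hk.decays 4) hf.base hz
  have iH' := (Hop_integral_Wsl h4 hp hc' ha (hk.prof 4 2) hf hz).2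
  rw [Hop_Dop h4 hp hc' ha (hk.prof 4 2) hf hz]
  set W := fun σ => Wsl (-(1 / 2)) (pd j gs) f σ z with hW
  set W' := fun σ => Wsl (1 / 2) (pd j gs) f σ z with hW'
  set H' := fun σ => Hop (Wsl (1 / 2) (pd j gs) f σ) z with hH'
  have e1 : ∀ σ, W' σ = (1 - σ) * W σ := fun σ => by simp only [hW', hW, Wsl_half]
  have e2 : ∀ σ, H' σ = (1 - σ) * Hop (Wsl (-(1 / 2)) (pd j gs) f σ) z := fun σ => by
    simp only [hH', Wsl_half, Hop_const_mul]
  -- The slice identity multiplied by 1 - σ. Both boundary values vanish, and writing σW = W - W'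
  -- turns the derivative into H' + (3/2) W' - W, where 3/2 is c + 1 for c = 1/2.
  have key := integral_unit_of_hasDerivAt (G := fun σ => (1 - σ) * (σ * W σ))
    (G' := fun σ => H' σ + 3 / 2 * W' σ - W σ) (A := 0) (B := 0)
    (fun σ h0 h1 => by
      refine (((hasDerivAt_id σ).const_sub 1).mul
        (hasDerivAt_slice h4 hk (heatProf_pd_gs j) hf.of_succ h0 h1 hz)).congr_deriv ?_
      simp only [e1, e2, id, hW]
      ring)
    (fun σ h => by
      simp only [hH', hW', hW, Wsl_eq_zero h, Hop_zero]; simp) ((iH'.add (iW'.const_mul _)).sub iW)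
    (by
      have h1 := tendsto_slice_zero h4 hp ha (hk.decays 4) hf.base hz
      have h2 : Tendsto (fun σ : ℝ => 1 - σ) (𝓝[>] 0) (𝓝 (1 - 0)) :=
        (Continuous.tendsto (by fun_prop) 0).mono_left nhdsWithin_le_nhds
      have h3 := h2.mul h1
      norm_num only [sub_self, zero_mul, mul_zero] at h3
      exact h3)
    (by
      have h1 := (tendsto_id.mono_left (nhdsWithin_le_nhds (s := Set.Iio (1 : ℝ)))).mul
        (tendsto_slice_one hf j hz)
      have h2 : Tendsto (fun σ : ℝ => 1 - σ) (𝓝[<] 1) (𝓝 (1 - 1)) :=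
        (Continuous.tendsto (by fun_prop) 1).mono_left nhdsWithin_le_nhds
      have h3 := h2.mul h1
      norm_num only [sub_self, zero_mul, mul_zero] at h3
      exact h3)
  have i1 : ∫ σ, (H' σ + 3 / 2 * W' σ - W σ) = (∫ σ, (H' σ + 3 / 2 * W' σ)) - ∫ σ, W σ :=
    integral_sub (iH'.add (iW'.const_mul _)) iW
  have i2 : ∫ σ, (H' σ + 3 / 2 * W' σ) = (∫ σ, H' σ) + ∫ σ, 3 / 2 * W' σ :=
    integral_add iH' (iW'.const_mul _)
  rw [i1, i2, integral_const_mul] at key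
  have e3 : z.1 ^ ((1 : ℝ) / 2 + 1) = z.1 * z.1 ^ (-(1 / 2) + 1 : ℝ) := by
    rw [show ((1 : ℝ) / 2 + 1) = 1 + (-(1 / 2) + 1) by norm_num, Real.rpow_add hz, Real.rpow_one]
  rw [Dop, e3, mul_assoc]
  congr 2
  change _ = ∫ σ, W σ
  linarith

end DuhamelHeat

/-! ### Joint smoothness and commutation of the scaled derivatives. -/

section Smoothness

variable {d : ℝ} {n p : ℕ} {f g : STime → ℝ} {a M N c : ℝ}

theorem fderiv_eq_X (f : STime → ℝ) {z : STime} (hz : 0 < z.1) :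
    fderiv ℝ f z = (z.1⁻¹ * X none f z) • ContinuousLinearMap.fst ℝ ℝ R3 +
      ∑ i, ((√z.1)⁻¹ * X (some i) f z) •
        (EuclideanSpace.proj i ∘L ContinuousLinearMap.snd ℝ ℝ R3 : STime →L[ℝ] ℝ) := by
  conv_lhs => rw [stime_clm_eq (fderiv ℝ f z)]
  rw [fderiv_time_eq _ hz]
  simp_rw [fderiv_space_eq _ _ hz]

theorem contDiffOn_sqrt_inv (n : ℕ∞) :
    ContDiffOn ℝ n (fun z : STime => (√z.1)⁻¹) {z : STime | 0 < z.1} := fun z hz => by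
  have h1 : ContDiffAt ℝ n (fun z : STime => √z.1) z := contDiffAt_fst.sqrt (ne_of_gt hz)
  exact (h1.inv (Real.sqrt_pos.2 hz).ne').contDiffWithinAt

theorem contDiffOn_time_inv (n : ℕ∞) :
    ContDiffOn ℝ n (fun z : STime => z.1⁻¹) {z : STime | 0 < z.1} := fun z hz =>
  (ContDiffAt.inv contDiffAt_fst (ne_of_gt hz)).contDiffWithinAt

/-- The full derivative combines the scaled ones with coefficients smooth for t > 0. One order is
lost because the fields of top order are only known to be bounded and measurable. -/
theorem Z.contDiffOn : ∀ {n : ℕ} {f : STime → ℝ}, Z p a (n + 1) M f →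
    ContDiffOn ℝ n f {z : STime | 0 < z.1}
  | 0, f, h => by
    refine contDiffOn_zero.2 fun z hz => (h.diff z hz).continuousAt.continuousWithinAt
  | n + 1, f, h => by
    push_cast
    rw [contDiffOn_succ_iff_fderiv_of_isOpen isOpen_posTime]
    refine ⟨fun z hz => (h.diff z hz).differentiableWithinAt, by simp, ?_⟩
    refine ContDiffOn.congr ?_ fun z hz => fderiv_eq_X f hz
    refine ContDiffOn.add ?_ (ContDiffOn.sum fun i _ => ?_)
    · exact ((contDiffOn_time_inv n).mul (h.X none).contDiffOn).smul contDiffOn_const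
    · exact ((contDiffOn_sqrt_inv n).mul (h.X (some i)).contDiffOn).smul contDiffOn_const

theorem Z.differentiableAt_fderiv (h : Z p a 2 M f) {z : STime} (hz : 0 < z.1) :
    DifferentiableAt ℝ (fderiv ℝ f) z := by
  have e : fderiv ℝ f =ᶠ[𝓝 z] fun z => (z.1⁻¹ * _root_.X none f z) • ContinuousLinearMap.fst ℝ ℝ R3 +
      ∑ i, ((√z.1)⁻¹ * _root_.X (some i) f z) •
        (EuclideanSpace.proj i ∘L ContinuousLinearMap.snd ℝ ℝ R3 : STime →L[ℝ] ℝ) := by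
    filter_upwards [posTime_mem_nhds hz] with w hw
    exact fderiv_eq_X f hw
  refine DifferentiableAt.congr_of_eventuallyEq ?_ e
  refine DifferentiableAt.add ?_ (DifferentiableAt.fun_sum fun i _ => ?_)
  · exact ((differentiableAt_fst.inv hz.ne').mul ((h.X none).diff z hz)).smul_const _
  · exact (((differentiableAt_fst.sqrt hz.ne').inv (Real.sqrt_pos.2 hz).ne').mul
      ((h.X (some i)).diff z hz)).smul_const _

theorem hasFDerivAt_dir_none (z : STime) :
    HasFDerivAt (fun z : STime => dir none z.1)
      ((ContinuousLinearMap.fst ℝ ℝ R3).smulRight ((1, 0) : STime)) z := by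
  have e : (fun z : STime => dir none z.1) =
      fun z => (ContinuousLinearMap.fst ℝ ℝ R3).smulRight ((1, 0) : STime) z := by
    funext z; simp [dir]
  rw [e]
  exact ContinuousLinearMap.hasFDerivAt _

theorem hasFDerivAt_dir_some (i : Fin 3) {z : STime} (hz : 0 < z.1) :
    HasFDerivAt (fun z : STime => dir (some i) z.1)
      (((1 / (2 * √z.1)) • ContinuousLinearMap.fst ℝ ℝ R3).smulRight ((0, bv i) : STime)) z := by
  have e : (fun z : STime => dir (some i) z.1) = fun z => √z.1 • ((0, bv i) : STime) := by
    funext z; simp [dir]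
  rw [e]
  exact (hasFDerivAt_fst.sqrt hz.ne').smul_const _

theorem X_X_eq (h : Z p a 2 M f) (i l : Option (Fin 3)) {D : STime →L[ℝ] STime} {z : STime}
    (hz : 0 < z.1) (hD : HasFDerivAt (fun z : STime => dir l z.1) D z) :
    X i (X l f) z = fderiv ℝ (fderiv ℝ f) z (dir i z.1) (dir l z.1) +
      fderiv ℝ f z (D (dir i z.1)) := by
  have e : X l f =ᶠ[𝓝 z] fun z => fderiv ℝ f z (dir l z.1) := by
    filter_upwards [posTime_mem_nhds hz] with w hw
    exact X_of_pos _ _ hw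
  rw [X_of_pos _ _ hz, e.fderiv_eq,
    ((h.differentiableAt_fderiv hz).hasFDerivAt.clm_apply hD).fderiv]
  simp [add_comm]

theorem Z.fderiv_symm (h : Z p a 2 M f) {z : STime} (hz : 0 < z.1) (v w : STime) :
    fderiv ℝ (fderiv ℝ f) z v w = fderiv ℝ (fderiv ℝ f) z w v := by
  refine second_derivative_symmetric_of_eventually_of_real (f := f) ?_
    (h.differentiableAt_fderiv hz).hasFDerivAt v w
  filter_upwards [posTime_mem_nhds hz] with y hy
  exact (h.diff y hy).hasFDerivAt

theorem X_some_comm (h : Z p a 2 M f) (i l : Fin 3) :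
    X (some i) (X (some l) f) = X (some l) (X (some i) f) := by
  funext z
  by_cases hz : 0 < z.1
  · rw [X_X_eq h (some i) (some l) hz (hasFDerivAt_dir_some l hz),
      X_X_eq h (some l) (some i) hz (hasFDerivAt_dir_some i hz), h.fderiv_symm hz]
    simp [dir]
  · rw [X_of_nonpos _ _ hz, X_of_nonpos _ _ hz]

/-- The commutator arises from t d/dt √t = √t/2; the second derivative itself is symmetric. -/
theorem X_none_some (h : Z p a 2 M f) (i : Fin 3) :
    X none (X (some i) f) = fun z => X (some i) (X none f) z + 1 / 2 * X (some i) f z := by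
  funext z
  by_cases hz : 0 < z.1
  · rw [X_X_eq h none (some i) hz (hasFDerivAt_dir_some i hz),
      X_X_eq h (some i) none hz (hasFDerivAt_dir_none z), h.fderiv_symm hz, X_of_pos _ _ hz]
    have e : (1 / (2 * √z.1)) * z.1 = 1 / 2 * √z.1 := by
      have := Real.sqrt_pos.2 hz
      field_simp
      rw [Real.sq_sqrt hz.le]
    have e2 : dir (some i) z.1 = √z.1 • ((0, bv i) : STime) := by simp [dir]
    simp only [ContinuousLinearMap.smulRight_apply, _root_.smul_apply, ContinuousLinearMap.coe_fst',
      smul_eq_mul, e2, map_smul]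
    simp only [dir]
    rw [e]
    simp
    ring
  · simp [X_of_nonpos _ _ hz]

theorem Z.Hop (hp : 1 ≤ p) (h : Z p a (n + 2) M f) : Z p a n (M + ∑ _i : Fin 3, M) (Hop f) :=
  Z.sub hp (h.X none).of_succ (Z.sum hp _ fun i _ => (h.X (some i)).X (some i))

theorem X_some_sub (hf : Z p a 1 M f) (hg : Z p a 1 N g) (j : Option (Fin 3)) :
    X j (fun z => f z - g z) = fun z => X j f z - X j g z := by
  have e : (fun z => f z - g z) = fun z => f z + -1 * g z := by funext z; ring
  rw [e, X_add j hf.diff (hg.const_mul (-1)).diff, X_const_mul]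
  funext z; ring

theorem X_fin_sum {F : Fin 3 → STime → ℝ} (h : ∀ i, Z p a 1 M (F i)) (j : Option (Fin 3)) :
    X j (fun z => ∑ i, F i z) = fun z => ∑ i, X j (F i) z := by
  simp only [Fin.sum_univ_three]
  rw [X_add (f := fun z => F 0 z + F 1 z) j (fun z hz => ((h 0).diff z hz).add ((h 1).diff z hz))
    (h 2).diff, X_add j (h 0).diff (h 1).diff]

/-- The heat operator commutes with the scaled space derivatives up to lower order. -/
theorem X_some_Hop (hp : 1 ≤ p) (h : Z p a 3 M f) (l : Fin 3) :
    X (some l) (Hop f) = fun z => Hop (X (some l) f) z - 1 / 2 * X (some l) f z := by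
  have h2 : Z p a 2 M f := h.of_succ
  have e1 := X_some_sub (h.X none).of_succ
    (Z.sum (n := 1) hp Finset.univ fun i _ => (h.X (some i)).X (some i)) (some l)
  change X (some l) (fun z => X none f z - ∑ i, X (some i) (X (some i) f) z) = _
  rw [e1, X_fin_sum (fun i => (h.X (some i)).X (some i)) (some l)]
  have e2 : ∀ i, X (some l) (X (some i) (X (some i) f)) = X (some i) (X (some i) (X (some l) f)) :=
    fun i => by rw [X_some_comm (h.X (some i)) l i, X_some_comm h2 l i]
  simp only [e2, Hop, X_none_some h2]
  funext z
  ring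

/-- The commutator of the heat operator with a scaled derivative is a multiple of that derivative,
so equality of mixed first derivatives, that is curl-freeness, is preserved. -/
theorem X_some_Hop_comm (hp : 1 ≤ p) (hf : Z p a 3 M f) (hg : Z p a 3 N g) {i l : Fin 3}
    (h : ∀ z : STime, 0 < z.1 → X (some l) f z = X (some i) g z) :
    X (some l) (Hop f) = X (some i) (Hop g) := by
  have e : X (some l) f = X (some i) g := by
    funext z
    by_cases hz : 0 < z.1
    · exact h z hz
    · rw [X_of_nonpos _ _ hz, X_of_nonpos _ _ hz]
  rw [X_some_Hop hp hf, X_some_Hop hp hg, e]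

end Smoothness

/-! ### The Poincaré lemma. -/

section Potential

/-- A differentiable curl-free vector field on `ℝ³` is a gradient. -/
theorem exists_potential {G : Fin 3 → R3 → ℝ} (hG : ∀ i, Differentiable ℝ (G i))
    (hcurl : ∀ i l x, pd l (G i) x = pd i (G l) x) :
    ∃ φ : R3 → ℝ, ContDiff ℝ 1 φ ∧ ∀ x i, fderiv ℝ φ x (bv i) = G i x := by
  obtain ⟨Q, hQ⟩ : ∃ Q : Fin 3 → R3 →L[ℝ] ℝ, ∀ i x, Q i x = x i :=
    ⟨fun i => EuclideanSpace.proj i, fun _ _ => rfl⟩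
  have hW : ∀ x, HasFDerivAt (fun x => ∑ i, G i x • Q i) (∑ i, (fderiv ℝ (G i) x).smulRight (Q i)) x :=
    fun x => HasFDerivAt.fun_sum fun i _ => (hG i x).hasFDerivAt.smul_const (Q i)
  have hWd : DifferentiableOn ℝ (fun x => ∑ i, G i x • Q i) Set.univ := fun x _ =>
    (hW x).differentiableAt.differentiableWithinAt
  obtain ⟨φ, hφ⟩ := convex_univ.exists_forall_hasFDerivAt_of_fderiv_symmetric isOpen_univ hWd
    fun x _ v w => by
      rw [(hW x).fderiv]
      simp only [_root_.sum_apply, ContinuousLinearMap.smulRight_apply, _root_.smul_apply,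
        hQ, smul_eq_mul]
      simp_rw [fun i => r3_clm_apply (fderiv ℝ (G i) x) v,
        fun i => r3_clm_apply (fderiv ℝ (G i) x) w, Finset.sum_mul]
      rw [Finset.sum_comm]
      refine Finset.sum_congr rfl fun i _ => Finset.sum_congr rfl fun l _ => ?_
      have := hcurl i l x
      rw [pd, pd] at this
      rw [this]; ring
  refine ⟨φ, contDiff_one_iff_fderiv.2 ⟨fun x => (hφ x trivial).differentiableAt, ?_⟩, fun x i => ?_⟩
  · have e : fderiv ℝ φ = fun x => ∑ i, G i x • Q i := funext fun x => (hφ x trivial).fderiv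
    rw [e]
    exact continuous_finsetSum _ fun i _ => (hG i).continuous.smul continuous_const
  · rw [(hφ x trivial).fderiv]
    simp [bv, hQ]

end Potential

/-! ### The quadratic term of the integral system. -/

section Duhamel

variable {n : ℕ} {M N A : ℝ}

/-- The triples `u` (for `some i`) together with the temperature (for `none`). -/
abbrev State : Type := Option (Fin 3) → STime → ℝ

/-- The Lebesgue exponents `3` for the velocity and `1` for the temperature. -/
def pe : Option (Fin 3) → ℕ
  | none => 1
  | some _ => 3

theorem one_le_pe (j : Option (Fin 3)) : 1 ≤ pe j := by
  cases j <;> simp [pe]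

/-- Both weights are 0: `L³` for the velocity and `L¹` for the temperature are critical for the
scaling. -/
def Nrm (n : ℕ) (M : ℝ) (W : State) : Prop := ∀ j, Z (pe j) 0 n M (W j)

/-- The Duhamel term with fluxes `S (some j) k` for `uₖ uⱼ` and `S none k` for `uₖ θ`. -/
noncomputable def Duh (S : Option (Fin 3) → Fin 3 → STime → ℝ) : State
  | none => fun z => -∑ k, Dop (-(1 / 2)) (pd k gs) (S none k) z
  -- The first sum is the projected transport of momentum. The second is the buoyancy of the Duhamel
  -- part of the temperature: two heat flows compose to one with an extra factor t - s, whence the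
  -- exponent 1/2. The index 2 is the vertical direction.
  | some i => fun z => -(∑ j, ∑ k, Dop (-(1 / 2)) (Ler 1 (pd k gs) i j) (S (some j) k) z +
      ∑ k, Dop (1 / 2) (Ler 1 (pd k gs) i 2) (S none k) z)

theorem prof_Ler_one (k i j : Fin 3) (n : ℕ) : Prof (7 / 2) n (Ler 1 (pd k gs) i j) :=
  prof_Ler (by norm_num) (by norm_num) (gaussPoly_pd_gs k) n i j

theorem prof_pd_gs (k : Fin 3) (n : ℕ) : Prof (7 / 2) n (pd k gs) := (gaussPoly_pd_gs k).prof _ n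

theorem exists_uniform_Dop {ι : Type*} [Fintype ι] {p n : ℕ} (hp : 1 ≤ p) {c : ℝ} (hc : -1 < c)
    (κ : ι → R3 → ℝ) (hκ : ∀ i, Prof (7 / 2) n (κ i)) :
    ∃ C, 0 ≤ C ∧ ∀ i, ∀ (M : ℝ) (f : STime → ℝ), Z p (1 / 2) n M f →
      Z p (1 / 2 - (c + 1)) n (C * M) (Dop c (κ i) f) := by
  choose C hC0 hC using fun i => exists_Z_Dop (p := p) (a := 1 / 2) (by norm_num : (3 : ℝ) < 7 / 2)
    hp hc (by norm_num) n (κ i) (hκ i)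
  refine ⟨∑ i, C i, Finset.sum_nonneg fun i _ => hC0 i, fun i M f hf => (hC i M f hf).mono ?_⟩
  exact mul_le_mul_of_nonneg_right
    (Finset.single_le_sum (fun i _ => hC0 i) (Finset.mem_univ i)) hf.base.nonneg

/-- The exponent c = -1/2 gains 1/2, which cancels the weight of the fluxes. The buoyancy term gains
3/2 and so has weight -1 in `L¹`, which interpolation converts to weight 0 in `L³`. -/
theorem exists_Z_Duh (n : ℕ) : ∃ K, 0 ≤ K ∧ ∀ (M : ℝ) (S : Option (Fin 3) → Fin 3 → STime → ℝ),
    (∀ j k, Z (pe j) (1 / 2) n M (S j k)) → Nrm n (K * M) (Duh S) := by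
  obtain ⟨C1, hC1, h1⟩ := exists_uniform_Dop (n := n) le_rfl (by norm_num : (-1 : ℝ) < -(1 / 2))
    (fun k => pd k gs) fun k => prof_pd_gs k n
  obtain ⟨C2, hC2, h2⟩ := exists_uniform_Dop (n := n) (by norm_num : 1 ≤ 3)
    (by norm_num : (-1 : ℝ) < -(1 / 2))
    (fun q : Fin 3 × Fin 3 × Fin 3 => Ler 1 (pd q.1 gs) q.2.1 q.2.2) fun q => prof_Ler_one _ _ _ n
  obtain ⟨C3, hC3, h3⟩ := exists_uniform_Dop (n := n) le_rfl (by norm_num : (-1 : ℝ) < 1 / 2)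
    (fun q : Fin 3 × Fin 3 => Ler 1 (pd q.1 gs) q.2 2) fun q => prof_Ler_one _ _ _ n
  refine ⟨3 * C1 + (9 * C2 + 3 * C3), by positivity, fun M S hS j => ?_⟩
  have hM : 0 ≤ M := (hS none 0).base.nonneg
  match j with
  | none =>
    have h := Z.neg (Z.sum le_rfl Finset.univ fun k _ => h1 k M _ (hS none k))
    norm_num at h
    refine Z.mono ?_ h
    nlinarith [mul_nonneg hC2 hM, mul_nonneg hC3 hM]
  | some i =>
    have a2 := Z.sum (by norm_num : 1 ≤ 3) Finset.univ fun j _ => Z.sum (by norm_num : 1 ≤ 3)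
      Finset.univ fun k _ => h2 (k, i, j) M _ (hS (some j) k)
    have a3 := (Z.sum le_rfl Finset.univ fun k _ => h3 (k, i) M _ (hS none k)).one_to_three
    norm_num at a2 a3
    have h := Z.neg (Z.add (by norm_num : 1 ≤ 3) a2 a3)
    refine Z.mono ?_ h
    nlinarith [mul_nonneg hC1 hM]

theorem Duh_sub {S T : Option (Fin 3) → Fin 3 → STime → ℝ}
    (hS : ∀ j k, ZBase (pe j) (1 / 2) M (S j k)) (hT : ∀ j k, ZBase (pe j) (1 / 2) N (T j k))
    (j : Option (Fin 3)) {z : STime} (hz : 0 < z.1) :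
    Duh (fun j k z => S j k z - T j k z) j z = Duh S j z - Duh T j z := by
  have h4 : (3 : ℝ) < 7 / 2 := by norm_num
  have hc : (-1 : ℝ) < -(1 / 2) := by norm_num
  have hc' : (-1 : ℝ) < 1 / 2 := by norm_num
  have ha : (1 / 2 : ℝ) < 1 := by norm_num
  match j with
  | none =>
    simp only [Duh]
    simp_rw [fun k => Dop_sub h4 (one_le_pe none) hc ha (prof_pd_gs k 0) (hS none k) (hT none k) hz]
    rw [Finset.sum_sub_distrib]; ring
  | some i =>
    simp only [Duh]
    simp_rw [fun k j => Dop_sub h4 (one_le_pe (some j)) hc ha (prof_Ler_one k i j 0) (hS (some j) k)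
      (hT (some j) k) hz, fun k => Dop_sub h4 (one_le_pe none) hc' ha (prof_Ler_one k i 2 0)
      (hS none k) (hT none k) hz, Finset.sum_sub_distrib]
    ring

theorem Duh_congr_before {S T : Option (Fin 3) → Fin 3 → STime → ℝ} {z : STime} (hz : 0 < z.1)
    (h : ∀ j k, ∀ w : STime, 0 < w.1 → w.1 < z.1 → S j k w = T j k w) (j : Option (Fin 3)) :
    Duh S j z = Duh T j z := by
  match j with
  | none =>
    simp only [Duh]
    simp_rw [fun k => Dop_congr_before (c := -(1 / 2)) (k := pd k gs) hz (h none k)]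
  | some i =>
    simp only [Duh]
    simp_rw [fun j k => Dop_congr_before (c := -(1 / 2)) (k := Ler 1 (pd k gs) i j) hz (h (some j) k),
      fun k => Dop_congr_before (c := 1 / 2) (k := Ler 1 (pd k gs) i 2) hz (h none k)]

/-- The quadratic term of the integral system. -/
noncomputable def Quad (W : State) : State := Duh fun j k z => W j z * W (some k) z

theorem Nrm.flux {V W : State} (hV : Nrm n M V) (hW : Nrm n N W) (j : Option (Fin 3)) (k : Fin 3) :
    Z (pe j) (1 / 2) n (2 ^ n * (M * N)) (fun z => V j z * W (some k) z) := by
  have := Z.mul (one_le_pe j) (hV j) (hW (some k))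
  norm_num at this
  exact this

theorem Nrm.mono {W : State} (h : M ≤ N) (hW : Nrm n M W) : Nrm n N W := fun j => (hW j).mono h

/-- Bounds for the quadratic term. -/
def QuadBound (n : ℕ) (K : ℝ) : Prop :=
  (∀ (M : ℝ) (W : State), Nrm n M W → Nrm n (K * (M * M)) (Quad W)) ∧
  ∀ (M δ : ℝ) (V W : State), Nrm n M V → Nrm n M W → Nrm n δ (fun j z => V j z - W j z) →
    Nrm n (K * (2 * M * δ)) (fun j z => Quad V j z - Quad W j z)

theorem exists_QuadBound (n : ℕ) : ∃ K, 0 ≤ K ∧ QuadBound n K := by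
  obtain ⟨K, hK0, hK⟩ := exists_Z_Duh n
  refine ⟨K * 2 ^ n, by positivity, fun M W hW => ?_, fun M δ V W hV hW hD => ?_⟩
  · rw [mul_assoc]
    exact hK _ _ fun j k => hW.flux hW j k
  · have h1 : ∀ j k, Z (pe j) (1 / 2) n (2 ^ n * (2 * M * δ))
        (fun z => V j z * V (some k) z - W j z * W (some k) z) := fun j k => by
      have a := Z.add (one_le_pe j) (hV.flux hD j k) (hD.flux hW j k)
      have e : (fun z => V j z * (V (some k) z - W (some k) z) + (V j z - W j z) * W (some k) z) =
          fun z => V j z * V (some k) z - W j z * W (some k) z := by funext z; ring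
      rw [e] at a
      refine a.mono (le_of_eq (by ring))
    intro j
    rw [mul_assoc]
    refine Z.congr (fun z hz => ?_) ?_ (hK _ _ h1 j)
    · exact (Duh_sub (fun j k => (hV.flux hV j k).base) (fun j k => (hW.flux hW j k).base) j hz).symm
    · exact ((hK _ _ fun j k => hV.flux hV j k) j).base.meas.sub
        ((hK _ _ fun j k => hW.flux hW j k) j).base.meas

end Duhamel

/-! ### Picard iteration for small data. -/

section Picard

variable {n p : ℕ} {a M N A K : ℝ} {L : State}

/-- A series is a superposition for counting measure, so bounds on all derivatives of the sum come
from `Z.superpose`. -/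
theorem Z.tsum (hp : 1 ≤ p) {E : ℕ → STime → ℝ} (h : ∀ m, Z p a n (A * (1 / 2) ^ m) (E m)) :
    Z p a n (2 * A) (fun z => ∑' m, E m z) ∧ ∀ z : STime, 0 < z.1 → Summable fun m => E m z := by
  have hE : Measurable (Function.uncurry E) := measurable_from_prod_countable_right fun m => (h m).base.meas
  have hs : Summable fun m : ℕ => A * (1 / 2 : ℝ) ^ m := summable_geometric_two.mul_left A
  have hM : Integrable (fun m : ℕ => A * (1 / 2 : ℝ) ^ m) Measure.count :=
    integrable_count_iff.2 hs.norm
  have key := Z.superpose hp hE hM h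
  have hS : ∀ z : STime, 0 < z.1 → Summable fun m => E m z := fun z hz =>
    (integrable_count_iff.1 (ZBase.integrable_family hE hM (fun m => (h m).base) hz)).of_norm
  refine ⟨?_, hS⟩
  have e : ∫ m : ℕ, A * (1 / 2 : ℝ) ^ m ∂Measure.count = 2 * A := by
    rw [integral_countable hM]
    simp only [Measure.real, Measure.count_singleton, ENNReal.toReal_one, smul_eq_mul, one_mul]
    rw [tsum_mul_left, tsum_geometric_two, mul_comm]
  rw [e] at key
  refine Z.congr (fun z hz => ?_) ?_ key
  · rw [integral_countable (integrable_count_iff.2 (hS z hz).norm)]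
    simp
  · exact Measurable.tsum fun m => (h m).base.meas

/-- The Picard iterates. -/
noncomputable def picard (L : State) : ℕ → State
  | 0 => L
  | m + 1 => fun j z => L j z + Quad (picard L m) j z

noncomputable def picardIncr (L : State) : ℕ → State
  | 0 => L
  | m + 1 => fun j z => picard L (m + 1) j z - picard L m j z

noncomputable def picardLim (L : State) : State := fun j z => ∑' m, picardIncr L m j z

theorem sum_picardIncr (L : State) (j : Option (Fin 3)) (z : STime) :
    ∀ m, ∑ i ∈ Finset.range (m + 1), picardIncr L i j z = picard L m j z
  | 0 => by simp [picardIncr, picard]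
  | m + 1 => by rw [Finset.sum_range_succ, sum_picardIncr L j z m]; simp [picardIncr]

theorem Nrm.add {V W : State} (hV : Nrm n M V) (hW : Nrm n N W) :
    Nrm n (M + N) (fun j z => V j z + W j z) := fun j => (hV j).add (one_le_pe j) (hW j)

/-- The smallness condition under which the Picard iteration converges. -/
structure SmallData (n : ℕ) (K A : ℝ) (L : State) : Prop where
  K_nonneg : 0 ≤ K
  bound : QuadBound n K
  A_nonneg : 0 ≤ A
  data : Nrm n A L
  small : 8 * K * A ≤ 1

theorem nrm_picard (h : SmallData n K A L) : ∀ m, Nrm n (2 * A) (picard L m)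
  | 0 => h.data.mono (by linarith [h.A_nonneg])
  | m + 1 => (h.data.add (h.bound.1 _ _ (nrm_picard h m))).mono (by nlinarith [h.K_nonneg, h.A_nonneg, h.small, mul_le_mul_of_nonneg_right h.small h.A_nonneg])

/-- All iterates have size at most 2A, so the difference estimate contracts by the factor 4KA, which
is at most 1/2 by the smallness condition. -/
theorem nrm_picardIncr (h : SmallData n K A L) : ∀ m, Nrm n (2 * A * (1 / 2) ^ m) (picardIncr L m)
  | 0 => h.data.mono (by linarith [h.A_nonneg])
  | 1 => by
    have e : picardIncr L 1 = Quad L := by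
      funext j z; simp [picardIncr, picard]
    rw [e]
    exact (h.bound.1 _ _ h.data).mono (by nlinarith [h.K_nonneg, h.A_nonneg, h.small, mul_le_mul_of_nonneg_right h.small h.A_nonneg])
  | m + 2 => by
    have e : picardIncr L (m + 2) = fun j z => Quad (picard L (m + 1)) j z - Quad (picard L m) j z := by
      funext j z; simp [picardIncr, picard]
    have h0 : (0 : ℝ) ≤ (1 / 2) ^ (m + 1) := by positivity
    rw [e]
    refine (h.bound.2 (2 * A) _ _ _ (nrm_picard h (m + 1))
      (nrm_picard h m) (nrm_picardIncr h (m + 1))).mono ?_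
    rw [pow_succ _ (m + 1)]
    nlinarith [mul_le_mul_of_nonneg_right h.small (mul_nonneg h.A_nonneg h0)]

theorem nrm_picardLim (h : SmallData n K A L) : Nrm n (4 * A) (picardLim L) := fun j =>
  ((Z.tsum (one_le_pe j) fun m => nrm_picardIncr h m j).1).mono (by linarith [h.A_nonneg])

theorem nrm_picardLim_sub (h : SmallData n K A L) (m : ℕ) :
    Nrm n (4 * A * (1 / 2) ^ m) (fun j z => picardLim L j z - picard L m j z) := fun j => by
  have hI := fun m => nrm_picardIncr h m j
  have h1 := Z.tsum (A := 2 * A * (1 / 2) ^ (m + 1)) (one_le_pe j) fun i =>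
    (hI (i + (m + 1))).mono (le_of_eq (by rw [pow_add]; ring))
  refine Z.congr (g := fun z => ∑' i, picardIncr L (i + (m + 1)) j z) (fun z hz => ?_) ?_
    (h1.1.mono (by
      rw [pow_succ]; nlinarith [mul_nonneg h.A_nonneg (by positivity : (0 : ℝ) ≤ (1 / 2) ^ m)]))
  · have h2 := ((Z.tsum (one_le_pe j) hI).2 z hz).sum_add_tsum_nat_add (m + 1)
    rw [sum_picardIncr] at h2
    simp only [picardLim]
    linarith
  · exact (nrm_picardLim h j).base.meas.sub
      (nrm_picard h m j).base.meas

/-- The defect of the fixed-point equation is a difference of the errors of consecutive iterates,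
and is O(2^(-m)) at each point for every `m`. -/
theorem picardLim_eq (h : SmallData n K A L) (j : Option (Fin 3)) {z : STime} (hz : 0 < z.1) :
    picardLim L j z = L j z + Quad (picardLim L) j z := by
  have hb : ∀ m : ℕ, |picardLim L j z - L j z - Quad (picardLim L) j z| ≤
      (4 * A + K * (8 * A * (4 * A))) * z.1 ^ (-0 - 3 / (2 * (pe j : ℝ))) * (1 / 2 : ℝ) ^ m := fun m => by
    have h1 := nrm_picardLim_sub h (m + 1)
    have h2 := h.bound.2 (4 * A) _ _ _ (nrm_picardLim h)
      ((nrm_picard h m).mono (by linarith [h.A_nonneg])) (nrm_picardLim_sub h m)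
    have h3 := (((h1 j).sub (one_le_pe j) (h2 j)).base).sup z hz
    have e : picardLim L j z - picard L (m + 1) j z - (Quad (picardLim L) j z - Quad (picard L m) j z) =
        picardLim L j z - L j z - Quad (picardLim L) j z := by
      simp only [picard]; ring
    rw [e] at h3
    refine h3.trans ?_
    have h4 : 0 ≤ z.1 ^ (-0 - 3 / (2 * (pe j : ℝ))) := Real.rpow_nonneg hz.le _
    have h5 : (0 : ℝ) ≤ (1 / 2) ^ m := by positivity
    have h6 : 4 * A * (1 / 2) ^ (m + 1) + K * (2 * (4 * A) * (4 * A * (1 / 2) ^ m)) ≤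
        (4 * A + K * (8 * A * (4 * A))) * (1 / 2) ^ m := by
      rw [pow_succ]; nlinarith [mul_nonneg h.A_nonneg h5]
    calc _ ≤ _ := mul_le_mul_of_nonneg_right h6 h4
      _ = _ := by ring
  have hlim : Tendsto (fun m : ℕ => (4 * A + K * (8 * A * (4 * A))) *
      z.1 ^ (-0 - 3 / (2 * (pe j : ℝ))) * (1 / 2 : ℝ) ^ m) atTop (𝓝 0) := by
    simpa using (tendsto_pow_atTop_nhds_zero_of_lt_one (by norm_num : (0 : ℝ) ≤ 1 / 2)
      (by norm_num)).const_mul ((4 * A + K * (8 * A * (4 * A))) * z.1 ^ (-0 - 3 / (2 * (pe j : ℝ))))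
  have h0 := abs_nonpos_iff.1 (ge_of_tendsto' hlim hb)
  linarith

end Picard

/-! ### Strong continuity of the heat semigroup at time zero. -/

section ApproximateIdentity

variable {d a A : ℝ} {p : ℕ} {k : R3 → ℝ} {f : R3 → ℝ}

/-- Translation is continuous in `L^p`. -/
theorem tendsto_eLpNorm_translate (hp : 1 ≤ p) (hf : MemLp f p volume) :
    ∃ w : R3 → ℝ, Continuous w ∧ w 0 = 0 ∧ (∃ B, ∀ h, |w h| ≤ B) ∧
      ∀ h, 0 ≤ w h ∧ eLpNorm (fun x => f (x - h) - f x) p volume = ENNReal.ofReal (w h) := by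
  have : Fact ((1 : ℝ≥0∞) ≤ p) := ⟨by exact_mod_cast hp⟩
  set F : Lp ℝ p (volume : Measure R3) := hf.toLp f with hF
  have : Fact ((p : ℝ≥0∞) ≠ ⊤) := ⟨by simp⟩
  -- The modulus of continuity is read off from the continuous isometric action of translations on
  -- `Lp`; the sign is chosen so that the translate is x ↦ f (x - h).
  set w : R3 → ℝ := fun h => ‖((DomAddAct.mk (-h) : R3ᵈᵃᵃ) +ᵥ F) - F‖ with hw
  have hiso : ∀ h : R3, ‖(DomAddAct.mk (-h) : R3ᵈᵃᵃ) +ᵥ F‖ = ‖F‖ := fun h =>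
    DomAddAct.norm_vadd_Lp _ _
  refine ⟨w, ?_, ?_, ⟨‖F‖ + ‖F‖, fun h => ?_⟩, fun h => ⟨norm_nonneg _, ?_⟩⟩
  · have h1 : Continuous fun h : R3 => (DomAddAct.mk (-h) : R3ᵈᵃᵃ) :=
      Continuous.comp (DomAddAct.continuous_mk (M := R3)) continuous_neg
    have h2 : Continuous fun h : R3 => (DomAddAct.mk (-h) : R3ᵈᵃᵃ) +ᵥ F := h1.vadd continuous_const
    exact (h2.sub continuous_const).norm
  · simp [hw]
  · rw [abs_of_nonneg (norm_nonneg _)]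
    exact (norm_sub_le _ _).trans (by rw [hiso h])
  · rw [hw, ofReal_norm, Lp.enorm_def]
    refine eLpNorm_congr_ae ?_
    have e : (DomAddAct.mk (-h) : R3ᵈᵃᵃ) +ᵥ F = MemLp.toLp _ (hf.comp_measurePreserving
      (measurePreserving_vadd (-h) (volume : Measure R3))) := DomAddAct.mk_vadd_toLp (-h) hf
    rw [e]
    filter_upwards [Lp.coeFn_sub (MemLp.toLp _ (hf.comp_measurePreserving
      (measurePreserving_vadd (-h) (volume : Measure R3)))) F, MemLp.coeFn_toLp hf,
      MemLp.coeFn_toLp (hf.comp_measurePreserving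
      (measurePreserving_vadd (-h) (volume : Measure R3)))] with x h2 h3 h4
    rw [h2, Pi.sub_apply, h3, h4]
    simp [vadd_eq_add, sub_eq_neg_add]

theorem Lop_eq_integral_profile (k f : R3 → ℝ) {t : ℝ} (ht : 0 < t) (x : R3) :
    Lop k f (t, x) = ∫ z, k z * f (x - √t • z) :=
  Psi_eq_integral_profile k _ ht _ x

theorem integrable_Lop (hd : 0 ≤ d) (hk : Decays d k) (hf : Measurable f)
    (hi : Integrable fun y => |f y| * (1 + ‖y‖) ^ (-d)) {t : ℝ} (ht : 0 < t) (x : R3) :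
    Integrable fun y => hker k t (x - y) * f y :=
  integrable_hker_mul (f := f ∘ Prod.snd) hd hk (hf.comp measurable_snd) hi (s := 1)
    (fun _ => le_rfl) ht x

/-- The heat semigroup is strongly continuous at time zero. -/
theorem tendsto_Lop_gs (hp : 1 ≤ p) (hf : MemLp f p volume) (hfm : Measurable f) :
    Tendsto (fun t => eLpNorm (fun x => Lop gs f (t, x) - f x) p volume) (𝓝[>] 0) (𝓝 0) := by
  obtain ⟨w, hwc, hw0, ⟨B, hB⟩, hw⟩ := tendsto_eLpNorm_translate hp hf
  have hg := GaussPoly.base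
  have hgi : Integrable gs := (hg.decays 4).integrable (by norm_num)
  have hgc : Continuous gs := contDiff_gs.continuous
  -- By Minkowski ‖e^{tΔ}f - f‖ is at most the Gaussian average of w(√t z), which tends to 0 by
  -- dominated convergence.
  have hlim : Tendsto (fun t : ℝ => ∫ z, |gs z| * w (√t • z)) (𝓝[>] 0) (𝓝 (∫ z, |gs z| * 0)) := by
    refine tendsto_integral_filter_of_dominated_convergence (fun z => |gs z| * B) ?_ ?_
      (hgi.abs.mul_const B) ?_
    · exact Eventually.of_forall fun t => (by fun_prop : Continuous fun z => |gs z| * w (√t • z)).aestronglyMeasurable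
    · refine Eventually.of_forall fun t => Eventually.of_forall fun z => ?_
      rw [norm_mul, Real.norm_eq_abs, abs_abs]
      exact mul_le_mul_of_nonneg_left (hB _) (abs_nonneg _)
    · refine Eventually.of_forall fun z => Tendsto.mul tendsto_const_nhds ?_
      have : Continuous fun t : ℝ => w (√t • z) := by fun_prop
      have h := (this.tendsto 0).mono_left (nhdsWithin_le_nhds (s := Set.Ioi 0))
      simpa [hw0] using h
  have hlim2 := ENNReal.tendsto_ofReal hlim
  simp only [mul_zero, integral_zero, ENNReal.ofReal_zero] at hlim2
  refine tendsto_of_tendsto_of_tendsto_of_le_of_le' tendsto_const_nhds hlim2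
    (Eventually.of_forall fun _ => zero_le) ?_
  filter_upwards [self_mem_nhdsWithin] with t ht
  have ht : (0 : ℝ) < t := ht
  have e : (fun x => Lop gs f (t, x) - f x) = fun x => ∫ z, gs z * (f (x - √t • z) - f x) := by
    funext x
    have hi : Integrable fun z => gs z * f (x - √t • z) := by
      have h1 := integrable_Lop (by norm_num : (0 : ℝ) ≤ 4) (hg.decays 4) hfm
        (integrable_data_decay (by norm_num) hp hf) ht x
      have h2 := (h1.comp_sub_left x)
      have h3 := h2.comp_smul (Real.sqrt_pos.2 ht).ne'
      have h4 := h3.const_mul (t ^ (3 / 2 : ℝ))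
      refine h4.congr (Eventually.of_forall fun z => ?_)
      have hs := (Real.sqrt_pos.2 ht).ne'
      simp only [hker, sub_sub_cancel, smul_smul, inv_mul_cancel₀ hs, one_smul]
      rw [← mul_assoc, ← mul_assoc, ← Real.rpow_add ht]
      norm_num
    simp_rw [mul_sub]
    rw [Lop_eq_integral_profile _ _ ht, integral_sub hi (hgi.mul_const _), integral_mul_const,
      integral_gs, one_mul]
  rw [e]
  have key := eLpNorm_integral_le (volume : Measure R3) (volume : Measure R3) hp
    (I := fun z x => gs z * (f (x - √t • z) - f x)) (M := fun z => ENNReal.ofReal (|gs z| * w (√t • z)))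
    (by
      refine Measurable.mul (hgc.measurable.comp measurable_fst) (Measurable.sub ?_ ?_)
      · exact hfm.comp (by fun_prop)
      · exact hfm.comp measurable_snd)
    (by fun_prop) (fun _ => ENNReal.ofReal_ne_top) (fun z => by
      have := eLpNorm_const_smul (gs z) (fun x => f (x - √t • z) - f x) p (volume : Measure R3)
      rw [(hw (√t • z)).2] at this
      rw [ENNReal.ofReal_mul (abs_nonneg _)]
      refine le_of_eq (Eq.trans this ?_)
      rw [Real.enorm_eq_ofReal_abs])
  refine key.trans (le_of_eq ?_)
  rw [ofReal_integral_eq_lintegral_ofReal]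
  · refine (hgi.abs.mul_const B).mono' (by fun_prop) (Eventually.of_forall fun z => ?_)
    rw [norm_mul, Real.norm_eq_abs, abs_abs]
    exact mul_le_mul_of_nonneg_left (hB _) (abs_nonneg _)
  · exact Eventually.of_forall fun z => mul_nonneg (abs_nonneg _) (hw _).1

end ApproximateIdentity

/-! ### Vanishing of the critical norms as t → 0. -/

section SmallTimes

variable {d a b A M N ε : ℝ} {n p : ℕ} {f g h : STime → ℝ}

/-- The scaling-invariant norms of `f(t)` tend to zero as `t → 0`. -/
def Small0 (p : ℕ) (f : STime → ℝ) : Prop :=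
  ∀ ε : ℝ, 0 < ε → ∃ T : ℝ, 0 < T ∧ ∀ t : ℝ, 0 < t → t < T →
    eLpNorm (fun x => f (t, x)) p volume ≤ ENNReal.ofReal ε ∧
      ∀ x, |f (t, x)| ≤ ε * t ^ (-0 - 3 / (2 * p) : ℝ)

/-- `√t ‖f(t)‖_∞ → 0` as `t → 0`. -/
def Van (f : STime → ℝ) : Prop :=
  ∀ ε : ℝ, 0 < ε → ∃ T : ℝ, 0 < T ∧ ∀ z : STime, 0 < z.1 → z.1 < T → |f z| ≤ ε * z.1 ^ (-(1 / 2) : ℝ)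

theorem Small0.van (h : Small0 3 f) : Van f := fun ε hε => by
  obtain ⟨T, hT, H⟩ := h ε hε
  refine ⟨T, hT, fun z hz hzT => ?_⟩
  have := (H z.1 hz hzT).2 z.2
  norm_num at this ⊢
  exact this

theorem Van.add (hf : Van f) (hg : Van g) : Van fun z => f z + g z := fun ε hε => by
  obtain ⟨T, hT, H⟩ := hf (ε / 2) (half_pos hε)
  obtain ⟨S, hS, G⟩ := hg (ε / 2) (half_pos hε)
  refine ⟨min T S, lt_min hT hS, fun z hz hzT => (abs_add_le _ _).trans ?_⟩
  have h1 := H z hz (hzT.trans_le (min_le_left _ _))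
  have h2 := G z hz (hzT.trans_le (min_le_right _ _))
  linarith

theorem ZBase.abs (hf : ZBase p a M f) : ZBase p a M fun z => |f z| where
  meas := hf.meas.abs
  lp t ht := by
    have h := eLpNorm_norm (fun x => f (t, x)) (p := (p : ℝ≥0∞)) (μ := volume)
    simp only [Real.norm_eq_abs] at h
    rw [h]
    exact hf.lp t ht
  sup z hz := by rw [abs_abs]; exact hf.sup z hz

theorem ZBase.small0 (hf : ZBase p a M f) (ha : a < 0) : Small0 p f := fun ε hε => by
  have hlim : Tendsto (fun t : ℝ => M * t ^ (-a)) (𝓝[>] 0) (𝓝 0) := by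
    have h1 : ContinuousAt (fun t : ℝ => M * t ^ (-a)) 0 :=
      continuousAt_const.mul (Real.continuousAt_rpow_const _ _ (Or.inr (by linarith)))
    have h2 := h1.tendsto.mono_left (nhdsWithin_le_nhds (s := Set.Ioi 0))
    simpa [Real.zero_rpow (by linarith : -a ≠ 0)] using h2
  obtain ⟨T, hT, H⟩ := (nhdsGT_basis (0 : ℝ)).eventually_iff.1 (hlim.eventually_le_const hε)
  refine ⟨T, hT, fun t ht htT => ⟨(hf.lp t ht).trans (ENNReal.ofReal_le_ofReal (H ⟨ht, htT⟩)),
    fun x => (hf.sup (t, x) ht).trans ?_⟩⟩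
  rw [show (-a - 3 / (2 * (p : ℝ))) = -a + (-0 - 3 / (2 * p)) by ring, Real.rpow_add ht, ← mul_assoc]
  exact mul_le_mul_of_nonneg_right (H ⟨ht, htT⟩) (Real.rpow_nonneg ht.le _)

/-- Vanishing at t = 0 is closed under approximation in the critical norm. Only a pointwise majorant
is asked for, so that kernels can be replaced by positive weights. -/
theorem Small0.of_approx (hp : 1 ≤ p)
    (H : ∀ ε : ℝ, 0 < ε → ∃ g h : STime → ℝ, Measurable g ∧ Small0 p g ∧ ZBase p 0 ε h ∧
      ∀ z : STime, 0 < z.1 → |f z| ≤ |g z| + |h z|) : Small0 p f := fun ε hε => by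
  obtain ⟨g, h, hgm, hg, hh, hle⟩ := H (ε / 2) (half_pos hε)
  obtain ⟨T, hT, G⟩ := hg (ε / 2) (half_pos hε)
  refine ⟨T, hT, fun t ht htT => ⟨?_, fun x => ?_⟩⟩
  · have h1 : eLpNorm (fun x => f (t, x)) p volume ≤
        eLpNorm (fun x => |g (t, x)| + |h (t, x)|) p volume :=
      eLpNorm_mono_real fun x => hle (t, x) ht
    refine h1.trans ((eLpNorm_add_le (f := fun x => |g (t, x)|) (g := fun x => |h (t, x)|)
      (measurable_slice hgm t).abs.aestronglyMeasurable
      (measurable_slice hh.meas t).abs.aestronglyMeasurable (by exact_mod_cast hp)).trans ?_)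
    have e1 := eLpNorm_norm (fun x => g (t, x)) (p := (p : ℝ≥0∞)) (μ := volume)
    have e2 := eLpNorm_norm (fun x => h (t, x)) (p := (p : ℝ≥0∞)) (μ := volume)
    simp only [Real.norm_eq_abs] at e1 e2
    rw [e1, e2]
    have h2 := hh.lp t ht
    rw [neg_zero, Real.rpow_zero, mul_one] at h2
    refine (add_le_add (G t ht htT).1 h2).trans ?_
    rw [← ENNReal.ofReal_add (by linarith) (by linarith), add_halves]
  · have h1 := hle (t, x) ht
    have h2 := (G t ht htT).2 x
    have h3 := hh.sup (t, x) ht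
    simp only at h3
    linarith

/-- Splitting of an integrable function into a bounded and a small part. -/
theorem exists_truncation {f : R3 → ℝ} (hf : MemLp f p volume) (hfm : Measurable f)
    (hε : 0 < ε) : ∃ f₁ f₂ : R3 → ℝ, Measurable f₁ ∧ Measurable f₂ ∧ (∀ x, f x = f₁ x + f₂ x) ∧
      (∀ x, |f₁ x| ≤ |f x|) ∧ (∀ x, |f₂ x| ≤ |f x|) ∧ (∃ R, 0 ≤ R ∧ ∀ x, |f₁ x| ≤ R) ∧
      eLpNorm f₂ p volume ≤ ENNReal.ofReal ε := by
  obtain ⟨R, hR, h⟩ := hf.eLpNorm_indicator_norm_ge_pos_le hfm.stronglyMeasurable hε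
  set s : Set R3 := {x | R ≤ ‖f x‖₊} with hs
  have hsm : MeasurableSet s := measurableSet_le measurable_const hfm.nnnorm.coe_nnreal_real
  refine ⟨sᶜ.indicator f, s.indicator f, hfm.indicator hsm.compl, hfm.indicator hsm, fun x => ?_,
    fun x => ?_, fun x => ?_, ⟨R, hR.le, fun x => ?_⟩, h⟩
  · rw [Set.indicator_compl_add_self_apply]
  · by_cases hx : x ∈ s <;> simp [hx]
  · by_cases hx : x ∈ s <;> simp [hx]
  · by_cases hx : x ∈ s
    · simp [hx, hR.le]
    · have : |f x| < R := not_le.1 hx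
      simp [hx, this.le]

theorem Lop_add_right (hd : 0 ≤ d) {k f g : R3 → ℝ} (hk : Decays d k) (hf : Measurable f)
    (hg : Measurable g) (hfi : Integrable fun y => |f y| * (1 + ‖y‖) ^ (-d))
    (hgi : Integrable fun y => |g y| * (1 + ‖y‖) ^ (-d)) {z : STime} (hz : 0 < z.1) :
    Lop k (fun y => f y + g y) z = Lop k f z + Lop k g z := by
  refine Eq.trans ?_ (integral_add (integrable_Lop hd hk hf hfi hz z.2)
    (integrable_Lop hd hk hg hgi hz z.2))
  refine integral_congr_ae (Eventually.of_forall fun y => ?_)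
  simp [mul_add]

theorem integrable_data_mono {f g : R3 → ℝ} (hf : Measurable f) (h : ∀ x, |f x| ≤ |g x|)
    (hg : Integrable fun y => |g y| * (1 + ‖y‖) ^ (-d)) :
    Integrable fun y => |f y| * (1 + ‖y‖) ^ (-d) := by
  refine hg.mono' (by fun_prop) (Eventually.of_forall fun y => ?_)
  rw [Real.norm_of_nonneg (by positivity)]
  exact mul_le_mul_of_nonneg_right (h y) (by positivity)

/-- The bounded part of the data evolves boundedly, which √t makes negligible; the remainder is
small in `L³`, and smoothing turns that into a small multiple of t^(-1/2). -/
theorem van_Lop_gs {f : R3 → ℝ} (hf : MemLp f (3 : ℕ) volume) (hfm : Measurable f) :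
    Van (Lop gs f) := fun ε hε => by
  have hg := GaussPoly.base
  have h4 : (3 : ℝ) < 4 := by norm_num
  have hgi : Integrable gs := (hg.decays 4).integrable h4
  obtain ⟨C, hC0, hC⟩ := exists_Z_Lop h4 (by norm_num : 1 ≤ 3) 0 gs (hg.decays 4)
  obtain ⟨f₁, f₂, m1, m2, hsum, b1, b2, ⟨R, hR0, hR⟩, hs⟩ := exists_truncation hf hfm
    (div_pos (half_pos hε) (by linarith : 0 < C + 1))
  have hi := integrable_data_decay h4 (by norm_num) hf
  set G := ∫ z, |gs z| with hG
  have hG0 : 0 ≤ G := integral_nonneg fun _ => abs_nonneg _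
  refine ⟨(ε / 2 / (G * R + 1)) ^ 2, by positivity, fun z hz hzT => ?_⟩
  have e : f = fun y => f₁ y + f₂ y := funext hsum
  rw [e, Lop_add_right (by norm_num) (hg.decays 4) m1 m2 (integrable_data_mono m1 b1 hi)
    (integrable_data_mono m2 b2 hi) hz]
  have h2 := ((hC f₂ _ ⟨m2, by positivity, hs⟩).base).sup z hz
  have h1 : |Lop gs f₁ z| ≤ G * R := abs_Psi_le_of_bound hgi hz (fun y => hR y) z.2
  have hs0 : 0 < √z.1 := Real.sqrt_pos.2 hz
  have h3 : √z.1 < ε / 2 / (G * R + 1) := (Real.sqrt_lt' (by positivity)).2 hzT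
  have h5 : z.1 ^ (-(1 / 2) : ℝ) = (√z.1)⁻¹ := by
    rw [Real.rpow_neg hz.le, ← Real.sqrt_eq_rpow]
  norm_num at h2
  rw [show (-(1 / 2) : ℝ) = -(1 / 2) from rfl] at h2
  rw [h5] at h2 ⊢
  have h6 : G * R ≤ ε / 2 * (√z.1)⁻¹ := by
    rw [← div_eq_mul_inv, le_div_iff₀ hs0]
    rw [lt_div_iff₀ (by positivity)] at h3
    nlinarith
  have h7 : C * (ε / 2 / (C + 1)) ≤ ε / 2 := by
    rw [← mul_div_assoc, div_le_iff₀ (by linarith)]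
    nlinarith
  have h8 := mul_le_mul_of_nonneg_right h7 (inv_pos.2 hs0).le
  have h9 := abs_add_le (Lop gs f₁ z) (Lop gs f₂ z)
  linarith

theorem abs_Lop_le {k κ f : R3 → ℝ} (hd : 0 ≤ d) (hκ : Decays d κ) (hf : Measurable f)
    (hi : Integrable fun y => |f y| * (1 + ‖y‖) ^ (-d)) (h : ∀ w, |k w| ≤ κ w) {z : STime}
    (hz : 0 < z.1) : |Lop k f z| ≤ Lop κ (fun y => |f y|) z := by
  have hi' : Integrable fun y => |(|f y|)| * (1 + ‖y‖) ^ (-d) := by simpa using hi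
  refine (abs_integral_le_integral_abs).trans (integral_mono_of_nonneg
    (Eventually.of_forall fun _ => abs_nonneg _) (integrable_Lop hd hκ hf.abs hi' hz z.2)
    (Eventually.of_forall fun y => ?_))
  simp only [hker]
  rw [abs_mul, abs_mul, abs_of_nonneg (Real.rpow_nonneg hz.le _)]
  exact mul_le_mul_of_nonneg_right (mul_le_mul_of_nonneg_left (h _) (Real.rpow_nonneg hz.le _))
    (abs_nonneg _)

theorem decays_weight (d : ℝ) : Decays d fun z : R3 => (1 + ‖z‖) ^ (-d) := by
  refine ⟨?_, 1, fun z => ?_⟩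
  · exact Continuous.rpow_const (by fun_prop) fun z => Or.inl (by positivity)
  · rw [abs_of_nonneg (by positivity), one_mul]

theorem Decays.mono {k : R3 → ℝ} (hk : Decays d k) (hb : b ≤ d) : Decays b k := by
  obtain ⟨C, hC⟩ := hk.2
  have hC0 : 0 ≤ C := by simpa using (abs_nonneg _).trans (hC 0)
  exact ⟨hk.1, C, fun z => (hC z).trans
    (mul_le_mul_of_nonneg_left (one_add_norm_rpow_mono (by linarith) z) hC0)⟩

/-- `t e^{tΔ}ℙ θ₀` vanishes in the critical norms as `t → 0` for integrable `θ₀`. -/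
theorem small0_time_mul_Lop {k f : R3 → ℝ} (hk : Decays (5 / 2) k) (hf : MemLp f (1 : ℕ) volume)
    (hfm : Measurable f) : Small0 3 fun z => z.1 ^ (1 : ℝ) * Lop k f z := by
  obtain ⟨D, hD⟩ := hk.2
  have hD0 : 0 ≤ D := by simpa using (abs_nonneg _).trans (hD 0)
  set k1 : R3 → ℝ := fun z => (1 + ‖z‖) ^ (-(7 / 2) : ℝ) with hk1
  set k2 : R3 → ℝ := fun z => (1 + ‖z‖) ^ (-(9 / 4) : ℝ) with hk2
  have d1 : Decays (7 / 2) k1 := decays_weight _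
  have d2 : Decays (9 / 4) k2 := decays_weight _
  obtain ⟨C, hC0, hC⟩ := exists_Z_Lop_one_three (by norm_num : (1 : ℝ) < 5 / 2) 0 k hk
  obtain ⟨C1, hC10, hC1⟩ := exists_Z_Lop (by norm_num : (3 : ℝ) < 7 / 2) (by norm_num : 1 ≤ 3) 0 k1 d1
  obtain ⟨C2, hC20, hC2⟩ := exists_Z_Lop_one_three (by norm_num : (1 : ℝ) < 9 / 4) 0 k2 d2
  obtain ⟨A, hA0, hA⟩ : ∃ A : ℝ, 0 ≤ A ∧ eLpNorm f (1 : ℕ) volume ≤ ENNReal.ofReal (A ^ 3) := by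
    refine ⟨((eLpNorm f (1 : ℕ) volume).toReal) ^ (1 / 3 : ℝ), by positivity, ?_⟩
    rw [← Real.rpow_natCast, ← Real.rpow_mul ENNReal.toReal_nonneg]
    norm_num
    rw [ENNReal.ofReal_toReal (by simpa using hf.2.ne)]
  refine Small0.of_approx (by norm_num) fun ε hε => ?_
  obtain ⟨f₁, f₂, m1, m2, hsum, b1, b2, ⟨R, hR0, hR⟩, hs⟩ := exists_truncation hf hfm
    (div_pos (half_pos hε) (by linarith : 0 < C + 1))
  -- The weight of order 5/2 is not integrable, so the kernel is split as well as the data. Cutting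
  -- at 1 + ‖w‖ = L gives the bound L times the weight of order 7/2, which is integrable and acts on
  -- the bounded part as an `L³` function with a gain of t, plus L^(-1/4) times the weight of order
  -- 9/4, which maps `L¹` to `L³` with a small constant.
  obtain ⟨L, hL0, hL⟩ : ∃ L : ℝ, 1 ≤ L ∧ D * C2 * A ^ 3 * L ^ (-(1 / 4) : ℝ) ≤ ε / 2 := by
    have h1 : Tendsto (fun L : ℝ => D * C2 * A ^ 3 * L ^ (-(1 / 4) : ℝ)) atTop (𝓝 0) := by
      simpa using (tendsto_rpow_neg_atTop (by norm_num : (0 : ℝ) < 1 / 4)).const_mul (D * C2 * A ^ 3)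
    exact ((eventually_ge_atTop 1).and (h1.eventually_le_const (half_pos hε))).exists
  have hLp : 0 < L := by linarith
  have hi : ∀ d : ℝ, 0 ≤ d → Integrable fun y => |f y| * (1 + ‖y‖) ^ (-d) := fun d hd =>
    integrable_data_decay_one hd (memLp_one_iff_integrable.1 (by simpa using hf))
  have hi1 : ∀ d : ℝ, 0 ≤ d → Integrable fun y => |f₁ y| * (1 + ‖y‖) ^ (-d) := fun d hd =>
    integrable_data_mono m1 b1 (hi d hd)
  have n1 : eLpNorm (fun y => |f₁ y|) (1 : ℕ) volume ≤ ENNReal.ofReal (A ^ 3) :=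
    (eLpNorm_mono fun x => by rw [Real.norm_eq_abs, abs_abs]; exact b1 x).trans hA
  have n3 := eLpNorm_three_le (B := R ^ (1 / 3 : ℝ)) hA0 n1 fun x => by
    rw [abs_abs, ← Real.rpow_natCast, ← Real.rpow_mul hR0]
    norm_num
    exact hR x
  have z1 : ZBase 3 (-1) (|D * L| * (C1 * (A * (R ^ (1 / 3 : ℝ)) ^ 2))) fun z => z.1 ^ (1 : ℝ) * (D * L * Lop k1 (fun y => |f₁ y|) z) := by
    have := ((hC1 _ _ ⟨m1.abs, by positivity, n3⟩).base.const_mul (D * L)).rpow_mul 1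
    rwa [zero_sub] at this
  have z2 : ZBase 3 0 (|D * L ^ (-(1 / 4) : ℝ)| * (C2 * A ^ 3))
      fun z => z.1 ^ (1 : ℝ) * (D * L ^ (-(1 / 4) : ℝ) * Lop k2 (fun y => |f₁ y|) z) := by
    have := ((hC2 _ _ ⟨m1.abs, by positivity, n1⟩).base.const_mul
      (D * L ^ (-(1 / 4) : ℝ))).rpow_mul 1
    rwa [sub_self] at this
  have z3 : ZBase 3 0 (C * (ε / 2 / (C + 1))) fun z => |z.1 ^ (1 : ℝ) * Lop k f₂ z| := by
    have := ((hC f₂ _ ⟨m2, by positivity, hs⟩).base.rpow_mul 1).abs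
    rwa [sub_self] at this
  refine ⟨_, _, z1.meas, z1.small0 (by norm_num), (z2.add (by norm_num) z3).mono ?_, fun z hz => ?_⟩
  · have h1 : C * (ε / 2 / (C + 1)) ≤ ε / 2 := by
      rw [← mul_div_assoc, div_le_iff₀ (by linarith)]
      nlinarith
    rw [abs_of_nonneg (by positivity)]
    nlinarith
  · have e : f = fun y => f₁ y + f₂ y := funext hsum
    have hz1 : 0 ≤ z.1 ^ (1 : ℝ) := Real.rpow_nonneg hz.le _
    have h1 : Lop k f z = Lop k f₁ z + Lop k f₂ z := by
      conv_lhs => rw [e]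
      exact Lop_add_right (by norm_num : (0 : ℝ) ≤ 5 / 2) hk m1 m2 (hi1 _ (by norm_num))
        (integrable_data_mono m2 b2 (hi _ (by norm_num))) hz
    have dκ1 : Decays (9 / 4) fun w => D * L * k1 w := (d1.mono (by norm_num)).const_mul _
    have dκ2 : Decays (9 / 4) fun w => D * L ^ (-(1 / 4) : ℝ) * k2 w := d2.const_mul _
    have h2 := abs_Lop_le (by norm_num) (dκ1.add dκ2) m1 (hi1 _ (by norm_num)) (k := k) (fun w => by
      refine (hD w).trans ?_
      rw [mul_assoc, mul_assoc, ← mul_add]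
      refine mul_le_mul_of_nonneg_left ?_ hD0
      have hw : 0 < 1 + ‖w‖ := by positivity
      rcases le_total (1 + ‖w‖) L with hwL | hwL
      · have : (1 + ‖w‖) ^ (-(5 / 2) : ℝ) = (1 + ‖w‖) * (1 + ‖w‖) ^ (-(7 / 2) : ℝ) := by
          rw [show (-(5 / 2) : ℝ) = 1 + -(7 / 2) by norm_num, Real.rpow_add hw, Real.rpow_one]
        rw [this]
        have h3 : 0 ≤ (1 + ‖w‖) ^ (-(7 / 2) : ℝ) := by positivity
        have h4 : 0 ≤ L ^ (-(1 / 4) : ℝ) * k2 w := by positivity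
        have := mul_le_mul_of_nonneg_right hwL h3
        simp only [hk1]
        linarith
      · have : (1 + ‖w‖) ^ (-(5 / 2) : ℝ) = (1 + ‖w‖) ^ (-(1 / 4) : ℝ) * (1 + ‖w‖) ^ (-(9 / 4) : ℝ) := by
          rw [← Real.rpow_add hw]; norm_num
        rw [this]
        have h3 : 0 ≤ (1 + ‖w‖) ^ (-(9 / 4) : ℝ) := by positivity
        have h4 : 0 ≤ L * k1 w := by positivity
        have := mul_le_mul_of_nonneg_right
          (Real.rpow_le_rpow_of_nonpos hLp hwL (by norm_num : (-(1 / 4) : ℝ) ≤ 0)) h3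
        simp only [hk2]
        linarith) hz
    rw [Lop_add_left (by norm_num) dκ1 dκ2 m1.abs (by simpa using hi1 _ (by norm_num)) hz,
      Lop_const_mul_left, Lop_const_mul_left] at h2
    rw [h1, mul_add]
    have h3 : |z.1 ^ (1 : ℝ) * Lop k f₁ z| ≤ z.1 ^ (1 : ℝ) * (D * L * Lop k1 (fun y => |f₁ y|) z) +
        z.1 ^ (1 : ℝ) * (D * L ^ (-(1 / 4) : ℝ) * Lop k2 (fun y => |f₁ y|) z) := by
      rw [abs_mul, abs_of_nonneg hz1, ← mul_add]
      exact mul_le_mul_of_nonneg_left h2 hz1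
    refine (abs_add_le _ _).trans ((add_le_add h3 le_rfl).trans ?_)
    rw [add_assoc]
    exact add_le_add (le_abs_self _) (le_abs_self _)

end SmallTimes

/-! ### Attainment of the initial data. -/

section InitialTime

variable {K A M : ℝ} {n : ℕ} {L W : State}

/-- Before time `T` one factor has small sup norm, so the truncated product has a small bound at all
times. The cut destroys differentiability in time, so only the base norm is claimed. -/
theorem ZBase.cut {p : ℕ} {a : ℝ} {f g : STime → ℝ} {M ε T : ℝ} (hε : 0 ≤ ε) (hf : ZBase p a M f)
    (hg : Measurable g)
    (h : ∀ z : STime, 0 < z.1 → z.1 < T → |g z| ≤ ε * z.1 ^ (-(1 / 2) : ℝ)) :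
    ZBase p (a + 1 / 2) (M * ε) fun z => if z.1 < T then f z * g z else 0 where
  meas := Measurable.ite (measurableSet_lt measurable_fst measurable_const) (hf.meas.mul hg)
    measurable_const
  lp t ht := by
    have hM := hf.nonneg
    by_cases hT : t < T
    · simp only [hT, if_true]
      refine (eLpNorm_mul_le_of_bound (B := ε * t ^ (-(1 / 2) : ℝ)) (by positivity) (hf.lp t ht)
        fun x => h (t, x) ht hT).trans (ENNReal.ofReal_le_ofReal (le_of_eq ?_))
      rw [neg_add, Real.rpow_add ht]; ring
    · simp [hT]
  sup z hz := by
    have hM := hf.nonneg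
    by_cases hT : z.1 < T
    · simp only [hT, if_true]
      rw [abs_mul]
      refine (mul_le_mul (hf.sup z hz) (h z hz hT) (abs_nonneg _) (by positivity)).trans (le_of_eq ?_)
      rw [show -(a + 1 / 2) - 3 / (2 * (p : ℝ)) = (-a - 3 / (2 * p)) + -(1 / 2) by ring,
        Real.rpow_add hz]
      ring
    · simp only [hT, if_false, abs_zero]; positivity

/-- The Duhamel term before time `S` does not change when the fluxes are cut off at `S`, and the cut
fluxes are small because the velocity factor is below η t^(-1/2) there. -/
theorem small0_Quad (hW : Nrm 0 M W) (hV : ∀ i : Fin 3, Van (W (some i))) (j : Option (Fin 3)) :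
    Small0 (pe j) (Quad W j) := fun ε hε => by
  obtain ⟨K, hK0, hK⟩ := exists_Z_Duh 0
  have hM : 0 ≤ M := (hW none).base.nonneg
  set η := ε / (K * M + 1) with hη
  have hη0 : 0 < η := by positivity
  choose T hT0 hT using fun i => hV i η hη0
  set S := min (T 0) (min (T 1) (T 2)) with hS
  have hS0 : 0 < S := lt_min (hT0 0) (lt_min (hT0 1) (hT0 2))
  have hST : ∀ i, S ≤ T i := fun i => by
    fin_cases i
    · exact min_le_left _ _
    · exact (min_le_right _ _).trans (min_le_left _ _)
    · exact (min_le_right _ _).trans (min_le_right _ _)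
  have hcut : ∀ j k, Z (pe j) (1 / 2) 0 (M * η)
      (fun z => if z.1 < S then W j z * W (some k) z else 0) := fun j k => by
    have := ZBase.cut hη0.le (hW j).base (hW (some k)).base.meas fun z hz hzS =>
      hT k z hz (hzS.trans_le (hST k))
    rwa [zero_add] at this
  have hD := (hK _ _ hcut j).base
  have hle : K * (M * η) ≤ ε := by
    rw [hη, ← mul_assoc, ← mul_div_assoc, div_le_iff₀ (by positivity)]
    nlinarith
  refine ⟨S, hS0, fun t ht htS => ?_⟩
  have e : ∀ x, Quad W j (t, x) = Duh (fun j k z => if z.1 < S then W j z * W (some k) z else 0) j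
      (t, x) := fun x => Duh_congr_before ht (fun j k w _ hw => by
    rw [if_pos (hw.trans htS)]) j
  simp only [e]
  constructor
  · refine (hD.lp t ht).trans (ENNReal.ofReal_le_ofReal ?_)
    rw [neg_zero, Real.rpow_zero, mul_one]
    exact hle
  · exact fun x => (hD.sup (t, x) ht).trans
      (mul_le_mul_of_nonneg_right hle (Real.rpow_nonneg ht.le _))

theorem van_picard (h : SmallData n K A L) (hL : ∀ i : Fin 3, Van (L (some i))) (i : Fin 3) :
    ∀ m, Van (picard L m (some i)) := by
  intro m
  induction m generalizing i with
  | zero => exact hL i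
  | succ m ih =>
    exact (hL i).add (small0_Quad (fun j => (nrm_picard h m j).base) ih (some i)).van

/-- Each iterate has the property, and the iterates converge to the limit uniformly in time in the
scaled sup norm. -/
theorem van_picardLim (h : SmallData n K A L) (hL : ∀ i : Fin 3, Van (L (some i))) (i : Fin 3) :
    Van (picardLim L (some i)) := fun ε hε => by
  have hlim : Tendsto (fun m : ℕ => 4 * A * (1 / 2 : ℝ) ^ m) atTop (𝓝 0) := by
    simpa using (tendsto_pow_atTop_nhds_zero_of_lt_one (by norm_num : (0 : ℝ) ≤ 1 / 2)
      (by norm_num)).const_mul (4 * A)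
  obtain ⟨m, hm⟩ := (hlim.eventually_le_const (half_pos hε)).exists
  obtain ⟨T, hT, H⟩ := van_picard h hL i m (ε / 2) (half_pos hε)
  refine ⟨T, hT, fun z hz hzT => ?_⟩
  have h1 := (nrm_picardLim_sub h m (some i)).base.sup z hz
  have h2 := H z hz hzT
  have e : (-0 - 3 / (2 * (pe (some i) : ℝ)) : ℝ) = -(1 / 2) := by simp [pe]; norm_num
  rw [e] at h1
  have h3 := mul_le_mul_of_nonneg_right hm (Real.rpow_nonneg hz.le (-(1 / 2)))
  have h4 := abs_add_le (picardLim L (some i) z - picard L m (some i) z) (picard L m (some i) z)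
  rw [sub_add_cancel] at h4
  linarith

/-- The data terms of the integral system. -/
noncomputable def Dat (u₀ : Fin 3 → R3 → ℝ) (θ₀ : R3 → ℝ) : State
  | none => Lop gs θ₀
  -- The second term is ∫₀ᵗ e^{(t-s)Δ}ℙ(e^{sΔ}θ₀ e₃) ds, whose integrand does not depend on s; hence
  -- the factor t.
  | some i => fun z => Lop gs (u₀ i) z + z.1 ^ (1 : ℝ) * Lop (Ler 0 gs i 2) θ₀ z

/-- Initial data of size `A`. -/
structure InitData (A : ℝ) (u₀ : Fin 3 → R3 → ℝ) (θ₀ : R3 → ℝ) : Prop where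
  nonneg : 0 ≤ A
  meas_u : ∀ i, Measurable (u₀ i)
  meas_θ : Measurable θ₀
  norm_u : ∀ i, eLpNorm (u₀ i) (3 : ℕ) volume ≤ ENNReal.ofReal A
  norm_θ : eLpNorm θ₀ (1 : ℕ) volume ≤ ENNReal.ofReal A

variable {u₀ : Fin 3 → R3 → ℝ} {θ₀ : R3 → ℝ}

theorem InitData.memLp_u (h : InitData A u₀ θ₀) (i : Fin 3) : MemLp (u₀ i) (3 : ℕ) volume :=
  ⟨(h.meas_u i).aestronglyMeasurable, (h.norm_u i).trans_lt ENNReal.ofReal_lt_top⟩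

theorem InitData.memLp_θ (h : InitData A u₀ θ₀) : MemLp θ₀ (1 : ℕ) volume :=
  ⟨h.meas_θ.aestronglyMeasurable, h.norm_θ.trans_lt ENNReal.ofReal_lt_top⟩

theorem InitData.integrable_θ (h : InitData A u₀ θ₀) : Integrable θ₀ :=
  memLp_one_iff_integrable.1 (by simpa using h.memLp_θ)

theorem prof_Ler_zero (i j : Fin 3) (n : ℕ) : Prof (5 / 2) n (Ler 0 gs i j) :=
  prof_Ler (by norm_num) (by norm_num) GaussPoly.base n i j

theorem exists_Nrm_Dat (n : ℕ) : ∃ C, 0 ≤ C ∧ ∀ A u₀ θ₀, InitData A u₀ θ₀ →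
    Nrm n (C * A) (Dat u₀ θ₀) := by
  have h4 : (3 : ℝ) < 4 := by norm_num
  obtain ⟨C1, hC1, h1⟩ := exists_Z_Lop h4 le_rfl n gs (GaussPoly.base.prof 4 n)
  obtain ⟨C2, hC2, h2⟩ := exists_Z_Lop h4 (by norm_num : 1 ≤ 3) n gs (GaussPoly.base.prof 4 n)
  choose C3 hC3 h3 using fun i => exists_Z_Lop_one_three (by norm_num : (1 : ℝ) < 5 / 2) n _
    (prof_Ler_zero i 2 n)
  have hs : ∀ i, C3 i ≤ ∑ i, C3 i := fun i =>
    Finset.single_le_sum (fun i _ => hC3 i) (Finset.mem_univ i)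
  have hs0 : 0 ≤ ∑ i, C3 i := Finset.sum_nonneg fun i _ => hC3 i
  refine ⟨C1 + (C2 + 2 ^ n * ∑ i, C3 i), by positivity, fun A u₀ θ₀ h j => ?_⟩
  have hA := h.nonneg
  match j with
  | none =>
    refine (h1 θ₀ A ⟨h.meas_θ, hA, h.norm_θ⟩).mono ?_
    have : 0 ≤ (C2 + 2 ^ n * ∑ i, C3 i) * A := by positivity
    linarith
  | some i =>
    have a1 := h2 (u₀ i) A ⟨h.meas_u i, hA, h.norm_u i⟩
    have a2 := (h3 i θ₀ A ⟨h.meas_θ, hA, h.norm_θ⟩).rpow_mul (by norm_num) 1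
    rw [sub_self] at a2
    refine (a1.add (by norm_num) a2).mono ?_
    have e1 : (1 + |(1 : ℝ)|) = 2 := by norm_num
    have : 0 ≤ C1 * A := by positivity
    have h5 : (2 : ℝ) ^ n * (C3 i * A) ≤ 2 ^ n * ((∑ i, C3 i) * A) := by
      gcongr
      exact hs i
    rw [e1]
    linarith

theorem InitData.small0_force (h : InitData A u₀ θ₀) (i : Fin 3) :
    Small0 3 fun z => z.1 ^ (1 : ℝ) * Lop (Ler 0 gs i 2) θ₀ z :=
  small0_time_mul_Lop (prof_Ler_zero i 2 0) h.memLp_θ h.meas_θ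

theorem InitData.van_Dat (h : InitData A u₀ θ₀) (i : Fin 3) : Van (Dat u₀ θ₀ (some i)) :=
  (van_Lop_gs (h.memLp_u i) (h.meas_u i)).add (h.small0_force i).van

theorem Small0.tendsto {p : ℕ} {f : STime → ℝ} (h : Small0 p f) :
    Tendsto (fun t => eLpNorm (fun x => f (t, x)) p volume) (𝓝[>] 0) (𝓝 0) := by
  refine ENNReal.tendsto_nhds_zero.2 fun ε hε => ?_
  obtain ⟨r, hr0, hr⟩ := ENNReal.lt_iff_exists_real_btwn.1 hε
  have hr1 : 0 < r := ENNReal.ofReal_pos.1 hr.1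
  obtain ⟨T, hT, H⟩ := h r hr1
  filter_upwards [Ioo_mem_nhdsGT hT] with t ht
  exact (H t ht.1 ht.2).1.trans hr.2.le

/-- The initial values of the components. -/
def initVal (u₀ : Fin 3 → R3 → ℝ) (θ₀ : R3 → ℝ) : Option (Fin 3) → R3 → ℝ
  | none => θ₀
  | some i => u₀ i

/-- The linear evolution converges to the data by strong continuity, while the buoyancy of θ₀ and
the quadratic term vanish in the critical norm. -/
theorem tendsto_picardLim (hI : InitData A u₀ θ₀) {B : ℝ} (h : SmallData n K B (Dat u₀ θ₀))
    (j : Option (Fin 3)) :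
    Tendsto (fun t => eLpNorm (fun x => picardLim (Dat u₀ θ₀) j (t, x) - initVal u₀ θ₀ j x)
      (pe j) volume) (𝓝[>] 0) (𝓝 0) := by
  have hW := nrm_picardLim h
  have hQ := (small0_Quad (fun j => (hW j).base) (van_picardLim h hI.van_Dat) j).tendsto
  have hQm : Measurable (Quad (picardLim (Dat u₀ θ₀)) j) := ((h.bound.1 _ _ hW) j).base.meas
  have hD : Tendsto (fun t => eLpNorm (fun x => Dat u₀ θ₀ j (t, x) - initVal u₀ θ₀ j x)
      (pe j) volume) (𝓝[>] 0) (𝓝 0) := by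
    match j with
    | none => exact tendsto_Lop_gs le_rfl hI.memLp_θ hI.meas_θ
    | some i =>
      have h1 := tendsto_Lop_gs (by norm_num) (hI.memLp_u i) (hI.meas_u i)
      have h2 := (hI.small0_force i).tendsto
      have h3 := h1.add h2
      rw [add_zero] at h3
      refine tendsto_of_tendsto_of_tendsto_of_le_of_le tendsto_const_nhds h3
        (fun _ => zero_le) fun t => ?_
      have m1 : Measurable fun x => Lop gs (u₀ i) (t, x) - u₀ i x :=
        (measurable_slice (measurable_Lop contDiff_gs.continuous (hI.meas_u i)) t).sub (hI.meas_u i)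
      have m2 : Measurable fun x : R3 => (t, x).1 ^ (1 : ℝ) * Lop (Ler 0 gs i 2) θ₀ (t, x) :=
        (measurable_slice (measurable_Lop (prof_Ler_zero i 2 0).base.1 hI.meas_θ) t).const_mul (t ^ (1 : ℝ))
      refine le_trans (le_of_eq ?_)
        (eLpNorm_add_le m1.aestronglyMeasurable m2.aestronglyMeasurable (by norm_num))
      refine congrArg (fun f => eLpNorm f _ _) (funext fun x => ?_)
      simp only [Dat, initVal, Pi.add_apply]
      ring
  have h3 := hD.add hQ
  rw [add_zero] at h3
  refine tendsto_of_tendsto_of_tendsto_of_le_of_le' tendsto_const_nhds h3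
    (Eventually.of_forall fun _ => zero_le) ?_
  filter_upwards [self_mem_nhdsWithin] with t ht
  have m0 : Measurable (initVal u₀ θ₀ j) := by
    match j with
    | none => exact hI.meas_θ
    | some i => exact hI.meas_u i
  have m1 : Measurable fun x => Dat u₀ θ₀ j (t, x) - initVal u₀ θ₀ j x :=
    (measurable_slice (h.data j).base.meas t).sub m0
  refine le_trans (le_of_eq ?_) (eLpNorm_add_le m1.aestronglyMeasurable
    (measurable_slice hQm t).aestronglyMeasurable (by exact_mod_cast one_le_pe j))
  refine congrArg (fun f => eLpNorm f _ _) (funext fun x => ?_)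
  simp only [Pi.add_apply]
  rw [picardLim_eq h j (z := (t, x)) ht]
  ring

end InitialTime

/-! ### Weighted spaces with unspecified constants. -/

section Qualitative

variable {p n m : ℕ} {a b c : ℝ} {f g : STime → ℝ} {k : R3 → ℝ}

/-- Membership in a weighted space with some constant. -/
def ZE (p : ℕ) (a : ℝ) (n : ℕ) (f : STime → ℝ) : Prop := ∃ M, Z p a n M f

theorem ZE.of_le (hmn : m ≤ n) (h : ZE p a n f) : ZE p a m f := by
  obtain ⟨M, h⟩ := h; exact ⟨M, Z.of_le hmn h⟩

theorem ZE.add (hp : 1 ≤ p) (hf : ZE p a n f) (hg : ZE p a n g) : ZE p a n fun z => f z + g z := by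
  obtain ⟨M, hf⟩ := hf
  obtain ⟨N, hg⟩ := hg
  exact ⟨_, hf.add hp hg⟩

theorem ZE.sub (hp : 1 ≤ p) (hf : ZE p a n f) (hg : ZE p a n g) : ZE p a n fun z => f z - g z := by
  obtain ⟨M, hf⟩ := hf
  obtain ⟨N, hg⟩ := hg
  exact ⟨_, hf.sub hp hg⟩

theorem ZE.const_mul (c : ℝ) (hf : ZE p a n f) : ZE p a n fun z => c * f z := by
  obtain ⟨M, hf⟩ := hf
  exact ⟨_, hf.const_mul c⟩

theorem ZE.sum (hp : 1 ≤ p) {F : Fin 3 → STime → ℝ} (h : ∀ i, ZE p a n (F i)) :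
    ZE p a n fun z => ∑ i, F i z := by
  choose M hM using h
  exact ⟨_, Z.sum hp Finset.univ fun i _ => hM i⟩

theorem ZE.Hop (hp : 1 ≤ p) (h : ZE p a (n + 2) f) : ZE p a n (Hop f) := by
  obtain ⟨M, h⟩ := h; exact ⟨_, h.Hop hp⟩

theorem ZE.Dop (hp : 1 ≤ p) (hc : -1 < c) (ha : a < 1) (hk : Prof (7 / 2) n k) (hf : ZE p a n f) :
    ZE p (a - (c + 1)) n (Dop c k f) := by
  obtain ⟨M, hf⟩ := hf
  obtain ⟨C, -, hC⟩ := exists_Z_Dop (by norm_num : (3 : ℝ) < 7 / 2) hp hc ha n k hk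
  exact ⟨_, hC M f hf⟩

theorem ZE.one_to_three (h : ZE 1 a n f) : ZE 3 (a + 1) n f := by
  obtain ⟨M, h⟩ := h; exact ⟨M, h.one_to_three⟩

theorem ZE.rpow_mul (hp : 1 ≤ p) (c : ℝ) (h : ZE p a n f) : ZE p (a - c) n fun z => z.1 ^ c * f z := by
  obtain ⟨M, h⟩ := h; exact ⟨_, h.rpow_mul hp c⟩

theorem ZE.diff (h : ZE p a (n + 1) f) : ∀ z : STime, 0 < z.1 → DifferentiableAt ℝ f z := by
  obtain ⟨M, h⟩ := h; exact h.diff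

theorem ZE.X_add (hf : ZE p a 1 f) (hg : ZE p a 1 g) (j : Option (Fin 3)) :
    _root_.X j (fun z => f z + g z) = fun z => _root_.X j f z + _root_.X j g z :=
  _root_.X_add j hf.diff hg.diff

theorem ZE.X_sub (hf : ZE p a 1 f) (hg : ZE p a 1 g) (j : Option (Fin 3)) :
    _root_.X j (fun z => f z - g z) = fun z => _root_.X j f z - _root_.X j g z := by
  obtain ⟨M, hf⟩ := hf
  obtain ⟨N, hg⟩ := hg
  exact X_some_sub hf hg j

theorem ZE.X_sum {F : Fin 3 → STime → ℝ} (h : ∀ i, ZE p a 1 (F i)) (j : Option (Fin 3)) :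
    _root_.X j (fun z => ∑ i, F i z) = fun z => ∑ i, _root_.X j (F i) z := by
  simp only [Fin.sum_univ_three]
  rw [_root_.X_add (f := fun z => F 0 z + F 1 z) j
    (fun z hz => ((h 0).diff z hz).add ((h 1).diff z hz)) (h 2).diff, ZE.X_add (h 0) (h 1)]

theorem ZE.Hop_add (hf : ZE p a 2 f) (hg : ZE p a 2 g) :
    _root_.Hop (fun z => f z + g z) = fun z => _root_.Hop f z + _root_.Hop g z := by
  obtain ⟨M, hf⟩ := hf
  obtain ⟨N, hg⟩ := hg
  exact _root_.Hop_add hf hg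

theorem ZE.Hop_sub (hf : ZE p a 2 f) (hg : ZE p a 2 g) :
    _root_.Hop (fun z => f z - g z) = fun z => _root_.Hop f z - _root_.Hop g z := by
  have e : (fun z => f z - g z) = fun z => f z + -1 * g z := by funext z; ring
  rw [e, ZE.Hop_add hf (hg.const_mul (-1)), Hop_const_mul]
  funext z; ring

theorem ZE.Hop_sum (hp : 1 ≤ p) {F : Fin 3 → STime → ℝ} (h : ∀ i, ZE p a 2 (F i)) :
    _root_.Hop (fun z => ∑ i, F i z) = fun z => ∑ i, _root_.Hop (F i) z := by
  simp only [Fin.sum_univ_three]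
  rw [ZE.Hop_add (f := fun z => F 0 z + F 1 z) ((h 0).add hp (h 1)) (h 2), ZE.Hop_add (h 0) (h 1)]

end Qualitative

/-! ### Velocity generated by buoyancy and fluxes: curl, divergence, heat operator. -/

section Forcing

variable {n : ℕ} {o : Fin 3 → R3 → ℝ} {κ : Fin 3 → Fin 3 → Fin 3 → R3 → ℝ} {θ₀ : R3 → ℝ}
  {Φ : Option (Fin 3) → Fin 3 → STime → ℝ}

/-- The velocity generated by the buoyancy of `θ₀` and the fluxes `Φ` through given kernels. -/
noncomputable def Force (o : Fin 3 → R3 → ℝ) (κ : Fin 3 → Fin 3 → Fin 3 → R3 → ℝ) (θ₀ : R3 → ℝ)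
    (Φ : Option (Fin 3) → Fin 3 → STime → ℝ) (i : Fin 3) (z : STime) : ℝ :=
  z.1 ^ (1 : ℝ) * Lop (o i) θ₀ z - (∑ j, ∑ k, Dop (-(1 / 2)) (κ k i j) (Φ (some j) k) z +
    ∑ k, Dop (1 / 2) (κ k i 2) (Φ none k) z)

/-- Standing assumptions on the sources of `Force`. -/
structure ForceData (θ₀ : R3 → ℝ) (Φ : Option (Fin 3) → Fin 3 → STime → ℝ) : Prop where
  meas : Measurable θ₀
  int : Integrable θ₀
  flux : ∀ j k, ZE (pe j) (1 / 2) 3 (Φ j k)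

variable (h : ForceData θ₀ Φ) (hn : n ≤ 3)

theorem ForceData.decay (h : ForceData θ₀ Φ) : Integrable fun y => |θ₀ y| * (1 + ‖y‖) ^ (-(5 / 2) : ℝ) :=
  integrable_data_decay_one (by norm_num) h.int

theorem ForceData.ZE_Lop (h : ForceData θ₀ Φ) {k : R3 → ℝ} (hk : Prof (5 / 2) n k) :
    ZE 3 0 n fun z => z.1 ^ (1 : ℝ) * Lop k θ₀ z := by
  obtain ⟨C, -, hC⟩ := exists_Z_Lop_one_three (by norm_num : (1 : ℝ) < 5 / 2) n k hk
  have h1 := hC θ₀ (eLpNorm θ₀ (1 : ℕ) volume).toReal ⟨h.meas, ENNReal.toReal_nonneg, by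
    rw [ENNReal.ofReal_toReal]
    simpa using (memLp_one_iff_integrable.2 h.int).2.ne⟩
  have h2 := ZE.rpow_mul (by norm_num) 1 ⟨_, h1⟩
  rwa [sub_self] at h2

theorem ForceData.ZE_vel (h : ForceData θ₀ Φ) (hn : n ≤ 3) {k : R3 → ℝ} (hk : Prof (7 / 2) n k)
    (j k' : Fin 3) : ZE 3 0 n (Dop (-(1 / 2)) k (Φ (some j) k')) := by
  have h1 := ZE.Dop (c := -(1 / 2)) (one_le_pe _) (by norm_num) (by norm_num) hk
    ((h.flux (some j) k').of_le hn)
  norm_num at h1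
  norm_num
  exact h1

theorem ForceData.ZE_temp (h : ForceData θ₀ Φ) (hn : n ≤ 3) {k : R3 → ℝ} (hk : Prof (7 / 2) n k)
    (k' : Fin 3) : ZE 3 0 n (Dop (1 / 2) k (Φ none k')) := by
  have h1 := (ZE.Dop (c := 1 / 2) le_rfl (by norm_num) (by norm_num) hk
    ((h.flux none k').of_le hn)).one_to_three
  norm_num at h1
  norm_num
  exact h1

theorem ForceData.ZE_sum (h : ForceData θ₀ Φ) (hn : n ≤ 3) (hκ : ∀ k i j, Prof (7 / 2) n (κ k i j))
    (i : Fin 3) : ZE 3 0 n fun z => ∑ j, ∑ k, Dop (-(1 / 2)) (κ k i j) (Φ (some j) k) z +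
      ∑ k, Dop (1 / 2) (κ k i 2) (Φ none k) z := by
  have h3 : 1 ≤ 3 := by norm_num
  exact (ZE.sum h3 fun j => ZE.sum h3 fun k => h.ZE_vel hn (hκ k i j) j k).add h3
    (ZE.sum h3 fun k => h.ZE_temp hn (hκ k i 2) k)

theorem ForceData.ZE_Force (h : ForceData θ₀ Φ) (hn : n ≤ 3) (ho : ∀ i, Prof (5 / 2) n (o i))
    (hκ : ∀ k i j, Prof (7 / 2) n (κ k i j)) (i : Fin 3) : ZE 3 0 n (Force o κ θ₀ Φ i) :=
  (h.ZE_Lop (ho i)).sub (by norm_num) (h.ZE_sum hn hκ i)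

theorem ForceData.X_Force (h : ForceData θ₀ Φ) (ho : ∀ i, Prof (5 / 2) 1 (o i))
    (hκ : ∀ k i j, Prof (7 / 2) 1 (κ k i j)) (l i : Fin 3) (z : STime) :
    X (some l) (Force o κ θ₀ Φ i) z = z.1 ^ (1 : ℝ) * X (some l) (Lop (o i) θ₀) z -
      (∑ j, ∑ k, X (some l) (Dop (-(1 / 2)) (κ k i j) (Φ (some j) k)) z +
        ∑ k, X (some l) (Dop (1 / 2) (κ k i 2) (Φ none k)) z) := by
  have h3 : 1 ≤ 3 := by norm_num
  have a1 := fun j k => h.ZE_vel (n := 1) (by norm_num) (hκ k i j) j k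
  have a2 := fun k => h.ZE_temp (n := 1) (by norm_num) (hκ k i 2) k
  have b : Force o κ θ₀ Φ i = fun z => z.1 ^ (1 : ℝ) * Lop (o i) θ₀ z -
    (∑ j, ∑ k, Dop (-(1 / 2)) (κ k i j) (Φ (some j) k) z +
    ∑ k, Dop (1 / 2) (κ k i 2) (Φ none k) z) := rfl
  rw [b, ZE.X_sub (h.ZE_Lop (ho i)) (h.ZE_sum (by norm_num) hκ i),
    ZE.X_add (ZE.sum h3 fun j => ZE.sum h3 fun k => a1 j k) (ZE.sum h3 a2),
    ZE.X_sum (fun j => ZE.sum h3 fun k => a1 j k), ZE.X_sum a2]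
  simp_rw [fun j => ZE.X_sum (a1 j) (some l)]
  rw [X_some_rpow_mul 1 l fun z hz =>
    (hasFDerivAt_Lop (by norm_num) (ho i) h.meas h.decay hz).differentiableAt]

theorem ForceData.Hop_Force (h : ForceData θ₀ Φ) (ho : ∀ i, Prof (5 / 2) 2 (o i))
    (hκ : ∀ k i j, Prof (7 / 2) 2 (κ k i j)) (i : Fin 3) (z : STime) :
    Hop (Force o κ θ₀ Φ i) z = Hop (fun z => z.1 ^ (1 : ℝ) * Lop (o i) θ₀ z) z -
      (∑ j, ∑ k, Hop (Dop (-(1 / 2)) (κ k i j) (Φ (some j) k)) z +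
        ∑ k, Hop (Dop (1 / 2) (κ k i 2) (Φ none k)) z) := by
  have h3 : 1 ≤ 3 := by norm_num
  have a1 := fun j k => h.ZE_vel (n := 2) (by norm_num) (hκ k i j) j k
  have a2 := fun k => h.ZE_temp (n := 2) (by norm_num) (hκ k i 2) k
  have b : Force o κ θ₀ Φ i = fun z => z.1 ^ (1 : ℝ) * Lop (o i) θ₀ z -
    (∑ j, ∑ k, Dop (-(1 / 2)) (κ k i j) (Φ (some j) k) z +
    ∑ k, Dop (1 / 2) (κ k i 2) (Φ none k) z) := rfl
  rw [b, ZE.Hop_sub (h.ZE_Lop (ho i)) (h.ZE_sum (by norm_num) hκ i),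
    ZE.Hop_add (ZE.sum h3 fun j => ZE.sum h3 fun k => a1 j k) (ZE.sum h3 a2),
    ZE.Hop_sum h3 (fun j => ZE.sum h3 fun k => a1 j k), ZE.Hop_sum h3 a2]
  simp_rw [fun j => ZE.Hop_sum h3 (a1 j)]

/-- Stated for general kernels and used for the gradient parts, whose curl-freeness is inherited
term by term. -/
theorem ForceData.X_Force_comm (h : ForceData θ₀ Φ) (ho : ∀ i, Prof (5 / 2) 1 (o i))
    (hκ : ∀ k i j, Prof (7 / 2) 1 (κ k i j)) (hoc : ∀ i l, pd l (o i) = pd i (o l))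
    (hκc : ∀ k i j l, pd l (κ k i j) = pd i (κ k l j)) (i l : Fin 3) {z : STime} (hz : 0 < z.1) :
    X (some l) (Force o κ θ₀ Φ i) z = X (some i) (Force o κ θ₀ Φ l) z := by
  have h72 : (3 : ℝ) < 7 / 2 := by norm_num
  rw [h.X_Force ho hκ, h.X_Force ho hκ,
    X_some_Lop_comm (by norm_num) (ho i) (ho l) h.meas h.decay (hoc i l) hz]
  congr 2
  · refine Finset.sum_congr rfl fun j _ => Finset.sum_congr rfl fun k _ => ?_
    obtain ⟨M, hM⟩ := (h.flux (some j) k).of_le (by norm_num : 1 ≤ 3)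
    exact X_some_Dop_comm h72 (one_le_pe _) (by norm_num) (by norm_num) (hκ k i j) (hκ k l j) hM
      (hκc k i j l) hz
  · refine Finset.sum_congr rfl fun k _ => ?_
    obtain ⟨M, hM⟩ := (h.flux none k).of_le (by norm_num : 1 ≤ 3)
    exact X_some_Dop_comm h72 (one_le_pe _) (by norm_num) (by norm_num) (hκ k i 2) (hκ k l 2) hM
      (hκc k i 2 l) hz

/-- Used for the full Leray kernels, whose divergence vanishes; the velocity is then divergence-free
by construction. -/
theorem ForceData.sum_X_Force (h : ForceData θ₀ Φ) (ho : ∀ i, Prof (5 / 2) 1 (o i))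
    (hκ : ∀ k i j, Prof (7 / 2) 1 (κ k i j)) (hod : ∀ w, ∑ i, pd i (o i) w = 0)
    (hκd : ∀ k j w, ∑ i, pd i (κ k i j) w = 0) {z : STime} (hz : 0 < z.1) :
    ∑ i, X (some i) (Force o κ θ₀ Φ i) z = 0 := by
  have h72 : (3 : ℝ) < 7 / 2 := by norm_num
  simp_rw [fun i => h.X_Force ho hκ i i z]
  rw [Finset.sum_sub_distrib, ← Finset.mul_sum,
    sum_X_some_Lop (by norm_num) ho hod h.meas h.decay hz, Finset.sum_add_distrib,
    Finset.sum_comm, Finset.sum_comm (f := fun i k => X (some i) (Dop (1 / 2) (κ k i 2) (Φ none k)) z)]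
  have e1 : ∀ j, ∑ i, ∑ k, X (some i) (Dop (-(1 / 2)) (κ k i j) (Φ (some j) k)) z = 0 := fun j => by
    rw [Finset.sum_comm]
    refine Finset.sum_eq_zero fun k _ => ?_
    obtain ⟨M, hM⟩ := (h.flux (some j) k).of_le (by norm_num : 1 ≤ 3)
    exact sum_X_some_Dop h72 (one_le_pe _) (by norm_num) (by norm_num) (fun i => hκ k i j)
      (hκd k j) hM hz
  have e2 : ∀ k, ∑ i, X (some i) (Dop (1 / 2) (κ k i 2) (Φ none k)) z = 0 := fun k => by
    obtain ⟨M, hM⟩ := (h.flux none k).of_le (by norm_num : 1 ≤ 3)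
    exact sum_X_some_Dop h72 (one_le_pe _) (by norm_num) (by norm_num) (fun i => hκ k i 2)
      (hκd k 2) hM hz
  rw [Finset.sum_eq_zero fun j _ => e1 j, Finset.sum_eq_zero fun k _ => e2 k]
  simp

/-- The multiples `δᵢⱼ q` of a profile. -/
noncomputable def diagProf (q : R3 → ℝ) (i j : Fin 3) (z : R3) : ℝ := (if i = j then 1 else 0) * q z

/-- The Leray projection is the identity plus a gradient. The identity part carries the nonlinearity
and the buoyancy, and the gradient part carries only the pressure. -/
theorem ForceData.Force_split (h : ForceData θ₀ Φ) (i : Fin 3) {z : STime} (hz : 0 < z.1) :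
    Force (fun i => Ler 0 gs i 2) (fun k => Ler 1 (pd k gs)) θ₀ Φ i z =
      Force (fun i => diagProf gs i 2) (fun k => diagProf (pd k gs)) θ₀ Φ i z +
      Force (fun i => Rie 0 gs i 2) (fun k => Rie 1 (pd k gs)) θ₀ Φ i z := by
  have h72 : (3 : ℝ) < 7 / 2 := by norm_num
  have d1 : ∀ k i j, Decays (7 / 2) (diagProf (pd k gs) i j) := fun k i j =>
    ((gaussPoly_pd_gs k).decays _).const_mul _
  have d2 : ∀ k i j, Decays (7 / 2) (Rie 1 (pd k gs) i j) := fun k i j =>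
    prof_Rie (by norm_num) (by norm_num) (gaussPoly_pd_gs k) 0 i j
  have e1 : Lop (Ler 0 gs i 2) θ₀ z = Lop (diagProf gs i 2) θ₀ z + Lop (Rie 0 gs i 2) θ₀ z :=
    Lop_add_left (by norm_num) ((GaussPoly.base.decays _).const_mul _)
      (prof_Rie (by norm_num) (by norm_num) GaussPoly.base 0 i 2 : Decays (5 / 2) _) h.meas h.decay hz
  have e2 : ∀ c : ℝ, -1 < c → ∀ i j k jj, Dop c (Ler 1 (pd k gs) i j) (Φ jj k) z =
      Dop c (diagProf (pd k gs) i j) (Φ jj k) z + Dop c (Rie 1 (pd k gs) i j) (Φ jj k) z :=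
    fun c hc i j k jj => by
      obtain ⟨M, hM⟩ := h.flux jj k
      exact Dop_add_left h72 (one_le_pe _) hc (by norm_num) (d1 k i j) (d2 k i j) hM.base hz
  simp only [Force]
  rw [e1]
  simp_rw [e2 (-(1 / 2)) (by norm_num), e2 (1 / 2) (by norm_num), Finset.sum_add_distrib]
  ring

theorem Dop_diagProf (c : ℝ) (q : R3 → ℝ) (i j : Fin 3) (f : STime → ℝ) :
    Dop c (diagProf q i j) f = fun z => (if i = j then 1 else 0) * Dop c q f z :=
  funext fun z => Dop_const_mul_left _ q f z

/-- The vertical component receives t times the temperature, whose Duhamel formula reappears here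
because (∂ₜ - Δ) removes one factor t - s; the remaining term is the divergence of the momentum
flux. -/
theorem ForceData.Hop_diag (h : ForceData θ₀ Φ) (i : Fin 3) {z : STime} (hz : 0 < z.1) :
    Hop (Force (fun i => diagProf gs i 2) (fun k => diagProf (pd k gs)) θ₀ Φ i) z =
      (if i = 2 then 1 else 0) * (z.1 *
        (Lop gs θ₀ z - ∑ k, Dop (-(1 / 2)) (pd k gs) (Φ none k) z)) -
      √z.1 * ∑ k, X (some k) (Φ (some i) k) z := by
  rw [h.Hop_Force (o := fun i => diagProf gs i 2) (κ := fun k => diagProf (pd k gs))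
    (fun i => (GaussPoly.base.prof _ 2).const_mul _)
    fun k i j => ((gaussPoly_pd_gs k).prof _ 2).const_mul _]
  have e0 : (fun z : STime => z.1 ^ (1 : ℝ) * Lop (diagProf gs i 2) θ₀ z) =
      fun z => (if i = 2 then 1 else 0) * (z.1 ^ (1 : ℝ) * Lop gs θ₀ z) := by
    funext z
    have e : Lop (diagProf gs i 2) θ₀ z = _ := Lop_const_mul_left (if i = 2 then 1 else 0) gs θ₀ z
    rw [e]; ring
  obtain ⟨C, -, hC⟩ := exists_Z_Lop (by norm_num : (3 : ℝ) < 4) le_rfl 2 gs (GaussPoly.base.prof 4 2)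
  have h1 := hC θ₀ (eLpNorm θ₀ (1 : ℕ) volume).toReal ⟨h.meas, ENNReal.toReal_nonneg, by
    rw [ENNReal.ofReal_toReal]
    simpa using (memLp_one_iff_integrable.2 h.int).2.ne⟩
  rw [e0, Hop_const_mul]
  simp only [Hop_rpow_mul 1 h1 hz, Hop_Lop_gs (by norm_num) h.meas h.decay hz, Dop_diagProf,
    Hop_const_mul]
  have e1 : ∀ j k, Hop (Dop (-(1 / 2)) (pd k gs) (Φ (some j) k)) z =
      √z.1 * X (some k) (Φ (some j) k) z := fun j k => by
    obtain ⟨M, hM⟩ := (h.flux (some j) k).of_le (by norm_num : 2 ≤ 3)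
    exact Hop_Dop_neg_half (one_le_pe _) (by norm_num) hM k hz
  have e2 : ∀ k, Hop (Dop (1 / 2) (pd k gs) (Φ none k)) z =
      z.1 * Dop (-(1 / 2)) (pd k gs) (Φ none k) z := fun k => by
    obtain ⟨M, hM⟩ := (h.flux none k).of_le (by norm_num : 2 ≤ 3)
    exact Hop_Dop_half (one_le_pe _) (by norm_num) hM k hz
  simp_rw [e1, e2, ← Finset.mul_sum]
  by_cases hi : i = 2
  · simp [hi, Real.rpow_one]; ring
  · simp [hi]

end Forcing

/-! ### The equations in scaled form. -/

section ScaledEquations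

variable {A B K : ℝ} {u₀ : Fin 3 → R3 → ℝ} {θ₀ : R3 → ℝ}

/-- The fluxes `u_k u_j` and `u_k θ`. -/
def fluxOf (W : State) (j : Option (Fin 3)) (k : Fin 3) (z : STime) : ℝ := W j z * W (some k) z

/-- The solution of the integral system with data `(u₀, θ₀)`. -/
noncomputable def sol (u₀ : Fin 3 → R3 → ℝ) (θ₀ : R3 → ℝ) : State := picardLim (Dat u₀ θ₀)

/-- Small divergence-free initial data. -/
structure GoodData (K A B : ℝ) (u₀ : Fin 3 → R3 → ℝ) (θ₀ : R3 → ℝ) : Prop where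
  init : InitData A u₀ θ₀
  small : SmallData 3 K B (Dat u₀ θ₀)
  div : ∀ z : STime, 0 < z.1 → ∑ i, X (some i) (Lop gs (u₀ i)) z = 0

theorem GoodData.nrm (h : GoodData K A B u₀ θ₀) : Nrm 3 (4 * B) (sol u₀ θ₀) := nrm_picardLim h.small

theorem GoodData.forceData (h : GoodData K A B u₀ θ₀) : ForceData θ₀ (fluxOf (sol u₀ θ₀)) where
  meas := h.init.meas_θ
  int := h.init.integrable_θ
  flux j k := ⟨_, h.nrm.flux h.nrm j k⟩

theorem GoodData.vel_eq (h : GoodData K A B u₀ θ₀) (i : Fin 3) {z : STime} (hz : 0 < z.1) :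
    sol u₀ θ₀ (some i) z = Lop gs (u₀ i) z +
      Force (fun i => Ler 0 gs i 2) (fun k => Ler 1 (pd k gs)) θ₀ (fluxOf (sol u₀ θ₀)) i z := by
  refine (picardLim_eq h.small (some i) hz).trans ?_
  show Lop gs (u₀ i) z + z.1 ^ (1 : ℝ) * Lop (Ler 0 gs i 2) θ₀ z +
    -(∑ j, ∑ k, Dop (-(1 / 2)) (Ler 1 (pd k gs) i j) (fluxOf (sol u₀ θ₀) (some j) k) z +
      ∑ k, Dop (1 / 2) (Ler 1 (pd k gs) i 2) (fluxOf (sol u₀ θ₀) none k) z) = _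
  rw [Force]
  ring

theorem GoodData.temp_eq (h : GoodData K A B u₀ θ₀) {z : STime} (hz : 0 < z.1) :
    sol u₀ θ₀ none z = Lop gs θ₀ z -
      ∑ k, Dop (-(1 / 2)) (pd k gs) (fluxOf (sol u₀ θ₀) none k) z := by
  rw [sol, picardLim_eq h.small none hz]
  rfl

theorem GoodData.ZE_Lop (h : GoodData K A B u₀ θ₀) (n : ℕ) (i : Fin 3) : ZE 3 0 n (Lop gs (u₀ i)) := by
  obtain ⟨C, -, hC⟩ := exists_Z_Lop (by norm_num : (3 : ℝ) < 4) (by norm_num : 1 ≤ 3) n gs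
    (GaussPoly.base.prof 4 n)
  exact ⟨_, hC _ _ ⟨h.init.meas_u i, h.init.nonneg, h.init.norm_u i⟩⟩

theorem GoodData.ZE_Lop_temp (h : GoodData K A B u₀ θ₀) (n : ℕ) : ZE 1 0 n (Lop gs θ₀) := by
  obtain ⟨C, -, hC⟩ := exists_Z_Lop (by norm_num : (3 : ℝ) < 4) le_rfl n gs (GaussPoly.base.prof 4 n)
  exact ⟨_, hC _ _ ⟨h.init.meas_θ, h.init.nonneg, h.init.norm_θ⟩⟩

theorem GoodData.diff (h : GoodData K A B u₀ θ₀) (j : Option (Fin 3)) :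
    ∀ z : STime, 0 < z.1 → DifferentiableAt ℝ (sol u₀ θ₀ j) z := (h.nrm j).diff

/-- The evolved data are divergence-free by assumption, and the remaining terms have divergence-free
kernels. -/
theorem GoodData.vel_div (h : GoodData K A B u₀ θ₀) {z : STime} (hz : 0 < z.1) :
    ∑ i, X (some i) (sol u₀ θ₀ (some i)) z = 0 := by
  have ho : ∀ i, Prof (5 / 2) 1 (Ler 0 gs i 2) := fun i => prof_Ler_zero i 2 1
  have hκ : ∀ k i j, Prof (7 / 2) 1 (Ler 1 (pd k gs) i j) := fun k i j => prof_Ler_one k i j 1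
  have e : ∀ i, X (some i) (sol u₀ θ₀ (some i)) z = X (some i) (Lop gs (u₀ i)) z +
      X (some i) (Force (fun i => Ler 0 gs i 2) (fun k => Ler 1 (pd k gs)) θ₀
        (fluxOf (sol u₀ θ₀)) i) z := fun i => by
    rw [X_congr (some i) fun z hz => h.vel_eq i hz,
      ZE.X_add (h.ZE_Lop 1 i) (h.forceData.ZE_Force (by norm_num) ho hκ i)]
  simp_rw [e]
  rw [Finset.sum_add_distrib, h.div z hz, zero_add]
  exact h.forceData.sum_X_Force ho hκ
    (fun w => sum_pd_Ler le_rfl GaussPoly.base heatProf_gs 2 w)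
    (fun k j w => sum_pd_Ler zero_le_one (gaussPoly_pd_gs k) (heatProf_pd_gs k) j w) hz

/-- Incompressibility turns the divergence of the flux into the transport term. -/
theorem GoodData.sum_X_flux (h : GoodData K A B u₀ θ₀) (j : Option (Fin 3)) {z : STime}
    (hz : 0 < z.1) : ∑ k, X (some k) (fluxOf (sol u₀ θ₀) j k) z =
      ∑ k, sol u₀ θ₀ (some k) z * X (some k) (sol u₀ θ₀ j) z := by
  have e : ∀ k, X (some k) (fluxOf (sol u₀ θ₀) j k) z =
      sol u₀ θ₀ (some k) z * X (some k) (sol u₀ θ₀ j) z +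
        sol u₀ θ₀ j z * X (some k) (sol u₀ θ₀ (some k)) z := fun k => by
    have e1 : fluxOf (sol u₀ θ₀) j k = fun z => sol u₀ θ₀ j z * sol u₀ θ₀ (some k) z := rfl
    rw [e1, X_mul (some k) (h.diff j) (h.diff (some k))]
    ring
  simp_rw [e]
  rw [Finset.sum_add_distrib, ← Finset.mul_sum, h.vel_div hz, mul_zero, add_zero]

theorem GoodData.heat_temp (h : GoodData K A B u₀ θ₀) {z : STime} (hz : 0 < z.1) :
    Hop (sol u₀ θ₀ none) z =
      -(√z.1 * ∑ k, sol u₀ θ₀ (some k) z * X (some k) (sol u₀ θ₀ none) z) := by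
  have a : ∀ k, ZE 1 0 2 (Dop (-(1 / 2)) (pd k gs) (fluxOf (sol u₀ θ₀) none k)) := fun k => by
    have := ZE.Dop (c := -(1 / 2)) (one_le_pe none) (by norm_num) (by norm_num) (prof_pd_gs k 2)
      ((h.forceData.flux none k).of_le (by norm_num))
    norm_num at this
    norm_num
    exact this
  rw [Hop_congr fun z hz => h.temp_eq hz, ZE.Hop_sub (h.ZE_Lop_temp 2) (ZE.sum le_rfl a),
    ZE.Hop_sum le_rfl a]
  have e : ∀ k, Hop (Dop (-(1 / 2)) (pd k gs) (fluxOf (sol u₀ θ₀) none k)) z =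
      √z.1 * X (some k) (fluxOf (sol u₀ θ₀) none k) z := fun k => by
    obtain ⟨M, hM⟩ := (h.forceData.flux none k).of_le (by norm_num : 2 ≤ 3)
    exact Hop_Dop_neg_half (one_le_pe _) (by norm_num) hM k hz
  simp only [e]
  rw [← Finset.mul_sum, h.sum_X_flux none hz,
    Hop_Lop_gs (by norm_num) h.init.meas_θ h.forceData.decay hz, zero_sub]

/-- The scaled pressure gradient (up to the sign). -/
noncomputable def presGrad (u₀ : Fin 3 → R3 → ℝ) (θ₀ : R3 → ℝ) (i : Fin 3) : STime → ℝ :=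
  Hop (Force (fun i => Rie 0 gs i 2) (fun k => Rie 1 (pd k gs)) θ₀ (fluxOf (sol u₀ θ₀)) i)

theorem prof_Rie_zero (i : Fin 3) (n : ℕ) : Prof (5 / 2) n (Rie 0 gs i 2) :=
  prof_Rie (by norm_num) (by norm_num) GaussPoly.base n i 2

theorem prof_Rie_one (k i j : Fin 3) (n : ℕ) : Prof (7 / 2) n (Rie 1 (pd k gs) i j) :=
  prof_Rie (by norm_num) (by norm_num) (gaussPoly_pd_gs k) n i j

theorem GoodData.ZE_presGrad (h : GoodData K A B u₀ θ₀) (i : Fin 3) : ZE 3 0 1 (presGrad u₀ θ₀ i) :=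
  (h.forceData.ZE_Force (n := 3) le_rfl (fun i => prof_Rie_zero i 3)
    (fun k i j => prof_Rie_one k i j 3) i).Hop (by norm_num)

/-- The gradient kernels are curl-free, the velocity they generate is therefore curl-free, and the
heat operator preserves this. It takes three derivatives, which is why the norm has order 3. -/
theorem GoodData.presGrad_curl (h : GoodData K A B u₀ θ₀) (i l : Fin 3) :
    X (some l) (presGrad u₀ θ₀ i) = X (some i) (presGrad u₀ θ₀ l) := by
  have a := fun i => h.forceData.ZE_Force (n := 3) le_rfl (fun i => prof_Rie_zero i 3)
    (fun k i j => prof_Rie_one k i j 3) i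
  obtain ⟨M, hM⟩ := a i
  obtain ⟨N, hN⟩ := a l
  refine X_some_Hop_comm (by norm_num) hM hN fun z hz => ?_
  exact h.forceData.X_Force_comm (fun i => prof_Rie_zero i 1) (fun k i j => prof_Rie_one k i j 1)
    (fun i l => pd_Rie_comm le_rfl GaussPoly.base i 2 l)
    (fun k i j l => pd_Rie_comm zero_le_one (gaussPoly_pd_gs k) i j l) i l hz

/-- The heat operator kills the evolved data, is computed exactly on the diagonal kernels, and
defines the pressure term on the gradient kernels. -/
theorem GoodData.heat_vel (h : GoodData K A B u₀ θ₀) (i : Fin 3) {z : STime} (hz : 0 < z.1) :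
    Hop (sol u₀ θ₀ (some i)) z = presGrad u₀ θ₀ i z +
      (if i = 2 then 1 else 0) * (z.1 * sol u₀ θ₀ none z) -
      √z.1 * ∑ k, sol u₀ θ₀ (some k) z * X (some k) (sol u₀ θ₀ (some i)) z := by
  have a1 := h.forceData.ZE_Force (n := 2) (o := fun i => diagProf gs i 2)
    (κ := fun k => diagProf (pd k gs)) (by norm_num)
    (fun i => (GaussPoly.base.prof _ 2).const_mul _)
    (fun k i j => ((gaussPoly_pd_gs k).prof _ 2).const_mul _) i
  have a2 := h.forceData.ZE_Force (n := 2) (by norm_num) (fun i => prof_Rie_zero i 2)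
    (fun k i j => prof_Rie_one k i j 2) i
  rw [Hop_congr fun z hz => (h.vel_eq i hz).trans (by rw [h.forceData.Force_split i hz]),
    ZE.Hop_add (h.ZE_Lop 2 i) (a1.add (by norm_num) a2), ZE.Hop_add a1 a2]
  simp only
  rw [h.forceData.Hop_diag i hz, Hop_Lop_gs (by norm_num : (0 : ℝ) ≤ 4) (h.init.meas_u i)
    (integrable_data_decay (by norm_num) (by norm_num) (h.init.memLp_u i)) hz, ← h.temp_eq hz,
    h.sum_X_flux (some i) hz, presGrad]
  ring

end ScaledEquations

/-! ### From distributional divergence of the data to divergence of their evolution. -/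

section WeakDivergence

variable {d : ℝ} {v : Fin 3 → R3 → ℝ} {ψ : R3 → ℝ}

/-- The distributional divergence of the field `v` vanishes. -/
def WeakDivFree (v : Fin 3 → R3 → ℝ) : Prop :=
  ∀ φ : R3 → ℝ, ContDiff ℝ ∞ φ → HasCompactSupport φ → ∫ x, ∑ i, v i x * pd i φ x = 0

/-- A smooth cutoff function, equal to `1` on the unit ball. -/
noncomputable def cutoff : ContDiffBump (0 : R3) := ⟨1, 2, one_pos, one_lt_two⟩

/-- The rescaled cutoff functions. -/
noncomputable def cutoffs (n : ℕ) (y : R3) : ℝ := cutoff (((n : ℝ) + 1)⁻¹ • y)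

theorem contDiff_cutoffs (n : ℕ) : ContDiff ℝ ∞ (cutoffs n) :=
  cutoff.contDiff.comp (by fun_prop)

theorem hasCompactSupport_cutoffs (n : ℕ) : HasCompactSupport (cutoffs n) :=
  cutoff.hasCompactSupport.comp_smul (by positivity)

theorem abs_cutoffs_le (n : ℕ) (y : R3) : |cutoffs n y| ≤ 1 := by
  rw [cutoffs, abs_of_nonneg cutoff.nonneg]
  exact cutoff.le_one

theorem exists_abs_pd_cutoffs_le : ∃ C, 0 ≤ C ∧ ∀ n i y, |pd i (cutoffs n) y| ≤ C := by
  obtain ⟨C, hC⟩ := (cutoff.hasCompactSupport.fderiv (𝕜 := ℝ)).exists_bound_of_continuous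
    ((cutoff.contDiff (n := 1)).continuous_fderiv (by norm_num))
  have hC0 : 0 ≤ C := (norm_nonneg _).trans (hC 0)
  refine ⟨C, hC0, fun n i y => ?_⟩
  have h0 : (0 : ℝ) ≤ ((n : ℝ) + 1)⁻¹ := by positivity
  have h1 : ((n : ℝ) + 1)⁻¹ ≤ 1 := inv_le_one_of_one_le₀ (by linarith [Nat.cast_nonneg (α := ℝ) n])
  have h : HasFDerivAt (cutoffs n) (fderiv ℝ cutoff (((n : ℝ) + 1)⁻¹ • y) ∘L
      (((n : ℝ) + 1)⁻¹ • ContinuousLinearMap.id ℝ R3)) y :=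
    (((cutoff.contDiff (n := 1)).differentiable (by norm_num)) _).hasFDerivAt.comp y
      (((n : ℝ) + 1)⁻¹ • ContinuousLinearMap.id ℝ R3).hasFDerivAt
  rw [pd, h.fderiv, ContinuousLinearMap.comp_apply, ← Real.norm_eq_abs]
  refine (ContinuousLinearMap.le_opNorm _ _).trans
    ((mul_le_mul (hC _) ?_ (norm_nonneg _) hC0).trans_eq (mul_one C))
  have : ‖bv i‖ = 1 := by simp [bv]
  simp only [_root_.smul_apply, ContinuousLinearMap.id_apply, norm_smul, this, mul_one,
    Real.norm_of_nonneg h0]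
  exact h1

theorem cutoffs_eventually (y : R3) : ∀ᶠ n in atTop, cutoffs n =ᶠ[𝓝 y] fun _ => 1 := by
  obtain ⟨N, hN⟩ := exists_nat_gt ‖y‖
  filter_upwards [eventually_ge_atTop N] with n hn
  have : Metric.ball (0 : R3) ((n : ℝ) + 1) ∈ 𝓝 y := by
    refine Metric.isOpen_ball.mem_nhds ?_
    rw [mem_ball_zero_iff]
    have : (N : ℝ) ≤ n := by exact_mod_cast hn
    linarith
  filter_upwards [this] with w hw
  rw [mem_ball_zero_iff] at hw
  refine cutoff.one_of_mem_closedBall ?_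
  rw [mem_closedBall_zero_iff, norm_smul, Real.norm_of_nonneg (by positivity)]
  show _ ≤ (1 : ℝ)
  rw [inv_mul_le_one₀ (by positivity)]
  exact hw.le

/-- Test functions need only decay with the weight. The product with a rescaled cutoff is an
admissible test function; the cutoffs and their gradients are bounded uniformly and near each point
are eventually 1, so dominated convergence applies. -/
theorem WeakDivFree.integral_eq_zero (hv : WeakDivFree v) (hm : ∀ i, Measurable (v i))
    (hi : ∀ i, Integrable fun y => |v i y| * (1 + ‖y‖) ^ (-d)) (hψ : ContDiff ℝ ∞ ψ) {c : ℝ}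
    (h0 : ∀ y, |ψ y| ≤ c * (1 + ‖y‖) ^ (-d)) (h1 : ∀ i y, |pd i ψ y| ≤ c * (1 + ‖y‖) ^ (-d)) :
    ∫ y, ∑ i, v i y * pd i ψ y = 0 := by
  obtain ⟨C, hC0, hC⟩ := exists_abs_pd_cutoffs_le
  have hd : Differentiable ℝ ψ := hψ.differentiable (by simp)
  have hcd : ∀ n, Differentiable ℝ (cutoffs n) := fun n => (contDiff_cutoffs n).differentiable (by simp)
  have hpd : ∀ i (k : R3 → ℝ), ContDiff ℝ ∞ k → Continuous (pd i k) := fun i k hk =>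
    (hk.continuous_fderiv (by simp)).clm_apply continuous_const
  have h : ∀ n, ∫ y, ∑ i, v i y * pd i (fun y => cutoffs n y * ψ y) y = 0 := fun n =>
    hv _ ((contDiff_cutoffs n).mul hψ) (hasCompactSupport_cutoffs n).mul_right
  have ht : Tendsto (fun n => ∫ y, ∑ i, v i y * pd i (fun y => cutoffs n y * ψ y) y) atTop
      (𝓝 (∫ y, ∑ i, v i y * pd i ψ y)) := by
    refine tendsto_integral_of_dominated_convergence
      (fun y => ∑ i, (C + 1) * c * (|v i y| * (1 + ‖y‖) ^ (-d))) (fun n => ?_)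
      (integrable_finsetSum _ fun i _ => (hi i).const_mul _) (fun n => ?_) ?_
    · refine (Finset.measurable_fun_sum _ fun i _ => (hm i).mul ?_).aestronglyMeasurable
      exact (hpd i _ ((contDiff_cutoffs n).mul hψ)).measurable
    · refine Eventually.of_forall fun y => (norm_sum_le _ _).trans (Finset.sum_le_sum fun i _ => ?_)
      rw [pd_mul (hcd n) hd, norm_mul, Real.norm_eq_abs, Real.norm_eq_abs]
      have e : |pd i (cutoffs n) y * ψ y + cutoffs n y * pd i ψ y| ≤
          C * (c * (1 + ‖y‖) ^ (-d)) + 1 * (c * (1 + ‖y‖) ^ (-d)) := by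
        refine (abs_add_le _ _).trans (add_le_add ?_ ?_)
        · rw [abs_mul]; exact mul_le_mul (hC n i y) (h0 y) (abs_nonneg _) hC0
        · rw [abs_mul]; exact mul_le_mul (abs_cutoffs_le n y) (h1 i y) (abs_nonneg _) zero_le_one
      exact (mul_le_mul_of_nonneg_left e (abs_nonneg _)).trans_eq (by ring)
    · refine Eventually.of_forall fun y => ?_
      refine tendsto_const_nhds.congr' ?_
      filter_upwards [cutoffs_eventually y] with n hn
      refine Finset.sum_congr rfl fun i _ => ?_
      have : (fun y => cutoffs n y * ψ y) =ᶠ[𝓝 y] ψ := by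
        filter_upwards [hn] with w hw
        rw [hw, one_mul]
      rw [pd, pd, this.fderiv_eq]
  simp_rw [h] at ht
  exact (tendsto_nhds_unique ht tendsto_const_nhds)

theorem pd_hker_sub (hψ : Differentiable ℝ ψ) {t : ℝ} (x y : R3) (i : Fin 3) :
    pd i (fun y => hker ψ t (x - y)) y = -(√t)⁻¹ * hker (pd i ψ) t (x - y) := by
  have h : HasFDerivAt (fun y => hker ψ t (x - y)) (t ^ (-(3 / 2) : ℝ) •
      (fderiv ℝ ψ ((√t)⁻¹ • (x - y)) ∘L ((√t)⁻¹ • -ContinuousLinearMap.id ℝ R3))) y := by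
    have h1 : HasFDerivAt (fun y => (√t)⁻¹ • (x - y)) ((√t)⁻¹ • -ContinuousLinearMap.id ℝ R3) y :=
      ((hasFDerivAt_id y).const_sub x).fun_const_smul (√t)⁻¹
    exact ((hψ _).hasFDerivAt.comp y h1).const_mul _
  rw [pd, h.fderiv]
  simp [hker, pd]
  ring

/-- The divergence of e^{tΔ}v at x is, up to a factor, the pairing of `v` with the gradient of the
Gaussian centred at x. -/
theorem WeakDivFree.sum_X_Lop_gs (hv : WeakDivFree v) (hm : ∀ i, Measurable (v i))
    (hi : ∀ i, Integrable fun y => |v i y| * (1 + ‖y‖) ^ (-(4 : ℝ))) {z : STime} (hz : 0 < z.1) :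
    ∑ i, X (some i) (Lop gs (v i)) z = 0 := by
  have hs : √z.1 ≠ 0 := (Real.sqrt_pos.2 hz).ne'
  have hg : ∀ i : Fin 3, Decays 4 (pd i gs) := fun i => (GaussPoly.base.pd i).decays 4
  rw [Finset.sum_congr rfl fun i _ =>
    X_some_Lop (by norm_num) (GaussPoly.base.prof 4 1) (hm i) (hi i) i hz]
  simp only [Lop, Psi]
  refine (integral_finsetSum Finset.univ fun i _ => integrable_hker_mul (d := 4) (by norm_num)
    (hg i) ((hm i).comp measurable_snd) (hi i) (s := 1) (fun y => le_rfl) hz z.2).symm.trans ?_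
  have hb : ∀ k, Decays 4 k → ∃ c, 0 ≤ c ∧ ∀ y, |hker k z.1 (z.2 - y)| ≤ c * (1 + ‖y‖) ^ (-(4 : ℝ)) :=
    fun k hk => by
      obtain ⟨c, h0, hc⟩ := hker_bound (by norm_num) hk hz (norm_nonneg z.2)
      exact ⟨c, h0, hc z.1 (by linarith) (by linarith) z.2 le_rfl⟩
  obtain ⟨c₀, h0, hc₀⟩ := hb gs (GaussPoly.base.decays 4)
  choose c hc0 hc using fun i => hb _ (hg i)
  have hcd : ContDiff ℝ ∞ fun y : R3 => hker gs z.1 (z.2 - y) :=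
    contDiff_const.mul (contDiff_gs.comp (by fun_prop))
  have key := hv.integral_eq_zero hm hi hcd
    (c := c₀ + ∑ i, (√z.1)⁻¹ * c i) (fun y => (hc₀ y).trans ?_) (fun i y => ?_)
  · simp_rw [pd_hker_sub GaussPoly.base.differentiable] at key
    have e : (fun y : R3 => ∑ i, v i y * (-(√z.1)⁻¹ * hker (pd i gs) z.1 (z.2 - y))) =
        fun y => -(√z.1)⁻¹ * ∑ i, hker (pd i gs) z.1 (z.2 - y) * v i y := by
      funext y
      rw [Finset.mul_sum]
      exact Finset.sum_congr rfl fun i _ => by ring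
    rw [e, integral_const_mul] at key
    exact (mul_eq_zero.1 key).resolve_left (neg_ne_zero.2 (inv_ne_zero hs))
  · have : 0 ≤ ∑ i, (√z.1)⁻¹ * c i := Finset.sum_nonneg fun i _ => mul_nonneg (by positivity) (hc0 i)
    gcongr
    linarith
  · rw [pd_hker_sub GaussPoly.base.differentiable, abs_mul, abs_neg, abs_of_nonneg (by positivity)]
    have h2 : (√z.1)⁻¹ * c i ≤ ∑ i, (√z.1)⁻¹ * c i := Finset.single_le_sum
      (f := fun i => (√z.1)⁻¹ * c i) (fun i _ => mul_nonneg (by positivity) (hc0 i)) (Finset.mem_univ i)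
    calc (√z.1)⁻¹ * |hker (pd i gs) z.1 (z.2 - y)| ≤ (√z.1)⁻¹ * (c i * (1 + ‖y‖) ^ (-(4 : ℝ))) :=
          mul_le_mul_of_nonneg_left (hc i y) (by positivity)
      _ = ((√z.1)⁻¹ * c i) * (1 + ‖y‖) ^ (-(4 : ℝ)) := by ring
      _ ≤ _ := mul_le_mul_of_nonneg_right (by linarith) (by positivity)

/-- The `L³_σ` condition in coordinates. -/
theorem weakDivFree_iff {u : R3 → R3} :
    WeakDivFree (fun i x => u x i) ↔ ∀ φ : R3 → ℝ, ContDiff ℝ ∞ φ → HasCompactSupport φ →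
      ∫ x, inner ℝ (u x) (gradient φ x) = 0 := by
  have e : ∀ φ : R3 → ℝ, ∀ x, inner ℝ (u x) (gradient φ x) = ∑ i, u x i * pd i φ x := fun φ x => by
    rw [inner_gradient_right, r3_clm_apply]
    rfl
  simp only [e]
  rfl

theorem WeakDivFree.congr {w : Fin 3 → R3 → ℝ} (hv : WeakDivFree v) (h : ∀ i, v i =ᵐ[volume] w i) :
    WeakDivFree w := fun φ h1 h2 => by
  rw [← hv φ h1 h2]
  refine integral_congr_ae ?_
  have : ∀ᵐ x : R3, ∀ i, v i x = w i x := ae_all_iff.2 h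
  filter_upwards [this] with x hx
  simp only [hx]

end WeakDivergence

/-! ### Classical regularity of time slices. -/

section Slices

variable {n p : ℕ} {f : STime → ℝ} {a M t : ℝ}

/-- A slice is the composition of a translate of `F` with the linear inclusion of space into
space-time; joint continuity of the spatial derivatives then follows from that of the full ones. -/
theorem iteratedFDeriv_slice {E : Type*} [NormedAddCommGroup E] [NormedSpace ℝ E] {F : STime → E}
    {m : ℕ} (hF : ContDiffOn ℝ m F {z : STime | 0 < z.1}) (ht : 0 < t) (x : R3) :
    iteratedFDeriv ℝ m (fun x => F (t, x)) x =
      (iteratedFDeriv ℝ m F (t, x)).compContinuousLinearMap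
        fun _ => ContinuousLinearMap.inr ℝ ℝ R3 := by
  set s : Set STime := {z | 0 < (z + (t, 0)).1} with hs
  have hso : IsOpen s := isOpen_posTime.preimage (by fun_prop : Continuous fun z : STime => z + (t, 0))
  have h1 : ContDiffOn ℝ m (fun z => F (z + (t, 0))) s :=
    hF.comp (by fun_prop : ContDiff ℝ m fun z : STime => z + (t, 0)).contDiffOn fun z hz => hz
  have hu : ContinuousLinearMap.inr ℝ ℝ R3 ⁻¹' s = Set.univ := by
    ext y; simp [hs, ht]
  have hx : ContinuousLinearMap.inr ℝ ℝ R3 x ∈ s := by simp [hs, ht]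
  have h2 := ContinuousLinearMap.iteratedFDerivWithin_comp_right (ContinuousLinearMap.inr ℝ ℝ R3) h1
    hso.uniqueDiffOn (by rw [hu]; exact uniqueDiffOn_univ) hx (i := m) le_rfl
  rw [hu, iteratedFDerivWithin_univ, iteratedFDerivWithin_of_isOpen m hso hx,
    iteratedFDeriv_comp_add_right] at h2
  have e : (fun z => F (z + (t, 0))) ∘ ContinuousLinearMap.inr ℝ ℝ R3 = fun x => F (t, x) := by
    funext y; simp
  rw [e] at h2
  rw [h2]
  simp

theorem isClassical_of_contDiffOn {E : Type*} [NormedAddCommGroup E] [NormedSpace ℝ E]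
    {F : STime → E} {g : ℝ → R3 → E} (hF : ContDiffOn ℝ 2 F {z : STime | 0 < z.1})
    (hg : ∀ t, 0 < t → g t = fun x => F (t, x)) : IsClassicalForPosTime g := by
  have hset : (Set.Ioi (0 : ℝ) ×ˢ Set.univ : Set STime) = {z | 0 < z.1} := by
    ext z; simp
  have hslice : ∀ t, 0 < t → ContDiff ℝ 2 fun x => F (t, x) := fun t ht => by
    rw [← contDiffOn_univ]
    exact hF.comp (by fun_prop : ContDiff ℝ 2 fun x : R3 => ((t, x) : STime)).contDiffOn
      fun x _ => ht
  refine ⟨?_, fun t ht => by rw [hg t ht]; exact hslice t ht, ?_⟩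
  · rw [hset]
    exact (hF.of_le one_le_two).congr fun z hz => by rw [hg z.1 hz]
  · rw [hset]
    have h1 : ContinuousOn (iteratedFDeriv ℝ 2 F) {z : STime | 0 < z.1} :=
      (hF.continuousOn_iteratedFDerivWithin le_rfl isOpen_posTime.uniqueDiffOn).congr
        fun z hz => (iteratedFDerivWithin_of_isOpen 2 isOpen_posTime hz).symm
    refine ((ContinuousMultilinearMap.compContinuousLinearMapL (𝕜 := ℝ) (F := E)
      fun _ : Fin 2 => ContinuousLinearMap.inr ℝ ℝ R3).continuous.comp_continuousOn h1).congr
      fun z hz => ?_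
    simp only [hg z.1 hz]
    exact iteratedFDeriv_slice (m := 2) hF hz z.2

theorem pd_slice (hf : ∀ z : STime, 0 < z.1 → DifferentiableAt ℝ f z) (ht : 0 < t) (i : Fin 3)
    (x : R3) : pd i (fun x => f (t, x)) x = (√t)⁻¹ * X (some i) f (t, x) := by
  rw [pd, (hasFDerivAt_space hf ht x).fderiv, ContinuousLinearMap.comp_apply,
    ContinuousLinearMap.inr_apply, fderiv_space_eq f i ht]

theorem pd_pd_slice (h : Z p a 2 M f) (ht : 0 < t) (i l : Fin 3) (x : R3) :
    pd i (pd l fun x => f (t, x)) x = t⁻¹ * X (some i) (X (some l) f) (t, x) := by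
  have e : (pd l fun x => f (t, x)) = fun x => (fun z => (√t)⁻¹ * X (some l) f z) (t, x) :=
    funext fun x => pd_slice h.diff ht l x
  rw [e, pd_slice (fun z hz => ((h.X (some l)).diff z hz).const_mul _) ht, X_const_mul, ← mul_assoc,
    ← mul_inv, Real.mul_self_sqrt ht.le]

theorem laplacian_eq_sum_pd {g : R3 → ℝ} (hg : ContDiff ℝ 2 g) (x : R3) :
    Laplacian.laplacian g x = ∑ i, pd i (pd i g) x := by
  rw [InnerProductSpace.laplacian_eq_iteratedFDeriv_orthonormalBasis g
    (EuclideanSpace.basisFun (Fin 3) ℝ)]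
  refine Finset.sum_congr rfl fun i _ => ?_
  have hd : DifferentiableAt ℝ (fderiv ℝ g) x :=
    (hg.fderiv_right (m := 1) (by norm_num)).differentiable (by norm_num) x
  have e : pd i (pd i g) x = fderiv ℝ (fderiv ℝ g) x (bv i) (bv i) := by
    have : HasFDerivAt (pd i g) ((fderiv ℝ (fderiv ℝ g) x).flip (bv i)) x := by
      have h := hd.hasFDerivAt.clm_apply (hasFDerivAt_const (bv i) x)
      rw [ContinuousLinearMap.comp_zero, zero_add] at h
      exact h
    rw [pd, this.fderiv]
    rfl
  rw [iteratedFDeriv_two_apply, e]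
  simp [bv]

theorem Z.contDiff_slice (h : Z p a 3 M f) (ht : 0 < t) : ContDiff ℝ 2 fun x => f (t, x) :=
  (isClassical_of_contDiffOn (g := fun t x => f (t, x)) h.contDiffOn fun _ _ => rfl).2.1 t ht

theorem laplacian_slice (h : Z p a 3 M f) (ht : 0 < t) (x : R3) :
    Laplacian.laplacian (fun x => f (t, x)) x = t⁻¹ * ∑ i, X (some i) (X (some i) f) (t, x) := by
  rw [laplacian_eq_sum_pd (h.contDiff_slice ht), Finset.mul_sum]
  exact Finset.sum_congr rfl fun i _ => pd_pd_slice (h.of_le (by norm_num)) ht i i x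

end Slices

/-! ### Bounds in `L^q` for 3 ≤ q ≤ ∞. -/

section Interpolation

variable {f : STime → ℝ} {a M t : ℝ} {n : ℕ}

/-- Interpolation through |g|^r ≤ S^(r-3) |g|³. -/
theorem eLpNorm_le_of_three_top {g : R3 → ℝ} {N S : ℝ} (hN : 0 ≤ N) (hS : 0 < S)
    (hgN : eLpNorm g (3 : ℕ) volume ≤ ENNReal.ofReal N) (hgS : ∀ x, |g x| ≤ S) {r : ℝ} (hr : 3 ≤ r) :
    eLpNorm g (ENNReal.ofReal r) volume ≤ ENNReal.ofReal (S ^ (1 - 3 / r) * N ^ (3 / r)) := by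
  have hr0 : 0 < r := by linarith
  rw [eLpNorm_natCast_le_iff g (by norm_num)] at hgN
  rw [eLpNorm_eq_lintegral_rpow_enorm_toReal (by simpa using hr0) ENNReal.ofReal_ne_top,
    ENNReal.toReal_ofReal hr0.le]
  have h1 : ∀ x, ‖g x‖ₑ ^ r ≤ ENNReal.ofReal (S ^ (r - 3)) * ‖g x‖ₑ ^ 3 := fun x => by
    rw [Real.enorm_eq_ofReal_abs, ENNReal.ofReal_rpow_of_nonneg (abs_nonneg _) hr0.le,
      ← ENNReal.ofReal_pow (abs_nonneg _), ← ENNReal.ofReal_mul (by positivity)]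
    refine ENNReal.ofReal_le_ofReal ?_
    calc |g x| ^ r = |g x| ^ (r - 3) * |g x| ^ 3 := by
          rw [← Real.rpow_natCast _ 3, ← Real.rpow_add_of_nonneg (abs_nonneg _) (by linarith) (by norm_num)]
          norm_num
      _ ≤ _ := mul_le_mul_of_nonneg_right
          (Real.rpow_le_rpow (abs_nonneg _) (hgS x) (by linarith)) (by positivity)
  have h2 : ∫⁻ x, ‖g x‖ₑ ^ r ≤ ENNReal.ofReal (S ^ (r - 3) * N ^ 3) := by
    refine (lintegral_mono h1).trans ?_
    rw [lintegral_const_mul' _ _ ENNReal.ofReal_ne_top, ENNReal.ofReal_mul (by positivity),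
      ENNReal.ofReal_pow hN]
    gcongr
  refine (ENNReal.rpow_le_rpow h2 (by positivity)).trans_eq ?_
  rw [ENNReal.ofReal_rpow_of_nonneg (by positivity) (by positivity),
    Real.mul_rpow (by positivity) (by positivity), ← Real.rpow_mul hS.le, ← Real.rpow_natCast N 3,
    ← Real.rpow_mul hN]
  congr 3
  · field_simp
  · norm_num; ring

theorem ZBase.eLpNorm_le (h : ZBase 3 a M f) (ht : 0 < t) {q : ℝ≥0∞} (hq : 3 ≤ q) :
    eLpNorm (fun x => f (t, x)) q volume ≤
      ENNReal.ofReal (M * t ^ (-a - 3 / 2 * (1 / 3 - (q⁻¹).toReal))) := by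
  have hM := h.nonneg
  have hsup : ∀ x, |f (t, x)| ≤ M * t ^ (-a - 1 / 2) := fun x => by
    have := h.sup (t, x) ht
    norm_num at this ⊢
    exact this
  -- A vanishing constant is treated separately, because recombining the real powers of `M` requires
  -- it to be positive.
  rcases hM.eq_or_lt with rfl | hM0
  · have : (fun x => f (t, x)) = fun _ => 0 := funext fun x => by
      have := hsup x
      rw [zero_mul] at this
      exact abs_eq_zero.1 (le_antisymm this (abs_nonneg _))
    rw [this]
    simp
  · induction q with
    | top =>
      refine (eLpNormEssSup_le_of_ae_bound (Eventually.of_forall hsup)).trans_eq ?_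
      norm_num
    | coe r =>
      have hr : (3 : ℝ) ≤ r := by exact_mod_cast hq
      have := eLpNorm_le_of_three_top (N := M * t ^ (-a)) (by positivity) (by positivity) (h.lp t ht)
        hsup hr
      rw [ENNReal.ofReal_coe_nnreal] at this
      refine this.trans_eq ?_
      have hr0 : (r : ℝ) ≠ 0 := by linarith
      have hi : ((r : ℝ≥0∞)⁻¹).toReal = (r : ℝ)⁻¹ := by simp
      rw [Real.mul_rpow hM (by positivity), Real.mul_rpow hM (by positivity), ← Real.rpow_mul ht.le,
        ← Real.rpow_mul ht.le, mul_mul_mul_comm, ← Real.rpow_add hM0, ← Real.rpow_add ht, hi,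
        sub_add_cancel, Real.rpow_one]
      congr 3
      field_simp
      ring

/-- The gradient is bounded by the sum of its three partial derivatives, hence the factor 3; each
carries t^(-1/2) from unscaling. -/
theorem Z.eLpNorm_iteratedFDeriv_le (h : Z 3 a 3 M f) (ht : 0 < t) {k : ℕ} (hk : k ≤ 1) {q : ℝ≥0∞}
    (hq : 3 ≤ q) : eLpNorm (iteratedFDeriv ℝ k fun x => f (t, x)) q volume ≤
      ENNReal.ofReal (3 * M * t ^ (-(k : ℝ) / 2 - a - 3 / 2 * (1 / 3 - (q⁻¹).toReal))) := by
  have hM := h.base.nonneg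
  have hk' : k = 0 ∨ k = 1 := by omega
  rcases hk' with rfl | rfl
  · rw [eLpNorm_congr_norm_ae (g := fun x => f (t, x))
      (Eventually.of_forall fun x => norm_iteratedFDeriv_zero)]
    refine (h.base.eLpNorm_le ht hq).trans (ENNReal.ofReal_le_ofReal ?_)
    have : 0 ≤ t ^ (-a - 3 / 2 * (1 / 3 - (q⁻¹).toReal)) := by positivity
    simp only [Nat.cast_zero, neg_zero, zero_div, zero_sub]
    nlinarith
  · set e := -a - 3 / 2 * (1 / 3 - (q⁻¹).toReal) with he
    have hX : ∀ i, AEStronglyMeasurable (fun x => (√t)⁻¹ * _root_.X (some i) f (t, x)) volume := fun i =>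
      ((measurable_slice (h.meas_X (some i)) t).const_mul _).aestronglyMeasurable
    calc eLpNorm (iteratedFDeriv ℝ 1 fun x => f (t, x)) q volume
        ≤ eLpNorm (∑ i, fun x => ‖(√t)⁻¹ * _root_.X (some i) f (t, x)‖) q volume := by
          refine eLpNorm_mono_real fun x => ?_
          rw [norm_iteratedFDeriv_one, Finset.sum_apply]
          refine (norm_r3_clm_le _).trans_eq (Finset.sum_congr rfl fun i _ => ?_)
          rw [← pd_slice h.diff ht i x]
          rfl
      _ ≤ ∑ i, eLpNorm (fun x => ‖(√t)⁻¹ * _root_.X (some i) f (t, x)‖) q volume :=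
          eLpNorm_sum_le (fun i _ => (hX i).norm) (le_trans (by norm_num) hq)
      _ ≤ ∑ _i : Fin 3, ENNReal.ofReal ((√t)⁻¹ * (M * t ^ e)) := Finset.sum_le_sum fun i _ => by
          rw [eLpNorm_norm]
          have e1 : (fun x => (√t)⁻¹ * _root_.X (some i) f (t, x)) = (√t)⁻¹ • fun x => _root_.X (some i) f (t, x) := rfl
          rw [e1, eLpNorm_const_smul, ENNReal.ofReal_mul (by positivity), Real.enorm_eq_ofReal_abs,
            abs_of_nonneg (by positivity)]
          gcongr
          exact (h.X (some i)).base.eLpNorm_le ht hq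
      _ = _ := by
          rw [Finset.sum_const, Finset.card_univ, Fintype.card_fin, nsmul_eq_mul, Nat.cast_ofNat,
            ← ENNReal.ofReal_ofNat, ← ENNReal.ofReal_mul (by norm_num)]
          congr 1
          have e2 : -((1 : ℕ) : ℝ) / 2 - a - 3 / 2 * (1 / 3 - (q⁻¹).toReal) = -(1 / 2) + e := by
            rw [he]; push_cast; ring
          rw [e2, Real.rpow_add ht, Real.rpow_neg ht.le, ← Real.sqrt_eq_rpow]
          ring

theorem norm_le_sum_coord (w : R3) : ‖w‖ ≤ ∑ i, ‖w i‖ := by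
  conv_lhs => rw [← sum_coord_smul_bv w]
  refine (norm_sum_le _ _).trans (Finset.sum_le_sum fun i _ => ?_)
  rw [norm_smul]
  simp [bv]

theorem fderiv_apply_coord {g : R3 → R3} (hg : Differentiable ℝ g) (x w : R3) (i : Fin 3) :
    (fderiv ℝ g x w) i = fderiv ℝ (fun x => g x i) x w := by
  have : fderiv ℝ (fun x => g x i) x = PiLp.proj 2 (fun _ => ℝ) i ∘L fderiv ℝ g x :=
    ((PiLp.proj 2 (fun _ : Fin 3 => ℝ) i : R3 →L[ℝ] ℝ).hasFDerivAt.comp x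
      (hg x).hasFDerivAt).fderiv
  rw [this]
  rfl

theorem norm_iteratedFDeriv_le_sum {g : R3 → R3} (hg : Differentiable ℝ g) {k : ℕ} (hk : k ≤ 1)
    (x : R3) : ‖iteratedFDeriv ℝ k g x‖ ≤ ∑ i, ‖iteratedFDeriv ℝ k (fun x => g x i) x‖ := by
  have hk' : k = 0 ∨ k = 1 := by omega
  rcases hk' with rfl | rfl
  · simp only [norm_iteratedFDeriv_zero]
    exact norm_le_sum_coord _
  · simp only [norm_iteratedFDeriv_one]
    refine ContinuousLinearMap.opNorm_le_bound _ (Finset.sum_nonneg fun i _ => norm_nonneg _)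
      fun w => (norm_le_sum_coord _).trans ?_
    rw [Finset.sum_mul]
    refine Finset.sum_le_sum fun i _ => ?_
    rw [fderiv_apply_coord hg]
    exact ContinuousLinearMap.le_opNorm _ _

end Interpolation

/-! ### Continuity in time with values in `L^p`. -/

section TimeContinuity

variable {p : ℕ} {f : STime → ℝ} {a M t s : ℝ} {n : ℕ}

theorem Z.sub_eq_integral (h : Z p a 2 M f) (hs : 0 < s) (ht : 0 < t) (x : R3) :
    f (t, x) - f (s, x) = ∫ r in s..t, r⁻¹ * _root_.X none f (r, x) := by
  have hpos : ∀ r ∈ Set.uIcc s t, 0 < r := fun r hr =>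
    (lt_min hs ht).trans_le (Set.mem_Icc.1 hr).1
  refine (intervalIntegral.integral_eq_sub_of_hasDerivAt
    (fun r hr => hasDerivAt_time h.diff (hpos r hr) x) ?_).symm
  refine ContinuousOn.intervalIntegrable fun r hr => ContinuousAt.continuousWithinAt ?_
  exact (continuousAt_inv₀ (hpos r hr).ne').mul
    (hasDerivAt_time (h.X none).diff (hpos r hr) x).continuousAt

/-- The increment is the integral of r⁻¹ (r∂ᵣf), where the scaled derivative is bounded in `L^p` and
r⁻¹ ≤ 2/s; Minkowski gives local Lipschitz continuity. -/
theorem Z.eLpNorm_sub_le (hp : 1 ≤ p) (h : Z p 0 2 M f) (hs : 0 < s) (ht : s / 2 ≤ t) :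
    eLpNorm (fun x => f (t, x) - f (s, x)) p volume ≤ ENNReal.ofReal (2 / s * M * |t - s|) := by
  have hM := h.base.nonneg
  have ht0 : 0 < t := by linarith
  -- The integrand is cut off below s/2 so that the majorant required by Minkowski holds for every
  -- real r.
  set I : ℝ → R3 → ℝ := fun r x => (Set.Ici (s / 2)).indicator
    (fun r => r⁻¹ * _root_.X none f (r, x)) r with hI
  have hIm : Measurable (Function.uncurry I) := by
    have e : Function.uncurry I = (Prod.fst ⁻¹' Set.Ici (s / 2) : Set STime).indicator
        fun z => z.1⁻¹ * _root_.X none f z := by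
      funext z
      simp only [hI, Function.uncurry, Set.indicator, Set.mem_preimage]
    rw [e]
    exact (measurable_fst.inv.mul (h.meas_X none)).indicator (measurable_fst measurableSet_Ici)
  have hIb : ∀ r, eLpNorm (I r) p volume ≤ ENNReal.ofReal (2 / s * M) := fun r => by
    by_cases hr : r ∈ Set.Ici (s / 2)
    · have hr0 : 0 < r := lt_of_lt_of_le (by linarith) hr
      have e : I r = r⁻¹ • fun x => _root_.X none f (r, x) := by
        funext x; simp [hI, Set.indicator_of_mem hr]
      rw [e, eLpNorm_const_smul, Real.enorm_eq_ofReal_abs, abs_of_pos (inv_pos.2 hr0),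
        ENNReal.ofReal_mul (by positivity)]
      have h1 := (h.X none).base.lp r hr0
      rw [neg_zero, Real.rpow_zero, mul_one] at h1
      gcongr
      rw [inv_eq_one_div, div_le_div_iff₀ hr0 hs]
      have : s / 2 ≤ r := hr
      linarith
    · have e : I r = fun _ => 0 := by
        funext x; simp [hI, Set.indicator_of_notMem hr]
      rw [e]; simp
  have hle := eLpNorm_integral_le (volume.restrict (Set.uIoc s t)) (volume : Measure R3) hp hIm
    aemeasurable_const (fun _ => ENNReal.ofReal_ne_top) hIb
  have hvol : volume (Set.uIoc s t) = ENNReal.ofReal |t - s| := by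
    rw [Set.uIoc, Real.volume_Ioc, max_sub_min_eq_abs, abs_sub_comm]
  rw [lintegral_const, Measure.restrict_apply_univ, hvol, ← ENNReal.ofReal_mul (by positivity)] at hle
  refine le_trans (le_of_eq ?_) hle
  refine eLpNorm_congr_norm_ae (Eventually.of_forall fun x => ?_)
  rw [h.sub_eq_integral hs ht0, intervalIntegral.norm_integral_eq_norm_integral_uIoc]
  congr 1
  refine setIntegral_congr_fun measurableSet_uIoc fun r hr => ?_
  have hr2 : r ∈ Set.Ici (s / 2) := by
    have := (Set.mem_Icc.1 (Set.uIoc_subset_uIcc hr)).1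
    exact (le_min (by linarith) ht).trans this
  simp only [hI, Set.indicator_of_mem hr2]

theorem ZBase.memLp (h : ZBase p a M f) (ht : 0 < t) : MemLp (fun x => f (t, x)) p volume :=
  ⟨(measurable_slice h.meas t).aestronglyMeasurable,
    (h.lp t ht).trans_lt ENNReal.ofReal_lt_top⟩

theorem Z.isContinuousIntoLp (hp : 1 ≤ p) (h : Z p 0 2 M f) {g : ℝ → R3 → ℝ}
    (hg : ∀ t, 0 < t → g t = fun x => f (t, x)) (hg0 : MemLp (g 0) p volume)
    (hlim : Tendsto (fun t => eLpNorm (fun x => f (t, x) - g 0 x) p volume) (𝓝[>] 0) (𝓝 0)) :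
    IsContinuousIntoLp p g := by
  refine ⟨fun t ht => ?_, fun s hs => ?_⟩
  · rcases ht.eq_or_lt with rfl | ht
    · exact hg0
    · rw [hg t ht]; exact h.base.memLp ht
  · rcases hs.eq_or_lt with rfl | hs
    · rw [← Set.Ioi_insert, nhdsWithin_insert, tendsto_sup]
      constructor
      · rw [tendsto_pure_left]
        intro U hU
        simpa using mem_of_mem_nhds hU
      · refine hlim.congr' ?_
        filter_upwards [self_mem_nhdsWithin] with t ht
        rw [hg t ht]
        rfl
    · refine Tendsto.mono_left ?_ nhdsWithin_le_nhds
      have hb : Tendsto (fun t => ENNReal.ofReal (2 / s * M * |t - s|)) (𝓝 s) (𝓝 0) := by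
        have : Continuous fun t => ENNReal.ofReal (2 / s * M * |t - s|) :=
          ENNReal.continuous_ofReal.comp (by fun_prop)
        simpa using this.tendsto s
      refine tendsto_of_tendsto_of_tendsto_of_le_of_le' tendsto_const_nhds hb
        (Eventually.of_forall fun _ => zero_le) ?_
      filter_upwards [eventually_ge_nhds (by linarith : s / 2 < s)] with t ht
      rw [hg s hs, hg t (by linarith)]
      exact h.eLpNorm_sub_le hp hs ht

theorem memLp_of_coord {q : ℝ≥0∞} {w : R3 → R3} (h : ∀ i, MemLp (fun x => w x i) q volume) :
    MemLp w q volume := by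
  have e : w = fun x => ∑ i, (ContinuousLinearMap.toSpanSingleton ℝ (bv i)) (w x i) := by
    funext x
    exact (sum_coord_smul_bv (w x)).symm
  rw [e]
  exact memLp_finsetSum _ fun i _ =>
    (ContinuousLinearMap.toSpanSingleton ℝ (bv i)).comp_memLp' (h i)

theorem eLpNorm_le_sum_coord {q : ℝ≥0∞} (hq : 1 ≤ q) {w : R3 → R3}
    (h : ∀ i, AEStronglyMeasurable (fun x => w x i) volume) :
    eLpNorm w q volume ≤ ∑ i, eLpNorm (fun x => w x i) q volume := by
  calc eLpNorm w q volume ≤ eLpNorm (∑ i, fun x => ‖w x i‖) q volume :=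
        eLpNorm_mono_real fun x => by
          rw [Finset.sum_apply]; exact norm_le_sum_coord _
    _ ≤ ∑ i, eLpNorm (fun x => ‖w x i‖) q volume := eLpNorm_sum_le (fun i _ => (h i).norm) hq
    _ = _ := Finset.sum_congr rfl fun i _ => eLpNorm_norm _

theorem isContinuousIntoLp_of_coord {q : ℝ≥0∞} (hq : 1 ≤ q) {u : ℝ → R3 → R3}
    (h : ∀ i, IsContinuousIntoLp q fun t x => u t x i) : IsContinuousIntoLp q u := by
  refine ⟨fun t ht => memLp_of_coord fun i => (h i).1 t ht, fun s hs => ?_⟩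
  have hsum : Tendsto (fun t => ∑ i, eLpNorm ((fun x => u t x i) - fun x => u s x i) q volume)
      (𝓝[Set.Ici 0] s) (𝓝 0) := by
    simpa using tendsto_finsetSum Finset.univ fun i _ => (h i).2 s hs
  refine tendsto_of_tendsto_of_tendsto_of_le_of_le' tendsto_const_nhds hsum
    (Eventually.of_forall fun _ => zero_le) ?_
  filter_upwards [self_mem_nhdsWithin] with t ht
  exact eLpNorm_le_sum_coord hq (w := u t - u s) fun i => (((h i).1 t ht).sub ((h i).1 s hs)).1

theorem weakDivFree_of_pd {v : Fin 3 → R3 → ℝ} (hv : ∀ i, ContDiff ℝ 1 (v i))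
    (h : ∀ x, ∑ i, pd i (v i) x = 0) : WeakDivFree v := fun φ hφ hc => by
  have hφd : Differentiable ℝ φ := hφ.differentiable (by simp)
  have hpd : ∀ i (k : R3 → ℝ), ContDiff ℝ 1 k → Continuous (pd i k) := fun i k hk =>
    (hk.continuous_fderiv (by simp)).clm_apply continuous_const
  have hφ1 : ContDiff ℝ 1 φ := hφ.of_le (by simp)
  have hcp : ∀ i, HasCompactSupport (pd i φ) := fun i => hc.fderiv_apply ℝ (bv i)
  have i1 : ∀ i, Integrable fun x => v i x * pd i φ x := fun i =>
    ((hv i).continuous.mul (hpd i φ hφ1)).integrable_of_hasCompactSupport (hcp i).mul_left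
  have i2 : ∀ i, Integrable fun x => pd i (v i) x * φ x := fun i =>
    ((hpd i _ (hv i)).mul hφ.continuous).integrable_of_hasCompactSupport hc.mul_left
  have e : ∀ i, ∫ x, v i x * pd i φ x = -∫ x, pd i (v i) x * φ x := fun i =>
    integral_mul_fderiv_eq_neg_fderiv_mul_of_integrable (i2 i) (i1 i)
      (((hv i).continuous.mul hφ.continuous).integrable_of_hasCompactSupport hc.mul_left)
      (fun x _ => (hv i).differentiable (by simp) x) fun x _ => hφd x
  rw [integral_finsetSum _ fun i _ => i1 i]
  simp_rw [e]
  rw [Finset.sum_neg_distrib, ← integral_finsetSum _ fun i _ => i2 i]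
  have : (fun x => ∑ i, pd i (v i) x * φ x) = fun _ => 0 := funext fun x => by
    rw [← Finset.sum_mul, h x, zero_mul]
  rw [this]
  simp

end TimeContinuity

/-! ### Assembly of the strong solution. -/

section StrongSolution

variable {A B K t : ℝ} {v : Fin 3 → R3 → ℝ} {ϑ : R3 → ℝ}

theorem deriv_coord {g : ℝ → R3} (hg : DifferentiableAt ℝ g t) (i : Fin 3) :
    (deriv g t) i = deriv (fun s => g s i) t :=
  ((PiLp.proj 2 (fun _ : Fin 3 => ℝ) i : R3 →L[ℝ] ℝ).hasFDerivAt.comp_hasDerivAt t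
    hg.hasDerivAt).deriv.symm

theorem laplacian_coord {g : R3 → R3} (hg : ContDiff ℝ 2 g) (x : R3) (i : Fin 3) :
    (Laplacian.laplacian g x) i = Laplacian.laplacian (fun x => g x i) x :=
  (hg.contDiffAt.laplacian_CLM_comp_left
    (l := (PiLp.proj 2 (fun _ : Fin 3 => ℝ) i : R3 →L[ℝ] ℝ))).symm

theorem gradient_coord (g : R3 → ℝ) (x : R3) (i : Fin 3) :
    (gradient g x) i = fderiv ℝ g x (bv i) := by
  have h : inner ℝ (bv i) (gradient g x) = fderiv ℝ g x (bv i) := by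
    rw [inner_gradient_right]; rfl
  rw [← h, bv, EuclideanSpace.inner_single_left]
  simp

/-- The velocity field on space-time. -/
noncomputable def velField (v : Fin 3 → R3 → ℝ) (ϑ : R3 → ℝ) (z : STime) : R3 :=
  WithLp.toLp 2 fun i => sol v ϑ (some i) z

/-- The velocity, with its initial value. -/
noncomputable def velocity (v : Fin 3 → R3 → ℝ) (ϑ : R3 → ℝ) (t : ℝ) (x : R3) : R3 :=
  if 0 < t then velField v ϑ (t, x) else WithLp.toLp 2 fun i => v i x

/-- The temperature, with its initial value. -/
noncomputable def temp (v : Fin 3 → R3 → ℝ) (ϑ : R3 → ℝ) (t : ℝ) (x : R3) : ℝ :=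
  if 0 < t then sol v ϑ none (t, x) else ϑ x

theorem velocity_of_pos (v : Fin 3 → R3 → ℝ) (ϑ : R3 → ℝ) (ht : 0 < t) :
    velocity v ϑ t = fun x => velField v ϑ (t, x) := funext fun _ => if_pos ht

theorem temp_of_pos (v : Fin 3 → R3 → ℝ) (ϑ : R3 → ℝ) (ht : 0 < t) :
    temp v ϑ t = fun x => sol v ϑ none (t, x) := funext fun _ => if_pos ht

theorem velocity_zero (v : Fin 3 → R3 → ℝ) (ϑ : R3 → ℝ) :
    velocity v ϑ 0 = fun x => WithLp.toLp 2 fun i => v i x := funext fun _ => if_neg (lt_irrefl _)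

theorem temp_zero (v : Fin 3 → R3 → ℝ) (ϑ : R3 → ℝ) : temp v ϑ 0 = ϑ :=
  funext fun _ => if_neg (lt_irrefl _)

namespace GoodData

theorem vel (h : GoodData K A B v ϑ) (i : Fin 3) : Z 3 0 3 (4 * B) (sol v ϑ (some i)) := h.nrm (some i)

theorem temp (h : GoodData K A B v ϑ) : Z 1 0 3 (4 * B) (sol v ϑ none) := h.nrm none

theorem contDiffOn_velField (h : GoodData K A B v ϑ) :
    ContDiffOn ℝ 2 (velField v ϑ) {z : STime | 0 < z.1} :=
  contDiffOn_euclidean.2 fun i => (h.vel i).contDiffOn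

theorem regular_velocity (h : GoodData K A B v ϑ) : IsClassicalForPosTime (velocity v ϑ) :=
  isClassical_of_contDiffOn h.contDiffOn_velField fun _ ht => velocity_of_pos v ϑ ht

theorem regular_temp (h : GoodData K A B v ϑ) : IsClassicalForPosTime (_root_.temp v ϑ) :=
  isClassical_of_contDiffOn h.temp.contDiffOn fun _ ht => temp_of_pos v ϑ ht

theorem contDiff_velField (h : GoodData K A B v ϑ) (ht : 0 < t) :
    ContDiff ℝ 2 fun x => velField v ϑ (t, x) := by
  have := h.regular_velocity.2.1 t ht
  rwa [velocity_of_pos v ϑ ht] at this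

theorem differentiable_velField (h : GoodData K A B v ϑ) (ht : 0 < t) :
    Differentiable ℝ fun x => velField v ϑ (t, x) :=
  (h.contDiff_velField ht).differentiable (by norm_num)

theorem sum_pd_vel (h : GoodData K A B v ϑ) (ht : 0 < t) (x : R3) :
    ∑ i, pd i (fun x => sol v ϑ (some i) (t, x)) x = 0 := by
  simp_rw [fun i => pd_slice (h.vel i).diff ht i x]
  rw [← Finset.mul_sum, h.vel_div (z := (t, x)) ht, mul_zero]

theorem incompressible (h : GoodData K A B v ϑ) (ht : 0 < t) (x : R3) :
    divergence (velocity v ϑ t) x = 0 := by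
  rw [velocity_of_pos v ϑ ht, ← h.sum_pd_vel ht x]
  exact Finset.sum_congr rfl fun i _ => fderiv_apply_coord (h.differentiable_velField ht) x _ i

theorem transport (f : STime → ℝ) (hf : ∀ z : STime, 0 < z.1 → DifferentiableAt ℝ f z) (ht : 0 < t)
    (x : R3) : fderiv ℝ (fun x => f (t, x)) x (velField v ϑ (t, x)) =
      (√t)⁻¹ * ∑ k, sol v ϑ (some k) (t, x) * X (some k) f (t, x) := by
  rw [r3_clm_apply, Finset.mul_sum]
  refine Finset.sum_congr rfl fun k _ => ?_
  have := pd_slice hf ht k x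
  rw [pd] at this
  rw [this]
  simp only [velField]
  ring

theorem temperature (h : GoodData K A B v ϑ) (ht : 0 < t) (x : R3) :
    deriv (fun s => _root_.temp v ϑ s x) t + fderiv ℝ (_root_.temp v ϑ t) x (velocity v ϑ t x) =
      Laplacian.laplacian (_root_.temp v ϑ t) x := by
  have hd : deriv (fun s => _root_.temp v ϑ s x) t = t⁻¹ * X none (sol v ϑ none) (t, x) := by
    rw [← (hasDerivAt_time h.temp.diff ht x).deriv]
    refine Filter.EventuallyEq.deriv_eq ?_
    filter_upwards [eventually_gt_nhds ht] with s hs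
    rw [temp_of_pos v ϑ hs]
  have key := h.heat_temp (z := (t, x)) ht
  rw [Hop] at key
  have hs : √t * √t = t := Real.mul_self_sqrt ht.le
  have hs0 : √t ≠ 0 := (Real.sqrt_pos.2 ht).ne'
  rw [hd, temp_of_pos v ϑ ht, velocity_of_pos v ϑ ht, transport _ h.temp.diff ht,
    laplacian_slice h.temp ht]
  rw [sub_eq_iff_eq_add] at key
  rw [key]
  simp only
  have e : t⁻¹ * √t = (√t)⁻¹ := by
    rw [inv_mul_eq_div, div_eq_iff ht.ne', eq_inv_mul_iff_mul_eq₀ hs0, hs]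
  linear_combination
    -(∑ k, sol v ϑ (some k) (t, x) * X (some k) (sol v ϑ none) (t, x)) * e

/-- The factor t⁻¹ undoes the scaling of the heat operator, and the sign moves the pressure gradient
to the left-hand side of the equation. -/
theorem exists_pressure (h : GoodData K A B v ϑ) (ht : 0 < t) :
    ∃ φ : R3 → ℝ, ContDiff ℝ 1 φ ∧
      ∀ x i, fderiv ℝ φ x (bv i) = -t⁻¹ * presGrad v ϑ i (t, x) := by
  have hd : ∀ i (z : STime), 0 < z.1 → DifferentiableAt ℝ (fun z => -t⁻¹ * presGrad v ϑ i z) z :=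
    fun i z hz => by
      obtain ⟨M, hM⟩ := h.ZE_presGrad i
      exact (hM.diff z hz).const_mul _
  refine exists_potential (G := fun i x => -t⁻¹ * presGrad v ϑ i (t, x)) (fun i x => ?_)
    fun i l x => ?_
  · exact (hasFDerivAt_space (hd i) ht x).differentiableAt
  · rw [pd_slice (hd i) ht, pd_slice (hd l) ht, X_const_mul, X_const_mul, h.presGrad_curl i l]

theorem momentum (h : GoodData K A B v ϑ) : ∃ P : ℝ → R3 → ℝ,
    (∀ t : ℝ, 0 < t → ContDiff ℝ 1 (P t)) ∧ ∀ t : ℝ, 0 < t → ∀ x : R3,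
      deriv (fun s : ℝ => velocity v ϑ s x) t + fderiv ℝ (velocity v ϑ t) x (velocity v ϑ t x) +
        gradient (P t) x = Laplacian.laplacian (velocity v ϑ t) x + _root_.temp v ϑ t x • e3 := by
  choose! P hP1 hP2 using fun t (ht : 0 < t) => h.exists_pressure ht
  refine ⟨P, hP1, fun t ht x => ?_⟩
  have hdf : DifferentiableAt ℝ (fun s => velField v ϑ (s, x)) t := by
    have h1 : DifferentiableAt ℝ (velField v ϑ) (t, x) :=
      (h.contDiffOn_velField.contDiffAt (posTime_mem_nhds ht)).differentiableAt (by norm_num)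
    exact DifferentiableAt.comp (g := velField v ϑ) t h1
      (by fun_prop : DifferentiableAt ℝ (fun s : ℝ => ((s, x) : STime)) t)
  have hd : deriv (fun s : ℝ => velocity v ϑ s x) t = deriv (fun s => velField v ϑ (s, x)) t := by
    refine Filter.EventuallyEq.deriv_eq ?_
    filter_upwards [eventually_gt_nhds ht] with s hs
    rw [velocity_of_pos v ϑ hs]
  rw [hd, velocity_of_pos v ϑ ht, temp_of_pos v ϑ ht]
  ext i
  have hs : √t * √t = t := Real.mul_self_sqrt ht.le
  have hs0 : √t ≠ 0 := (Real.sqrt_pos.2 ht).ne'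
  have e : t⁻¹ * √t = (√t)⁻¹ := by
    rw [inv_mul_eq_div, div_eq_iff ht.ne', eq_inv_mul_iff_mul_eq₀ hs0, hs]
  have e3i : (e3 : R3) i = if i = 2 then 1 else 0 := by
    simp [e3]
  have key := h.heat_vel i (z := (t, x)) ht
  rw [Hop, sub_eq_iff_eq_add] at key
  have h1 : deriv (fun s => velField v ϑ (s, x) i) t = t⁻¹ * X none (sol v ϑ (some i)) (t, x) :=
    (hasDerivAt_time (h.vel i).diff ht x).deriv
  have h2 : fderiv ℝ (fun x => velField v ϑ (t, x) i) x (velField v ϑ (t, x)) =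
      (√t)⁻¹ * ∑ k, sol v ϑ (some k) (t, x) * X (some k) (sol v ϑ (some i)) (t, x) :=
    transport _ (h.vel i).diff ht x
  have h3 : Laplacian.laplacian (fun x => velField v ϑ (t, x) i) x =
      t⁻¹ * ∑ k, X (some k) (X (some k) (sol v ϑ (some i))) (t, x) := laplacian_slice (h.vel i) ht x
  rw [PiLp.add_apply, PiLp.add_apply, PiLp.add_apply, PiLp.smul_apply, deriv_coord hdf,
    fderiv_apply_coord (h.differentiable_velField ht), laplacian_coord (h.contDiff_velField ht),
    gradient_coord, hP2 t ht x i, h1, h2, h3, e3i, key, smul_eq_mul]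
  simp only
  have e4 : t⁻¹ * t = 1 := inv_mul_cancel₀ ht.ne'
  linear_combination
    -(∑ k, sol v ϑ (some k) (t, x) * X (some k) (sol v ϑ (some i)) (t, x)) * e +
      (if i = 2 then (1 : ℝ) else 0) * sol v ϑ none (t, x) * e4

theorem continuous_velocity (h : GoodData K A B v ϑ) : IsContinuousIntoLp 3 (velocity v ϑ) := by
  refine isContinuousIntoLp_of_coord (by norm_num) fun i => ?_
  have h0 : (fun x => velocity v ϑ 0 x i) = v i := by rw [velocity_zero]
  have := (h.vel i).of_le (by norm_num : 2 ≤ 3) |>.isContinuousIntoLp (by norm_num)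
    (g := fun t x => velocity v ϑ t x i) (fun t ht => by rw [velocity_of_pos v ϑ ht]; rfl)
    (by rw [h0]; exact h.init.memLp_u i)
    (by
      simp only [velocity_zero]
      exact tendsto_picardLim h.init h.small (some i))
  exact_mod_cast this

theorem continuous_temp (h : GoodData K A B v ϑ) : IsContinuousIntoLp 1 (_root_.temp v ϑ) := by
  have := h.temp.of_le (by norm_num : 2 ≤ 3) |>.isContinuousIntoLp le_rfl
    (g := _root_.temp v ϑ) (fun t ht => temp_of_pos v ϑ ht)
    (by rw [temp_zero]; exact h.init.memLp_θ)
    (by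
      simp only [temp_zero]
      exact tendsto_picardLim h.init h.small none)
  exact_mod_cast this

theorem solenoidal_of_pos (h : GoodData K A B v ϑ) (ht : 0 < t) : MemL3Sigma (velocity v ϑ t) := by
  refine ⟨h.continuous_velocity.1 t ht.le, weakDivFree_iff.1 ?_⟩
  rw [velocity_of_pos v ϑ ht]
  exact weakDivFree_of_pd (fun i => ((h.vel i).contDiff_slice ht).of_le one_le_two)
    fun x => h.sum_pd_vel ht x

/-- The constant is 36 = 3 · 3 · 4: three components, three partial derivatives, and the size 4B of
the Picard limit. -/
theorem velocity_bound (h : GoodData K A B v ϑ) (ht : 0 < t) {k : ℕ} (hk : k ≤ 1) {q : ℝ≥0∞}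
    (hq : 3 ≤ q) : eLpNorm (iteratedFDeriv ℝ k (velocity v ϑ t)) q volume ≤
      ENNReal.ofReal (36 * B * t ^ (-(k : ℝ) / 2 - 3 / 2 * (1 / 3 - (q⁻¹).toReal))) := by
  rw [velocity_of_pos v ϑ ht]
  have hm : ∀ i, AEStronglyMeasurable (iteratedFDeriv ℝ k fun x => sol v ϑ (some i) (t, x)) volume :=
    fun i => (((h.vel i).contDiff_slice ht).continuous_iteratedFDeriv
      (by exact_mod_cast hk.trans one_le_two)).aestronglyMeasurable
  calc eLpNorm (iteratedFDeriv ℝ k fun x => velField v ϑ (t, x)) q volume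
      ≤ eLpNorm (∑ i, fun x => ‖iteratedFDeriv ℝ k (fun x => sol v ϑ (some i) (t, x)) x‖) q volume :=
        eLpNorm_mono_real fun x => by
          rw [Finset.sum_apply]
          exact norm_iteratedFDeriv_le_sum (h.differentiable_velField ht) hk x
    _ ≤ ∑ i, eLpNorm (fun x => ‖iteratedFDeriv ℝ k (fun x => sol v ϑ (some i) (t, x)) x‖) q volume :=
        eLpNorm_sum_le (fun i _ => (hm i).norm) (le_trans (by norm_num) hq)
    _ ≤ ∑ _i : Fin 3, ENNReal.ofReal (3 * (4 * B) *
          t ^ (-(k : ℝ) / 2 - 0 - 3 / 2 * (1 / 3 - (q⁻¹).toReal))) :=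
        Finset.sum_le_sum fun i _ => by
          rw [eLpNorm_norm]
          exact (h.vel i).eLpNorm_iteratedFDeriv_le ht hk hq
    _ = _ := by
        rw [Finset.sum_const, Finset.card_univ, Fintype.card_fin, nsmul_eq_mul, Nat.cast_ofNat,
          ← ENNReal.ofReal_ofNat, ← ENNReal.ofReal_mul (by norm_num), sub_zero]
        congr 1
        ring

theorem temp_bound (h : GoodData K A B v ϑ) (ht : 0 < t) {k : ℕ} (hk : k ≤ 1) {q : ℝ≥0∞}
    (hq : 3 ≤ q) : eLpNorm (iteratedFDeriv ℝ k (_root_.temp v ϑ t)) q volume ≤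
      ENNReal.ofReal (12 * B * t ^ (-(k : ℝ) / 2 - 1 - 3 / 2 * (1 / 3 - (q⁻¹).toReal))) := by
  rw [temp_of_pos v ϑ ht]
  refine (h.temp.one_to_three.eLpNorm_iteratedFDeriv_le ht hk hq).trans_eq ?_
  rw [zero_add]
  congr 1
  ring

theorem isStrongSolution (h : GoodData K A B v ϑ) {u₀ : R3 → R3} {θ₀ : R3 → ℝ}
    (hu : (fun x => WithLp.toLp 2 fun i => v i x) =ᵐ[volume] u₀) (hθ : ϑ =ᵐ[volume] θ₀)
    (hdiv : WeakDivFree v) : IsStrongSolution u₀ θ₀ (velocity v ϑ) (_root_.temp v ϑ) where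
  continuous_u := h.continuous_velocity
  solenoidal_u t ht := by
    rcases ht.eq_or_lt with rfl | ht
    · refine ⟨h.continuous_velocity.1 0 le_rfl, weakDivFree_iff.1 ?_⟩
      rw [velocity_zero]
      exact hdiv
    · exact h.solenoidal_of_pos ht
  continuous_θ := h.continuous_temp
  initial_u := by rw [velocity_zero]; exact hu
  initial_θ := by rw [temp_zero]; exact hθ
  regular_u := h.regular_velocity
  regular_θ := h.regular_temp
  momentum := h.momentum
  incompressible _ ht x := h.incompressible ht x
  temperature _ ht x := h.temperature ht x

end GoodData

end StrongSolution

/-! ### Choice of constants and conclusion. -/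

theorem theorem2p2 :
    ∃ ε₁ : ℝ, 0 < ε₁ ∧ ∃ C : ℝ, 0 < C ∧
      ∀ ε₀ : ℝ, 0 < ε₀ → ε₀ ≤ ε₁ →
      ∀ (u₀ : R3 → R3) (θ₀ : R3 → ℝ), MemL3Sigma u₀ → MemLp θ₀ 1 volume →
        eLpNorm u₀ 3 volume + eLpNorm θ₀ 1 volume ≤ ENNReal.ofReal ε₀ →
        ∃ (u : ℝ → R3 → R3) (θ : ℝ → R3 → ℝ), IsStrongSolution u₀ θ₀ u θ ∧
          ∀ t : ℝ, 0 < t → ∀ k : ℕ, k ≤ 1 → ∀ q : ℝ≥0∞, 3 ≤ q →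
            eLpNorm (iteratedFDeriv ℝ k (u t)) q volume
              ≤ ENNReal.ofReal
                  (C * ε₀ * t ^ (-(k : ℝ) / 2 - 3 / 2 * (1 / 3 - (q⁻¹).toReal))) ∧
            eLpNorm (iteratedFDeriv ℝ k (θ t)) q volume
              ≤ ENNReal.ofReal
                  (C * ε₀ * t ^ (-(k : ℝ) / 2 - 1 - 3 / 2 * (1 / 3 - (q⁻¹).toReal))) := by
  obtain ⟨K, hK0, hK⟩ := exists_QuadBound 3
  obtain ⟨D, hD0, hD⟩ := exists_Nrm_Dat 3
  -- The evolved data have size Dε₀, so Picard's condition reads 8KDε₀ ≤ 1. The summand 1 keeps both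
  -- constants positive even if `K` or `D` vanishes.
  refine ⟨(8 * K * D + 1)⁻¹, by positivity, 36 * D + 1, by positivity,
    fun ε₀ hε₀ hε u₀ θ₀ hu₀ hθ₀ hsmall => ?_⟩
  -- The data are replaced by measurable representatives, which also serve as the values of the
  -- solution at time 0; hence the initial conditions hold almost everywhere.
  obtain ⟨w, hwm, hwe⟩ := hu₀.1.1
  obtain ⟨ϑ, hϑm, hϑe⟩ := hθ₀.1
  have hci : ∀ i, (fun x => u₀ x i) =ᵐ[volume] fun x => w x i := fun i => by
    filter_upwards [hwe] with x hx
    rw [hx]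
  have hI : InitData ε₀ (fun i x => w x i) ϑ := by
    refine ⟨hε₀.le, fun i => ?_, hϑm.measurable, fun i => ?_, ?_⟩
    · exact (PiLp.proj 2 (fun _ : Fin 3 => ℝ) i : R3 →L[ℝ] ℝ).continuous.measurable.comp
        hwm.measurable
    · have h1 : eLpNorm (fun x => w x i) (3 : ℕ) volume ≤ eLpNorm w (3 : ℕ) volume :=
        eLpNorm_mono fun x => PiLp.norm_apply_le _ i
      rw [eLpNorm_congr_ae hwe.symm] at h1
      exact h1.trans (le_trans (by exact_mod_cast le_self_add) hsmall)
    · rw [eLpNorm_congr_ae hϑe.symm]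
      exact le_trans (by exact_mod_cast le_add_self) hsmall
  have hdiv : WeakDivFree fun i x => w x i := (weakDivFree_iff.2 hu₀.2).congr hci
  have hG : GoodData K ε₀ (D * ε₀) (fun i x => w x i) ϑ := by
    refine ⟨hI, ⟨hK0, hK, by positivity, hD _ _ _ hI, ?_⟩, fun z hz => ?_⟩
    · calc 8 * K * (D * ε₀) = 8 * K * D * ε₀ := by ring
        _ ≤ (8 * K * D + 1) * (8 * K * D + 1)⁻¹ :=
          mul_le_mul (by linarith) hε hε₀.le (by positivity)
        _ = 1 := mul_inv_cancel₀ (by positivity)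
    · exact hdiv.sum_X_Lop_gs hI.meas_u
        (fun i => integrable_data_decay (by norm_num) (by norm_num) (hI.memLp_u i)) hz
  refine ⟨_, _, hG.isStrongSolution hwe.symm hϑe.symm hdiv, fun t ht k hk q hq => ⟨?_, ?_⟩⟩
  · refine (hG.velocity_bound ht hk hq).trans (ENNReal.ofReal_le_ofReal ?_)
    refine mul_le_mul_of_nonneg_right ?_ (by positivity)
    linarith
  · refine (hG.temp_bound ht hk hq).trans (ENNReal.ofReal_le_ofReal ?_)
    refine mul_le_mul_of_nonneg_right ?_ (by positivity)
    linarith [mul_nonneg hD0 hε₀.le]
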